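/- **Setup.** Let $R_0$ be a finite, crystallographic, reduced, irreducible root system spanning a Euclidean space $(V_0,\langle\cdot,\cdot\rangle)$, normalized so that long roots have squared length $2$; put $\alpha^\vee=2\alpha/\|\alpha\|^2$. Fix a base $\alpha_1,\dots,\alpha_n$, with positive roots $R_0^+$, highest root $\varphi$, Weyl group $W_0$, simple reflections $s_1,\dots,s_n$, length $l$ and longest element $w_0$. Let $P^\vee=\{\lambda\in V_0:\langle\lambda,\alpha\rangle\in\mathbb Z\ \forall\alpha\in R_0\}$, $W=W_0\ltimes P^\vee=\{\tau(\lambda)u\}_{\lambda\in P^\vee,\,u\in W_0}$, acting on $\mathbb Rc\oplus V_0$ by $\tau(\lambda)u(rc+v)=(r-\langle\lambda,uv\rangle)c+uv$. Let $R=\{2(rc+\alpha)/\|\alpha\|^2:r\in\mathbb Z,\alpha\in R_0\}$, with simple roots $a_0=c-\varphi^\vee$, $a_i=\alpha_i^\vee$, positive and negative roots $R^\pm$, and simple reflections $s_0=s_\varphi\tau(-\varphi^\vee),s_1,\dots,s_n$. Put $l(w)=\#(R^+\cap w^{-1}R^-)$ for $w\in W$ and $\Omega=\{w\in W:l(w)=0\}$.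 Let $k:R\to\mathbb C^\times$ be any $W$-invariant function, $k_j=k_{a_j}$, and $k^{-1}$ the function $a\mapsto k_a^{-1}$. Let $m\ge1$ be the integer with $m\langle P^\vee,P^\vee\rangle=\mathbb Z$, and let $q^{1/m}\in\mathbb C^\times$ be arbitrary (roots of unity are allowed, both for $q^{1/m}$ and for the $k_j$); $q^r=(q^{1/m})^{mr}$ for $r\in\frac1m\mathbb Z$. **Hecke algebra.** $H(k)$ is the complex algebra generated by $T_0,\dots,T_n$ and $T_\omega$ ($\omega\in\Omega$), with the braid relations of the $s_j$, $(T_j-k_j)(T_j+k_j^{-1})=0$, $T_\omega T_{\omega'}=T_{\omega\omega'}$, $T_e=1$, and $T_\omega T_i=T_jT_\omega$ if $\omega(a_i)=a_j$. For a reduced expression $w=s_{i_1}\cdots s_{i_{l(w)}}\omega$ put $T_w=T_{i_1}\cdots T_{i_{l(w)}}T_\omega$. Let $\lambda\mapsto Y^\lambda$ be the group homomorphism $P^\vee\to H(k)^\times$ with $Y^\lambda=T_{\tau(\lambda)}$ for dominant $\lambda$. For $I\subseteq\{1,\dots,n\}$ let $H_I(k)$ be the subalgebra generated by all $Y^\lambda$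 and the $T_i$, $i\in I$. **Functions.** Let $T=\mathrm{Hom}(P^\vee,\mathbb C^\times)$, let $\mathbb C[T]$ be its algebra of regular functions, with basis $e^\lambda$ ($\lambda\in P^\vee$), let $\mathbb C(T)$ be the quotient field, and $e_q^{rc+\lambda}=q^re^\lambda$. $W$ acts on $\mathbb C[T]$ and $\mathbb C(T)$ by $w_q(e^\mu)=e_q^{w\mu}$. Let $\mathbb C_{\sigma,\nabla}^{k,q}[T]\subset\mathbb C(T)$ be the subalgebra generated by $\mathbb C[T]$ and all $(1-e_q^a)^{-1}$, $(k_a^{-1}-k_ae_q^a)^{-1}$ ($a\in R$), and let $\mathcal D=\mathbb C_{\sigma,\nabla}^{k,q}[T]\#_qW$ be the smashed product, with $w\cdot f=w_q(f)\cdot w$. Put $c_a^{k,q}=(k_a^{-1}-k_ae_q^a)/(1-e_q^a)$ and $c_j^{k,q}=c_{a_j}^{k,q}$. **Parabolic data.** Fix $I\subseteq\{1,\dots,n\}$ and a sign $\pm$. Let $W_{0,I}=\langle s_i\rangle_{i\in I}$ and $W_0^I=\{w\in W_0:l(ws_i)>l(w)\ \forall i\in I\}$. Let $\overline{w_0}$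 be the element of minimal length in $w_0W_{0,I}$, and $I^*=\{j:\alpha_j=\overline{w_0}(\alpha_i)\text{ for some }i\in I\}$. Let $\gamma\in T_I^{k^{\pm1}}$, i.e. $\gamma\in T$ and $\gamma^{\alpha_i^\vee}=k_i^{\pm2}$ for all $i\in I$, and let $\overline{w_0}\gamma^{-1}\in T$ be the point $\lambda\mapsto\gamma^{-\overline{w_0}^{-1}\lambda}$. **Theorem.** There are unique algebra homomorphisms - $\pi=\pi^{k^{-1},q}:H(k^{-1})\to\mathcal D$ with $T_j\mapsto k_j^{-1}+c_j^{k^{-1},q}(s_j-1)$ and $T_\omega\mapsto\omega$; - $\nabla=\nabla^{k,q}:\mathcal D\to\mathcal D\otimes_{\mathbb C}H(k)$ with $f\mapsto f\otimes 1$, $s_j\mapsto (c_j^{k,q})^{-1}s_j\otimes T_j+\frac{c_j^{k,q}-k_j}{c_j^{k,q}}s_j\otimes1$ and $\omega\mapsto\omega\otimes T_\omega$; - $\chi=\chi_\gamma^{k,\pm,I}:H_I(k)\to\mathbb C$ with $Y^\lambda\mapsto\gamma^\lambda$ and $T_i\mapsto\pm k_i^{\pm1}$ ($i\in I$); - $\chi'=\chi_{\overline{w_0}\gamma^{-1}}^{k^{-1},\pm,I^*}:H_{I^*}(k^{-1})\to\mathbb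 C$ with $Y^\lambda\mapsto(\overline{w_0}\gamma^{-1})^\lambda$ and $T_i\mapsto\pm k_i^{\mp1}$ ($i\in I^*$). Let $M=M^{k,\pm,I}(\gamma)=H(k)\otimes_{H_I(k)}\mathbb C_\chi$ be the induced module and $v_w=T_w\otimes1\in M$. For every left $\mathcal D$-module $L$, the map $$\phi\mapsto\psi_\phi=\sum_{w\in W_0^I}\pi\bigl(T_{w\overline{w_0}^{-1}}\bigr)\phi\otimes v_w$$ restricts to a $\mathbb C$-linear isomorphism from $$L_\pi^{I^*,\pm}[\overline{w_0}\gamma^{-1}]=\{\phi\in L:\pi(h)\phi=\chi'(h)\phi\ \ \forall h\in H_{I^*}(k^{-1})\}$$ (the common eigenfunctions of the Cherednik–Dunkl operators $\pi(Y^\lambda)$ with spectral point $\overline{w_0}\gamma^{-1}$ that satisfy $\pi(T_i)\phi=\pm k_i^{\mp1}\phi$ for $i\in I^*$) onto the space $$\{\psi\in L\otimes_{\mathbb C}M:\nabla(w)\psi=\psi\ \ \forall w\in W\}$$ of $W$-invariant solutions of the quantum affine Knizhnik–Zamolodchikov equations with values in $M$. -/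

import Mathlib

open scoped TensorProduct RealInnerProductSpace

noncomputable section

/-- A finite, crystallographic, reduced, irreducible root system in the Euclidean space `V`, with
its long roots of squared length `2`, together with a chosen base.  Roots and coroots both live
in `V`: the pairing is the scalar product and `α^∨ = 2 α / ‖α‖²`. -/
structure EuclideanRootSystem (ι V : Type*) [Finite ι] [NormedAddCommGroup V]
    [InnerProductSpace ℝ V] where
  P : RootPairing ι ℝ V V
  isRootSystem : P.IsRootSystem
  isCrystallographic : P.IsCrystallographic
  isReduced : P.IsReduced
  isIrreducible : P.IsIrreducible
  pairing_eq : ∀ x y : V, P.toLinearMap x y = ⟪x, y⟫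
  coroot_eq : ∀ i, P.coroot i = (2 / ⟪P.root i, P.root i⟫) • P.root i
  norm_le : ∀ i, ⟪P.root i, P.root i⟫ ≤ 2
  exists_long : ∃ i, ⟪P.root i, P.root i⟫ = 2
  base : P.Base

namespace EuclideanRootSystem

variable {ι V : Type*} [Finite ι] [NormedAddCommGroup V] [InnerProductSpace ℝ V]
variable (S : EuclideanRootSystem ι V)

/-! ### The finite Weyl group -/

/-- The root `α_i`. -/
abbrev root (i : ι) : V := S.P.root i

/-- The finite Weyl group `W₀`. -/
abbrev W0 : Type _ := S.P.weylGroup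

/-- The index set `{1, …, n}` of the simple roots. -/
abbrev Idx : Type _ := S.base.support

/-- The reflection `s_α ∈ W₀` in the root `α = α_i`. -/
abbrev refl0 (i : ι) : S.W0 := RootPairing.weylGroup.ofIdx S.P i

theorem inner_reflection (i : ι) (x y : V) :
    ⟪S.P.reflection i x, S.P.reflection i y⟫ = ⟪x, y⟫ := by
  have hne : ⟪S.root i, S.root i⟫ ≠ 0 := inner_self_ne_zero.mpr (S.P.ne_zero i)
  have h : ∀ z, S.P.coroot' i z = 2 / ⟪S.root i, S.root i⟫ * ⟪z, S.root i⟫ := by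
    intro z
    change S.P.toLinearMap z (S.P.coroot i) = _
    rw [S.pairing_eq, S.coroot_eq, inner_smul_right]
  simp only [RootPairing.reflection_apply, h, inner_sub_left, inner_sub_right, real_inner_smul_left,
    real_inner_smul_right]
  rw [real_inner_comm (S.root i) y]
  generalize ⟪S.root i, S.root i⟫ = N at hne
  field_simp
  ring

/-- `W₀` acts by isometries. -/
theorem inner_smul_smul (w : S.W0) (x y : V) : ⟪w • x, w • y⟫ = ⟪x, y⟫ := by
  let B : S.P.InvariantForm :=
    { form := innerₗ V
      symm := ⟨fun x y => by simp [real_inner_comm]⟩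
      ne_zero := fun i => by simpa using S.P.ne_zero i
      isOrthogonal_reflection := fun i x y => S.inner_reflection i x y }
  exact RootPairing.InvariantForm.apply_weylGroup_smul S.P (B := B) w x y

theorem smul_root (w : S.W0) (i : ι) : w • S.root i = S.root (w • i) :=
  S.P.weylGroup_apply_root w i

theorem inner_smul_left_eq (w : S.W0) (x y : V) : ⟪w • x, y⟫ = ⟪x, w⁻¹ • y⟫ := by
  rw [← S.inner_smul_smul w x (w⁻¹ • y), smul_inv_smul]

instance : Finite S.W0 := by
  have := S.isRootSystem
  refine Finite.of_injective (fun (w : S.W0) (i : ι) => w • i) ?_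
  intro w w' h
  apply Subtype.ext
  apply RootPairing.Equiv.weightHom_injective S.P
  apply LinearEquiv.toLinearMap_injective
  refine LinearMap.ext_on_range (RootPairing.IsRootSystem.span_root_eq_top (P := S.P)) ?_
  intro i
  have h1 := S.smul_root w i
  have h2 := S.smul_root w' i
  have h3 : w • i = w' • i := congrFun h i
  rw [h3, ← h2] at h1
  exact h1

instance : Fintype S.W0 := Fintype.ofFinite _

/-- The length `l(w) = #(R₀⁺ ∩ w⁻¹ R₀⁻)` on `W₀`. -/
def len0 (w : S.W0) : ℕ := {i : ι | S.base.IsPos i ∧ ¬ S.base.IsPos (w • i)}.ncard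

theorem exists_longest : ∃ w : S.W0, ∀ u : S.W0, S.len0 u ≤ S.len0 w :=
  Finite.exists_max S.len0

/-- The longest element `w₀` of `W₀`. -/
def w0 : S.W0 := S.exists_longest.choose

/-- The standard parabolic subgroup `W_{0,I}`. -/
def W0sub (I : Set S.Idx) : Subgroup S.W0 :=
  Subgroup.closure ((fun i : S.Idx => S.refl0 i) '' I)

/-- The set `W₀^I` of minimal coset representatives of `W₀ / W_{0,I}`. -/
def W0min (I : Set S.Idx) : Set S.W0 :=
  {w | ∀ i ∈ I, S.len0 w < S.len0 (w * S.refl0 i)}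

instance (I : Set S.Idx) : Fintype (S.W0min I) := Fintype.ofFinite _

theorem exists_minRep (I : Set S.Idx) (w : S.W0) :
    ∃ u : S.W0, u⁻¹ * w ∈ S.W0sub I ∧
      ∀ v : S.W0, v⁻¹ * w ∈ S.W0sub I → S.len0 u ≤ S.len0 v := by
  obtain ⟨u, hu, h⟩ := Set.exists_min_image {u : S.W0 | u⁻¹ * w ∈ S.W0sub I} S.len0
    (Set.toFinite _) ⟨w, by simp [one_mem]⟩
  exact ⟨u, hu, fun v hv => h v hv⟩

/-- `w̄`, the element of minimal length in the coset `w W_{0,I}`. -/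
def minRep (I : Set S.Idx) (w : S.W0) : S.W0 := (S.exists_minRep I w).choose

/-- The subset `I^*`, defined by `w̄₀ (α_i) = α_{i^*}` for `i ∈ I`. -/
def star (I : Set S.Idx) : Set S.Idx :=
  {j | ∃ i ∈ I, S.minRep I S.w0 • S.root i = S.root j}

theorem exists_highest : ∃ i : ι, ⟪S.root i, S.root i⟫ = 2 ∧
    ∀ j : ι, ⟪S.root j, S.root j⟫ = 2 → S.base.height j ≤ S.base.height i := by
  obtain ⟨i, hi, h⟩ := Set.exists_max_image {i : ι | ⟪S.root i, S.root i⟫ = 2} S.base.height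
    (Set.toFinite _) S.exists_long
  exact ⟨i, hi, fun j hj => h j hj⟩

/-- (The index of) the longest root `φ`: the long root of greatest height.  Since the highest root
of an irreducible root system is long, this is the highest root. -/
def phi : ι := S.exists_highest.choose

theorem inner_phi : ⟪S.root S.phi, S.root S.phi⟫ = 2 := S.exists_highest.choose_spec.1

/-! ### Coweights and the extended affine Weyl group -/

/-- The coweight lattice `P^∨`. -/
def Pv : AddSubgroup V where
  carrier := {x | ∀ i, ∃ z : ℤ, ⟪x, S.root i⟫ = z}
  zero_mem' := fun i => ⟨0, by simp⟩
  add_mem' := by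
    intro x y hx hy i
    obtain ⟨a, ha⟩ := hx i
    obtain ⟨b, hb⟩ := hy i
    exact ⟨a + b, by rw [inner_add_left, ha, hb]; push_cast; rfl⟩
  neg_mem' := by
    intro x hx i
    obtain ⟨a, ha⟩ := hx i
    exact ⟨-a, by rw [inner_neg_left, ha]; push_cast; rfl⟩

theorem smul_mem_Pv (w : S.W0) {x : V} (hx : x ∈ S.Pv) : w • x ∈ S.Pv := by
  intro i
  rw [S.inner_smul_left_eq, S.smul_root]
  exact hx _

instance : DistribMulAction S.W0 S.Pv where
  smul w x := ⟨w • (x : V), S.smul_mem_Pv w x.2⟩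
  one_smul x := Subtype.ext (one_smul _ (x : V))
  mul_smul u w x := Subtype.ext (mul_smul u w (x : V))
  smul_zero w := Subtype.ext (smul_zero w)
  smul_add w x y := Subtype.ext (smul_add w (x : V) (y : V))

@[simp] theorem coe_smul (w : S.W0) (x : S.Pv) : ((w • x : S.Pv) : V) = w • (x : V) := rfl

/-- The scalar product on `P^∨`. -/
def ip (x y : S.Pv) : ℝ := ⟪(x : V), (y : V)⟫

/-- The coroot `α_i^∨` as an element of `P^∨`. -/
def cor (i : ι) : S.Pv := ⟨S.P.coroot i, fun j => by
  have := S.isCrystallographic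
  obtain ⟨z, hz⟩ := S.P.exists_value (S := ℤ) j i
  refine ⟨z, ?_⟩
  rw [real_inner_comm, ← S.pairing_eq]
  simpa using hz.symm⟩

/-- The action of `W₀` on `P^∨` by automorphisms. -/
def W0toAut : S.W0 →* MulAut (Multiplicative S.Pv) where
  toFun w :=
    { toFun := fun x => .ofAdd (w • x.toAdd)
      invFun := fun x => .ofAdd (w⁻¹ • x.toAdd)
      left_inv := fun x => by simp
      right_inv := fun x => by simp
      map_mul' := fun x y => by simp [smul_add] }
  map_one' := by ext x; simp
  map_mul' u w := by ext x; simp [mul_smul]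

/-- The extended affine Weyl group `W = W₀ ⋉ P^∨`; the element `⟨λ, u⟩` is `τ(λ) u`. -/
abbrev W : Type _ := Multiplicative S.Pv ⋊[S.W0toAut] S.W0

/-- The translation `τ(λ) ∈ W`. -/
def tau (x : S.Pv) : S.W := SemidirectProduct.inl (.ofAdd x)

/-- The inclusion `W₀ ⊆ W`. -/
def incl : S.W0 →* S.W := SemidirectProduct.inr

/-- The part `ℝ c ⊕ P^∨` of the space `ℝ c ⊕ V` of affine functionals on `V`; the pair `(r, λ)`
is `r c + λ`.  It contains the affine roots. -/
abbrev Aff : Type _ := ℝ × S.Pv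

/-- The action of `W` on `ℝ c ⊕ P^∨`, by `τ(λ) u (r c + μ) = (r - ⟨λ, u μ⟩) c + u μ`. -/
def act (w : S.W) (a : S.Aff) : S.Aff :=
  (a.1 - S.ip w.left.toAdd (w.right • a.2), w.right • a.2)

/-- The twisted affine root system
`R = {a^∨ | a ∈ ℤ c + R₀}`, where `(r c + α)^∨ = 2 (r c + α) / ‖α‖²`. -/
def R : Set S.Aff :=
  {a | ∃ (r : ℤ) (i : ι), a = (2 / ⟪S.root i, S.root i⟫ * r, S.cor i)}

/-- The simple affine roots: `a_0 = c - φ^∨` (index `none`) and `a_i = α_i^∨` (index `some i`). -/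
def simple : Option S.Idx → S.Aff
  | none => (1, -S.cor S.phi)
  | some i => (0, S.cor i)

/-- The simple reflections: `s_0 = s_φ τ(-φ^∨)` and `s_i = s_{α_i}`. -/
def s : Option S.Idx → S.W
  | none => S.incl (S.refl0 S.phi) * S.tau (-S.cor S.phi)
  | some i => S.incl (S.refl0 i)

/-- The positive affine roots. -/
def Rpos : Set S.Aff := {a | a ∈ S.R ∧ a ∈ AddSubmonoid.closure (Set.range S.simple)}

/-- The negative affine roots. -/
def Rneg : Set S.Aff := {a | -a ∈ S.Rpos}

/-- The length `l(w) = #(R⁺ ∩ w⁻¹ R⁻)` on `W`. -/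
def len (w : S.W) : ℕ := {a : S.Aff | a ∈ S.Rpos ∧ S.act w a ∈ S.Rneg}.ncard

/-- The group `Ω` of elements of length zero of `W`. -/
abbrev Om : Type _ := {w : S.W // S.len w = 0}

theorem smul_cor (w : S.W0) (i : ι) : w • S.cor i = S.cor (w • i) := by
  apply Subtype.ext
  change w • S.P.coroot i = S.P.coroot (w • i)
  rw [S.coroot_eq, S.coroot_eq, smul_comm]
  have h := S.smul_root w i
  have h2 := S.inner_smul_smul w (S.root i) (S.root i)
  simp only [root] at h h2
  rw [h] at h2 ⊢
  rw [h2]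

theorem act_mem_R (w : S.W) {a : S.Aff} (ha : a ∈ S.R) : S.act w a ∈ S.R := by
  obtain ⟨r, i, rfl⟩ := ha
  obtain ⟨z, hz⟩ := w.left.toAdd.2 (w.right • i)
  refine ⟨r - z, w.right • i, ?_⟩
  have h := S.smul_root w.right i
  have h2 := S.inner_smul_smul w.right (S.root i) (S.root i)
  rw [h] at h2
  refine Prod.ext ?_ (S.smul_cor w.right i)
  change _ - S.ip w.left.toAdd (w.right • S.cor i) = _
  rw [S.smul_cor, h2]
  change _ - ⟪((w.left.toAdd : S.Pv) : V), S.P.coroot (w.right • i)⟫ = _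
  rw [S.coroot_eq, inner_smul_right]
  simp only [root] at h2 hz
  rw [hz, h2]
  push_cast
  ring

theorem neg_cor (i : ι) : ∃ j, S.root j = -S.root i ∧ S.cor j = -S.cor i := by
  refine ⟨S.P.reflectionPerm i i, by simp, ?_⟩
  apply Subtype.ext
  change S.P.coroot _ = - S.P.coroot i
  simp

theorem simple_mem_R (j : Option S.Idx) : S.simple j ∈ S.R := by
  cases j with
  | none =>
    obtain ⟨j, hj, hj'⟩ := S.neg_cor S.phi
    refine ⟨1, j, ?_⟩
    rw [hj, hj', inner_neg_neg, S.inner_phi]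
    simp [simple]
  | some i => exact ⟨0, i, by simp [simple]⟩

/-- A multiplicity function: a `W`-invariant function `R → ℂ^×`. -/
structure Mult where
  toFun : S.R → ℂˣ
  inv' : ∀ (w : S.W) (a : S.R), toFun ⟨S.act w a, S.act_mem_R w a.2⟩ = toFun a

variable {S} in
/-- The multiplicity function `k⁻¹`. -/
def Mult.inv (k : S.Mult) : S.Mult where
  toFun a := (k.toFun a)⁻¹
  inv' w a := by rw [k.inv']

variable {S} in
/-- The simple affine root `a_j` as an element of `R`. -/
def simpleR (j : Option S.Idx) : S.R := ⟨S.simple j, S.simple_mem_R j⟩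

variable {S} in
/-- `k_j = k_{a_j}`. -/
def Mult.val (k : S.Mult) (j : Option S.Idx) : ℂˣ := k.toFun (simpleR j)

/-- The choice of `q^{1/m}`, with `m` the positive integer such that `m ⟨P^∨, P^∨⟩ = ℤ`. -/
structure QParam where
  m : ℕ
  m_pos : 0 < m
  span_eq : AddSubgroup.closure {x : ℝ | ∃ u v : S.Pv, x = m * S.ip u v} =
    (Int.castAddHom ℝ).range
  q1 : ℂˣ

variable {S} in
/-- `q^r = (q^{1/m})^{m r}` for `r ∈ (1/m) ℤ`. -/
def QParam.pow (q : S.QParam) (r : ℝ) : ℂˣ := q.q1 ^ ⌊q.m * r⌋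

/-! ### Functions on the torus -/

/-- The complex torus `T = Hom(P^∨, ℂ^×)`. -/
abbrev Torus : Type _ := Multiplicative S.Pv →* ℂˣ

/-- The algebra `ℂ[T]` of regular functions on `T`, which has basis `e^λ` (`λ ∈ P^∨`). -/
abbrev CT : Type _ := AddMonoidAlgebra ℂ S.Pv

instance : TwoUniqueSums S.Pv :=
  TwoUniqueSums.of_injective_addHom S.Pv.subtype.toAddHom Subtype.val_injective
    (by
      let _ : Module ℚ V := Module.compHom V (algebraMap ℚ ℝ)
      infer_instance)

instance : IsDomain S.CT := NoZeroDivisors.to_isDomain _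

/-- The field `ℂ(T)` of rational functions on `T`. -/
abbrev CTK : Type _ := FractionRing S.CT

variable {S}

theorem QParam.exists_int (q : S.QParam) (u v : S.Pv) : ∃ z : ℤ, (q.m : ℝ) * S.ip u v = z := by
  have h : (q.m : ℝ) * S.ip u v ∈ (Int.castAddHom ℝ).range := by
    rw [← q.span_eq]
    exact AddSubgroup.subset_closure ⟨u, v, rfl⟩
  obtain ⟨z, hz⟩ := h
  exact ⟨z, hz.symm⟩

theorem QParam.pow_sub (q : S.QParam) (r : ℝ) (u v : S.Pv) :
    q.pow (r - S.ip u v) = q.pow r * q.pow (-S.ip u v) := by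
  obtain ⟨z, hz⟩ := q.exists_int u v
  simp only [QParam.pow]
  rw [mul_sub, mul_neg, hz, Int.floor_sub_intCast, ← Int.cast_neg, Int.floor_intCast, ← zpow_add,
    sub_eq_add_neg]

variable (S) in
theorem ip_add_right (u v v' : S.Pv) : S.ip u (v + v') = S.ip u v + S.ip u v' :=
  inner_add_right _ _ _

variable (S) in
theorem ip_add_left (u u' v : S.Pv) : S.ip (u + u') v = S.ip u v + S.ip u' v :=
  inner_add_left _ _ _

variable (S) in
theorem ip_smul_smul (w : S.W0) (u v : S.Pv) : S.ip (w • u) (w • v) = S.ip u v :=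
  S.inner_smul_smul w _ _

/-- The monomial `e_q^{r c + λ} = q^r e^λ` in `ℂ[T]`. -/
def QParam.mon (q : S.QParam) (a : S.Aff) : S.CT := AddMonoidAlgebra.single a.2 (q.pow a.1 : ℂ)

/-- The endomorphism `w_q` of `ℂ[T]`, given by `w_q (e^μ) = e_q^{w μ}`; thus
`u_q (e^μ) = e^{u μ}` and `τ(λ)_q (e^μ) = q^{-⟨λ, μ⟩} e^μ`. -/
def QParam.actHom (q : S.QParam) (w : S.W) : S.CT →ₐ[ℂ] S.CT :=
  AddMonoidAlgebra.lift ℂ S.CT S.Pv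
    { toFun := fun x => q.mon (S.act w (0, x.toAdd))
      map_one' := by
        simp [mon, act, ip, pow, AddMonoidAlgebra.one_def]
      map_mul' := fun x y => by
        simp only [mon, act, AddMonoidAlgebra.single_mul_single, toAdd_mul, smul_add]
        congr 1
        rw [ip_add_right, ← Units.val_mul, sub_add_eq_sub_sub, q.pow_sub, zero_sub, zero_sub] }

theorem QParam.actHom_mon (q : S.QParam) (w : S.W) (a : S.Aff) :
    q.actHom w (q.mon a) = q.mon (S.act w a) := by
  simp only [QParam.actHom, QParam.mon, AddMonoidAlgebra.lift_single, MonoidHom.coe_mk,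
    OneHom.coe_mk, AddMonoidAlgebra.smul_single, act, toAdd_ofAdd, smul_eq_mul]
  congr 1
  rw [q.pow_sub a.1, zero_sub, Units.val_mul]

theorem act_mul (u w : S.W) (a : S.Aff) : S.act (u * w) a = S.act u (S.act w a) := by
  refine Prod.ext ?_ (mul_smul u.right w.right a.2)
  change a.1 - S.ip (u.left.toAdd + u.right • w.left.toAdd) ((u.right * w.right) • a.2) =
    a.1 - S.ip w.left.toAdd (w.right • a.2) -
      S.ip u.left.toAdd (u.right • w.right • a.2)
  rw [ip_add_left, mul_smul, ip_smul_smul]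
  ring

theorem act_one (a : S.Aff) : S.act 1 a = a := by
  refine Prod.ext ?_ (one_smul _ a.2)
  change a.1 - S.ip 0 _ = a.1
  simp [ip]

theorem QParam.single_eq (q : S.QParam) (x : S.Pv) :
    (AddMonoidAlgebra.single x 1 : S.CT) = q.mon (0, x) := by
  simp [QParam.mon, QParam.pow]

/-- The action of `W` on `ℂ[T]` by algebra automorphisms. -/
def QParam.actC (q : S.QParam) : S.W →* (S.CT ≃ₐ[ℂ] S.CT) :=
  (AlgEquiv.algHomUnitsEquiv ℂ S.CT).toMonoidHom.comp
    (MonoidHom.toHomUnits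
      { toFun := q.actHom
        map_one' := by
          refine AddMonoidAlgebra.algHom_ext (fun x => ?_) (by ext)
          rw [q.single_eq, q.actHom_mon, act_one]
          rfl
        map_mul' := fun u w => by
          refine AddMonoidAlgebra.algHom_ext (fun x => ?_) (by ext)
          change _ = q.actHom u (q.actHom w _)
          rw [q.single_eq, q.actHom_mon, q.actHom_mon, q.actHom_mon, act_mul] })

theorem QParam.actC_mon (q : S.QParam) (w : S.W) (a : S.Aff) :
    q.actC w (q.mon a) = q.mon (S.act w a) := q.actHom_mon w a

/-- The action of `W` on `ℂ(T)` by field automorphisms. -/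
def QParam.actK (q : S.QParam) : S.W →* (S.CTK ≃ₐ[ℂ] S.CTK) :=
  (IsFractionRing.fieldEquivOfAlgEquivHom ℂ S.CTK).comp q.actC

/-- The monomial `e_q^a` in `ℂ(T)`. -/
def QParam.e (q : S.QParam) (a : S.Aff) : S.CTK := algebraMap S.CT S.CTK (q.mon a)

theorem QParam.actK_algebraMap (q : S.QParam) (w : S.W) (f : S.CT) :
    q.actK w (algebraMap S.CT S.CTK f) = algebraMap S.CT S.CTK (q.actC w f) :=
  IsFractionRing.fieldEquivOfAlgEquiv_algebraMap ..

theorem QParam.actK_e (q : S.QParam) (w : S.W) (a : S.Aff) :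
    q.actK w (q.e a) = q.e (S.act w a) := by
  rw [QParam.e, q.actK_algebraMap, q.actC_mon, QParam.e]

/-- The element `1 - e_q^a` of `ℂ(T)`. -/
def QParam.den1 (q : S.QParam) (a : S.Aff) : S.CTK := 1 - q.e a

/-- The element `k_a⁻¹ - k_a e_q^a` of `ℂ(T)`. -/
def QParam.den2 (q : S.QParam) (k : S.Mult) (a : S.R) : S.CTK :=
  algebraMap ℂ S.CTK ((k.toFun a)⁻¹ : ℂˣ) - algebraMap ℂ S.CTK (k.toFun a : ℂˣ) * q.e a

/-- The subalgebra `ℂ_{σ,∇}^{k,q}[T]` of `ℂ(T)`, generated by `ℂ[T]` and the elements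
`(1 - e_q^a)⁻¹` and `(k_a⁻¹ - k_a e_q^a)⁻¹` for all `a ∈ R`. -/
def Csn (k : S.Mult) (q : S.QParam) : Subalgebra ℂ S.CTK :=
  Algebra.adjoin ℂ (Set.range (algebraMap S.CT S.CTK) ∪
    Set.range (fun a : S.R => (q.den1 a)⁻¹) ∪ Set.range (fun a : S.R => (q.den2 k a)⁻¹))

theorem actK_mem_Csn (k : S.Mult) (q : S.QParam) (w : S.W) {x : S.CTK} (hx : x ∈ Csn k q) :
    q.actK w x ∈ Csn k q := by
  have h : Csn k q ≤ (Csn k q).comap (q.actK w : S.CTK →ₐ[ℂ] S.CTK) := by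
    refine Algebra.adjoin_le ?_
    rintro x ((⟨f, rfl⟩ | ⟨a, rfl⟩) | ⟨a, rfl⟩)
    · refine Algebra.subset_adjoin (Or.inl (Or.inl ⟨q.actC w f, ?_⟩))
      exact (q.actK_algebraMap w f).symm
    · refine Algebra.subset_adjoin (Or.inl (Or.inr ⟨⟨S.act w a, S.act_mem_R w a.2⟩, ?_⟩))
      change (1 - q.e _)⁻¹ = q.actK w (1 - q.e _)⁻¹
      rw [map_inv₀, map_sub, map_one, q.actK_e]
    · refine Algebra.subset_adjoin (Or.inr ⟨⟨S.act w a, S.act_mem_R w a.2⟩, ?_⟩)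
      change (q.den2 k _)⁻¹ = q.actK w (q.den2 k _)⁻¹
      simp only [QParam.den2]
      rw [map_inv₀, map_sub, map_mul, q.actK_e, AlgEquiv.commutes, AlgEquiv.commutes, k.inv']
  exact h hx

instance (k : S.Mult) (q : S.QParam) : MulSemiringAction S.W (Csn k q) where
  smul w x := ⟨q.actK w x, actK_mem_Csn k q w x.2⟩
  one_smul x := Subtype.ext (by change q.actK 1 _ = _; rw [map_one]; rfl)
  mul_smul u w x := Subtype.ext (by
    change q.actK (u * w) _ = q.actK u (q.actK w _); rw [map_mul]; rfl)
  smul_zero w := Subtype.ext (map_zero (q.actK w))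
  smul_add w x y := Subtype.ext (map_add (q.actK w) (x : S.CTK) y)
  smul_one w := Subtype.ext (map_one (q.actK w))
  smul_mul w x y := Subtype.ext (map_mul (q.actK w) (x : S.CTK) y)

instance (k : S.Mult) (q : S.QParam) : SMulCommClass S.W ℂ (Csn k q) where
  smul_comm w c x := Subtype.ext (map_smul (q.actK w) c (x : S.CTK))

/-- The smashed product algebra `ℂ_{σ,∇}^{k,q}[T] #_q W`, in which `w f = (w_q f) w`. -/
abbrev Smash (k : S.Mult) (q : S.QParam) : Type _ := SkewMonoidAlgebra (Csn k q) S.W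

/-- The element `w` of the smashed product algebra. -/
def gp (k : S.Mult) (q : S.QParam) (w : S.W) : Smash k q := SkewMonoidAlgebra.single w 1

/-- The element `f` of the smashed product algebra. -/
def fn (k : S.Mult) (q : S.QParam) (f : Csn k q) : Smash k q := SkewMonoidAlgebra.single 1 f

/-- The function `(z⁻¹ - z e_q^a) / (1 - e_q^a)`, which is `c_a^{k,q}` for `z = k_a` and
`c_a^{k⁻¹,q}` for `z = k_a⁻¹`. -/
def cfun (k : S.Mult) (q : S.QParam) (z : ℂˣ) (a : S.R) : Csn k q :=
  ⟨(algebraMap ℂ S.CTK (z⁻¹ : ℂˣ) - algebraMap ℂ S.CTK (z : ℂ) * q.e a) * (q.den1 a)⁻¹,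
    mul_mem (sub_mem (Subalgebra.algebraMap_mem _ _) (mul_mem (Subalgebra.algebraMap_mem _ _)
      (Algebra.subset_adjoin (Or.inl (Or.inl ⟨_, rfl⟩)))))
      (Algebra.subset_adjoin (Or.inl (Or.inr ⟨a, rfl⟩)))⟩

/-- The function `(c_a^{k,q})⁻¹ = (1 - e_q^a) / (k_a⁻¹ - k_a e_q^a)`. -/
def cinv (k : S.Mult) (q : S.QParam) (a : S.R) : Csn k q :=
  ⟨q.den1 a * (q.den2 k a)⁻¹,
    mul_mem (sub_mem (one_mem _) (Algebra.subset_adjoin (Or.inl (Or.inl ⟨_, rfl⟩))))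
      (Algebra.subset_adjoin (Or.inr ⟨a, rfl⟩))⟩

/-! ### The extended affine Hecke algebra -/

/-- The alternating product `x y x ⋯` with `n` factors. -/
def altProd {A : Type*} [Monoid A] : ℕ → A → A → A
  | 0, _, _ => 1
  | n + 1, x, y => x * altProd n y x

/-- The generator `T_j` of the free algebra on the `T_j` (`0 ≤ j ≤ n`) and `T_ω` (`ω ∈ Ω`). -/
def preT (j : Option S.Idx) : FreeAlgebra ℂ (Option S.Idx ⊕ S.Om) := FreeAlgebra.ι ℂ (Sum.inl j)

/-- The generator `T_ω` of the free algebra. -/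
def preO (o : S.Om) : FreeAlgebra ℂ (Option S.Idx ⊕ S.Om) := FreeAlgebra.ι ℂ (Sum.inr o)

/-- The defining relations of the extended affine Hecke algebra `H(k) = H^a(k) # Ω`. -/
inductive HeckeRel (k : S.Mult) : FreeAlgebra ℂ (Option S.Idx ⊕ S.Om) →
    FreeAlgebra ℂ (Option S.Idx ⊕ S.Om) → Prop
  | braid (i j : Option S.Idx) (hij : i ≠ j) (hfin : IsOfFinOrder (S.s i * S.s j)) :
      HeckeRel k (altProd (orderOf (S.s i * S.s j)) (preT i) (preT j))
        (altProd (orderOf (S.s i * S.s j)) (preT j) (preT i))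
  | quadratic (j : Option S.Idx) :
      HeckeRel k ((preT j - algebraMap ℂ _ (k.val j : ℂ)) *
        (preT j + algebraMap ℂ _ ((k.val j)⁻¹ : ℂˣ))) 0
  | one (o : S.Om) (ho : (o : S.W) = 1) : HeckeRel k (preO o) 1
  | mul (o o' o'' : S.Om) (ho : (o'' : S.W) = o * o') : HeckeRel k (preO o * preO o') (preO o'')
  | conj (o : S.Om) (i j : Option S.Idx) (hij : S.act o (S.simple i) = S.simple j) :
      HeckeRel k (preO o * preT i) (preT j * preO o)

/-- The extended affine Hecke algebra `H(k)`. -/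
abbrev Hecke (k : S.Mult) : Type _ := RingQuot (HeckeRel k)

/-- The generator `T_j` of `H(k)`. -/
def T (k : S.Mult) (j : Option S.Idx) : Hecke k := RingQuot.mkAlgHom ℂ (HeckeRel k) (preT j)

/-- The generator `T_ω` of `H(k)`. -/
def TO (k : S.Mult) (o : S.Om) : Hecke k := RingQuot.mkAlgHom ℂ (HeckeRel k) (preO o)

/-- `(l, ω)` is a reduced expression `w = s_{i_1} ⋯ s_{i_r} ω`, `r = l(w)`. -/
def IsReducedExpr (w : S.W) (p : List (Option S.Idx) × S.Om) : Prop :=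
  w = (p.1.map S.s).prod * p.2 ∧ p.1.length = S.len w

open Classical in
/-- `T_w = T_{i_1} ⋯ T_{i_r} T_ω` for a reduced expression `w = s_{i_1} ⋯ s_{i_r} ω`.  Every `w`
has a reduced expression, and `T_w` does not depend on the one that is used. -/
def Tw (k : S.Mult) (w : S.W) : Hecke k :=
  if h : ∃ p, IsReducedExpr w p then (h.choose.1.map (T k)).prod * TO k h.choose.2 else 0

/-- The dominant coweights. -/
def IsDominant (x : S.Pv) : Prop := ∀ i : ι, S.base.IsPos i → 0 ≤ ⟪(x : V), S.root i⟫

open Classical in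
/-- The group homomorphism `λ ↦ Y^λ` with `Y^λ = T_{τ(λ)}` for dominant `λ`, that is
`Y^λ = T_{τ(μ)} T_{τ(ν)}⁻¹` for `λ = μ - ν` with `μ`, `ν` dominant.  Every `λ` is such a
difference, and `Y^λ` does not depend on the choice of `μ` and `ν`. -/
def Y (k : S.Mult) (x : S.Pv) : Hecke k :=
  if h : ∃ p : S.Pv × S.Pv, IsDominant p.1 ∧ IsDominant p.2 ∧ x = p.1 - p.2 then
    Tw k (S.tau h.choose.1) * Ring.inverse (Tw k (S.tau h.choose.2))
  else 0

/-- The standard parabolic subalgebra `H_I(k)`, generated by the `Y^λ` and the `T_i`, `i ∈ I`. -/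
def HeckeI (k : S.Mult) (I : Set S.Idx) : Subalgebra ℂ (Hecke k) :=
  Algebra.adjoin ℂ (Set.range (Y k) ∪ (fun i : S.Idx => T k (some i)) '' I)

/-- The element `Y^λ` of `H_I(k)`. -/
def YI (k : S.Mult) (I : Set S.Idx) (x : S.Pv) : HeckeI k I :=
  ⟨Y k x, Algebra.subset_adjoin (Or.inl ⟨x, rfl⟩)⟩

/-- The element `T_i` of `H_I(k)`, for `i ∈ I`. -/
def TI (k : S.Mult) (I : Set S.Idx) (i : I) : HeckeI k I :=
  ⟨T k (some i), Algebra.subset_adjoin (Or.inr ⟨i, i.2, rfl⟩)⟩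

/-- `T_I^{k^ε}`: the points `γ` of the torus with `γ^{α_i^∨} = k_i^{2 ε}` for `i ∈ I`. -/
def torusI (k : S.Mult) (ε : ℤˣ) (I : Set S.Idx) : Set S.Torus :=
  {γ | ∀ i ∈ I, γ (.ofAdd (S.cor i)) = (k.val (some i) ^ (ε : ℤ)) ^ 2}

/-- The action of `W₀` on the torus: `(w t)^λ = t^{w⁻¹ λ}`. -/
def torusAct (w : S.W0) (t : S.Torus) : S.Torus := t.comp (S.W0toAut w⁻¹).toMonoidHom

/-- `χ` is the character `χ_γ^{k,ε,I}` of `H_I(k)`: `Y^λ ↦ γ^λ` and `T_i ↦ ε k_i^ε`, `i ∈ I`. -/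
def IsChi (k : S.Mult) (ε : ℤˣ) (I : Set S.Idx) (γ : S.Torus) (χ : HeckeI k I →ₐ[ℂ] ℂ) : Prop :=
  (∀ x : S.Pv, χ (YI k I x) = (γ (.ofAdd x) : ℂ)) ∧
    ∀ i : I, χ (TI k I i) = ((ε : ℤ) : ℂ) * (k.val (some i) ^ (ε : ℤ) : ℂˣ)

/-- The module `Ind_{H_I(k)}^{H(k)} χ = H(k) ⊗_{H_I(k)} ℂ_χ`, that is, the quotient of `H(k)` by
the left ideal generated by the elements `h - χ(h)` with `h ∈ H_I(k)`. -/
abbrev Ind (k : S.Mult) (I : Set S.Idx) (χ : HeckeI k I →ₐ[ℂ] ℂ) : Type _ :=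
  Hecke k ⧸ Submodule.span (Hecke k)
    (Set.range fun h : HeckeI k I => (h : Hecke k) - algebraMap ℂ (Hecke k) (χ h))

/-- The vector `v_w = T_w ⊗ 1` of the induced module. -/
def vec (k : S.Mult) (I : Set S.Idx) (χ : HeckeI k I →ₐ[ℂ] ℂ) (w : S.W0) : Ind k I χ :=
  Submodule.Quotient.mk (Tw k (S.incl w))

/-! ### Cherednik's representations -/

/-- `π` is the algebra homomorphism `π^{k⁻¹,q} : H(k⁻¹) → ℂ_{σ,∇}^{k,q}[T] #_q W` with
`T_j ↦ k_j⁻¹ + c_j^{k⁻¹,q} (s_j - 1)` and `T_ω ↦ ω`. -/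
def IsPi (k : S.Mult) (q : S.QParam) (π : Hecke k.inv →ₐ[ℂ] Smash k q) : Prop :=
  (∀ j, π (T k.inv j) = algebraMap ℂ _ (k.inv.val j : ℂ) +
      fn k q (cfun k q (k.inv.val j) (simpleR j)) * (gp k q (S.s j) - 1)) ∧
    ∀ o : S.Om, π (TO k.inv o) = gp k q o

/-- `D` is the algebra homomorphism
`∇^{k,q} : ℂ_{σ,∇}^{k,q}[T] #_q W → (ℂ_{σ,∇}^{k,q}[T] #_q W) ⊗ H(k)` with `f ↦ f`,
`s_j ↦ (c_j^{k,q})⁻¹ s_j T_j + (c_j^{k,q} - k_j) (c_j^{k,q})⁻¹ s_j` and `ω ↦ ω T_ω`. -/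
def IsNabla (k : S.Mult) (q : S.QParam) (D : Smash k q →ₐ[ℂ] Smash k q ⊗[ℂ] Hecke k) : Prop :=
  (∀ f, D (fn k q f) = fn k q f ⊗ₜ 1) ∧
  (∀ j, D (gp k q (S.s j)) =
    (fn k q (cinv k q (simpleR j)) * gp k q (S.s j)) ⊗ₜ T k j +
    (fn k q ((cfun k q (k.val j) (simpleR j) - algebraMap ℂ _ (k.val j : ℂ)) *
      cinv k q (simpleR j)) * gp k q (S.s j)) ⊗ₜ 1) ∧
  ∀ o : S.Om, D (gp k q o) = gp k q o ⊗ₜ TO k o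

section Modules

variable {k : S.Mult} {q : S.QParam}
variable (L : Type*) [AddCommGroup L] [Module ℂ L] [Module (Smash k q) L]
  [IsScalarTower ℂ (Smash k q) L]

/-- The action of `(ℂ_{σ,∇}^{k,q}[T] #_q W) ⊗ H(k)` on `Γ_L(N) = L ⊗ N`, for an `H(k)`-module
`N`. -/
def gammaRep (N : Type*) [AddCommGroup N] [Module ℂ N] [Module (Hecke k) N]
    [IsScalarTower ℂ (Hecke k) N] :
    Smash k q ⊗[ℂ] Hecke k →ₐ[ℂ] Module.End ℂ (L ⊗[ℂ] N) :=
  (Module.endTensorEndAlgHom (R := ℂ) (S := ℂ) (A := ℂ) (M := L) (N := N)).comp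
    (Algebra.TensorProduct.map (Algebra.lsmul ℂ ℂ L) (Algebra.lsmul ℂ ℂ N))

/-- The space `Γ_L(N)_∇^W` of `W`-invariant solutions of the quantum affine KZ equations: the
`m ∈ L ⊗ N` with `∇(w) m = m` for all `w ∈ W`. -/
def kzInvariants (D : Smash k q →ₐ[ℂ] Smash k q ⊗[ℂ] Hecke k)
    (N : Type*) [AddCommGroup N] [Module ℂ N] [Module (Hecke k) N]
    [IsScalarTower ℂ (Hecke k) N] : Submodule ℂ (L ⊗[ℂ] N) :=
  Submodule.mk (AddSubmonoid.mk (AddSubsemigroup.mk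
    {m | ∀ w : S.W, gammaRep (k := k) (q := q) L N (D (gp k q w)) m = m}
    (fun hx hy w => by rw [map_add, hx w, hy w])) (fun w => map_zero _))
    (fun c x hx w => by rw [map_smul, hx w])

/-- The space of the `φ ∈ L` with `π(h) φ = χ(h) φ` for all `h ∈ H_J(k⁻¹)`. -/
def eigenspace (π : Hecke k.inv →ₐ[ℂ] Smash k q) (J : Set S.Idx)
    (χ : HeckeI k.inv J →ₐ[ℂ] ℂ) : Submodule ℂ L :=
  Submodule.mk (AddSubmonoid.mk (AddSubsemigroup.mk
    {f | ∀ h : HeckeI k.inv J, π h • f = χ h • f}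
    (fun hx hy h => by rw [smul_add, smul_add, hx h, hy h]))
    (fun h => by rw [smul_zero, smul_zero]))
    (fun c x hx h => by rw [smul_comm, hx h, smul_comm])

/-- The map `φ ↦ ψ_φ = ∑_{w ∈ W₀^I} π(T_{w w̄₀⁻¹}) φ ⊗ v_w`. -/
def psi (π : Hecke k.inv →ₐ[ℂ] Smash k q) (I : Set S.Idx) (χ : HeckeI k I →ₐ[ℂ] ℂ) (f : L) :
    L ⊗[ℂ] Ind k I χ :=
  ∑ w : S.W0min I,
    (π (Tw k.inv (S.incl (w * (S.minRep I S.w0)⁻¹))) • f) ⊗ₜ[ℂ] vec k I χ w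

end Modules

end EuclideanRootSystem

end

/-! The proof rewrites `W`-invariance as an intertwining condition and then solves that condition by
duality. Let `dag` be the anti-homomorphism H(k⁻¹) → H(k) with T_w ↦ T_w⁻¹. The element s_j c_j of
the smashed product is inverse to c_j⁻¹ s_j, and s_j(c_j^k) = c_j^{k⁻¹}. Multiplying ∇(s_j)ψ = ψ by
s_j c_j therefore leaves π(T_j)ψ = T_j⁻¹ψ, with T_j⁻¹ acting on the second factor
(`crossed_identities`, `gammaRep_s_iff`). Hence, for every H(k)-module N, a vector of L ⊗ N is
invariant exactly when π(h) ⊗ 1 and 1 ⊗ dag(h) agree on it for all h (`mem_kzInvariants_iff`).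

For the induced module M, let δ_w be the functionals dual to the basis v_w. The functional δ of the
longest index w̄₀ is special in two ways. Under the transposed action of H_{I*}(k⁻¹) it is an
eigenvector with character χ' (`coord_dagRep`): the Y^λ act triangularly on the v_w, and T_j with j
∈ I* preserves the coset w̄₀ W_{0,I}. Its translates under T_{w w̄₀⁻¹} are exactly the other δ_w
(`coord_dagRep_Tw`). So contracting an intertwining ψ with δ gives an eigenfunction φ, and all other
coefficients of ψ are π(T_{w w̄₀⁻¹})φ. Conversely the elements T_{w w̄₀⁻¹} z with z ∈ H_{I*}(k⁻¹)
span H(k⁻¹), and with the common character of φ and δ this makes ψ_φ intertwining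
(`isIntertwining_sum`).

Existence of ∇ is the statement that c_j⁻¹(T_j + c_j - k_j) defines a one-cocycle: unitarity for
s_j² = 1, and a Yang-Baxter equation for each rank-two subsystem of finite order (`chain_orderOf`).
Existence of π needs no second computation. The cocycle for k⁻¹ makes the smashed product act on C ⊗
H(k⁻¹), where C is the ring of functions; the orbit map of 1 ⊗ 1 is injective by triangularity
(`orb_injective`) and carries the Demazure-Lusztig operators to left multiplication by the T_j
(`orb_demazure_mul`), so the Hecke relations transfer. Nothing here restricts q or k.

The characters come from functionals T_u Y^λ ↦ g(u)γ^λ on the Bernstein basis that are equivariant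
under H_I on the right (`extFun_mul_T`); this uses no presentation of H_I. The basis T_w comes from
a regular representation with commuting left and right operators, and T_u Y^λ from the relations
between T_i and Y^λ. Lengths and reduced words are treated once for an abstract `RootAction`, which
is applied to W₀ and to W. -/

/-- A group acting on an additive group with a set of roots, a base of simple roots and simple
reflections, as it is used to study lengths and reduced expressions. -/
structure RootAction (G B E : Type*) [Group G] [AddCommGroup E] [DistribMulAction G E] where
  R : Set E
  simple : B → E
  s : B → G
  smul_mem : ∀ (g : G) {a : E}, a ∈ R → g • a ∈ R
  neg_mem : ∀ {a : E}, a ∈ R → -a ∈ R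
  simple_mem : ∀ j, simple j ∈ R
  zero_notMem : (0 : E) ∉ R
  linInd : LinearIndependent ℤ simple
  mem_or_neg_mem : ∀ {a : E}, a ∈ R → a ∈ AddSubmonoid.closure (Set.range simple) ∨
    -a ∈ AddSubmonoid.closure (Set.range simple)
  reduced : ∀ (j : B) (n : ℕ), n • simple j ∈ R → n = 1
  s_smul : ∀ (j : B) (a : E), ∃ n : ℤ, s j • a = a - n • simple j
  s_simple : ∀ j, s j • simple j = -simple j
  s_mul_s : ∀ j, s j * s j = 1
  conj : ∀ (g : G) (i j : B), g • simple i = simple j → g * s i = s j * g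
  finite_inv : ∀ g : G, {a : E | (a ∈ R ∧ a ∈ AddSubmonoid.closure (Set.range simple)) ∧
    (-(g • a) ∈ R ∧ -(g • a) ∈ AddSubmonoid.closure (Set.range simple))}.Finite

/-! ### Positive roots, inversions and lengths for an abstract root action. -/

namespace RootAction

variable {G B E : Type*} [Group G] [AddCommGroup E] [DistribMulAction G E] (Φ : RootAction G B E)

/-- Positive roots. -/
def Pos (a : E) : Prop := a ∈ Φ.R ∧ a ∈ AddSubmonoid.closure (Set.range Φ.simple)

/-- The positive roots that `g` makes negative. -/
def inv (g : G) : Set E := {a | Φ.Pos a ∧ Φ.Pos (-(g • a))}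

/-- The length of `g`. -/
noncomputable def len (g : G) : ℕ := (Φ.inv g).ncard

theorem inv_finite (g : G) : (Φ.inv g).Finite := Φ.finite_inv g

variable {Φ}

/-- Coordinates in the simple roots are unique, and nonnegative coordinates cannot cancel in a sum,
so a sum supported on `I` has both summands supported on `I`. Most positivity arguments below reduce
to this. -/
theorem mem_closure_of_add_mem_span {x y : E} {I : Set B}
    (hx : x ∈ AddSubmonoid.closure (Set.range Φ.simple))
    (hy : y ∈ AddSubmonoid.closure (Set.range Φ.simple))
    (h : x + y ∈ Submodule.span ℤ (Φ.simple '' I)) :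
    x ∈ AddSubmonoid.closure (Φ.simple '' I) := by
  obtain ⟨c, rfl⟩ := AddSubmonoid.mem_closure_range_iff.mp hx
  obtain ⟨d, rfl⟩ := AddSubmonoid.mem_closure_range_iff.mp hy
  rw [Finsupp.mem_span_image_iff_linearCombination] at h
  obtain ⟨l, hl, h⟩ := h
  have key : ∀ e : B →₀ ℕ, (e.sum fun i n => n • Φ.simple i) =
      Finsupp.linearCombination ℤ Φ.simple (e.mapRange (Nat.cast : ℕ → ℤ) Nat.cast_zero) := by
    intro e
    rw [Finsupp.linearCombination_apply, Finsupp.sum_mapRange_index (by simp)]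
    simp
  rw [key, key, ← map_add] at h
  have h' := linearIndependent_iff_injective_finsuppLinearCombination.mp Φ.linInd h
  refine AddSubmonoid.sum_mem _ fun i hi => AddSubmonoid.nsmul_mem _ ?_ _
  refine AddSubmonoid.subset_closure (Set.mem_image_of_mem _ ?_)
  by_contra hiI
  have h0 : l i = 0 := by
    by_contra hne
    exact hiI (hl (Finsupp.mem_support_iff.mpr hne))
  rw [h'] at h0
  simp only [Finsupp.coe_add, Pi.add_apply, Finsupp.mapRange_apply] at h0
  exact Finsupp.mem_support_iff.mp hi (by omega)

theorem Pos.mem_closure_of_mem_span {a : E} {I : Set B} (ha : Φ.Pos a)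
    (h : a ∈ Submodule.span ℤ (Φ.simple '' I)) : a ∈ AddSubmonoid.closure (Φ.simple '' I) :=
  mem_closure_of_add_mem_span (y := 0) ha.2 (zero_mem _) (by simpa using h)

theorem Pos.not_neg {a : E} (ha : Φ.Pos a) : ¬ Φ.Pos (-a) := by
  intro h
  -- With an empty set of simple roots the conclusion is that the root is zero.
  have := mem_closure_of_add_mem_span (I := ∅) ha.2 h.2 (by simp)
  simp only [Set.image_empty, AddSubmonoid.closure_empty, AddSubmonoid.mem_bot] at this
  exact Φ.zero_notMem (this ▸ ha.1)

variable (Φ) in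
theorem pos_or_neg {a : E} (ha : a ∈ Φ.R) : Φ.Pos a ∨ Φ.Pos (-a) :=
  (Φ.mem_or_neg_mem ha).imp (fun h => ⟨ha, h⟩) fun h => ⟨Φ.neg_mem ha, h⟩

theorem not_pos_iff {a : E} (ha : a ∈ Φ.R) : ¬ Φ.Pos a ↔ Φ.Pos (-a) :=
  ⟨(Φ.pos_or_neg ha).resolve_left, fun h h' => h'.not_neg h⟩

theorem not_pos_neg_iff {a : E} (ha : a ∈ Φ.R) : ¬ Φ.Pos (-a) ↔ Φ.Pos a :=
  ⟨(Φ.pos_or_neg ha).resolve_right, fun h h' => h.not_neg h'⟩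

variable (Φ) in
theorem pos_simple (j : B) : Φ.Pos (Φ.simple j) :=
  ⟨Φ.simple_mem j, AddSubmonoid.subset_closure ⟨j, rfl⟩⟩

/-- The positive vectors `a` and `-(s j • a)` add up to a multiple of the simple root, so `a` is
itself a natural multiple of it, and `reduced` leaves only the multiple one. -/
theorem Pos.eq_simple_of_neg {a : E} {j : B} (ha : Φ.Pos a) (h : Φ.Pos (-(Φ.s j • a))) :
    a = Φ.simple j := by
  obtain ⟨n, hn⟩ := Φ.s_smul j a
  have := mem_closure_of_add_mem_span (I := {j}) ha.2 h.2 (by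
    rw [hn, Set.image_singleton]
    exact Submodule.mem_span_singleton.mpr ⟨n, by abel⟩)
  rw [Set.image_singleton, AddSubmonoid.mem_closure_singleton] at this
  obtain ⟨m, rfl⟩ := this
  rw [Φ.reduced j m ha.1, one_smul]

theorem Pos.s_smul {a : E} {j : B} (ha : Φ.Pos a) (h : a ≠ Φ.simple j) : Φ.Pos (Φ.s j • a) :=
  (not_pos_neg_iff (Φ.smul_mem _ ha.1)).mp fun h' => h (ha.eq_simple_of_neg h')

variable (Φ) in
theorem s_inv (j : B) : (Φ.s j)⁻¹ = Φ.s j := inv_eq_of_mul_eq_one_left (Φ.s_mul_s j)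

variable (Φ) in
theorem s_smul_s_smul (j : B) (a : E) : Φ.s j • Φ.s j • a = a := by
  rw [← mul_smul, Φ.s_mul_s, one_smul]

variable (Φ) in
@[simp] theorem s_mul_s_mul (j : B) (g : G) : Φ.s j * (Φ.s j * g) = g := by
  rw [← mul_assoc, Φ.s_mul_s, one_mul]

variable (Φ) in
@[simp] theorem mul_s_mul_s (j : B) (g : G) : g * Φ.s j * Φ.s j = g := by
  rw [mul_assoc, Φ.s_mul_s, mul_one]

theorem Pos.of_smul_simple {g : G} {I : Set B} (h : ∀ i ∈ I, Φ.Pos (g • Φ.simple i)) {a : E}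
    (ha : a ∈ Φ.R) (haI : a ∈ AddSubmonoid.closure (Φ.simple '' I)) : Φ.Pos (g • a) := by
  refine ⟨Φ.smul_mem g ha, ?_⟩
  clear ha
  induction haI using AddSubmonoid.closure_induction with
  | mem x hx => obtain ⟨i, hi, rfl⟩ := hx; exact (h i hi).2
  | zero => rw [smul_zero]; exact zero_mem _
  | add x y _ _ hx hy => rw [smul_add]; exact add_mem hx hy

/-- The simple reflection permutes the positive roots other than its own root, which is the one new
inversion. -/
theorem inv_mul_s {g : G} {j : B} (h : Φ.Pos (g • Φ.simple j)) :
    Φ.inv (g * Φ.s j) = insert (Φ.simple j) ((Φ.s j • ·) '' Φ.inv g) := by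
  ext a
  simp only [Set.mem_insert_iff, Set.mem_image, inv, Set.mem_ofPred_eq]
  constructor
  · rintro ⟨h1, h2⟩
    by_cases ha : a = Φ.simple j
    · exact Or.inl ha
    · refine Or.inr ⟨Φ.s j • a, ⟨h1.s_smul ha, by rwa [← mul_smul]⟩, Φ.s_smul_s_smul j a⟩
  · rintro (rfl | ⟨b, ⟨h1, h2⟩, rfl⟩)
    · exact ⟨Φ.pos_simple j, by rwa [mul_smul, Φ.s_simple, smul_neg, neg_neg]⟩
    · refine ⟨h1.s_smul ?_, by rwa [mul_smul, Φ.s_smul_s_smul]⟩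
      rintro rfl
      exact h.not_neg h2

theorem len_mul_s {g : G} {j : B} (h : Φ.Pos (g • Φ.simple j)) :
    Φ.len (g * Φ.s j) = Φ.len g + 1 := by
  rw [len, inv_mul_s h, Set.ncard_insert_of_notMem _ ((Φ.inv_finite g).image _),
    Set.ncard_image_of_injective _ (MulAction.injective _), len]
  rintro ⟨b, hb, hb'⟩
  have : b = -Φ.simple j := by
    rw [← Φ.s_simple, ← hb']; exact (Φ.s_smul_s_smul j b).symm
  subst this
  exact (Φ.pos_simple j).not_neg hb.1

theorem len_mul_s_of_neg {g : G} {j : B} (h : Φ.Pos (-(g • Φ.simple j))) :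
    Φ.len g = Φ.len (g * Φ.s j) + 1 := by
  have := len_mul_s (Φ := Φ) (g := g * Φ.s j) (j := j)
    (by rwa [mul_smul, Φ.s_simple, smul_neg])
  rwa [Φ.mul_s_mul_s] at this

variable (Φ) in
theorem len_inv (g : G) : Φ.len g⁻¹ = Φ.len g := by
  have h : Φ.inv g⁻¹ = (fun a => -(g • a)) '' Φ.inv g := by
    ext a
    simp only [inv, Set.mem_ofPred_eq, Set.mem_image]
    constructor
    · rintro ⟨h1, h2⟩
      exact ⟨-(g⁻¹ • a), ⟨h2, by simpa using h1⟩, by simp⟩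
    · rintro ⟨b, ⟨h1, h2⟩, rfl⟩
      exact ⟨h2, by simpa using h1⟩
  rw [len, h, Set.ncard_image_of_injective _ fun a b hab => MulAction.injective g (neg_injective hab),
    len]

theorem len_s_mul {g : G} {j : B} (h : Φ.Pos (g⁻¹ • Φ.simple j)) :
    Φ.len (Φ.s j * g) = Φ.len g + 1 := by
  rw [← Φ.len_inv, mul_inv_rev, Φ.s_inv, len_mul_s h, Φ.len_inv]

theorem len_s_mul_of_neg {g : G} {j : B} (h : Φ.Pos (-(g⁻¹ • Φ.simple j))) :
    Φ.len g = Φ.len (Φ.s j * g) + 1 := by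
  rw [← Φ.len_inv (Φ.s j * g), mul_inv_rev, Φ.s_inv, ← len_mul_s_of_neg h, Φ.len_inv]

variable (Φ) in
theorem smul_simple_mem (g : G) (j : B) : g • Φ.simple j ∈ Φ.R := Φ.smul_mem g (Φ.simple_mem j)

theorem pos_smul_simple_iff {g : G} {j : B} :
    Φ.Pos (g • Φ.simple j) ↔ Φ.len g < Φ.len (g * Φ.s j) := by
  constructor
  · intro h; rw [len_mul_s h]; exact Nat.lt_succ_self _
  · intro h
    by_contra h'
    rw [not_pos_iff (Φ.smul_simple_mem _ _)] at h'
    have := len_mul_s_of_neg h'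
    omega

theorem pos_inv_smul_simple_iff {g : G} {j : B} :
    Φ.Pos (g⁻¹ • Φ.simple j) ↔ Φ.len g < Φ.len (Φ.s j * g) := by
  rw [pos_smul_simple_iff, Φ.len_inv, ← Φ.len_inv (Φ.s j * g), mul_inv_rev, Φ.s_inv]

theorem len_eq_zero_iff {g : G} : Φ.len g = 0 ↔ ∀ a, Φ.Pos a → Φ.Pos (g • a) := by
  rw [len, Set.ncard_eq_zero (Φ.inv_finite g), Set.eq_empty_iff_forall_notMem]
  refine forall_congr' fun a => ⟨fun h ha => ?_, fun h ha => (h ha.1).not_neg ha.2⟩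
  rw [← not_pos_neg_iff (Φ.smul_mem g ha.1)]
  exact fun h' => h ⟨ha, h'⟩

theorem len_eq_zero_iff_simple {g : G} : Φ.len g = 0 ↔ ∀ j, Φ.Pos (g • Φ.simple j) := by
  rw [len_eq_zero_iff]
  refine ⟨fun h j => h _ (Φ.pos_simple j), fun h a ha => ?_⟩
  refine Pos.of_smul_simple (I := Set.univ) (fun i _ => h i) ha.1 ?_
  rw [Set.image_univ]; exact ha.2

theorem exists_neg_of_len_ne_zero {g : G} (h : Φ.len g ≠ 0) : ∃ j, Φ.Pos (-(g • Φ.simple j)) := by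
  by_contra! h'
  exact h (len_eq_zero_iff_simple.mpr fun j => (not_pos_neg_iff (Φ.smul_simple_mem _ _)).mp (h' j))

theorem exists_neg_left_of_len_ne_zero {g : G} (h : Φ.len g ≠ 0) :
    ∃ j, Φ.Pos (-(g⁻¹ • Φ.simple j)) :=
  exists_neg_of_len_ne_zero (by rwa [Φ.len_inv])

variable (Φ) in
@[simp] theorem len_one : Φ.len 1 = 0 := len_eq_zero_iff.mpr fun a ha => by rwa [one_smul]

variable (Φ) in
@[simp] theorem len_s (j : B) : Φ.len (Φ.s j) = 1 := by
  have := len_mul_s (Φ := Φ) (g := 1) (j := j) (by rw [one_smul]; exact Φ.pos_simple j)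
  simpa using this

/-- If no inversion of `h` is undone by `g`, the inversions of `g * h` are the disjoint union of
those of `h` and the pullback of those of `g`. All additivity statements for translations go through
this criterion. -/
theorem len_mul_of_inv {g h : G} (H : ∀ a, Φ.Pos a → Φ.Pos (-(h • a)) → Φ.Pos (-((g * h) • a))) :
    Φ.len (g * h) = Φ.len g + Φ.len h := by
  have key : Φ.inv (g * h) = (h⁻¹ • ·) '' Φ.inv g ∪ Φ.inv h := by
    ext a
    simp only [inv, Set.mem_union, Set.mem_image, Set.mem_ofPred_eq]
    constructor
    · rintro ⟨h1, h2⟩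
      rcases Φ.pos_or_neg (Φ.smul_mem h h1.1) with h3 | h3
      · exact Or.inl ⟨h • a, ⟨h3, by rwa [← mul_smul]⟩, by simp⟩
      · exact Or.inr ⟨h1, h3⟩
    · rintro (⟨b, ⟨h1, h2⟩, rfl⟩ | ⟨h1, h2⟩)
      · refine ⟨?_, by simpa [mul_smul] using h2⟩
        by_contra h3
        rw [not_pos_iff (Φ.smul_mem _ h1.1)] at h3
        have := H _ h3 (by simpa using h1)
        rw [mul_smul, smul_neg, smul_inv_smul, smul_neg, neg_neg] at this
        exact this.not_neg h2
      · exact ⟨h1, H a h1 h2⟩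
  rw [len, key, Set.ncard_union_eq _ ((Φ.inv_finite g).image _) (Φ.inv_finite h),
    Set.ncard_image_of_injective _ (MulAction.injective _), len, len]
  rw [Set.disjoint_left]
  rintro _ ⟨b, hb, rfl⟩ hb'
  have := hb'.2
  rw [smul_inv_smul] at this
  exact hb.1.not_neg this

theorem len_mul_of_left {g h : G} (hg : Φ.len g = 0) : Φ.len (g * h) = Φ.len h := by
  rw [len_mul_of_inv, hg, zero_add]
  intro a _ h2
  rw [mul_smul, ← smul_neg]
  exact len_eq_zero_iff.mp hg _ h2

theorem len_mul_of_right {g h : G} (hh : Φ.len h = 0) : Φ.len (g * h) = Φ.len g := by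
  rw [← Φ.len_inv, mul_inv_rev, len_mul_of_left (by rwa [Φ.len_inv]), Φ.len_inv]

/-- The conjugate `g s_i g⁻¹` has length one, so it makes some simple root negative. Pulled back by
`g`, that root is positive and is made negative by `s_i`, hence it is the i-th simple root. -/
theorem exists_smul_simple_of_len_eq_zero {g : G} (hg : Φ.len g = 0) (i : B) :
    ∃ j, g • Φ.simple i = Φ.simple j := by
  have hpos := len_eq_zero_iff.mp hg _ (Φ.pos_simple i)
  have hlen : Φ.len (g * Φ.s i * g⁻¹) = 1 := by
    rw [len_mul_of_right (by rwa [Φ.len_inv]), len_mul_of_left hg, Φ.len_s]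
  obtain ⟨j, hj⟩ := exists_neg_of_len_ne_zero (by rw [hlen]; exact one_ne_zero)
  refine ⟨j, ?_⟩
  have h1 : Φ.Pos (g⁻¹ • Φ.simple j) :=
    len_eq_zero_iff.mp (by rwa [Φ.len_inv]) _ (Φ.pos_simple j)
  have h2 : Φ.Pos (-(Φ.s i • g⁻¹ • Φ.simple j)) := by
    have := (len_eq_zero_iff (g := g⁻¹)).mp (by rwa [Φ.len_inv]) _ hj
    rw [mul_smul, mul_smul, smul_neg, inv_smul_smul] at this
    exact this
  rw [← h1.eq_simple_of_neg h2, smul_inv_smul]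

theorem len_s_mul_le (j : B) (g : G) : Φ.len (Φ.s j * g) ≤ Φ.len g + 1 := by
  rcases Φ.pos_or_neg (Φ.smul_simple_mem g⁻¹ j) with h | h
  · exact (len_s_mul h).le
  · have := len_s_mul_of_neg h; omega

theorem len_le_len_s_mul (j : B) (g : G) : Φ.len g ≤ Φ.len (Φ.s j * g) + 1 := by
  simpa using len_s_mul_le (Φ := Φ) j (Φ.s j * g)

theorem len_prod_mul_le (l : List B) (g : G) :
    Φ.len ((l.map Φ.s).prod * g) ≤ l.length + Φ.len g := by
  induction l with
  | nil => simp
  | cons j l ih =>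
    simp only [List.map_cons, List.prod_cons, List.length_cons, mul_assoc]
    have := len_s_mul_le (Φ := Φ) j ((l.map Φ.s).prod * g)
    omega

variable (Φ) in
/-- Induction along left multiplication by simple reflections that raise the length. -/
theorem induction_left {p : G → Prop} (h0 : ∀ g, Φ.len g = 0 → p g)
    (hs : ∀ j g, Φ.Pos (g⁻¹ • Φ.simple j) → p g → p (Φ.s j * g)) (g : G) : p g := by
  induction hn : Φ.len g generalizing g with
  | zero => exact h0 g hn
  | succ n ih =>
    obtain ⟨j, hj⟩ := exists_neg_left_of_len_ne_zero (Φ := Φ) (g := g) (by omega)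
    have h1 := len_s_mul_of_neg hj
    have h2 := hs j (Φ.s j * g) (by
      rwa [mul_inv_rev, mul_smul, Φ.s_inv, Φ.s_simple, smul_neg]) (ih _ (by omega))
    rwa [Φ.s_mul_s_mul] at h2

theorem len_mul_le (g h : G) : Φ.len (g * h) ≤ Φ.len g + Φ.len h := by
  induction g using Φ.induction_left with
  | h0 g hg => rw [len_mul_of_left hg]; omega
  | hs j g hj ih =>
    rw [len_s_mul hj, mul_assoc]
    have := len_s_mul_le (Φ := Φ) j (g * h)
    omega

end RootAction

/-! ### Alternating words in two elements. -/

namespace EuclideanRootSystem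

section altProd

variable {A : Type*}

@[simp] theorem altProd_zero [Monoid A] (x y : A) : altProd 0 x y = 1 := rfl

theorem altProd_succ [Monoid A] (n : ℕ) (x y : A) :
    altProd (n + 1) x y = x * altProd n y x := rfl

theorem map_altProd {A' F : Type*} [Monoid A] [Monoid A'] [FunLike F A A'] [MonoidHomClass F A A']
    (f : F) (n : ℕ) (x y : A) : f (altProd n x y) = altProd n (f x) (f y) := by
  induction n generalizing x y with
  | zero => exact map_one f
  | succ n ih => rw [altProd_succ, map_mul, ih, altProd_succ]

theorem exists_altProd_succ_eq_mul [Monoid A] (n : ℕ) (x y : A) :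
    ∃ z, (z = x ∨ z = y) ∧ altProd (n + 1) x y = altProd n x y * z := by
  induction n generalizing x y with
  | zero => exact ⟨x, Or.inl rfl, by simp [altProd_succ]⟩
  | succ n ih =>
    obtain ⟨z, hz, h⟩ := ih y x
    exact ⟨z, hz.symm, by rw [altProd_succ, h, altProd_succ, mul_assoc]⟩

variable [Group A] {x y : A}

theorem altProd_mul_inv_altProd (hx : x * x = 1) (hy : y * y = 1) (n : ℕ) :
    altProd n x y * (altProd n y x)⁻¹ = (x * y) ^ n := by
  induction n generalizing x y with
  | zero => simp
  | succ n ih =>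
    rw [altProd_succ, altProd_succ, mul_inv_rev, inv_eq_of_mul_eq_one_left hy, mul_assoc,
      ← mul_assoc (altProd n y x), ih hy hx, pow_succ' (x * y), ← mul_assoc x]
    have : ∀ n : ℕ, (y * x) ^ n * y = y * (x * y) ^ n := by
      intro n
      induction n with
      | zero => simp
      | succ n ih => rw [pow_succ', mul_assoc, ih, pow_succ', mul_assoc, mul_assoc]
    rw [mul_assoc, this, ← mul_assoc]

/-- The quotient of the two alternating words is a power of the product when both letters are
involutions, so a braid relation of `n` letters amounts to `(x * y) ^ n = 1`. -/
theorem altProd_eq_iff (hx : x * x = 1) (hy : y * y = 1) (n : ℕ) :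
    altProd n x y = altProd n y x ↔ (x * y) ^ n = 1 := by
  rw [← altProd_mul_inv_altProd hx hy, mul_inv_eq_one]

theorem altProd_mul_of_mem (hx : x * x = 1) (hy : y * y = 1) {z : A} (hz : z = x ∨ z = y) (n : ℕ) :
    altProd (n + 1) x y * z = altProd (n + 2) x y ∨ altProd (n + 1) x y * z = altProd n x y := by
  induction n generalizing x y with
  | zero => rcases hz with rfl | rfl <;> simp [altProd_succ, hx]
  | succ n ih =>
    rcases ih hy hx hz.symm with h | h
    · exact Or.inl (by rw [altProd_succ, mul_assoc, h]; rfl)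
    · exact Or.inr (by rw [altProd_succ, mul_assoc, h]; rfl)

end altProd

end EuclideanRootSystem

/-! ### Dihedral subgroups and Matsumoto's theorem. -/

namespace RootAction

open EuclideanRootSystem

variable {G B E : Type*} [Group G] [AddCommGroup E] [DistribMulAction G E] {Φ : RootAction G B E}

theorem s_smul_mem_span {I : Set B} {i : B} (hi : i ∈ I) {a : E}
    (ha : a ∈ Submodule.span ℤ (Φ.simple '' I)) :
    Φ.s i • a ∈ Submodule.span ℤ (Φ.simple '' I) := by
  obtain ⟨n, hn⟩ := Φ.s_smul i a
  rw [hn]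
  exact sub_mem ha (Submodule.smul_mem _ _ (Submodule.subset_span ⟨i, hi, rfl⟩))

theorem altProd_inv_smul_mem_span {x y : B} (n : ℕ) {a : E}
    (ha : a ∈ Submodule.span ℤ (Φ.simple '' {x, y})) :
    (altProd n (Φ.s x) (Φ.s y))⁻¹ • a ∈ Submodule.span ℤ (Φ.simple '' {x, y}) := by
  induction n generalizing x y a with
  | zero => simpa using ha
  | succ n ih =>
    rw [altProd_succ, mul_inv_rev, mul_smul, Φ.s_inv, Set.pair_comm]
    rw [Set.pair_comm] at ha
    exact ih (s_smul_mem_span (by simp) ha)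

/-- As letters are added, the root could become negative only by first meeting the simple root of
the next letter. By `conj` such a coincidence is a braid relation with `r + 1` letters, which is
excluded. -/
theorem pos_altProd_inv_smul {x y : B} {r : ℕ}
    (h : ∀ n, 1 ≤ n → n ≤ r → altProd n (Φ.s x) (Φ.s y) ≠ altProd n (Φ.s y) (Φ.s x)) :
    Φ.Pos ((altProd r (Φ.s x) (Φ.s y))⁻¹ • Φ.simple y) := by
  induction r with
  | zero => simpa using Φ.pos_simple y
  | succ r ih =>
    have ih := ih fun n h1 h2 => h n h1 (by omega)
    obtain ⟨z, hz, e⟩ := exists_altProd_succ_eq_mul r (Φ.s x) (Φ.s y)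
    obtain ⟨t, rfl⟩ : ∃ t, z = Φ.s t := by
      rcases hz with rfl | rfl
      exacts [⟨x, rfl⟩, ⟨y, rfl⟩]
    rw [e, mul_inv_rev, mul_smul, Φ.s_inv]
    refine ih.s_smul fun h' => h (r + 1) (by omega) le_rfl ?_
    have h2 := Φ.conj _ _ _ h'
    rw [e, altProd_succ, ← mul_right_inj (altProd r (Φ.s x) (Φ.s y))⁻¹, ← mul_assoc, ← mul_assoc, h2]
    group

theorem ne_of_lt_orderOf {x y : B} {n : ℕ} (h1 : 1 ≤ n)
    (h2 : ¬ IsOfFinOrder (Φ.s x * Φ.s y) ∨ n < orderOf (Φ.s x * Φ.s y)) :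
    altProd n (Φ.s x) (Φ.s y) ≠ altProd n (Φ.s y) (Φ.s x) := by
  rw [Ne, altProd_eq_iff (Φ.s_mul_s x) (Φ.s_mul_s y)]
  intro h
  rcases h2 with h2 | h2
  · exact h2 (isOfFinOrder_iff_pow_eq_one.mpr ⟨n, h1, h⟩)
  · exact absurd (orderOf_le_of_pow_eq_one h1 h) (by omega)

theorem orderOf_s_comm (x y : B) : orderOf (Φ.s y * Φ.s x) = orderOf (Φ.s x * Φ.s y) := by
  rw [← orderOf_inv, mul_inv_rev, Φ.s_inv, Φ.s_inv]

theorem isOfFinOrder_s_comm {x y : B} (h : IsOfFinOrder (Φ.s x * Φ.s y)) :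
    IsOfFinOrder (Φ.s y * Φ.s x) := by
  rw [← isOfFinOrder_inv_iff, mul_inv_rev, Φ.s_inv, Φ.s_inv]; exact h

theorem pos_altProd_inv_smul_of_lt {x y : B} {r : ℕ} (hr : r < orderOf (Φ.s x * Φ.s y)) :
    Φ.Pos ((altProd r (Φ.s x) (Φ.s y))⁻¹ • Φ.simple y) :=
  pos_altProd_inv_smul fun n h1 h2 => ne_of_lt_orderOf h1 (Or.inr (by omega))

theorem len_altProd {x y : B} {r : ℕ} (hr : r ≤ orderOf (Φ.s x * Φ.s y)) :
    Φ.len (altProd r (Φ.s x) (Φ.s y)) = r := by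
  induction r generalizing x y with
  | zero => simp
  | succ r ih =>
    rw [← orderOf_s_comm] at hr
    rw [altProd_succ, len_s_mul (pos_altProd_inv_smul_of_lt hr), ih (by omega)]

/-- One letter beyond the order, the braid relation rewrites the tail so that it starts with the
first letter, and the two cancel. The loss of two then persists for longer words. -/
theorem len_altProd_add_two_le {x y : B} (h : IsOfFinOrder (Φ.s x * Φ.s y)) {r : ℕ}
    (hr : orderOf (Φ.s x * Φ.s y) < r) : Φ.len (altProd r (Φ.s x) (Φ.s y)) + 2 ≤ r := by
  induction r generalizing x y with
  | zero => omega
  | succ r ih =>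
    rcases Nat.lt_or_ge (orderOf (Φ.s x * Φ.s y)) r with h' | h'
    · have := ih (x := y) (y := x) (isOfFinOrder_s_comm h) (by rwa [orderOf_s_comm])
      have h2 := len_s_mul_le (Φ := Φ) x (altProd r (Φ.s y) (Φ.s x))
      rw [altProd_succ]
      omega
    · have hr' : r = orderOf (Φ.s x * Φ.s y) := by omega
      have hpos : 0 < r := hr' ▸ h.orderOf_pos
      obtain ⟨t, rfl⟩ : ∃ t, r = t + 1 := ⟨r - 1, by omega⟩
      have e : altProd (t + 1) (Φ.s x) (Φ.s y) = altProd (t + 1) (Φ.s y) (Φ.s x) := by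
        rw [altProd_eq_iff (Φ.s_mul_s x) (Φ.s_mul_s y), hr', pow_orderOf_eq_one]
      rw [altProd_succ, ← e, altProd_succ, Φ.s_mul_s_mul,
        len_altProd (by rw [orderOf_s_comm]; omega)]

/-- An element with two left descents is divisible on the left by the longest element of the
dihedral group they generate. -/
theorem exists_eq_altProd_mul {g : G} {i j : B} (hi : Φ.Pos (-(g⁻¹ • Φ.simple i)))
    (hj : Φ.Pos (-(g⁻¹ • Φ.simple j))) :
    IsOfFinOrder (Φ.s i * Φ.s j) ∧ ∃ g', g = altProd (orderOf (Φ.s i * Φ.s j)) (Φ.s i) (Φ.s j) * g' ∧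
      Φ.len g = orderOf (Φ.s i * Φ.s j) + Φ.len g' := by
  -- `Q r` says that an alternating word of `r` letters, starting with either generator, splits off
  -- on the left with lengths adding up. The length of `g` bounds such `r`, so there is a largest
  -- one.
  let Q : ℕ → Prop := fun r => ∃ x y : B, ((x = i ∧ y = j) ∨ (x = j ∧ y = i)) ∧
    ∃ g', g = altProd r (Φ.s x) (Φ.s y) * g' ∧ Φ.len g = r + Φ.len g'
  have hQ1 : Q 1 := ⟨i, j, Or.inl ⟨rfl, rfl⟩, Φ.s i * g, by simp [altProd_succ],
    by rw [len_s_mul_of_neg hi, add_comm]⟩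
  obtain ⟨r, ⟨x, y, hxy, g', hg, hlen⟩, hnot⟩ : ∃ r, Q (r + 1) ∧ ¬ Q (r + 2) := by
    by_contra! hc
    have : ∀ r, Q (r + 1) := fun r => by
      induction r with
      | zero => exact hQ1
      | succ r ih => exact hc r ih
    obtain ⟨x, y, -, g', -, hlen⟩ := this (Φ.len g)
    omega
  -- Maximality of `r`: a left descent of `g'` in the dihedral group would either prolong the
  -- alternating word or cancel its last letter, and the latter contradicts additivity of lengths.
  have hpos : ∀ z ∈ ({x, y} : Set B), Φ.Pos (g'⁻¹ • Φ.simple z) := by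
    intro z hz
    by_contra hc
    rw [not_pos_iff (Φ.smul_simple_mem _ _)] at hc
    have h1 := len_s_mul_of_neg hc
    have h2 : g = altProd (r + 1) (Φ.s x) (Φ.s y) * Φ.s z * (Φ.s z * g') := by
      rw [mul_assoc, Φ.s_mul_s_mul, hg]
    rcases altProd_mul_of_mem (Φ.s_mul_s x) (Φ.s_mul_s y) (z := Φ.s z)
      (by rcases hz with rfl | rfl <;> simp) r with h3 | h3
    · exact hnot ⟨x, y, hxy, Φ.s z * g', by rw [h2, h3], by omega⟩
    · rw [h3] at h2
      have h4 := len_mul_le (Φ := Φ) (altProd r (Φ.s x) (Φ.s y)) (Φ.s z * g')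
      have h5 : ∀ x y, Φ.len (altProd r (Φ.s x) (Φ.s y)) ≤ r := by
        clear * -
        induction r with
        | zero => simp
        | succ r ih =>
          intro x y
          have := len_s_mul_le (Φ := Φ) x (altProd r (Φ.s y) (Φ.s x))
          have := ih y x
          rw [altProd_succ]; omega
      have h6 := h5 x y
      rw [← h2] at h4
      omega
  have hy : Φ.Pos (-(g⁻¹ • Φ.simple y)) := by
    rcases hxy with ⟨rfl, rfl⟩ | ⟨rfl, rfl⟩ <;> assumption
  -- Without a braid relation this short, the inverse of the word carries the simple root of `y` to
  -- a positive combination of the two simple roots. By `hpos` the inverse of `g'` keeps it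
  -- positive, although `y` is a left descent of `g`.
  obtain ⟨n, hn1, hn2, hn⟩ : ∃ n, 1 ≤ n ∧ n ≤ r + 1 ∧
      altProd n (Φ.s x) (Φ.s y) = altProd n (Φ.s y) (Φ.s x) := by
    by_contra! hc
    have h1 := pos_altProd_inv_smul hc
    have h2 := h1.mem_closure_of_mem_span (I := {x, y}) (altProd_inv_smul_mem_span _
      (Submodule.subset_span ⟨y, by simp, rfl⟩))
    have h3 := Pos.of_smul_simple hpos h1.1 h2
    rw [← mul_smul, ← mul_inv_rev, ← hg] at h3
    exact h3.not_neg hy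
  rw [altProd_eq_iff (Φ.s_mul_s x) (Φ.s_mul_s y)] at hn
  have hfin : IsOfFinOrder (Φ.s x * Φ.s y) := isOfFinOrder_iff_pow_eq_one.mpr ⟨n, hn1, hn⟩
  have hle : orderOf (Φ.s x * Φ.s y) ≤ r + 1 := (orderOf_le_of_pow_eq_one hn1 hn).trans hn2
  have heq : r + 1 = orderOf (Φ.s x * Φ.s y) := by
    by_contra hne
    have h1 := len_altProd_add_two_le hfin (r := r + 1) (by omega)
    have h2 := len_mul_le (Φ := Φ) (altProd (r + 1) (Φ.s x) (Φ.s y)) g'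
    rw [← hg] at h2
    omega
  rw [heq] at hg hlen
  rcases hxy with ⟨rfl, rfl⟩ | ⟨rfl, rfl⟩
  · exact ⟨hfin, g', hg, hlen⟩
  · refine ⟨isOfFinOrder_s_comm hfin, g', ?_, by rw [orderOf_s_comm, hlen]⟩
    rw [orderOf_s_comm, hg]
    congr 1
    rw [altProd_eq_iff (Φ.s_mul_s _) (Φ.s_mul_s _), pow_orderOf_eq_one]

/-- The alternating word `i j i ⋯` with `n` letters. -/
def altList : ℕ → B → B → List B
  | 0, _, _ => []
  | n + 1, i, j => i :: altList n j i

theorem length_altList (n : ℕ) (i j : B) : (altList n i j).length = n := by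
  induction n generalizing i j with
  | zero => rfl
  | succ n ih => simp [altList, ih]

theorem prod_map_altList {M : Type*} [Monoid M] (X : B → M) (n : ℕ) (i j : B) :
    ((altList n i j).map X).prod = altProd n (X i) (X j) := by
  induction n generalizing i j with
  | zero => rfl
  | succ n ih => simp [altList, ih, altProd_succ]

variable (Φ) in
/-- `(l, ω)` is a reduced expression of `g`. -/
structure IsReduced (g : G) (l : List B) (ω : G) : Prop where
  eq : g = (l.map Φ.s).prod * ω
  length_eq : l.length = Φ.len g
  len_eq : Φ.len ω = 0

theorem IsReduced.cons {g : G} {l : List B} {ω : G} (h : Φ.IsReduced g l ω) {j : B}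
    (hj : Φ.Pos (g⁻¹ • Φ.simple j)) : Φ.IsReduced (Φ.s j * g) (j :: l) ω :=
  ⟨by simp [h.eq, mul_assoc], by simp [len_s_mul hj, h.length_eq], h.len_eq⟩

theorem IsReduced.tail {g : G} {l : List B} {ω : G} {j : B} (h : Φ.IsReduced g (j :: l) ω) :
    Φ.Pos (-(g⁻¹ • Φ.simple j)) ∧ Φ.IsReduced (Φ.s j * g) l ω := by
  have e : Φ.s j * g = (l.map Φ.s).prod * ω := by
    rw [h.eq, List.map_cons, List.prod_cons, mul_assoc, Φ.s_mul_s_mul]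
  have h1 := len_prod_mul_le (Φ := Φ) l ω
  have h2 := h.length_eq
  have h3 := h.len_eq
  rw [← e] at h1
  rw [List.length_cons] at h2
  have hneg : Φ.Pos (-(g⁻¹ • Φ.simple j)) := by
    rw [← not_pos_iff (Φ.smul_simple_mem _ _), pos_inv_smul_simple_iff]
    omega
  exact ⟨hneg, e, by have := len_s_mul_of_neg hneg; omega, h3⟩

variable (Φ) in
theorem exists_isReduced (g : G) : ∃ l ω, Φ.IsReduced g l ω := by
  induction g using Φ.induction_left with
  | h0 g hg => exact ⟨[], g, by simp, by simp [hg], hg⟩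
  | hs j g hj ih =>
    obtain ⟨l, ω, h⟩ := ih
    exact ⟨j :: l, ω, h.cons hj⟩

/-- Matsumoto's theorem. -/
theorem IsReduced.prod_eq {M : Type*} [Monoid M] {X : B → M} (Z : G → M)
    (hX : ∀ i j, i ≠ j → IsOfFinOrder (Φ.s i * Φ.s j) →
      altProd (orderOf (Φ.s i * Φ.s j)) (X i) (X j) =
        altProd (orderOf (Φ.s i * Φ.s j)) (X j) (X i))
    {g : G} {l l' : List B} {ω ω' : G} (h : Φ.IsReduced g l ω) (h' : Φ.IsReduced g l' ω') :
    (l.map X).prod * Z ω = (l'.map X).prod * Z ω' := by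
  induction hn : Φ.len g generalizing g l l' ω ω' with
  | zero =>
    have e1 := List.length_eq_zero_iff.mp (h.length_eq.trans hn)
    have e2 := List.length_eq_zero_iff.mp (h'.length_eq.trans hn)
    subst e1 e2
    have e3 := h.eq
    rw [h'.eq] at e3
    simp only [List.map_nil, List.prod_nil, one_mul] at e3
    rw [e3]
  | succ n ih =>
    obtain ⟨i, t, rfl⟩ := List.exists_cons_of_length_eq_add_one (h.length_eq.trans hn)
    obtain ⟨j, t', rfl⟩ := List.exists_cons_of_length_eq_add_one (h'.length_eq.trans hn)
    obtain ⟨hi, ht⟩ := h.tail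
    obtain ⟨hj, ht'⟩ := h'.tail
    have hli := len_s_mul_of_neg hi
    have hlj := len_s_mul_of_neg hj
    simp only [List.map_cons, List.prod_cons, mul_assoc]
    by_cases hij : i = j
    · subst hij
      rw [ih ht ht' (by omega)]
    -- Two words with different first letters are compared through two further words, obtained from
    -- one reduced word of `g'` by prefixing the two sides of the braid relation. Each comparison
    -- then shares a first letter, and the induction hypothesis applies to the shorter elements `s i
    -- * g` and `s j * g`.
    · obtain ⟨hfin, g', hg', hlen⟩ := exists_eq_altProd_mul hi hj
      obtain ⟨u, ν, hu⟩ := Φ.exists_isReduced g'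
      set m := orderOf (Φ.s i * Φ.s j) with hm
      have hmpos : 0 < m := hfin.orderOf_pos
      obtain ⟨p, hp⟩ : ∃ p, m = p + 1 := ⟨m - 1, by omega⟩
      have hg'' : g = altProd m (Φ.s j) (Φ.s i) * g' := by
        rw [hg']
        congr 1
        rw [altProd_eq_iff (Φ.s_mul_s _) (Φ.s_mul_s _), hm, pow_orderOf_eq_one]
      have r1 : Φ.IsReduced (Φ.s i * g) (altList p j i ++ u) ν := by
        refine ⟨?_, ?_, hu.len_eq⟩
        · rw [List.map_append, List.prod_append, prod_map_altList, mul_assoc, ← hu.eq]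
          rw [hp, altProd_succ, mul_assoc] at hg'
          nth_rewrite 1 [hg']
          rw [Φ.s_mul_s_mul]
        · rw [List.length_append, length_altList, hu.length_eq]; omega
      have r2 : Φ.IsReduced (Φ.s j * g) (altList p i j ++ u) ν := by
        refine ⟨?_, ?_, hu.len_eq⟩
        · rw [List.map_append, List.prod_append, prod_map_altList, mul_assoc, ← hu.eq]
          rw [hp, altProd_succ, mul_assoc] at hg''
          nth_rewrite 1 [hg'']
          rw [Φ.s_mul_s_mul]
        · rw [List.length_append, length_altList, hu.length_eq]; omega
      rw [ih ht r1 (by omega), ih ht' r2 (by omega)]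
      simp only [List.map_append, List.prod_append, prod_map_altList, ← mul_assoc]
      rw [← altProd_succ, ← altProd_succ, ← hp, hX i j hij hfin]

end RootAction

/-! ### Lifting braid relations to a map on the whole group. -/

namespace RootAction

open EuclideanRootSystem

variable {G B E : Type*} [Group G] [AddCommGroup E] [DistribMulAction G E] {Φ : RootAction G B E}

/-- Elements of a monoid that satisfy the braid relations and the relations of the elements of
length zero. -/
structure BraidData (Φ : RootAction G B E) (M : Type*) [Monoid M] where
  X : B → M
  Z : G → M
  braid : ∀ i j, i ≠ j → IsOfFinOrder (Φ.s i * Φ.s j) →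
    altProd (orderOf (Φ.s i * Φ.s j)) (X i) (X j) = altProd (orderOf (Φ.s i * Φ.s j)) (X j) (X i)
  Z_one : Z 1 = 1
  Z_mul : ∀ g h, Φ.len g = 0 → Φ.len h = 0 → Z (g * h) = Z g * Z h
  Z_X : ∀ g i j, Φ.len g = 0 → g • Φ.simple i = Φ.simple j → Z g * X i = X j * Z g

namespace BraidData

variable {M : Type*} [Monoid M] (D : BraidData Φ M)

/-- The product over a reduced expression. -/
noncomputable def lift (g : G) : M :=
  ((Φ.exists_isReduced g).choose.map D.X).prod * D.Z (Φ.exists_isReduced g).choose_spec.choose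

theorem lift_eq {g : G} {l : List B} {ω : G} (h : Φ.IsReduced g l ω) :
    D.lift g = (l.map D.X).prod * D.Z ω :=
  IsReduced.prod_eq D.Z D.braid (Φ.exists_isReduced g).choose_spec.choose_spec h

theorem lift_of_len_eq_zero {g : G} (hg : Φ.len g = 0) : D.lift g = D.Z g := by
  rw [D.lift_eq (l := []) (ω := g) ⟨by simp, by simp [hg], hg⟩]; simp

@[simp] theorem lift_one : D.lift 1 = 1 := by
  rw [D.lift_of_len_eq_zero Φ.len_one, D.Z_one]

theorem lift_s_mul {g : G} {j : B} (h : Φ.Pos (g⁻¹ • Φ.simple j)) :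
    D.lift (Φ.s j * g) = D.X j * D.lift g := by
  obtain ⟨l, ω, hl⟩ := Φ.exists_isReduced g
  rw [D.lift_eq hl, D.lift_eq (hl.cons h), List.map_cons, List.prod_cons, mul_assoc]

theorem lift_s (j : B) : D.lift (Φ.s j) = D.X j := by
  have := D.lift_s_mul (g := 1) (j := j) (by simpa using Φ.pos_simple j)
  simpa using this

theorem lift_zero_mul {g h : G} (hg : Φ.len g = 0) : D.lift (g * h) = D.Z g * D.lift h := by
  induction h using Φ.induction_left generalizing g with
  | h0 h hh =>
    rw [D.lift_of_len_eq_zero hh, D.lift_of_len_eq_zero (by rw [len_mul_of_left hg, hh]),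
      D.Z_mul _ _ hg hh]
  | hs j h hj ih =>
    obtain ⟨i, hi⟩ := exists_smul_simple_of_len_eq_zero hg j
    rw [D.lift_s_mul hj, ← mul_assoc, Φ.conj _ _ _ hi, mul_assoc, D.lift_s_mul, ih hg, ← mul_assoc,
      ← mul_assoc, D.Z_X _ _ _ hg hi]
    rw [mul_inv_rev, mul_smul, ← hi, inv_smul_smul]
    exact hj

theorem lift_mul {g h : G} (H : Φ.len (g * h) = Φ.len g + Φ.len h) :
    D.lift (g * h) = D.lift g * D.lift h := by
  induction g using Φ.induction_left with
  | h0 g hg => rw [D.lift_zero_mul hg, D.lift_of_len_eq_zero hg]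
  | hs j g hj ih =>
    rw [len_s_mul hj, mul_assoc] at H
    have h1 := len_s_mul_le (Φ := Φ) j (g * h)
    have h2 := len_mul_le (Φ := Φ) g h
    rw [mul_assoc, D.lift_s_mul, D.lift_s_mul hj, ih (by omega), mul_assoc]
    rw [pos_inv_smul_simple_iff]
    omega

theorem lift_mul_s {g : G} {j : B} (h : Φ.Pos (g • Φ.simple j)) :
    D.lift (g * Φ.s j) = D.lift g * D.X j := by
  rw [D.lift_mul, D.lift_s]
  rw [len_mul_s h, Φ.len_s]

/-- If the `X j` are involutions then the lift is a homomorphism. -/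
noncomputable def liftHom (hX : ∀ j, D.X j * D.X j = 1) : G →* M where
  toFun := D.lift
  map_one' := D.lift_one
  map_mul' g h := by
    induction g using Φ.induction_left with
    | h0 g hg => rw [D.lift_zero_mul hg, D.lift_of_len_eq_zero hg]
    | hs j g hj ih =>
      rw [D.lift_s_mul hj, mul_assoc, mul_assoc, ← ih]
      rcases Φ.pos_or_neg (Φ.smul_simple_mem (g * h)⁻¹ j) with h' | h'
      · exact D.lift_s_mul h'
      · have := D.lift_s_mul (g := Φ.s j * (g * h)) (j := j)
          (by rwa [mul_inv_rev, mul_smul, Φ.s_inv, Φ.s_simple, smul_neg])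
        rw [Φ.s_mul_s_mul] at this
        rw [this, ← mul_assoc (D.X j) (D.X j), hX, one_mul]

end BraidData

end RootAction

/-! ### The regular representation of the generic Hecke algebra. -/

namespace RootAction

open EuclideanRootSystem

variable {G B E : Type*} [Group G] [AddCommGroup E] [DistribMulAction G E] (Φ : RootAction G B E)

section Regular

variable (p : B → ℂ)

open Classical in
/-- The operator of left multiplication by `T_j` in the regular representation. -/
noncomputable def leftOp (j : B) : Module.End ℂ (G →₀ ℂ) :=
  Finsupp.linearCombination ℂ fun g => Finsupp.single (Φ.s j * g) 1 +
    (if Φ.Pos (g⁻¹ • Φ.simple j) then 0 else p j) • Finsupp.single g 1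

open Classical in
/-- The operator of right multiplication by `T_j` in the regular representation. -/
noncomputable def rightOp (j : B) : Module.End ℂ (G →₀ ℂ) :=
  Finsupp.linearCombination ℂ fun g => Finsupp.single (g * Φ.s j) 1 +
    (if Φ.Pos (g • Φ.simple j) then 0 else p j) • Finsupp.single g 1

/-- Left translation. -/
noncomputable def leftTr (g : G) : Module.End ℂ (G →₀ ℂ) := Finsupp.lmapDomain ℂ ℂ (g * ·)

/-- Right translation. -/
noncomputable def rightTr (g : G) : Module.End ℂ (G →₀ ℂ) := Finsupp.lmapDomain ℂ ℂ (· * g)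

open Classical in
theorem leftOp_single (j : B) (g : G) : Φ.leftOp p j (Finsupp.single g 1) =
    Finsupp.single (Φ.s j * g) 1 +
      (if Φ.Pos (g⁻¹ • Φ.simple j) then 0 else p j) • Finsupp.single g 1 := by
  rw [leftOp, Finsupp.linearCombination_single, one_smul]

open Classical in
theorem rightOp_single (j : B) (g : G) : Φ.rightOp p j (Finsupp.single g 1) =
    Finsupp.single (g * Φ.s j) 1 +
      (if Φ.Pos (g • Φ.simple j) then 0 else p j) • Finsupp.single g 1 := by
  rw [rightOp, Finsupp.linearCombination_single, one_smul]

theorem leftTr_single (g h : G) :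
    leftTr g (Finsupp.single h 1) = Finsupp.single (g * h) 1 := by
  simp [leftTr]

theorem rightTr_single (g h : G) :
    rightTr g (Finsupp.single h 1) = Finsupp.single (h * g) 1 := by
  simp [rightTr]

theorem end_ext {G : Type*} {U V : Module.End ℂ (G →₀ ℂ)}
    (h : ∀ g, U (Finsupp.single g 1) = V (Finsupp.single g 1)) : U = V :=
  Finsupp.lhom_ext' fun g => LinearMap.ext_ring (h g)

variable {p}

/-- Multiplying by `s j` on the right does not affect whether `s i` lengthens on the left, unless
`g` carries the j-th simple root to plus or minus the i-th. In these two cases `s i * g = g * s j`,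
and `hp` makes the two parameters equal. -/
theorem leftOp_rightOp (hp : ∀ (g : G) i j, g • Φ.simple i = Φ.simple j → p i = p j) (i j : B) :
    Commute (Φ.leftOp p i) (Φ.rightOp p j) := by
  classical
  refine end_ext fun g => ?_
  simp only [Module.End.mul_apply, leftOp_single, rightOp_single, map_add, map_smul, mul_inv_rev,
    Φ.s_inv, mul_smul, mul_assoc]
  by_cases h : g • Φ.simple j = Φ.simple i
  · have h1 : g⁻¹ • Φ.simple i = Φ.simple j := by rw [← h, inv_smul_smul]
    have h2 := Φ.conj _ _ _ h
    rw [h, h1, Φ.s_simple, Φ.s_simple, h2, if_pos (Φ.pos_simple i), if_pos (Φ.pos_simple j),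
      if_neg (Φ.pos_simple i).not_neg, if_neg (Φ.pos_simple j).not_neg, hp _ _ _ h]
  by_cases h' : g • Φ.simple j = -Φ.simple i
  · have h1 : g⁻¹ • Φ.simple i = -Φ.simple j := by
      rw [← neg_neg (Φ.simple i), ← h', smul_neg, inv_smul_smul]
    have h3 : (Φ.s i * g) • Φ.simple j = Φ.simple i := by
      rw [mul_smul, h', smul_neg, Φ.s_simple, neg_neg]
    have h2 := Φ.conj _ _ _ h3
    rw [Φ.s_mul_s_mul, mul_assoc] at h2
    have h4 : g * Φ.s j = Φ.s i * g := by
      nth_rewrite 2 [← h2]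
      rw [Φ.s_mul_s_mul]
    rw [h', h1, smul_neg, smul_neg, Φ.s_simple, Φ.s_simple, h4, if_neg (Φ.pos_simple i).not_neg,
      if_neg (Φ.pos_simple j).not_neg, neg_neg, neg_neg, if_pos (Φ.pos_simple i),
      if_pos (Φ.pos_simple j), hp _ _ _ h3]
  have key : ∀ (l : B) (b : E), b ∈ Φ.R → b ≠ Φ.simple l → b ≠ -Φ.simple l →
      (Φ.Pos (Φ.s l • b) ↔ Φ.Pos b) := by
    intro l b hb h1 h2
    refine ⟨fun h => ?_, fun h => h.s_smul h1⟩
    have := h.s_smul (j := l) fun e => h2 (by rw [← Φ.s_simple, ← e, Φ.s_smul_s_smul])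
    rwa [Φ.s_smul_s_smul] at this
  have e1 : Φ.Pos (Φ.s j • g⁻¹ • Φ.simple i) ↔ Φ.Pos (g⁻¹ • Φ.simple i) := by
    refine key j _ (Φ.smul_simple_mem _ _) (fun e => h ?_) (fun e => h' ?_)
    · rw [← e, smul_inv_smul]
    · rw [← neg_neg (Φ.simple j), ← e, smul_neg, smul_inv_smul]
  have e2 : Φ.Pos (Φ.s i • g • Φ.simple j) ↔ Φ.Pos (g • Φ.simple j) :=
    key i _ (Φ.smul_simple_mem _ _) h h'
  rw [if_congr e1 rfl rfl, if_congr e2 rfl rfl]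
  module

theorem leftOp_rightTr (i : B) {g : G} (hg : Φ.len g = 0) :
    Commute (Φ.leftOp p i) (rightTr g) := by
  classical
  refine end_ext fun h => ?_
  have e : Φ.Pos ((h * g)⁻¹ • Φ.simple i) ↔ Φ.Pos (h⁻¹ • Φ.simple i) := by
    rw [mul_inv_rev, mul_smul]
    refine ⟨fun H => ?_, fun H => len_eq_zero_iff.mp (by rwa [Φ.len_inv]) _ H⟩
    have := len_eq_zero_iff.mp hg _ H
    rwa [smul_inv_smul] at this
  simp only [Module.End.mul_apply, leftOp_single, rightTr_single, map_add, map_smul, mul_assoc,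
    if_congr e rfl rfl]

theorem leftOp_mul_leftOp (j : B) :
    Φ.leftOp p j * Φ.leftOp p j = 1 + p j • Φ.leftOp p j := by
  classical
  refine end_ext fun g => ?_
  simp only [Module.End.mul_apply, leftOp_single, map_add, map_smul, mul_inv_rev,
    Φ.s_inv, mul_smul, Φ.s_mul_s_mul, Φ.s_simple, smul_neg, LinearMap.add_apply,
    Module.End.one_apply, LinearMap.smul_apply]
  rcases Φ.pos_or_neg (Φ.smul_simple_mem g⁻¹ j) with h | h
  · rw [if_pos h, if_neg h.not_neg]
    module
  · rw [if_pos h, if_neg (fun h' => h'.not_neg h)]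
    module

/-- The right operators generate everything from the vector at `1`, so an operator that commutes
with them is determined by one value. This reduces the braid relations of the left operators to
alternating words applied to `1`, where they are products of basis elements. -/
theorem end_eq_of_commute {U V : Module.End ℂ (G →₀ ℂ)}
    (h1 : U (Finsupp.single 1 1) = V (Finsupp.single 1 1))
    (hU : ∀ j, Commute U (Φ.rightOp p j)) (hV : ∀ j, Commute V (Φ.rightOp p j))
    (hU' : ∀ g, Φ.len g = 0 → Commute U (rightTr g))
    (hV' : ∀ g, Φ.len g = 0 → Commute V (rightTr g)) : U = V := by
  classical
  refine end_ext fun g => ?_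
  suffices ∀ g : G, U (Finsupp.single g⁻¹ 1) = V (Finsupp.single g⁻¹ 1) by simpa using this g⁻¹
  intro g
  induction g using Φ.induction_left with
  | h0 g hg =>
    rw [← one_mul g⁻¹, ← rightTr_single, ← Module.End.mul_apply, ← Module.End.mul_apply,
      (hU' _ (by rwa [Φ.len_inv])).eq, (hV' _ (by rwa [Φ.len_inv])).eq, Module.End.mul_apply, h1,
      Module.End.mul_apply]
  | hs j g hj ih =>
    have e : Finsupp.single (Φ.s j * g)⁻¹ (1 : ℂ) = Φ.rightOp p j (Finsupp.single g⁻¹ 1) := by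
      rw [rightOp_single, if_pos hj, zero_smul, add_zero, mul_inv_rev, Φ.s_inv]
    rw [e, ← Module.End.mul_apply, ← Module.End.mul_apply, (hU j).eq, (hV j).eq,
      Module.End.mul_apply, ih, Module.End.mul_apply]

theorem altProd_leftOp_single {i j : B} {n : ℕ} (hn : n ≤ orderOf (Φ.s i * Φ.s j)) :
    altProd n (Φ.leftOp p i) (Φ.leftOp p j) (Finsupp.single 1 1) =
      Finsupp.single (altProd n (Φ.s i) (Φ.s j)) 1 := by
  classical
  induction n generalizing i j with
  | zero => rfl
  | succ n ih =>
    rw [← orderOf_s_comm] at hn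
    rw [altProd_succ, Module.End.mul_apply, ih (by omega), leftOp_single,
      if_pos (pos_altProd_inv_smul_of_lt hn), zero_smul, add_zero, altProd_succ]

theorem commute_altProd {M : Type*} [Monoid M] {x y z : M} (hx : Commute x z) (hy : Commute y z)
    (n : ℕ) : Commute (altProd n x y) z := by
  induction n generalizing x y with
  | zero => exact Commute.one_left z
  | succ n ih => exact hx.mul_left (ih hy hx)

/-- The regular representation. -/
noncomputable def regular (hp : ∀ (g : G) i j, g • Φ.simple i = Φ.simple j → p i = p j) :
    BraidData Φ (Module.End ℂ (G →₀ ℂ)) where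
  X := Φ.leftOp p
  Z := leftTr
  braid i j _ hfin := by
    refine Φ.end_eq_of_commute (p := p) ?_
      (fun l => commute_altProd (Φ.leftOp_rightOp hp i l) (Φ.leftOp_rightOp hp j l) _)
      (fun l => commute_altProd (Φ.leftOp_rightOp hp j l) (Φ.leftOp_rightOp hp i l) _)
      (fun g hg => commute_altProd (Φ.leftOp_rightTr i hg) (Φ.leftOp_rightTr j hg) _)
      (fun g hg => commute_altProd (Φ.leftOp_rightTr j hg) (Φ.leftOp_rightTr i hg) _)
    rw [Φ.altProd_leftOp_single le_rfl, Φ.altProd_leftOp_single (orderOf_s_comm _ _).ge,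
      (altProd_eq_iff (Φ.s_mul_s i) (Φ.s_mul_s j) _).mpr (pow_orderOf_eq_one _)]
  Z_one := end_ext fun g => by simp [leftTr_single]
  Z_mul g h _ _ := end_ext fun g => by simp [leftTr_single, mul_assoc]
  Z_X g i j hg h := by
    classical
    refine end_ext fun h' => ?_
    have h2 := Φ.conj _ _ _ h
    have h3 : (g * h')⁻¹ • Φ.simple j = h'⁻¹ • Φ.simple i := by
      rw [← h, mul_inv_rev, mul_smul, inv_smul_smul]
    simp only [Module.End.mul_apply, leftOp_single, leftTr_single, map_add, map_smul, h3]
    rw [← mul_assoc, h2, mul_assoc, hp _ _ _ h]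

theorem regular_lift_single (hp : ∀ (g : G) i j, g • Φ.simple i = Φ.simple j → p i = p j) (g : G) :
    (Φ.regular hp).lift g (Finsupp.single 1 1) = Finsupp.single g 1 := by
  classical
  induction g using Φ.induction_left with
  | h0 g hg =>
    rw [BraidData.lift_of_len_eq_zero _ hg]
    simp [regular, leftTr_single]
  | hs j g hj ih =>
    rw [BraidData.lift_s_mul _ hj, Module.End.mul_apply, ih]
    simp [regular, leftOp_single, if_pos hj]

end Regular

end RootAction

/-! ### Yang-Baxter equations in the rank-two Hecke algebras. -/

section YangBaxter

variable {K A : Type*} [CommRing K] [Ring A] [Algebra K A] {a b : A} {P Q u₁ u₂ u₃ u₄ u₅ u₆ : K}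

theorem yangBaxter_two (h : a * b = b * a) :
    (a - (P * u₁) • 1) * (b - (Q * u₂) • 1) = (b - (Q * u₂) • 1) * (a - (P * u₁) • 1) := by
  simp only [sub_mul, mul_sub, smul_mul_assoc, mul_smul_comm, one_mul, mul_one, h]
  module

/-- After expansion the longest words agree by the braid relation and squares reduce by the
quadratic relations. What is left is a multiple of `b - a` whose coefficient vanishes by `hu`. -/
theorem yangBaxter_three (ha : a * a = 1 + P • a) (hb : b * b = 1 + P • b)
    (h : a * (b * a) = b * (a * b)) (hu : u₁ * u₃ = u₂ * (u₁ + u₃ - 1)) :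
    (a - (P * u₁) • 1) * ((b - (P * u₂) • 1) * (a - (P * u₃) • 1)) =
      (b - (P * u₃) • 1) * ((a - (P * u₂) • 1) * (b - (P * u₁) • 1)) := by
  simp only [sub_mul, mul_sub, smul_mul_assoc, mul_smul_comm, one_mul, mul_one, h, ha, hb]
  linear_combination (norm := module) (P * P * hu) • (b - a)

/-- Here the surviving terms are multiples of `a * b - b * a`; the parameters may differ, since the
two generators need not be conjugate. -/
theorem yangBaxter_four (ha : a * a = 1 + P • a) (hb : b * b = 1 + Q • b)
    (h : a * (b * (a * b)) = b * (a * (b * a)))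
    (hu : u₁ * u₂ + u₂ * u₃ + u₃ * u₄ - u₂ - u₃ - u₁ * u₄ = 0) :
    (a - (P * u₁) • 1) * ((b - (Q * u₂) • 1) * ((a - (P * u₃) • 1) * (b - (Q * u₄) • 1))) =
      (b - (Q * u₄) • 1) * ((a - (P * u₃) • 1) * ((b - (Q * u₂) • 1) * (a - (P * u₁) • 1))) := by
  have ha' : ∀ z, a * (a * z) = z + P • (a * z) := fun z => by
    rw [← mul_assoc, ha, add_mul, one_mul, smul_mul_assoc]
  have hb' : ∀ z, b * (b * z) = z + Q • (b * z) := fun z => by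
    rw [← mul_assoc, hb, add_mul, one_mul, smul_mul_assoc]
  simp only [sub_mul, mul_sub, mul_add, smul_mul_assoc, mul_smul_comm, one_mul, mul_one, h, ha, hb,
    ha', hb']
  linear_combination (norm := module) (P * Q * hu) • (a * b - b * a)

/-- The quadratic condition `hu` kills the coefficient of `a * b * a * b - b * a * b * a`. The other
three conditions together kill that of `a * b - b * a`: the parts with P² and with Q² belong to the
two subsystems of type A₂, one for each root length, and the part with P²Q² is `hu₃`. -/
theorem yangBaxter_six (ha : a * a = 1 + P • a) (hb : b * b = 1 + Q • b)
    (h : a * (b * (a * (b * (a * b)))) = b * (a * (b * (a * (b * a)))))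
    (hu : u₁ * u₂ + u₂ * u₃ + u₃ * u₄ + u₄ * u₅ + u₅ * u₆ - u₂ - u₃ - u₄ - u₅ - u₁ * u₆ = 0)
    (hu₁ : u₁ * u₅ = u₃ * (u₁ + u₅ - 1)) (hu₂ : u₂ * u₆ = u₄ * (u₂ + u₆ - 1))
    (hu₃ : u₂ * u₄ + u₂ * u₅ + u₃ * u₅ - u₁ * u₂ * u₄ - u₁ * u₂ * u₅ + u₁ * u₃ * u₆ + u₁ * u₄ * u₆
      - u₂ * u₃ * u₄ - u₂ * u₃ * u₅ - u₂ * u₄ * u₅ - u₂ * u₅ * u₆ - u₃ * u₄ * u₅ - u₃ * u₅ * u₆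
      + u₁ * u₂ * u₃ * u₄ - u₁ * u₂ * u₃ * u₆ + u₁ * u₂ * u₄ * u₅ + u₁ * u₂ * u₅ * u₆
      - u₁ * u₃ * u₄ * u₆ - u₁ * u₄ * u₅ * u₆ + u₂ * u₃ * u₄ * u₅ + u₂ * u₃ * u₅ * u₆
      + u₃ * u₄ * u₅ * u₆ = 0) :
    (a - (P * u₁) • 1) * ((b - (Q * u₂) • 1) * ((a - (P * u₃) • 1) * ((b - (Q * u₄) • 1) *
      ((a - (P * u₅) • 1) * (b - (Q * u₆) • 1))))) =
    (b - (Q * u₆) • 1) * ((a - (P * u₅) • 1) * ((b - (Q * u₄) • 1) * ((a - (P * u₃) • 1) *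
      ((b - (Q * u₂) • 1) * (a - (P * u₁) • 1))))) := by
  have ha' : ∀ z, a * (a * z) = z + P • (a * z) := fun z => by
    rw [← mul_assoc, ha, add_mul, one_mul, smul_mul_assoc]
  have hb' : ∀ z, b * (b * z) = z + Q • (b * z) := fun z => by
    rw [← mul_assoc, hb, add_mul, one_mul, smul_mul_assoc]
  simp only [sub_mul, mul_sub, mul_add, smul_mul_assoc, mul_smul_comm, one_mul, mul_one, h, ha, hb,
    ha', hb']
  linear_combination (norm := module) (P * Q * hu) • (a * (b * (a * b)) - b * (a * (b * a))) +
    (P * P * Q * Q * hu₃ - P * P * hu₁ - Q * Q * hu₂) • (a * b - b * a)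

end YangBaxter

/-! ### Rational function identities behind the Yang-Baxter equations. -/

section RationalIdentities

variable {F : Type*} [Field F] {x y : F}

theorem inv_one_sub_mul_inv_one_sub (hx : 1 - x ≠ 0) (hy : 1 - y ≠ 0) (hxy : 1 - x * y ≠ 0) :
    (1 - x)⁻¹ * (1 - y)⁻¹ = (1 - x * y)⁻¹ * ((1 - x)⁻¹ + (1 - y)⁻¹ - 1) := by
  field_simp
  ring

theorem rational_identity_six (h1 : 1 - x ≠ 0) (h2 : 1 - x * y ≠ 0) (h3 : 1 - x ^ 2 * y ^ 3 ≠ 0)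
    (h4 : 1 - x * y ^ 2 ≠ 0) (h5 : 1 - x * y ^ 3 ≠ 0) (h6 : 1 - y ≠ 0) {u₁ u₂ u₃ u₄ u₅ u₆ : F}
    (e1 : u₁ = (1 - x)⁻¹) (e2 : u₂ = (1 - x * y)⁻¹) (e3 : u₃ = (1 - x ^ 2 * y ^ 3)⁻¹)
    (e4 : u₄ = (1 - x * y ^ 2)⁻¹) (e5 : u₅ = (1 - x * y ^ 3)⁻¹) (e6 : u₆ = (1 - y)⁻¹) :
    u₂ * u₄ + u₂ * u₅ + u₃ * u₅ - u₁ * u₂ * u₄ - u₁ * u₂ * u₅ + u₁ * u₃ * u₆ + u₁ * u₄ * u₆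
      - u₂ * u₃ * u₄ - u₂ * u₃ * u₅ - u₂ * u₄ * u₅ - u₂ * u₅ * u₆ - u₃ * u₄ * u₅ - u₃ * u₅ * u₆
      + u₁ * u₂ * u₃ * u₄ - u₁ * u₂ * u₃ * u₆ + u₁ * u₂ * u₄ * u₅ + u₁ * u₂ * u₅ * u₆
      - u₁ * u₃ * u₄ * u₆ - u₁ * u₄ * u₅ * u₆ + u₂ * u₃ * u₄ * u₅ + u₂ * u₃ * u₅ * u₆
      + u₃ * u₄ * u₅ * u₆ = 0 := by
  subst e1 e2 e3 e4 e5 e6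
  field_simp
  ring

end RationalIdentities

noncomputable section

namespace EuclideanRootSystem

variable {ι V : Type*} [Finite ι] [NormedAddCommGroup V] [InnerProductSpace ℝ V]
variable (S : EuclideanRootSystem ι V)

instance : S.P.IsRootSystem := S.isRootSystem
instance : S.P.IsCrystallographic := S.isCrystallographic
instance : S.P.IsReduced := S.isReduced
instance : S.P.IsIrreducible := S.isIrreducible

/-! ### Fundamental coweights and positivity -/

/-- The fundamental coweight dual to a simple root, as a vector. -/
def fundVec (i : S.Idx) : V := S.P.toLinearMap.toPerfPair.symm (S.base.toWeightBasis.coord i)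

theorem inner_fundVec (i : S.Idx) (x : V) : ⟪S.fundVec i, x⟫ = S.base.toWeightBasis.repr x i := by
  rw [← S.pairing_eq]
  change S.P.toLinearMap.toPerfPair (S.fundVec i) x = _
  rw [fundVec, LinearEquiv.apply_symm_apply, Module.Basis.coord_apply]

open Classical in
theorem inner_fundVec_root (i j : S.Idx) :
    ⟪S.fundVec i, S.root j⟫ = if i = j then 1 else 0 := by
  rw [inner_fundVec, RootPairing.Base.toWeightBasis_repr_root, Finsupp.single_apply]
  simp [eq_comm]

theorem eq_sum_fundVec (x : V) : x = ∑ i : S.Idx, ⟪S.fundVec i, x⟫ • S.root i := by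
  conv_lhs => rw [← S.base.toWeightBasis.sum_repr x]
  simp [inner_fundVec]

theorem inner_eq_sum_fundVec (x y : V) :
    ⟪y, x⟫ = ∑ i : S.Idx, ⟪S.fundVec i, x⟫ * ⟪y, S.root i⟫ := by
  conv_lhs => rw [S.eq_sum_fundVec x]
  simp [inner_sum, inner_smul_right]

theorem exists_int_inner_fundVec (j : ι) : ∃ f : S.Idx → ℤ, (∀ i, ⟪S.fundVec i, S.root j⟫ = f i) ∧
    S.base.height j = ∑ i, f i ∧ ((∀ i, 0 ≤ f i) ∨ ∀ i, f i ≤ 0) := by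
  classical
  obtain ⟨f, -, h, hf⟩ := S.base.exists_root_eq_sum_int j
  refine ⟨fun i => f i, fun i => ?_, ?_, h.imp (fun h i => h.le i) fun h i => h.le i⟩
  · rw [root, hf, inner_sum, Finset.sum_eq_single_of_mem (i : ι) i.2]
    · rw [← Int.cast_smul_eq_zsmul ℝ, inner_smul_right, S.inner_fundVec_root, if_pos rfl, mul_one]
    · intro l hl hne
      rw [← Int.cast_smul_eq_zsmul ℝ, inner_smul_right, S.inner_fundVec_root i ⟨l, hl⟩, if_neg,
        mul_zero]
      rintro rfl
      exact hne rfl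
  · rw [RootPairing.Base.height_eq_sum hf]
    exact (Finset.sum_coe_sort S.base.support f).symm

theorem inner_fundVec_nonneg {j : ι} (h : S.base.IsPos j) (i : S.Idx) :
    0 ≤ ⟪S.fundVec i, S.root j⟫ := by
  obtain ⟨f, hf, hh, hs⟩ := S.exists_int_inner_fundVec j
  rw [hf]
  rcases hs with hs | hs
  · exact_mod_cast hs i
  · have : S.base.height j ≤ 0 := hh ▸ Finset.sum_nonpos fun i _ => hs i
    have h' : 0 < S.base.height j := h
    omega

theorem inner_fundVec_nonpos {j : ι} (h : ¬ S.base.IsPos j) (i : S.Idx) :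
    ⟪S.fundVec i, S.root j⟫ ≤ 0 := by
  obtain ⟨f, hf, hh, hs⟩ := S.exists_int_inner_fundVec j
  rw [hf]
  rcases hs with hs | hs
  · have : 0 ≤ S.base.height j := hh ▸ Finset.sum_nonneg fun i _ => hs i
    exact absurd ((S.base.isPos_iff').mpr this) h
  · exact_mod_cast hs i

theorem exists_inner_fundVec_ne_zero (j : ι) : ∃ i, ⟪S.fundVec i, S.root j⟫ ≠ 0 := by
  by_contra! h
  refine S.P.ne_zero j ?_
  have := S.eq_sum_fundVec (S.root j)
  simpa [h] using this

theorem isPos_iff_inner_fundVec (j : ι) : S.base.IsPos j ↔ ∀ i, 0 ≤ ⟪S.fundVec i, S.root j⟫ := by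
  refine ⟨S.inner_fundVec_nonneg, fun h => ?_⟩
  by_contra h'
  obtain ⟨i, hi⟩ := S.exists_inner_fundVec_ne_zero j
  exact hi (le_antisymm (S.inner_fundVec_nonpos h' i) (h i))

theorem inner_root_pos (i : ι) : 0 < ⟪S.root i, S.root i⟫ :=
  real_inner_self_pos.mpr (S.P.ne_zero i)

/-- A coroot is a positive multiple of its root, so the fundamental coweights detect its sign too.
This passes from positivity of roots, in terms of which `len0` is defined, to coroots, from which
the affine roots are built. -/
theorem coroot_mem_closure_iff (j : ι) :
    S.P.coroot j ∈ AddSubmonoid.closure (S.P.coroot '' S.base.support) ↔ S.base.IsPos j := by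
  have hc : ∀ i, 0 < 2 / ⟪S.root i, S.root i⟫ := fun i => div_pos two_pos (S.inner_root_pos i)
  have key : ∀ x ∈ AddSubmonoid.closure (S.P.coroot '' S.base.support), ∀ i,
      0 ≤ ⟪S.fundVec i, x⟫ := by
    intro x hx i
    induction hx using AddSubmonoid.closure_induction with
    | mem x hx =>
      obtain ⟨l, hl, rfl⟩ := hx
      rw [S.coroot_eq, inner_smul_right]
      exact mul_nonneg (hc l).le (S.inner_fundVec_nonneg (S.base.isPos_of_mem_support hl) i)
    | zero => simp
    | add x y _ _ hx hy => rw [inner_add_right]; exact add_nonneg hx hy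
  constructor
  · intro h
    rw [isPos_iff_inner_fundVec]
    intro i
    have := key _ h i
    rw [S.coroot_eq, inner_smul_right] at this
    exact nonneg_of_mul_nonneg_right this (hc j)
  · intro h
    refine (S.base.coroot_mem_or_neg_mem j).resolve_right fun h' => ?_
    obtain ⟨i, hi⟩ := S.exists_inner_fundVec_ne_zero j
    have h1 := key _ h' i
    rw [inner_neg_right, S.coroot_eq, inner_smul_right] at h1
    have h2 := S.inner_fundVec_nonneg h i
    have h3 := mul_pos (hc j) (lt_of_le_of_ne h2 hi.symm)
    linarith

/-! ### The highest root -/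

/-- The dominance condition. -/
def Dom (x : V) : Prop := ∀ i : S.Idx, 0 ≤ ⟪x, S.root i⟫

variable {S} in
theorem Dom.inner_nonneg {x y : V} (hx : S.Dom x) (hy : ∀ i, 0 ≤ ⟪S.fundVec i, y⟫) :
    0 ≤ ⟪x, y⟫ := by
  rw [S.inner_eq_sum_fundVec]
  exact Finset.sum_nonneg fun i _ => mul_nonneg (hy i) (hx i)

/-- Reflecting a root in a simple root that has negative pairing with it raises the root. -/
theorem exists_root_eq_add {j : ι} {i : S.Idx} (h : ⟪S.root j, S.root i⟫ < 0) :
    ∃ (l : ι) (c : ℝ), 0 < c ∧ S.root l = S.root j + c • S.root i ∧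
      S.base.height j < S.base.height l ∧ ⟪S.root l, S.root l⟫ = ⟪S.root j, S.root j⟫ := by
  have hp : (S.P.pairingIn ℤ j i : ℝ) = ⟪S.root j, S.P.coroot i⟫ := by
    rw [← S.pairing_eq]
    exact S.P.algebraMap_pairingIn ℤ j i
  have hneg : ⟪S.root j, S.P.coroot i⟫ < 0 := by
    rw [S.coroot_eq, inner_smul_right]
    exact mul_neg_of_pos_of_neg (div_pos two_pos (S.inner_root_pos i)) h
  have hroot : S.P.root (S.P.reflectionPerm i j) =
      S.P.root j + (-S.P.pairingIn ℤ j i) • S.P.root i := by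
    rw [RootPairing.root_reflectionPerm, neg_smul, S.P.reflection_apply_root' ℤ, sub_eq_add_neg]
  refine ⟨S.P.reflectionPerm i j, -⟪S.root j, S.P.coroot i⟫, neg_pos.mpr hneg, ?_, ?_, ?_⟩
  · rw [root, hroot, ← Int.cast_smul_eq_zsmul ℝ, Int.cast_neg, hp]
  · rw [S.base.height_add_zsmul hroot, RootPairing.Base.height_one_of_mem_support i.2]
    rw [← hp] at hneg
    have : S.P.pairingIn ℤ j i < 0 := by exact_mod_cast hneg
    simpa using this
  · rw [root, RootPairing.root_reflectionPerm, S.inner_reflection]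

theorem dom_phi : S.Dom (S.root S.phi) := by
  intro i
  by_contra! h
  obtain ⟨l, c, -, -, hh, hn⟩ := S.exists_root_eq_add h
  have := S.exists_highest.choose_spec.2 l (by rw [hn]; exact S.inner_phi)
  exact absurd hh (not_lt.mpr this)

/-- Among the roots above the given one, take one of greatest height. A negative pairing with a
simple root would allow raising it further. -/
theorem exists_dom_ge (j : ι) : ∃ l, S.Dom (S.root l) ∧
    ∀ i, ⟪S.fundVec i, S.root j⟫ ≤ ⟪S.fundVec i, S.root l⟫ := by
  obtain ⟨l, hl, hmax⟩ := Set.exists_max_image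
    {l : ι | ∀ i, ⟪S.fundVec i, S.root j⟫ ≤ ⟪S.fundVec i, S.root l⟫} S.base.height
    (Set.toFinite _) ⟨j, fun i => le_rfl⟩
  refine ⟨l, fun i => ?_, hl⟩
  by_contra! h
  obtain ⟨l', c, hc, he, hh, -⟩ := S.exists_root_eq_add h
  refine absurd hh (not_lt.mpr (hmax l' fun m => (hl m).trans ?_))
  rw [he, inner_add_right, inner_smul_right]
  have := S.inner_fundVec_nonneg (S.base.isPos_of_mem_support i.2) m
  have := mul_nonneg hc.le this
  linarith

theorem isPos_of_dom {j : ι} (h : S.Dom (S.root j)) : S.base.IsPos j := by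
  by_contra h'
  have h1 : 0 ≤ ⟪S.root j, -S.root j⟫ :=
    h.inner_nonneg fun i => by
      rw [inner_neg_right]; exact neg_nonneg.mpr (S.inner_fundVec_nonpos h' i)
  rw [inner_neg_right] at h1
  have := S.inner_root_pos j
  linarith

theorem inner_simple_nonpos {i j : S.Idx} (h : i ≠ j) : ⟪S.root i, S.root j⟫ ≤ 0 := by
  have h1 : S.P.pairingIn ℤ i j ≤ 0 :=
    S.base.pairingIn_le_zero_of_ne (fun e => h (Subtype.ext e)) i.2 j.2
  have hp : (S.P.pairingIn ℤ i j : ℝ) = ⟪S.root i, S.P.coroot j⟫ := by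
    rw [← S.pairing_eq]
    exact S.P.algebraMap_pairingIn ℤ i j
  have h2 : ⟪S.root i, S.P.coroot j⟫ ≤ 0 := by rw [← hp]; exact_mod_cast h1
  rw [S.coroot_eq, inner_smul_right] at h2
  by_contra! h3
  have := mul_pos (div_pos two_pos (S.inner_root_pos j)) h3
  linarith

/-- Simple roots pair nonpositively, so dominance forces each simple root outside the support to be
orthogonal to the support. The span of the support is then stable under all simple reflections, and
irreducibility makes it the whole space. -/
theorem inner_fundVec_pos_of_dom {j : ι} (h : S.Dom (S.root j)) (i : S.Idx) :
    0 < ⟪S.fundVec i, S.root j⟫ := by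
  classical
  have hpos := S.inner_fundVec_nonneg (S.isPos_of_dom h)
  by_contra! hi
  have hi0 : ⟪S.fundVec i, S.root j⟫ = 0 := le_antisymm hi (hpos i)
  let s : Set S.Idx := {l | ⟪S.fundVec l, S.root j⟫ ≠ 0}
  have horth : ∀ l ∉ s, ∀ m ∈ s, ⟪S.root m, S.root l⟫ = 0 := by
    intro l hl m hm
    have hl0 : ⟪S.fundVec l, S.root j⟫ = 0 := by simpa [s] using hl
    have h1 := h l
    rw [real_inner_comm, S.inner_eq_sum_fundVec] at h1
    have hterm : ∀ t ∈ Finset.univ, ⟪S.fundVec t, S.root j⟫ * ⟪S.root l, S.root t⟫ ≤ 0 := by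
      intro t _
      by_cases htl : l = t
      · rw [← htl, hl0, zero_mul]
      · exact mul_nonpos_of_nonneg_of_nonpos (hpos t) (S.inner_simple_nonpos htl)
    have h2 := (Finset.sum_eq_zero_iff_of_nonpos hterm).mp
      (le_antisymm (Finset.sum_nonpos hterm) h1) m (Finset.mem_univ _)
    rw [real_inner_comm]
    exact (mul_eq_zero.mp h2).resolve_left hm
  have htop : Submodule.span ℝ ((fun l : S.Idx => S.root l) '' s) = ⊤ := by
    refine RootPairing.IsIrreducible.eq_top_of_invtSubmodule_reflection (P := S.P) _ ?_ ?_
    · rw [← S.base.forall_mem_support_invtSubmodule_iff]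
      intro l hl
      by_cases hls : (⟨l, hl⟩ : S.Idx) ∈ s
      · exact Submodule.mem_invtSubmodule_reflection_of_mem _ _
          (Submodule.subset_span ⟨⟨l, hl⟩, hls, rfl⟩)
      · rw [Module.End.mem_invtSubmodule, Submodule.span_le]
        rintro _ ⟨m, hm, rfl⟩
        have : S.P.reflection l (S.root m) = S.root m := by
          rw [RootPairing.reflection_apply]
          change _ - S.P.toLinearMap _ (S.P.coroot l) • _ = _
          rw [S.pairing_eq, S.coroot_eq, inner_smul_right, horth ⟨l, hl⟩ hls m hm]
          simp
        have hmem : S.P.reflection l (S.root m) ∈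
            Submodule.span ℝ ((fun l : S.Idx => S.root l) '' s) := by
          rw [this]
          exact Submodule.subset_span ⟨m, hm, rfl⟩
        exact hmem
    · obtain ⟨m, hm⟩ := S.exists_inner_fundVec_ne_zero j
      intro hbot
      have : S.root m ∈ Submodule.span ℝ ((fun l : S.Idx => S.root l) '' s) :=
        Submodule.subset_span ⟨m, hm, rfl⟩
      rw [hbot] at this
      exact S.P.ne_zero m (by simpa using this)
  have hker : Submodule.span ℝ ((fun l : S.Idx => S.root l) '' s) ≤
      LinearMap.ker (innerₗ V (S.fundVec i)) := by
    rw [Submodule.span_le]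
    rintro _ ⟨m, hm, rfl⟩
    have : i ≠ m := by rintro rfl; exact hm hi0
    simp [S.inner_fundVec_root, this]
  rw [htop] at hker
  have := hker (Submodule.mem_top (x := S.root i))
  simp [S.inner_fundVec_root] at this

theorem inner_pos_of_dom {j l : ι} (hj : S.Dom (S.root j)) (hl : S.Dom (S.root l)) :
    0 < ⟪S.root j, S.root l⟫ := by
  refine lt_of_le_of_ne (hj.inner_nonneg (S.inner_fundVec_nonneg (S.isPos_of_dom hl))) fun h => ?_
  have h1 : ∀ i ∈ Finset.univ, 0 ≤ ⟪S.fundVec i, S.root l⟫ * ⟪S.root j, S.root i⟫ := fun i _ =>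
    mul_nonneg (S.inner_fundVec_pos_of_dom hl i).le (hj i)
  rw [S.inner_eq_sum_fundVec] at h
  have h2 := (Finset.sum_eq_zero_iff_of_nonneg h1).mp h.symm
  have h3 : ∀ i : S.Idx, ⟪S.root j, S.root i⟫ = 0 := fun i =>
    (mul_eq_zero.mp (h2 i (Finset.mem_univ _))).resolve_left (S.inner_fundVec_pos_of_dom hl i).ne'
  have h4 := S.inner_eq_sum_fundVec (S.root j) (S.root j)
  simp only [h3, mul_zero, Finset.sum_const_zero] at h4
  exact (S.inner_root_pos j).ne' h4

/-- The root `φ` is the highest root. -/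
theorem inner_fundVec_le_phi (j : ι) (i : S.Idx) :
    ⟪S.fundVec i, S.root j⟫ ≤ ⟪S.fundVec i, S.root S.phi⟫ := by
  obtain ⟨l, hl, hle⟩ := S.exists_dom_ge j
  refine (hle i).trans ?_
  by_cases he : l = S.phi
  · rw [he]
  have hpos := S.inner_pos_of_dom S.dom_phi hl
  have hpair : 0 < S.P.pairingIn ℤ S.phi l := by
    have hp : (S.P.pairingIn ℤ S.phi l : ℝ) = ⟪S.root S.phi, S.P.coroot l⟫ := by
      rw [← S.pairing_eq]
      exact S.P.algebraMap_pairingIn ℤ S.phi l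
    have : (0 : ℝ) < S.P.pairingIn ℤ S.phi l := by
      rw [hp, S.coroot_eq, inner_smul_right]
      exact mul_pos (div_pos two_pos (S.inner_root_pos l)) hpos
    exact_mod_cast this
  -- Two distinct roots with positive pairing differ by a root. If φ - l is positive, then φ lies
  -- above l, as wanted.
  obtain ⟨m, hm⟩ := S.P.root_sub_root_mem_of_pairingIn_pos hpair (Ne.symm he)
  have hm' : S.root m = S.root S.phi - S.root l := hm
  by_cases hmp : S.base.IsPos m
  · have := S.inner_fundVec_nonneg hmp i
    rw [hm', inner_sub_right] at this
    linarith
  -- If φ - l is negative, pairing l - φ with the dominant roots l and φ gives ⟨φ, l⟩ ≥ 2. Since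
  -- both squared lengths are at most 2, the root φ - l would have length zero.
  · exfalso
    have hn : ∀ t, 0 ≤ ⟪S.fundVec t, S.root l - S.root S.phi⟫ := fun t => by
      have := S.inner_fundVec_nonpos hmp t
      rw [hm', inner_sub_right] at this
      rw [inner_sub_right]; linarith
    have h1 := hl.inner_nonneg hn
    have h2 := S.dom_phi.inner_nonneg hn
    rw [inner_sub_right] at h1 h2
    have h3 := S.norm_le l
    have h4 := S.inner_phi
    have h5 : ⟪S.root l, S.root S.phi⟫ = ⟪S.root S.phi, S.root l⟫ := real_inner_comm _ _
    have h6 : ⟪S.root m, S.root m⟫ = 0 := by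
      rw [hm', inner_sub_left, inner_sub_right, inner_sub_right]
      simp only [root] at *
      linarith
    exact (S.inner_root_pos m).ne' h6

end EuclideanRootSystem

noncomputable section

namespace EuclideanRootSystem

variable {ι V : Type*} [Finite ι] [NormedAddCommGroup V] [InnerProductSpace ℝ V]
variable (S : EuclideanRootSystem ι V)

/-! ### The finite Weyl group as a group acting on the coroots -/

theorem cor_injective : Function.Injective S.cor := fun _ _ h =>
  S.P.coroot.injective (congrArg Subtype.val h)

theorem cor_coe (i : ι) : (S.cor i : V) = S.P.coroot i := rfl

/-- The integer `⟨x, α_i⟩` for a coweight `x`. -/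
def pr (x : S.Pv) (i : ι) : ℤ := (x.2 i).choose

theorem pr_cast (x : S.Pv) (i : ι) : (S.pr x i : ℝ) = ⟪(x : V), S.root i⟫ :=
  (x.2 i).choose_spec.symm

theorem W0_ext {w w' : S.W0} (h : ∀ i : ι, w • i = w' • i) : w = w' := by
  apply Subtype.ext
  apply RootPairing.Equiv.weightHom_injective S.P
  apply LinearEquiv.toLinearMap_injective
  refine LinearMap.ext_on_range (RootPairing.IsRootSystem.span_root_eq_top (P := S.P)) fun i => ?_
  have h1 := S.smul_root w i
  rw [h i, ← S.smul_root w' i] at h1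
  exact h1

theorem W0_ext_Pv {w w' : S.W0} (h : ∀ x : S.Pv, w • x = w' • x) : w = w' :=
  S.W0_ext fun i => S.cor_injective (by rw [← smul_cor, ← smul_cor, h])

theorem refl0_smul (i : ι) (x : S.Pv) : S.refl0 i • x = x - S.pr x i • S.cor i := by
  apply Subtype.ext
  have h1 : ((S.refl0 i • x : S.Pv) : V) = S.P.reflection i (x : V) := rfl
  rw [h1, RootPairing.reflection_apply]
  change (x : V) - S.P.toLinearMap x (S.P.coroot i) • S.root i = _
  rw [AddSubgroup.coe_sub, AddSubgroup.coe_zsmul, cor_coe, S.pairing_eq, S.coroot_eq,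
    inner_smul_right, ← Int.cast_smul_eq_zsmul ℝ, pr_cast, smul_smul, mul_comm]

theorem pr_smul (w : S.W0) (x : S.Pv) (i : ι) : S.pr (w • x) (w • i) = S.pr x i := by
  have : (S.pr (w • x) (w • i) : ℝ) = S.pr x i := by
    rw [pr_cast, pr_cast, ← smul_root, coe_smul, inner_smul_smul]
  exact_mod_cast this

theorem pr_add (x y : S.Pv) (i : ι) : S.pr (x + y) i = S.pr x i + S.pr y i := by
  have : (S.pr (x + y) i : ℝ) = S.pr x i + S.pr y i := by
    rw [pr_cast, pr_cast, pr_cast, AddSubgroup.coe_add, inner_add_left]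
  exact_mod_cast this

theorem pr_neg (x : S.Pv) (i : ι) : S.pr (-x) i = -S.pr x i := by
  have : (S.pr (-x) i : ℝ) = -S.pr x i := by
    rw [pr_cast, pr_cast, AddSubgroup.coe_neg, inner_neg_left]
  exact_mod_cast this

theorem pr_sub (x y : S.Pv) (i : ι) : S.pr (x - y) i = S.pr x i - S.pr y i := by
  rw [sub_eq_add_neg, pr_add, pr_neg, sub_eq_add_neg]

theorem mul_refl0 (w : S.W0) (i : ι) : w * S.refl0 i = S.refl0 (w • i) * w := by
  refine S.W0_ext_Pv fun x => ?_
  rw [mul_smul, mul_smul, refl0_smul, refl0_smul, smul_sub, pr_smul, ← smul_cor]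
  congr 1
  exact map_zsmul (DistribSMul.toAddMonoidHom S.Pv w) _ _

theorem pr_cor_self (i : ι) : S.pr (S.cor i) i = 2 := by
  have : (S.pr (S.cor i) i : ℝ) = 2 := by
    rw [pr_cast, cor_coe, S.coroot_eq, real_inner_smul_left]
    exact div_mul_cancel₀ _ (S.inner_root_pos i).ne'
  exact_mod_cast this

theorem refl0_smul_cor_self (i : ι) : S.refl0 i • S.cor i = -S.cor i := by
  rw [refl0_smul, pr_cor_self]; abel

theorem refl0_mul_self (i : ι) : S.refl0 i * S.refl0 i = 1 := by
  refine S.W0_ext_Pv fun x => ?_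
  rw [mul_smul, refl0_smul, refl0_smul, pr_sub, one_smul]
  have : S.pr (S.pr x i • S.cor i) i = 2 * S.pr x i := by
    have : (S.pr (S.pr x i • S.cor i) i : ℝ) = 2 * S.pr x i := by
      have h := S.pr_cast (S.cor i) i
      rw [pr_cor_self] at h
      rw [pr_cast, AddSubgroup.coe_zsmul, ← Int.cast_smul_eq_zsmul ℝ, real_inner_smul_left, ← h]
      push_cast; ring
    exact_mod_cast this
  rw [this]
  module

theorem zsmul_cor_eq {n : ℤ} {i l : ι} (h : n • S.cor i = S.cor l) :
    (n = 1 ∧ l = i) ∨ (n = -1 ∧ S.cor l = -S.cor i) := by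
  have hV : (n : ℝ) • S.P.coroot i = S.P.coroot l := by
    have := congrArg Subtype.val h
    rwa [AddSubgroup.coe_zsmul, ← Int.cast_smul_eq_zsmul ℝ] at this
  have hdep : ¬ LinearIndependent ℝ ![S.P.root i, S.P.root l] := by
    rw [S.coroot_eq, S.coroot_eq, smul_smul] at hV
    intro hli
    rw [LinearIndependent.pair_iff] at hli
    have h1 := (hli (n * (2 / ⟪S.root i, S.root i⟫)) (-(2 / ⟪S.root l, S.root l⟫)) (by
      rw [neg_smul, hV]; exact add_neg_cancel _)).2
    have := div_pos two_pos (S.inner_root_pos l)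
    linarith
  have hcases : i = l ∨ S.P.root i = -S.P.root l := by
    by_contra! hc
    exact hdep (RootPairing.IsReduced.linearIndependent S.P hc.1 hc.2)
  rcases hcases with rfl | hc
  · left
    refine ⟨?_, rfl⟩
    have : ((n : ℝ) - 1) • S.P.coroot i = 0 := by rw [sub_smul, hV, one_smul, sub_self]
    have := (smul_eq_zero.mp this).resolve_right (S.P.flip.ne_zero i)
    exact_mod_cast sub_eq_zero.mp this
  · right
    have h2 : S.cor l = -S.cor i := by
      apply Subtype.ext
      rw [AddSubgroup.coe_neg, cor_coe, cor_coe, S.coroot_eq, S.coroot_eq]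
      simp only [hc, inner_neg_neg, smul_neg, neg_neg]
    refine ⟨?_, h2⟩
    have : ((n : ℝ) + 1) • S.P.coroot i = 0 := by
      rw [add_smul, hV, one_smul, ← cor_coe, h2, AddSubgroup.coe_neg, cor_coe, neg_add_cancel]
    have := (smul_eq_zero.mp this).resolve_right (S.P.flip.ne_zero i)
    have := eq_neg_of_add_eq_zero_left this
    exact_mod_cast this

theorem cor_mem_closure_iff (j : ι) :
    S.cor j ∈ AddSubmonoid.closure (Set.range fun i : S.Idx => S.cor i) ↔ S.base.IsPos j := by
  rw [← coroot_mem_closure_iff]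
  have h1 : S.P.coroot '' S.base.support =
      S.Pv.subtype '' (Set.range fun i : S.Idx => S.cor i) := by
    ext x
    constructor
    · rintro ⟨i, hi, rfl⟩
      exact ⟨S.cor i, ⟨⟨i, hi⟩, rfl⟩, rfl⟩
    · rintro ⟨_, ⟨i, rfl⟩, rfl⟩
      exact ⟨i, i.2, rfl⟩
  rw [h1, ← AddMonoidHom.map_mclosure]
  exact (AddSubmonoid.mem_map_iff_mem (f := S.Pv.subtype) Subtype.val_injective).symm

theorem linearIndependent_cor : LinearIndependent ℤ fun i : S.Idx => S.cor i := by
  have h : LinearIndependent ℤ fun i : S.Idx => S.P.coroot i :=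
    S.base.linearIndepOn_coroot.restrict_scalars' ℤ
  exact LinearIndependent.of_comp S.Pv.subtype.toIntLinearMap h

theorem cor_ne_zero (i : ι) : S.cor i ≠ 0 :=
  fun h0 => S.P.flip.ne_zero i (congrArg Subtype.val h0)

theorem isPos_of_cor_eq_neg {i j : ι} (h : S.cor j = -S.cor i) :
    S.base.IsPos j ↔ ¬ S.base.IsPos i := by
  rw [← cor_mem_closure_iff, ← cor_mem_closure_iff, h]
  have hroot : S.P.root j = -S.P.root i := by
    have h' : S.P.coroot j = -S.P.coroot i := congrArg Subtype.val h
    have : S.P.coroot (S.P.reflectionPerm i i) = -S.P.coroot i := by simp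
    have : j = S.P.reflectionPerm i i := S.P.coroot.injective (by rw [h', this])
    rw [this]; simp
  have := RootPairing.Base.IsPos.neg_iff_not S.base i
  rw [← h, cor_mem_closure_iff, cor_mem_closure_iff, ← this]
  have e : j = S.P.reflectionPerm i i := S.P.root.injective (by rw [hroot]; simp)
  rw [e]
  rfl

/-- The finite Weyl group acting on the coweight lattice. -/
def finAction : RootAction S.W0 S.Idx S.Pv where
  R := Set.range S.cor
  simple i := S.cor i
  s i := S.refl0 i
  smul_mem := by rintro w _ ⟨i, rfl⟩; exact ⟨w • i, (S.smul_cor w i).symm⟩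
  neg_mem := by rintro _ ⟨i, rfl⟩; obtain ⟨j, -, hj⟩ := S.neg_cor i; exact ⟨j, hj⟩
  simple_mem j := ⟨j, rfl⟩
  zero_notMem := by rintro ⟨i, hi⟩; exact S.cor_ne_zero i hi
  linInd := S.linearIndependent_cor
  mem_or_neg_mem := by
    rintro _ ⟨i, rfl⟩
    obtain ⟨j, -, hj⟩ := S.neg_cor i
    rw [← hj, cor_mem_closure_iff, cor_mem_closure_iff, S.isPos_of_cor_eq_neg hj]
    exact em _
  reduced := by
    rintro j n ⟨l, hl⟩
    rcases S.zsmul_cor_eq (n := n) (by rw [natCast_zsmul]; exact hl.symm) with h | h <;> omega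
  s_smul j a := ⟨_, S.refl0_smul j a⟩
  s_simple j := S.refl0_smul_cor_self j
  s_mul_s j := S.refl0_mul_self j
  conj g i j h := by
    rw [mul_refl0]
    rw [smul_cor] at h
    rw [S.cor_injective h]
  finite_inv g := (Set.finite_range S.cor).subset fun a ha => ha.1.1

theorem finAction_pos (i : ι) : S.finAction.Pos (S.cor i) ↔ S.base.IsPos i :=
  ⟨fun h => (S.cor_mem_closure_iff i).mp h.2, fun h => ⟨⟨i, rfl⟩, (S.cor_mem_closure_iff i).mpr h⟩⟩

theorem len0_eq (w : S.W0) : S.len0 w = S.finAction.len w := by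
  rw [len0, RootAction.len, ← Set.ncard_image_of_injective _ S.cor_injective]
  congr 1
  ext x
  constructor
  · rintro ⟨i, ⟨h1, h2⟩, rfl⟩
    refine ⟨(S.finAction_pos i).mpr h1, ?_⟩
    rw [← RootAction.not_pos_iff (S.finAction.smul_mem w ⟨i, rfl⟩), smul_cor, finAction_pos]
    exact h2
  · rintro ⟨h1, h2⟩
    obtain ⟨i, rfl⟩ := h1.1
    refine ⟨i, ⟨(S.finAction_pos i).mp h1, ?_⟩, rfl⟩
    rw [← RootAction.not_pos_iff (S.finAction.smul_mem w ⟨i, rfl⟩), smul_cor, finAction_pos] at h2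
    exact h2

theorem exists_list_eq_prod (w : S.W0) : ∃ l : List S.Idx, w = (l.map S.finAction.s).prod := by
  -- Every root is reached from simple ones by simple reflections and sign changes, so every
  -- reflection is conjugate to a simple one inside the subgroup that the simple reflections
  -- generate.
  have hs : ∀ i : ι, S.refl0 i ∈ S.W0sub Set.univ := by
    intro i
    refine S.base.induction_reflect i (p := fun i => S.refl0 i ∈ S.W0sub Set.univ) ?_ ?_ ?_
    · intro i hi
      have h : S.refl0 (S.P.reflectionPerm i i) = S.refl0 i := by
        have := S.mul_refl0 (S.refl0 i) i
        exact (mul_right_cancel this).symm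
      rwa [h]
    · exact fun i hi => Subgroup.subset_closure ⟨⟨i, hi⟩, trivial, rfl⟩
    · intro i j hi hj
      have h : S.refl0 (S.P.reflectionPerm j i) = S.refl0 j * S.refl0 i * (S.refl0 j)⁻¹ := by
        rw [S.mul_refl0 (S.refl0 j) i, mul_inv_cancel_right]; rfl
      have hj' : S.refl0 j ∈ S.W0sub Set.univ :=
        Subgroup.subset_closure ⟨⟨j, hj⟩, trivial, rfl⟩
      rw [h]
      exact mul_mem (mul_mem hj' hi) (inv_mem hj')
  have htop : ∀ w : S.W0, w ∈ S.W0sub Set.univ := by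
    rintro ⟨w, hw⟩
    induction hw using RootPairing.weylGroup.induction with
    | mem i => exact hs i
    | one => exact one_mem _
    | mul x y hx hy h1 h2 => exact mul_mem h1 h2
  have hw := htop w
  induction hw using Subgroup.closure_induction with
  | mem x hx => obtain ⟨i, -, rfl⟩ := hx; exact ⟨[i], by simp [finAction]⟩
  | one => exact ⟨[], rfl⟩
  | mul x y _ _ hx hy =>
    obtain ⟨l, rfl⟩ := hx
    obtain ⟨l', rfl⟩ := hy
    exact ⟨l ++ l', by simp⟩
  | inv x _ hx =>
    obtain ⟨l, rfl⟩ := hx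
    refine ⟨l.reverse, ?_⟩
    rw [List.prod_inv_reverse, List.map_reverse, List.map_map]
    congr 2
    exact List.map_congr_left fun i _ => S.finAction.s_inv i

end EuclideanRootSystem

/-! ### The exchange condition for words that need not be reduced. -/

namespace RootAction

variable {G B E : Type*} [Group G] [AddCommGroup E] [DistribMulAction G E] {Φ : RootAction G B E}

/-- Reading the word from the right, some letter first makes the root negative. Just before that the
root is the simple root of this letter, so by `conj` the letter cancels against `s j`. -/
theorem exists_list_of_neg (l : List B) {j : B}
    (h : Φ.Pos (-((l.map Φ.s).prod • Φ.simple j))) :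
    ∃ l' : List B, l'.length < l.length ∧ (l.map Φ.s).prod * Φ.s j = (l'.map Φ.s).prod := by
  induction l with
  | nil => simpa using (Φ.pos_simple j).not_neg (by simpa using h)
  | cons i t ih =>
    rcases Φ.pos_or_neg (Φ.smul_simple_mem (t.map Φ.s).prod j) with h' | h'
    · rw [List.map_cons, List.prod_cons, mul_smul] at h
      have e := Φ.conj _ _ _ (h'.eq_simple_of_neg h)
      refine ⟨t, by simp, ?_⟩
      rw [List.map_cons, List.prod_cons, mul_assoc, e, Φ.s_mul_s_mul]
    · obtain ⟨l', h1, h2⟩ := ih h'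
      exact ⟨i :: l', by simpa using h1, by simp [mul_assoc, h2]⟩

/-- The hypothesis `hg` is essential, since an extended affine Weyl group has nontrivial elements of
length zero. A nonempty word of length zero admits a deletion by exchange, and induction on the
number of letters ends at the empty word. -/
theorem eq_one_of_len_eq_zero {g : G} (hg : ∃ l : List B, g = (l.map Φ.s).prod)
    (h : Φ.len g = 0) : g = 1 := by
  obtain ⟨n, hn⟩ : ∃ n, ∃ l : List B, g = (l.map Φ.s).prod ∧ l.length = n := by
    obtain ⟨l, hl⟩ := hg
    exact ⟨_, l, hl, rfl⟩
  induction n using Nat.strong_induction_on with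
  | _ n ih =>
    obtain ⟨l, hl, hlen⟩ := hn
    rcases List.eq_nil_or_concat l with rfl | ⟨t, j, rfl⟩
    · simpa using hl
    · simp only [List.concat_eq_append] at hl hlen
      rw [List.map_append, List.prod_append, List.map_singleton, List.prod_singleton] at hl
      have hp := len_eq_zero_iff_simple.mp h j
      rw [hl, mul_smul, Φ.s_simple, smul_neg] at hp
      obtain ⟨l', h1, h2⟩ := exists_list_of_neg t hp
      exact ih _ (by rw [← hlen]; simpa using h1.trans (Nat.lt_succ_self _))
        ⟨l', by rw [hl, h2], rfl⟩

end RootAction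

namespace EuclideanRootSystem

variable {ι V : Type*} [Finite ι] [NormedAddCommGroup V] [InnerProductSpace ℝ V]
variable (S : EuclideanRootSystem ι V)

theorem eq_one_of_finAction_len_eq_zero {w : S.W0} (h : S.finAction.len w = 0) : w = 1 :=
  RootAction.eq_one_of_len_eq_zero (S.exists_list_eq_prod w) h

end EuclideanRootSystem

noncomputable section

namespace EuclideanRootSystem

variable {ι V : Type*} [Finite ι] [NormedAddCommGroup V] [InnerProductSpace ℝ V]
variable (S : EuclideanRootSystem ι V)

/-! ### The extended affine Weyl group as a group acting on the affine roots -/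

instance : DistribMulAction S.W S.Aff where
  smul := S.act
  one_smul := act_one
  mul_smul := act_mul
  smul_zero w := Prod.ext (by change (0 : ℝ) - S.ip _ (_ • (0 : S.Pv)) = 0; simp [ip])
    (smul_zero w.right)
  smul_add w a b := by
    refine Prod.ext ?_ (smul_add w.right a.2 b.2)
    change a.1 + b.1 - S.ip _ (w.right • (a.2 + b.2)) =
      a.1 - S.ip _ (w.right • a.2) + (b.1 - S.ip _ (w.right • b.2))
    rw [smul_add, ip_add_right]
    ring

theorem smul_eq_act (w : S.W) (a : S.Aff) : w • a = S.act w a := rfl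

theorem smul_snd (w : S.W) (a : S.Aff) : (w • a).2 = w.right • a.2 := rfl

theorem smul_fst (w : S.W) (a : S.Aff) :
    (w • a).1 = a.1 - S.ip w.left.toAdd (w.right • a.2) := rfl

theorem incl_smul (u : S.W0) (a : S.Aff) : S.incl u • a = (a.1, u • a.2) := by
  refine Prod.ext ?_ rfl
  change a.1 - S.ip 0 _ = a.1
  simp [ip]

theorem tau_smul (x : S.Pv) (a : S.Aff) : S.tau x • a = (a.1 - S.ip x a.2, a.2) := by
  refine Prod.ext ?_ (one_smul _ a.2)
  change a.1 - S.ip x ((1 : S.W0) • a.2) = _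
  rw [one_smul]

theorem ip_sub_left (x y z : S.Pv) : S.ip (x - y) z = S.ip x z - S.ip y z :=
  inner_sub_left _ _ _

/-- The action on affine functionals is faithful, so identities in `W` can be checked there. -/
theorem W_ext {w w' : S.W} (h : ∀ a : S.Aff, w • a = w' • a) : w = w' := by
  have hr : w.right = w'.right := S.W0_ext_Pv fun x => congrArg Prod.snd (h (0, x))
  have hl : ∀ x, S.ip w.left.toAdd x = S.ip w'.left.toAdd x := by
    intro x
    have := congrArg Prod.fst (h (0, w.right⁻¹ • x))
    rw [smul_fst, smul_fst, ← hr, smul_inv_smul] at this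
    linarith
  have h0 : S.ip (w.left.toAdd - w'.left.toAdd) (w.left.toAdd - w'.left.toAdd) = 0 := by
    rw [ip_sub_left, hl, sub_self]
  have h1 : w.left.toAdd - w'.left.toAdd = 0 := Subtype.ext (inner_self_eq_zero.mp h0)
  exact SemidirectProduct.ext (Multiplicative.toAdd.injective (sub_eq_zero.mp h1)) hr

/-- (The index of) the root `-φ`. -/
def negPhi : ι := S.P.reflectionPerm S.phi S.phi

theorem root_negPhi : S.root S.negPhi = -S.root S.phi := by simp [negPhi]

theorem cor_negPhi : S.cor S.negPhi = -S.cor S.phi :=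
  Subtype.ext (by change S.P.coroot _ = -S.P.coroot _; simp [negPhi])

theorem pr_of_root_neg {i j : ι} (h : S.root j = -S.root i) (x : S.Pv) : S.pr x j = -S.pr x i := by
  have : (S.pr x j : ℝ) = -S.pr x i := by
    rw [pr_cast, pr_cast, h, inner_neg_right]
  exact_mod_cast this

/-- The gradient of a simple affine root. -/
def grad : Option S.Idx → ι
  | none => S.negPhi
  | some i => i

/-- The constant term of a simple affine root. -/
def cst : Option S.Idx → ℝ
  | none => 1
  | some _ => 0

theorem simple_eq (j : Option S.Idx) : S.simple j = (S.cst j, S.cor (S.grad j)) := by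
  cases j with
  | none => exact Prod.ext rfl S.cor_negPhi.symm
  | some i => rfl

/-- The number `2 / ‖α‖²`. -/
def nu (i : ι) : ℝ := 2 / ⟪S.root i, S.root i⟫

theorem cor_eq (i : ι) : (S.cor i : V) = S.nu i • S.root i := S.coroot_eq i

theorem one_le_nu (i : ι) : 1 ≤ S.nu i := by
  rw [nu, le_div_iff₀ (S.inner_root_pos i), one_mul]
  exact S.norm_le i

theorem nu_phi : S.nu S.phi = 1 := by rw [nu, S.inner_phi, div_self two_ne_zero]

theorem nu_eq_of_root_neg {i j : ι} (h : S.root j = -S.root i) : S.nu j = S.nu i := by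
  rw [nu, nu, h, inner_neg_neg]

theorem pairing_cast (i j : ι) : (S.P.pairingIn ℤ i j : ℝ) = S.nu j * ⟪S.root i, S.root j⟫ := by
  rw [← inner_smul_right, ← cor_eq, cor_coe, ← S.pairing_eq]
  exact S.P.algebraMap_pairingIn ℤ i j

theorem pr_cor (i j : ι) : S.pr (S.cor i) j = S.P.pairingIn ℤ j i := by
  have : (S.pr (S.cor i) j : ℝ) = S.P.pairingIn ℤ j i := by
    rw [pr_cast, pairing_cast, cor_eq, real_inner_smul_left, real_inner_comm]
  exact_mod_cast this

/-- By irreducibility some root of the same length as φ is not orthogonal to the given one, and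
2/‖α‖² is then a ratio of two Cartan integers, both on the crystallographic list. Integrality keeps
the constant terms of affine roots integral, as needed for positivity and for powers of q. -/
theorem exists_nat_nu (i : ι) : ∃ n : ℕ, S.nu i = n := by
  let B : S.P.InvariantForm :=
    { form := innerₗ V
      symm := ⟨fun x y => by simp [real_inner_comm]⟩
      ne_zero := fun i => by simpa using S.P.ne_zero i
      isOrthogonal_reflection := fun i x y => S.inner_reflection i x y }
  obtain ⟨l, h1, h2⟩ := S.P.exists_form_eq_form_and_form_ne_zero B i S.phi
  change ⟪S.root l, S.root l⟫ = ⟪S.root S.phi, S.root S.phi⟫ at h1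
  change ⟪S.root i, S.root l⟫ ≠ 0 at h2
  have hl : S.nu l = 1 := by rw [nu, h1]; exact S.nu_phi
  have e1 := S.pairing_cast i l
  have e2 := S.pairing_cast l i
  rw [hl, one_mul] at e1
  rw [real_inner_comm, ← e1] at e2
  have hge := S.one_le_nu i
  have hp := S.P.pairingIn_pairingIn_mem_set_of_isCrystal_of_isRed i l
  simp only [Set.mem_insert_iff, Set.mem_singleton_iff, Prod.mk.injEq] at hp
  rcases hp with h | h | h | h | h | h | h | h | h | h | h | h | h <;>
    rw [h.1, h.2] at e2 <;> rw [h.1] at e1 <;> push_cast at e1 e2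
  · exact absurd e1.symm h2
  · exact ⟨1, by push_cast; linarith⟩
  · exact ⟨1, by push_cast; linarith⟩
  · exact ⟨2, by push_cast; linarith⟩
  · exact absurd e2 (by linarith)
  · exact ⟨2, by push_cast; linarith⟩
  · exact absurd e2 (by linarith)
  · exact ⟨3, by push_cast; linarith⟩
  · exact absurd e2 (by linarith)
  · exact ⟨3, by push_cast; linarith⟩
  · exact absurd e2 (by linarith)
  · exact ⟨1, by push_cast; linarith⟩
  · exact ⟨1, by push_cast; linarith⟩

theorem s_smul_eq (j : Option S.Idx) (a : S.Aff) :
    S.s j • a = a - S.pr a.2 (S.grad j) • S.simple j := by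
  cases j with
  | some i =>
    change S.incl (S.refl0 i) • a = _
    rw [incl_smul, refl0_smul]
    refine Prod.ext ?_ rfl
    change a.1 = a.1 - S.pr a.2 i • (0 : ℝ)
    simp
  | none =>
    change (S.incl (S.refl0 S.phi) * S.tau (-S.cor S.phi)) • a = _
    rw [mul_smul, tau_smul, incl_smul, refl0_smul, grad, S.pr_of_root_neg S.root_negPhi]
    refine Prod.ext ?_ ?_
    · change a.1 - S.ip (-S.cor S.phi) a.2 = a.1 - (-S.pr a.2 S.phi) • (1 : ℝ)
      rw [zsmul_eq_mul, Int.cast_neg, pr_cast]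
      change a.1 - ⟪-(S.cor S.phi : V), _⟫ = _
      rw [cor_eq, nu_phi, one_smul, inner_neg_left, real_inner_comm]
      ring
    · change a.2 - S.pr a.2 S.phi • S.cor S.phi = a.2 - (-S.pr a.2 S.phi) • -S.cor S.phi
      simp

theorem neg_cor_mem_or (i : ι) : S.cor i ∈ AddSubmonoid.closure (Set.range fun i : S.Idx => S.cor i) ∨
    -S.cor i ∈ AddSubmonoid.closure (Set.range fun i : S.Idx => S.cor i) :=
  S.finAction.mem_or_neg_mem ⟨i, rfl⟩

theorem cor_mem_span (i : ι) : S.cor i ∈ Submodule.span ℤ (Set.range fun i : S.Idx => S.cor i) := by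
  have h : ∀ x ∈ AddSubmonoid.closure (Set.range fun i : S.Idx => S.cor i),
      x ∈ Submodule.span ℤ (Set.range fun i : S.Idx => S.cor i) := by
    intro x hx
    induction hx using AddSubmonoid.closure_induction with
    | mem x hx => exact Submodule.subset_span hx
    | zero => exact zero_mem _
    | add x y _ _ hx hy => exact add_mem hx hy
  rcases S.neg_cor_mem_or i with hi | hi
  · exact h _ hi
  · exact neg_mem_iff.mp (h _ hi)

/-- The span hypothesis supplies integer coefficients, and the pairing with a fundamental coweight
is the matching coefficient times a positive `nu`. -/
theorem mem_closure_cor_of_nonneg {x : S.Pv}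
    (hx : x ∈ Submodule.span ℤ (Set.range fun i : S.Idx => S.cor i))
    (h : ∀ l, 0 ≤ ⟪S.fundVec l, (x : V)⟫) :
    x ∈ AddSubmonoid.closure (Set.range fun i : S.Idx => S.cor i) := by
  classical
  obtain ⟨c, rfl⟩ := (Submodule.mem_span_range_iff_exists_fun ℤ).mp hx
  refine AddSubmonoid.sum_mem _ fun i _ => ?_
  have hc : 0 ≤ c i := by
    have := h i
    rw [AddSubgroup.val_finsetSum, inner_sum] at this
    simp only [AddSubgroup.coe_zsmul, ← Int.cast_smul_eq_zsmul ℝ, inner_smul_right, cor_eq,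
      inner_fundVec_root] at this
    simp only [mul_ite, mul_one, mul_zero, Finset.sum_ite_eq, Finset.mem_univ, if_true] at this
    have h2 := S.one_le_nu i
    by_contra! hneg
    have h3 : (c i : ℝ) < 0 := by exact_mod_cast hneg
    nlinarith
  obtain ⟨n, hn⟩ := Int.eq_ofNat_of_zero_le hc
  rw [hn, natCast_zsmul]
  exact AddSubmonoid.nsmul_mem _ (AddSubmonoid.subset_closure (Set.mem_range_self i)) _

/-- The constant term counts the copies of `a_0`; when it vanishes only the finite simple coroots
are involved. -/
theorem mem_closure_simple {a : S.Aff} (h : a ∈ AddSubmonoid.closure (Set.range S.simple)) :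
    0 ≤ a.1 ∧ (a.1 = 0 → a.2 ∈ AddSubmonoid.closure (Set.range fun i : S.Idx => S.cor i)) := by
  induction h using AddSubmonoid.closure_induction with
  | mem x hx =>
    obtain ⟨j, rfl⟩ := hx
    cases j with
    | none => exact ⟨zero_le_one, fun h => absurd h one_ne_zero⟩
    | some i => exact ⟨le_rfl, fun _ => AddSubmonoid.subset_closure ⟨i, rfl⟩⟩
  | zero => exact ⟨le_rfl, fun _ => zero_mem _⟩
  | add x y _ _ hx hy =>
    refine ⟨add_nonneg hx.1 hy.1, fun h => ?_⟩
    have h' : x.1 + y.1 = 0 := h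
    exact add_mem (hx.2 (by linarith [hx.1, hy.1])) (hy.2 (by linarith [hx.1, hy.1]))

theorem mk_zero_mem_closure {x : S.Pv}
    (h : x ∈ AddSubmonoid.closure (Set.range fun i : S.Idx => S.cor i)) :
    ((0, x) : S.Aff) ∈ AddSubmonoid.closure (Set.range S.simple) := by
  induction h using AddSubmonoid.closure_induction with
  | mem x hx => obtain ⟨i, rfl⟩ := hx; exact AddSubmonoid.subset_closure ⟨some i, rfl⟩
  | zero => exact zero_mem _
  | add x y _ _ hx hy =>
    have := add_mem hx hy
    rwa [Prod.mk_add_mk, add_zero] at this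

/-- The affine root `2 (r c + α) / ‖α‖²`. -/
def aroot (r : ℤ) (i : ι) : S.Aff := (S.nu i * r, S.cor i)

theorem aroot_mem (r : ℤ) (i : ι) : S.aroot r i ∈ S.R := ⟨r, i, rfl⟩

/-- With ν = 2/‖α‖², the root νrc + α^∨ equals νr(c - φ^∨) + (νrφ^∨ + α^∨). The second summand is
ν(rφ + α), which has nonnegative coordinates because φ is highest and r ≥ 1. -/
theorem aroot_mem_closure {r : ℤ} {i : ι} (hr : 0 < r) :
    S.aroot r i ∈ AddSubmonoid.closure (Set.range S.simple) := by
  obtain ⟨N, hN⟩ := S.exists_nat_nu i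
  obtain ⟨m, hm⟩ := Int.eq_ofNat_of_zero_le hr.le
  have hm1 : 1 ≤ m := by omega
  have key : (N * m) • S.cor S.phi + S.cor i ∈
      AddSubmonoid.closure (Set.range fun i : S.Idx => S.cor i) := by
    refine S.mem_closure_cor_of_nonneg ?_ fun l => ?_
    · exact add_mem (nsmul_mem (S.cor_mem_span _) _) (S.cor_mem_span _)
    · rw [AddSubgroup.coe_add, AddSubgroup.coe_nsmul, inner_add_right, cor_eq, cor_eq, nu_phi,
        one_smul, ← Nat.cast_smul_eq_nsmul ℝ, inner_smul_right, inner_smul_right, hN]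
      obtain ⟨j, hj, -⟩ := S.neg_cor i
      have h1 := S.inner_fundVec_le_phi j l
      rw [hj, inner_neg_right] at h1
      have h2 := S.inner_fundVec_nonneg (S.isPos_of_dom S.dom_phi) l
      have h3 : (1 : ℝ) ≤ m := by exact_mod_cast hm1
      have h4 : (0 : ℝ) ≤ N := Nat.cast_nonneg N
      push_cast
      have : 0 ≤ (N : ℝ) * ((m - 1) * ⟪S.fundVec l, S.root S.phi⟫ +
          (⟪S.fundVec l, S.root S.phi⟫ + ⟪S.fundVec l, S.root i⟫)) :=
        mul_nonneg h4 (add_nonneg (mul_nonneg (by linarith) h2) (by linarith))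
      linarith
  have e : S.aroot r i = (N * m) • S.simple none + (0, (N * m) • S.cor S.phi + S.cor i) := by
    refine Prod.ext ?_ ?_
    · change S.nu i * r = (N * m) • (1 : ℝ) + 0
      rw [hN, hm]; simp
    · change S.cor i = (N * m) • -S.cor S.phi + _
      simp
  rw [e]
  exact add_mem (nsmul_mem (AddSubmonoid.subset_closure (Set.mem_range_self none)) _)
    (S.mk_zero_mem_closure key)

theorem aroot_mem_closure_iff (r : ℤ) (i : ι) :
    S.aroot r i ∈ AddSubmonoid.closure (Set.range S.simple) ↔ 0 < r ∨ r = 0 ∧ S.base.IsPos i := by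
  constructor
  · intro h
    obtain ⟨h1, h2⟩ := S.mem_closure_simple h
    change 0 ≤ S.nu i * r at h1
    have hn := S.one_le_nu i
    have h3 : (0 : ℝ) ≤ r := nonneg_of_mul_nonneg_right h1 (by linarith)
    have h4 : 0 ≤ r := by exact_mod_cast h3
    rcases h4.eq_or_lt with rfl | h5
    · right
      refine ⟨rfl, (S.cor_mem_closure_iff i).mp (h2 ?_)⟩
      change S.nu i * _ = 0
      simp
    · exact Or.inl h5
  · rintro (h | ⟨rfl, h⟩)
    · exact S.aroot_mem_closure h
    · have := S.mk_zero_mem_closure ((S.cor_mem_closure_iff i).mpr h)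
      rw [aroot]
      simpa using this

theorem exists_neg_aroot (r : ℤ) (i : ι) :
    ∃ j, S.cor j = -S.cor i ∧ -S.aroot r i = S.aroot (-r) j := by
  obtain ⟨j, hj, hj'⟩ := S.neg_cor i
  refine ⟨j, hj', Prod.ext ?_ hj'.symm⟩
  change -(S.nu i * r) = S.nu j * (-r : ℤ)
  rw [S.nu_eq_of_root_neg hj]
  push_cast; ring

theorem linearIndependent_simple : LinearIndependent ℤ S.simple := by
  rw [Fintype.linearIndependent_iff]
  intro g hg
  rw [Fintype.sum_option] at hg
  have h0 : g none = 0 := by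
    have := congrArg Prod.fst hg
    simpa [simple, Prod.fst_sum] using this
  have h1 : ∑ i : S.Idx, g (some i) • S.cor i = 0 := by
    have := congrArg Prod.snd hg
    rw [h0] at this
    simpa [simple, Prod.snd_sum] using this
  rintro (_ | i)
  · exact h0
  · exact Fintype.linearIndependent_iff.mp S.linearIndependent_cor (fun i => g (some i)) h1 i

/-- The extended affine Weyl group acting on the affine roots. -/
def affAction : RootAction S.W (Option S.Idx) S.Aff where
  R := S.R
  simple := S.simple
  s := S.s
  smul_mem w _ ha := S.act_mem_R w ha
  neg_mem := by
    rintro _ ⟨r, i, rfl⟩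
    obtain ⟨j, -, hj⟩ := S.exists_neg_aroot r i
    change -S.aroot r i ∈ _
    rw [hj]
    exact S.aroot_mem _ _
  simple_mem := S.simple_mem_R
  zero_notMem := by
    rintro ⟨r, i, h⟩
    exact S.cor_ne_zero i (congrArg Prod.snd h).symm
  linInd := S.linearIndependent_simple
  mem_or_neg_mem := by
    rintro _ ⟨r, i, rfl⟩
    change S.aroot r i ∈ _ ∨ -S.aroot r i ∈ _
    obtain ⟨j, hj', hj⟩ := S.exists_neg_aroot r i
    rw [hj, aroot_mem_closure_iff, aroot_mem_closure_iff, S.isPos_of_cor_eq_neg hj']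
    by_cases S.base.IsPos i <;> simp_all <;> omega
  reduced := by
    rintro j n ⟨r, i, h⟩
    rw [simple_eq] at h
    have h2 : n • S.cor (S.grad j) = S.cor i := congrArg Prod.snd h
    rcases S.zsmul_cor_eq (n := n) (by rwa [natCast_zsmul]) with h | h <;> omega
  s_smul j a := ⟨_, S.s_smul_eq j a⟩
  s_simple j := by
    have : (S.simple j).2 = S.cor (S.grad j) := congrArg Prod.snd (S.simple_eq j)
    rw [s_smul_eq, this, pr_cor_self]
    module
  s_mul_s j := by
    refine S.W_ext fun a => ?_
    have : (S.simple j).2 = S.cor (S.grad j) := congrArg Prod.snd (S.simple_eq j)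
    have h2 : S.s j • S.simple j = -S.simple j := by
      rw [s_smul_eq, this, pr_cor_self]
      module
    rw [mul_smul, S.s_smul_eq j a, smul_sub, S.s_smul_eq j a, one_smul]
    have : S.s j • S.pr a.2 (S.grad j) • S.simple j = S.pr a.2 (S.grad j) • S.s j • S.simple j :=
      map_zsmul (DistribSMul.toAddMonoidHom S.Aff (S.s j)) _ _
    rw [this, h2]
    module
  conj g i j h := by
    refine S.W_ext fun a => ?_
    rw [mul_smul, mul_smul, s_smul_eq, s_smul_eq, smul_sub]
    congr 1
    have e : g • S.pr a.2 (S.grad i) • S.simple i = S.pr a.2 (S.grad i) • g • S.simple i :=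
      map_zsmul (DistribSMul.toAddMonoidHom S.Aff g) _ _
    rw [e, h]
    congr 1
    rw [smul_snd]
    have h2 : g.right • S.cor (S.grad i) = S.cor (S.grad j) := by
      have := congrArg Prod.snd h
      rwa [simple_eq, simple_eq] at this
    rw [smul_cor] at h2
    rw [← S.cor_injective h2, pr_smul]
  -- For each of the finitely many gradients, positivity of the root bounds `r` below by 0 and
  -- negativity of its image bounds `r` above.
  finite_inv g := by
    refine (Set.finite_iUnion fun i : ι => (Set.finite_Icc (0 : ℤ)
      ⌊S.ip g.left.toAdd (g.right • S.cor i)⌋).image fun r => S.aroot r i).subset ?_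
    rintro _ ⟨⟨⟨r, i, rfl⟩, h1⟩, -, h2⟩
    have h1' := (S.mem_closure_simple h1).1
    have h2' := (S.mem_closure_simple h2).1
    change 0 ≤ S.nu i * r at h1'
    change 0 ≤ -(S.nu i * r - S.ip g.left.toAdd (g.right • S.cor i)) at h2'
    have hn := S.one_le_nu i
    have h3 : (0 : ℝ) ≤ r := nonneg_of_mul_nonneg_right h1' (by linarith)
    refine Set.mem_iUnion.mpr ⟨i, r, ⟨by exact_mod_cast h3, Int.le_floor.mpr ?_⟩, rfl⟩
    nlinarith

theorem affAction_pos_aroot (r : ℤ) (i : ι) :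
    S.affAction.Pos (S.aroot r i) ↔ 0 < r ∨ r = 0 ∧ S.base.IsPos i := by
  rw [← aroot_mem_closure_iff]
  exact ⟨fun h => h.2, fun h => ⟨S.aroot_mem r i, h⟩⟩

theorem incl_smul_aroot (u : S.W0) (r : ℤ) (i : ι) : S.incl u • S.aroot r i = S.aroot r (u • i) := by
  rw [incl_smul]
  refine Prod.ext ?_ (S.smul_cor u i)
  change S.nu i * r = S.nu (u • i) * r
  rw [nu, nu, ← smul_root, inner_smul_smul]

theorem tau_smul_aroot (x : S.Pv) (r : ℤ) (i : ι) :
    S.tau x • S.aroot r i = S.aroot (r - S.pr x i) i := by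
  rw [tau_smul]
  refine Prod.ext ?_ rfl
  change S.nu i * r - ⟪(x : V), (S.cor i : V)⟫ = S.nu i * (r - S.pr x i : ℤ)
  rw [cor_eq, inner_smul_right, Int.cast_sub, pr_cast]
  ring

theorem neg_pos_aroot_iff (r : ℤ) (i : ι) :
    S.affAction.Pos (-S.aroot r i) ↔ r < 0 ∨ r = 0 ∧ ¬ S.base.IsPos i := by
  obtain ⟨j, hj', hj⟩ := S.exists_neg_aroot r i
  rw [hj, affAction_pos_aroot, S.isPos_of_cor_eq_neg hj']
  simp

theorem incl_s (i : S.Idx) : S.incl (S.finAction.s i) = S.affAction.s (some i) := rfl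

/-- An element of W₀ fixes constant terms, so only affine roots with constant term zero can change
sign. -/
theorem len_incl (u : S.W0) : S.affAction.len (S.incl u) = S.finAction.len u := by
  rw [RootAction.len, RootAction.len,
    ← Set.ncard_image_of_injective (f := fun x : S.Pv => ((0, x) : S.Aff)) _
      (fun x y h => congrArg Prod.snd h)]
  congr 1
  have e : ∀ i, S.aroot 0 i = (0, S.cor i) := fun i => by simp [aroot]
  ext a
  constructor
  · rintro ⟨h1, h2⟩
    obtain ⟨r, i, rfl⟩ := h1.1
    change S.affAction.Pos (S.aroot r i) at h1
    change S.affAction.Pos (-(_ • S.aroot r i)) at h2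
    rw [affAction_pos_aroot] at h1
    rw [incl_smul_aroot, neg_pos_aroot_iff] at h2
    have hr : r = 0 := by omega
    subst hr
    refine ⟨S.cor i, ⟨(S.finAction_pos i).mpr (by simpa using h1), ?_⟩, (e i).symm⟩
    rw [← RootAction.not_pos_iff (S.finAction.smul_mem u ⟨i, rfl⟩), smul_cor, finAction_pos]
    simpa using h2
  · rintro ⟨x, ⟨h1, h2⟩, rfl⟩
    obtain ⟨i, rfl⟩ := h1.1
    rw [← RootAction.not_pos_iff (S.finAction.smul_mem u ⟨i, rfl⟩), smul_cor, finAction_pos] at h2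
    rw [finAction_pos] at h1
    change S.affAction.Pos (0, S.cor i) ∧ S.affAction.Pos (-(S.incl u • ((0, S.cor i) : S.Aff)))
    rw [← e, affAction_pos_aroot, incl_smul_aroot, neg_pos_aroot_iff]
    simp [h1, h2]

end EuclideanRootSystem

noncomputable section

namespace EuclideanRootSystem

variable {ι V : Type*} [Finite ι] [NormedAddCommGroup V] [InnerProductSpace ℝ V]
variable {S : EuclideanRootSystem ι V} (k : S.Mult)

/-! ### The Hecke algebra -/

/-- The parameter `k_j - k_j⁻¹`. -/
def Mult.p (j : Option S.Idx) : ℂ := (k.val j : ℂ) - ((k.val j)⁻¹ : ℂˣ)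

theorem Mult.toFun_smul (w : S.W) {a b : S.R} (h : w • (a : S.Aff) = b) : k.toFun b = k.toFun a := by
  rw [← k.inv' w a]
  congr 1
  exact Subtype.ext h.symm

theorem Mult.val_eq {w : S.W} {i j : Option S.Idx} (h : w • S.simple i = S.simple j) :
    k.val i = k.val j := (k.toFun_smul (a := simpleR i) (b := simpleR j) w h).symm

theorem Mult.p_eq (w : S.W) (i j : Option S.Idx)
    (h : w • S.affAction.simple i = S.affAction.simple j) : k.p i = k.p j := by
  rw [Mult.p, Mult.p, k.val_eq h]

theorem T_mul_T (j : Option S.Idx) : T k j * T k j = 1 + k.p j • T k j := by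
  have h := RingQuot.mkAlgHom_rel ℂ (HeckeRel.quadratic (k := k) j)
  rw [map_mul, map_sub, map_add, map_zero, AlgHom.commutes, AlgHom.commutes] at h
  change (T k j - _) * (T k j + _) = 0 at h
  rw [sub_mul, mul_add, mul_add, ← Algebra.commutes, ← map_mul, ← Units.val_mul,
    mul_inv_cancel, Units.val_one, map_one, ← Algebra.smul_def, ← Algebra.smul_def] at h
  have h2 : k.p j • T k j = (k.val j : ℂ) • T k j - (((k.val j)⁻¹ : ℂˣ) : ℂ) • T k j := by
    rw [Mult.p]; module
  rw [h2, ← sub_eq_zero, ← h]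
  abel

theorem Om_len (o : S.Om) : S.affAction.len (o : S.W) = 0 := o.2

theorem TO_of_eq_one {o : S.Om} (h : (o : S.W) = 1) : TO k o = 1 :=
  (RingQuot.mkAlgHom_rel ℂ (HeckeRel.one (k := k) o h)).trans (map_one _)

theorem TO_mul_TO {o o' o'' : S.Om} (h : (o'' : S.W) = o * o') : TO k o * TO k o' = TO k o'' :=
  (map_mul _ _ _).symm.trans (RingQuot.mkAlgHom_rel ℂ (HeckeRel.mul (k := k) o o' o'' h))

theorem TO_mul_T {o : S.Om} {i j : Option S.Idx} (h : (o : S.W) • S.simple i = S.simple j) :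
    TO k o * T k i = T k j * TO k o := by
  have := RingQuot.mkAlgHom_rel ℂ (HeckeRel.conj (k := k) o i j h)
  rwa [map_mul, map_mul] at this

theorem T_braid {i j : Option S.Idx} (hij : i ≠ j) (h : IsOfFinOrder (S.s i * S.s j)) :
    altProd (orderOf (S.s i * S.s j)) (T k i) (T k j) =
      altProd (orderOf (S.s i * S.s j)) (T k j) (T k i) := by
  have := RingQuot.mkAlgHom_rel ℂ (HeckeRel.braid (k := k) i j hij h)
  rwa [map_altProd, map_altProd] at this

open Classical in
/-- The braid data of the generators of the Hecke algebra. -/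
def heckeData : S.affAction.BraidData (Hecke k) where
  X := T k
  Z w := if h : S.affAction.len w = 0 then TO k ⟨w, h⟩ else 1
  braid _ _ hij h := T_braid k hij h
  Z_one := by rw [dif_pos S.affAction.len_one, TO_of_eq_one k rfl]
  Z_mul g h hg hh := by
    rw [dif_pos hg, dif_pos hh, dif_pos ((RootAction.len_mul_of_left hg).trans hh)]
    exact (TO_mul_TO k rfl).symm
  Z_X g i j hg h := by rw [dif_pos hg, TO_mul_T k h]

theorem heckeData_Z (o : S.Om) : (heckeData k).Z o = TO k o := dif_pos o.2

theorem isReducedExpr_iff (w : S.W) (p : List (Option S.Idx) × S.Om) :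
    IsReducedExpr w p ↔ S.affAction.IsReduced w p.1 p.2 :=
  ⟨fun h => ⟨h.1, h.2, p.2.2⟩, fun h => ⟨h.eq, h.length_eq⟩⟩

theorem Tw_eq (w : S.W) : Tw k w = (heckeData k).lift w := by
  have h : ∃ p, IsReducedExpr w p := by
    obtain ⟨l, o, h⟩ := S.affAction.exists_isReduced w
    exact ⟨(l, ⟨o, h.len_eq⟩), (isReducedExpr_iff w _).mpr h⟩
  rw [Tw, dif_pos h, (heckeData k).lift_eq ((isReducedExpr_iff w _).mp h.choose_spec), heckeData_Z]
  rfl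

theorem Tw_one : Tw k (1 : S.W) = 1 := by rw [Tw_eq, RootAction.BraidData.lift_one]

theorem Tw_s (j : Option S.Idx) : Tw k (S.s j) = T k j := by
  rw [Tw_eq]; exact (heckeData k).lift_s j

theorem Tw_Om (o : S.Om) : Tw k (o : S.W) = TO k o := by
  rw [Tw_eq, RootAction.BraidData.lift_of_len_eq_zero _ (Om_len o), heckeData_Z]

theorem Tw_mul {g h : S.W} (H : S.affAction.len (g * h) = S.affAction.len g + S.affAction.len h) :
    Tw k (g * h) = Tw k g * Tw k h := by
  rw [Tw_eq, Tw_eq, Tw_eq, RootAction.BraidData.lift_mul _ H]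

theorem Tw_s_mul {g : S.W} {j : Option S.Idx} (h : S.affAction.Pos (g⁻¹ • S.simple j)) :
    Tw k (S.s j * g) = T k j * Tw k g := by
  rw [Tw_eq, Tw_eq]; exact (heckeData k).lift_s_mul h

theorem Tw_mul_s {g : S.W} {j : Option S.Idx} (h : S.affAction.Pos (g • S.simple j)) :
    Tw k (g * S.s j) = Tw k g * T k j := by
  rw [Tw_eq, Tw_eq]; exact (heckeData k).lift_mul_s h

/-- The inverse `T_j - (k_j - k_j⁻¹)` of `T_j`. -/
def Tinv (j : Option S.Idx) : Hecke k := T k j - k.p j • 1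

theorem T_mul_Tinv (j : Option S.Idx) : T k j * Tinv k j = 1 := by
  rw [Tinv, mul_sub, T_mul_T, mul_smul_comm, mul_one, add_sub_cancel_right]

theorem Tinv_mul_T (j : Option S.Idx) : Tinv k j * T k j = 1 := by
  rw [Tinv, sub_mul, T_mul_T, smul_mul_assoc, one_mul, add_sub_cancel_right]

/-- `T_j` as a unit. -/
def TU (j : Option S.Idx) : (Hecke k)ˣ := ⟨T k j, Tinv k j, T_mul_Tinv k j, Tinv_mul_T k j⟩

theorem isUnit_TO (o : S.Om) : IsUnit (TO k o) := by
  have h : S.len (o : S.W)⁻¹ = 0 := (S.affAction.len_inv _).trans o.2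
  refine ⟨⟨TO k o, TO k ⟨(o : S.W)⁻¹, h⟩, ?_, ?_⟩, rfl⟩
  · rw [TO_mul_TO k (o'' := ⟨1, S.affAction.len_one⟩) (by simp), TO_of_eq_one k rfl]
  · rw [TO_mul_TO k (o'' := ⟨1, S.affAction.len_one⟩) (by simp), TO_of_eq_one k rfl]

theorem isUnit_Tw (w : S.W) : IsUnit (Tw k w) := by
  induction w using S.affAction.induction_left with
  | h0 g hg => exact Tw_Om k ⟨g, hg⟩ ▸ isUnit_TO k _
  | hs j g hj ih =>
    change IsUnit (Tw k (S.s j * g))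
    rw [Tw_s_mul k hj]
    exact (TU k j).isUnit.mul ih

/-- `T_w` as a unit. -/
def TwU (w : S.W) : (Hecke k)ˣ := (isUnit_Tw k w).unit

@[simp] theorem val_TwU (w : S.W) : (TwU k w : Hecke k) = Tw k w := rfl

theorem TwU_mul {g h : S.W} (H : S.affAction.len (g * h) = S.affAction.len g + S.affAction.len h) :
    TwU k (g * h) = TwU k g * TwU k h := Units.ext (Tw_mul k H)

section Lift

variable {A : Type*} [Ring A] [Algebra ℂ A]

variable {k} in
theorem hecke_algHom_ext {f g : Hecke k →ₐ[ℂ] A} (hT : ∀ j, f (T k j) = g (T k j))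
    (hO : ∀ o, f (TO k o) = g (TO k o)) : f = g := by
  refine RingQuot.ringQuot_ext' _ _ _ (FreeAlgebra.hom_ext (funext ?_))
  rintro (j | o)
  · exact hT j
  · exact hO o

/-- The homomorphism from the Hecke algebra that is defined by braid data with the quadratic
relations. -/
def heckeLift (D : S.affAction.BraidData A) (hD : ∀ j, D.X j * D.X j = 1 + k.p j • D.X j) :
    Hecke k →ₐ[ℂ] A :=
  RingQuot.liftAlgHom ℂ ⟨FreeAlgebra.lift ℂ (Sum.elim D.X fun o => D.Z o), by
    have hT : ∀ j, FreeAlgebra.lift ℂ (Sum.elim D.X fun o : S.Om => D.Z o) (preT j) = D.X j :=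
      fun j => FreeAlgebra.lift_ι_apply _ _
    have hO : ∀ o, FreeAlgebra.lift ℂ (Sum.elim D.X fun o : S.Om => D.Z o) (preO o) = D.Z o :=
      fun o => FreeAlgebra.lift_ι_apply _ _
    intro x y h
    cases h with
    | braid i j hij hfin =>
      rw [map_altProd, map_altProd, hT, hT]
      exact D.braid i j hij hfin
    | quadratic j =>
      rw [map_mul, map_sub, map_add, map_zero, AlgHom.commutes, AlgHom.commutes, hT,
        sub_mul, mul_add, mul_add, hD, ← Algebra.commutes, ← map_mul, ← Units.val_mul,
        mul_inv_cancel, Units.val_one, map_one, ← Algebra.smul_def, ← Algebra.smul_def, Mult.p,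
        sub_smul]
      abel
    | one o ho => rw [hO, map_one, ho, D.Z_one]
    | mul o o' o'' ho => rw [map_mul, hO, hO, hO, ho, D.Z_mul _ _ o.2 o'.2]
    | conj o i j hij => rw [map_mul, map_mul, hO, hT, hT, D.Z_X _ _ _ o.2 hij]⟩

variable (D : S.affAction.BraidData A) (hD : ∀ j, D.X j * D.X j = 1 + k.p j • D.X j)

theorem heckeLift_T (j : Option S.Idx) : heckeLift k D hD (T k j) = D.X j :=
  (RingQuot.liftAlgHom_mkAlgHom_apply _ _ _ _).trans (FreeAlgebra.lift_ι_apply _ _)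

theorem heckeLift_TO (o : S.Om) : heckeLift k D hD (TO k o) = D.Z o :=
  (RingQuot.liftAlgHom_mkAlgHom_apply _ _ _ _).trans (FreeAlgebra.lift_ι_apply _ _)

theorem heckeLift_Tw (w : S.W) : heckeLift k D hD (Tw k w) = D.lift w := by
  induction w using S.affAction.induction_left with
  | h0 g hg =>
    rw [show Tw k g = TO k ⟨g, hg⟩ from Tw_Om k ⟨g, hg⟩, heckeLift_TO, D.lift_of_len_eq_zero hg]
  | hs j g hj ih =>
    rw [D.lift_s_mul hj]
    change heckeLift k D hD (Tw k (S.s j * g)) = _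
    rw [Tw_s_mul k hj, map_mul, ih, heckeLift_T]

end Lift

/-- The regular representation of the Hecke algebra, in the basis `T_w`. -/
def regRep : Hecke k →ₐ[ℂ] Module.End ℂ (S.W →₀ ℂ) :=
  heckeLift (A := Module.End ℂ (S.W →₀ ℂ)) k (S.affAction.regular k.p_eq)
    fun j => S.affAction.leftOp_mul_leftOp j

theorem regRep_Tw (w : S.W) : regRep k (Tw k w) (Finsupp.single 1 1) = Finsupp.single w 1 := by
  have h := heckeLift_Tw (A := Module.End ℂ (S.W →₀ ℂ)) k (S.affAction.regular k.p_eq)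
    (fun j => S.affAction.leftOp_mul_leftOp j) w
  exact (LinearMap.congr_fun h _).trans (RootAction.regular_lift_single _ _ _)

/-- The linear map `H(k) → ℂ^{(W)}` with `T_w ↦ w`. -/
def coords : Hecke k →ₗ[ℂ] S.W →₀ ℂ :=
  (LinearMap.applyₗ (Finsupp.single 1 1)).comp (regRep k).toLinearMap

theorem coords_Tw (w : S.W) : coords k (Tw k w) = Finsupp.single w 1 := regRep_Tw k w

theorem T_mul_Tw (j : Option S.Idx) (w : S.W) :
    T k j * Tw k w = Tw k (S.s j * w) ∨ T k j * Tw k w = Tw k (S.s j * w) + k.p j • Tw k w := by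
  rcases S.affAction.pos_or_neg (S.affAction.smul_simple_mem w⁻¹ j) with h | h
  · exact Or.inl (Tw_s_mul k h).symm
  · right
    have h2 := Tw_s_mul k (g := S.s j * w) (j := j) (by
      rw [mul_inv_rev, mul_smul]
      rw [show (S.s j)⁻¹ = S.s j from S.affAction.s_inv j,
        show S.s j • S.simple j = -S.simple j from S.affAction.s_simple j, smul_neg]
      exact h)
    rw [show S.s j * (S.s j * w) = w from S.affAction.s_mul_s_mul j w] at h2
    rw [h2, ← mul_assoc, T_mul_T, add_mul, one_mul, smul_mul_assoc]

/-- The span is stable under left multiplication by the generators and contains 1. -/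
theorem span_Tw : Submodule.span ℂ (Set.range (Tw k : S.W → Hecke k)) = ⊤ := by
  have key : ∀ h : Hecke k, ∀ x ∈ Submodule.span ℂ (Set.range (Tw k : S.W → Hecke k)),
      h * x ∈ Submodule.span ℂ (Set.range (Tw k : S.W → Hecke k)) := by
    intro h
    obtain ⟨y, rfl⟩ := RingQuot.mkAlgHom_surjective ℂ (HeckeRel k) h
    induction y using FreeAlgebra.induction with
    | grade0 r =>
      intro x hx
      rw [AlgHom.commutes, ← Algebra.smul_def]
      exact Submodule.smul_mem _ _ hx
    | mul a b ha hb => intro x hx; rw [map_mul, mul_assoc]; exact ha _ (hb _ hx)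
    | add a b ha hb => intro x hx; rw [map_add, add_mul]; exact add_mem (ha _ hx) (hb _ hx)
    | grade1 g =>
      intro x hx
      induction hx using Submodule.span_induction with
      | zero => rw [mul_zero]; exact zero_mem _
      | add x y _ _ hx hy => rw [mul_add]; exact add_mem hx hy
      | smul c x _ hx => rw [mul_smul_comm]; exact Submodule.smul_mem _ _ hx
      | mem x hx =>
        obtain ⟨w, rfl⟩ := hx
        rcases g with j | o
        · change T k j * _ ∈ _
          have m : ∀ w, Tw k w ∈ Submodule.span ℂ (Set.range (Tw k : S.W → Hecke k)) :=
            fun w => Submodule.subset_span ⟨w, rfl⟩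
          rcases T_mul_Tw k j w with h | h <;> rw [h]
          · exact m _
          · exact add_mem (m _) (Submodule.smul_mem _ _ (m _))
        · change TO k o * _ ∈ _
          rw [← Tw_Om, ← Tw_mul]
          · exact Submodule.subset_span ⟨_, rfl⟩
          · rw [RootAction.len_mul_of_left (Om_len o), Om_len, zero_add]
  refine eq_top_iff.mpr fun h _ => ?_
  have := key h 1 (Submodule.subset_span ⟨1, Tw_one k⟩)
  rwa [mul_one] at this

/-- In the regular representation `T_w` carries the vector at 1 to the vector at `w`, so the images
are visibly independent. -/
theorem linearIndependent_Tw : LinearIndependent ℂ (Tw k : S.W → Hecke k) := by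
  refine LinearIndependent.of_comp (coords k) ?_
  have : (coords k) ∘ (Tw k : S.W → Hecke k) = fun w => Finsupp.single w 1 :=
    funext fun w => coords_Tw k w
  rw [this]
  exact Finsupp.linearIndependent_single_one ℂ S.W

/-- The basis `T_w` of the Hecke algebra. -/
def basisTw : Module.Basis S.W ℂ (Hecke k) :=
  Module.Basis.mk (linearIndependent_Tw k) (span_Tw k).ge

theorem basisTw_apply (w : S.W) : basisTw k w = Tw k w := Module.Basis.mk_apply ..

end EuclideanRootSystem

noncomputable section

/-! ### Rank two -/

namespace RootAction

variable {G B E : Type*} [Group G] [AddCommGroup E] [DistribMulAction G E] {Φ : RootAction G B E}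

theorem smul_zsmul' (g : G) (n : ℤ) (a : E) : g • n • a = n • g • a :=
  map_zsmul (DistribSMul.toAddMonoidHom E g) n a

theorem prod_smul_sub_mem_span {I : Set B} {l : List B} (hl : ∀ i ∈ l, i ∈ I) (a : E) :
    (l.map Φ.s).prod • a - a ∈ Submodule.span ℤ (Φ.simple '' I) := by
  induction l with
  | nil => simp
  | cons i l ih =>
    rw [List.map_cons, List.prod_cons, mul_smul]
    obtain ⟨n, hn⟩ := Φ.s_smul i ((l.map Φ.s).prod • a)
    rw [hn, sub_right_comm]
    exact sub_mem (ih fun j hj => hl j (List.mem_cons_of_mem _ hj))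
      (Submodule.smul_mem _ _ (Submodule.subset_span ⟨i, hl i List.mem_cons_self, rfl⟩))

/-- A simple root outside `I` changes only by a combination of the simple roots in `I`, so its own
coefficient keeps it positive. Thus all simple roots stay positive and the length is zero. -/
theorem prod_eq_one_of_fix {I : Set B} {l : List B} (hl : ∀ i ∈ l, i ∈ I)
    (h : ∀ i ∈ I, (l.map Φ.s).prod • Φ.simple i = Φ.simple i) : (l.map Φ.s).prod = 1 := by
  refine eq_one_of_len_eq_zero (Φ := Φ) ⟨l, rfl⟩ (len_eq_zero_iff_simple.mpr fun j => ?_)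
  by_cases hj : j ∈ I
  · rw [h j hj]; exact Φ.pos_simple j
  · rw [← not_pos_neg_iff (Φ.smul_simple_mem _ _)]
    intro hneg
    have h1 := Φ.prod_smul_sub_mem_span hl (Φ.simple j)
    have h2 := mem_closure_of_add_mem_span (Φ.pos_simple j).2 hneg.2
      (by rw [← sub_eq_add_neg, ← neg_sub]; exact Submodule.neg_mem _ h1)
    have h3 : Φ.simple j ∈ Submodule.span ℤ (Φ.simple '' I) := by
      generalize Φ.simple j = z at h2
      induction h2 using AddSubmonoid.closure_induction with
      | mem x hx => exact Submodule.subset_span hx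
      | zero => exact zero_mem _
      | add x y _ _ hx hy => exact add_mem hx hy
    exact Φ.linInd.notMem_span_image hj h3

theorem zsmul_add_zsmul_inj {i j : B} (hij : i ≠ j) {m n m' n' : ℤ}
    (h : m • Φ.simple i + n • Φ.simple j = m' • Φ.simple i + n' • Φ.simple j) : m = m' ∧ n = n' := by
  have hinj : Function.Injective ![i, j] := by
    simp [Function.Injective, Fin.forall_fin_two, hij, hij.symm]
  have hli : LinearIndependent ℤ ![Φ.simple i, Φ.simple j] := by
    have e : ![Φ.simple i, Φ.simple j] = Φ.simple ∘ ![i, j] := by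
      ext a; fin_cases a <;> rfl
    rw [e]
    exact Φ.linInd.comp _ hinj
  have := LinearIndependent.pair_iff.mp hli (m - m') (n - n')
    (by rw [sub_smul, sub_smul, sub_add_sub_comm, h, sub_self])
  omega

theorem s_mul_s_smul {i j : B} {x y : ℤ} (hx : Φ.s i • Φ.simple j = Φ.simple j + x • Φ.simple i)
    (hy : Φ.s j • Φ.simple i = Φ.simple i + y • Φ.simple j) (m n : ℤ) :
    (Φ.s i * Φ.s j) • (m • Φ.simple i + n • Φ.simple j) =
      (m * (x * y - 1) - n * x) • Φ.simple i + (m * y - n) • Φ.simple j := by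
  simp only [mul_smul, smul_add, smul_zsmul', hy, hx, Φ.s_simple, smul_neg]
  module

theorem s_mul_s_pow_eq_one {i j : B} (n : ℕ)
    (hi : (Φ.s i * Φ.s j) ^ n • Φ.simple i = Φ.simple i)
    (hj : (Φ.s i * Φ.s j) ^ n • Φ.simple j = Φ.simple j) : (Φ.s i * Φ.s j) ^ n = 1 := by
  have e : ∀ n, ∃ l : List B, (∀ k ∈ l, k ∈ ({i, j} : Set B)) ∧
      (Φ.s i * Φ.s j) ^ n = (l.map Φ.s).prod := by
    intro n
    induction n with
    | zero => exact ⟨[], by simp, by simp⟩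
    | succ n ih =>
      obtain ⟨l, h1, h2⟩ := ih
      refine ⟨l ++ [i, j], ?_, by simp [pow_succ, h2]⟩
      intro k hk
      rcases List.mem_append.mp hk with h | h
      · exact h1 k h
      · simpa using h
  obtain ⟨l, h1, h2⟩ := e n
  rw [h2] at hi hj ⊢
  refine prod_eq_one_of_fix h1 ?_
  rintro k (rfl | rfl)
  · exact hi
  · exact hj

/-- Iterates of the matrix of `s_i s_j` on the span of two simple roots. -/
def rankTwo (x y : ℤ) (v : ℤ × ℤ) : ℤ × ℤ := (v.1 * (x * y - 1) - v.2 * x, v.1 * y - v.2)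

theorem s_mul_s_pow_smul {i j : B} {x y : ℤ}
    (hx : Φ.s i • Φ.simple j = Φ.simple j + x • Φ.simple i)
    (hy : Φ.s j • Φ.simple i = Φ.simple i + y • Φ.simple j) (r : ℕ) (v : ℤ × ℤ) :
    (Φ.s i * Φ.s j) ^ r • (v.1 • Φ.simple i + v.2 • Φ.simple j) =
      ((rankTwo x y)^[r] v).1 • Φ.simple i + ((rankTwo x y)^[r] v).2 • Φ.simple j := by
  induction r generalizing v with
  | zero => simp
  | succ r ih =>
    rw [pow_succ, mul_smul, s_mul_s_smul hx hy]
    exact ih (rankTwo x y v)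

/-- Orders of products of two simple reflections become finite computations with integer pairs,
decided below by evaluation. -/
theorem s_mul_s_pow_eq_one_iff {i j : B} (hij : i ≠ j) {x y : ℤ}
    (hx : Φ.s i • Φ.simple j = Φ.simple j + x • Φ.simple i)
    (hy : Φ.s j • Φ.simple i = Φ.simple i + y • Φ.simple j) (r : ℕ) :
    (Φ.s i * Φ.s j) ^ r = 1 ↔
      (rankTwo x y)^[r] (1, 0) = (1, 0) ∧ (rankTwo x y)^[r] (0, 1) = (0, 1) := by
  have h1 := s_mul_s_pow_smul hx hy r (1, 0)
  have h2 := s_mul_s_pow_smul hx hy r (0, 1)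
  simp only [one_smul, zero_smul, add_zero, zero_add] at h1 h2
  constructor
  · intro h
    rw [h, one_smul] at h1 h2
    have e1 := zsmul_add_zsmul_inj hij (m := 1) (n := 0) (by simpa using h1)
    have e2 := zsmul_add_zsmul_inj hij (m := 0) (n := 1) (by simpa using h2)
    exact ⟨Prod.ext e1.1.symm e1.2.symm, Prod.ext e2.1.symm e2.2.symm⟩
  · rintro ⟨e1, e2⟩
    rw [e1] at h1
    rw [e2] at h2
    exact s_mul_s_pow_eq_one r (by simpa using h1) (by simpa using h2)

theorem rankTwo_two_two (r : ℕ) : (rankTwo 2 2)^[r] (1, 0) = (2 * (r : ℤ) + 1, 2 * (r : ℤ)) := by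
  induction r with
  | zero => rfl
  | succ r ih =>
    rw [Function.iterate_succ_apply', ih, rankTwo]
    push_cast
    ext <;> ring

/-- This is the affine diagram of rank one: iterates grow linearly, so there is no braid relation to
verify. -/
theorem not_isOfFinOrder_of_two_two {i j : B} (hij : i ≠ j)
    (hx : Φ.s i • Φ.simple j = Φ.simple j + (2 : ℤ) • Φ.simple i)
    (hy : Φ.s j • Φ.simple i = Φ.simple i + (2 : ℤ) • Φ.simple j) :
    ¬ IsOfFinOrder (Φ.s i * Φ.s j) := by
  rw [isOfFinOrder_iff_pow_eq_one]
  rintro ⟨n, hn, h⟩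
  have := ((s_mul_s_pow_eq_one_iff hij hx hy n).mp h).1
  rw [rankTwo_two_two] at this
  have := congrArg Prod.snd this
  simp at this
  omega

theorem orderOf_of_zero_zero {i j : B} (hij : i ≠ j)
    (hx : Φ.s i • Φ.simple j = Φ.simple j + (0 : ℤ) • Φ.simple i)
    (hy : Φ.s j • Φ.simple i = Φ.simple i + (0 : ℤ) • Φ.simple j) :
    orderOf (Φ.s i * Φ.s j) = 2 := by
  refine orderOf_eq_prime ?_ ?_
  · rw [s_mul_s_pow_eq_one_iff hij hx hy]; decide
  · rw [← pow_one (_ * _), Ne, s_mul_s_pow_eq_one_iff hij hx hy]; decide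

theorem orderOf_of_one_one {i j : B} (hij : i ≠ j)
    (hx : Φ.s i • Φ.simple j = Φ.simple j + (1 : ℤ) • Φ.simple i)
    (hy : Φ.s j • Φ.simple i = Φ.simple i + (1 : ℤ) • Φ.simple j) :
    orderOf (Φ.s i * Φ.s j) = 3 := by
  refine orderOf_eq_prime ?_ ?_
  · rw [s_mul_s_pow_eq_one_iff hij hx hy]; decide
  · rw [← pow_one (_ * _), Ne, s_mul_s_pow_eq_one_iff hij hx hy]; decide

theorem orderOf_of_one_two {i j : B} (hij : i ≠ j)
    (hx : Φ.s i • Φ.simple j = Φ.simple j + (1 : ℤ) • Φ.simple i)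
    (hy : Φ.s j • Φ.simple i = Φ.simple i + (2 : ℤ) • Φ.simple j) :
    orderOf (Φ.s i * Φ.s j) = 4 := by
  refine orderOf_eq_prime_pow (p := 2) (n := 1) ?_ ?_
  · rw [s_mul_s_pow_eq_one_iff hij hx hy]; decide
  · rw [s_mul_s_pow_eq_one_iff hij hx hy]; decide

theorem orderOf_of_one_three {i j : B} (hij : i ≠ j)
    (hx : Φ.s i • Φ.simple j = Φ.simple j + (1 : ℤ) • Φ.simple i)
    (hy : Φ.s j • Φ.simple i = Φ.simple i + (3 : ℤ) • Φ.simple j) :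
    orderOf (Φ.s i * Φ.s j) = 6 := by
  refine orderOf_eq_of_pow_and_pow_div_prime (by norm_num) ?_ ?_
  · rw [s_mul_s_pow_eq_one_iff hij hx hy]; decide
  · intro p hp hp6
    have hle := Nat.le_of_dvd (by norm_num) hp6
    rw [Ne, s_mul_s_pow_eq_one_iff hij hx hy]
    interval_cases p <;> first | decide | (exfalso; revert hp hp6; decide)

end RootAction

namespace EuclideanRootSystem

variable {ι V : Type*} [Finite ι] [NormedAddCommGroup V] [InnerProductSpace ℝ V]
variable (S : EuclideanRootSystem ι V)

/-- The number `x` with `s_i a_j = a_j + x a_i`. -/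
def cart (i j : Option S.Idx) : ℤ := -S.P.pairingIn ℤ (S.grad i) (S.grad j)

theorem s_smul_simple (i j : Option S.Idx) :
    S.affAction.s i • S.affAction.simple j =
      S.affAction.simple j + S.cart i j • S.affAction.simple i := by
  have h := S.s_smul_eq i (S.simple j)
  have h2 : (S.simple j).2 = S.cor (S.grad j) := congrArg Prod.snd (S.simple_eq j)
  rw [h2, pr_cor] at h
  rw [cart, neg_smul, ← sub_eq_add_neg]
  exact h

theorem inner_grad_nonpos {i j : Option S.Idx} (h : i ≠ j) :
    ⟪S.root (S.grad i), S.root (S.grad j)⟫ ≤ 0 := by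
  have key : ∀ j : S.Idx, ⟪S.root S.negPhi, S.root j⟫ ≤ 0 := fun j => by
    rw [root_negPhi, inner_neg_left, neg_nonpos]
    exact S.dom_phi j
  match i, j, h with
  | none, none, h => exact absurd rfl h
  | none, some j, _ => exact key j
  | some i, none, _ => rw [real_inner_comm]; exact key i
  | some i, some j, h => exact S.inner_simple_nonpos fun e => h (congrArg some e)

theorem cart_cases {i j : Option S.Idx} (h : i ≠ j) (hfin : IsOfFinOrder (S.s i * S.s j)) :
    (S.cart i j = 0 ∧ S.cart j i = 0) ∨ (S.cart i j = 1 ∧ S.cart j i = 1) ∨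
    (S.cart i j = 1 ∧ S.cart j i = 2) ∨ (S.cart i j = 2 ∧ S.cart j i = 1) ∨
    (S.cart i j = 1 ∧ S.cart j i = 3) ∨ (S.cart i j = 3 ∧ S.cart j i = 1) := by
  have hp := S.P.pairingIn_pairingIn_mem_set_of_isCrystal_of_isRed (S.grad i) (S.grad j)
  have e1 := S.s_smul_simple i j
  have e2 := S.s_smul_simple j i
  have hneg : 0 ≤ S.cart i j := by
    have h1 := S.pairing_cast (S.grad i) (S.grad j)
    have h2 := mul_nonpos_of_nonneg_of_nonpos (zero_le_one.trans (S.one_le_nu (S.grad j)))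
      (S.inner_grad_nonpos h)
    rw [← h1] at h2
    have h3 : S.P.pairingIn ℤ (S.grad i) (S.grad j) ≤ 0 := by exact_mod_cast h2
    rw [cart]; omega
  have hn : ¬ (S.cart i j = 2 ∧ S.cart j i = 2) := by
    rintro ⟨h1, h2⟩
    rw [h1] at e1
    rw [h2] at e2
    exact RootAction.not_isOfFinOrder_of_two_two h e1 e2 hfin
  simp only [Set.mem_insert_iff, Set.mem_singleton_iff, Prod.mk.injEq] at hp
  simp only [cart] at *
  omega

end EuclideanRootSystem

end

noncomputable section

/-! ### Normalized Yang-Baxter factors and their unitarity. -/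

section YangBaxter

variable {K A : Type*} [CommRing K] [Ring A] [Algebra K A] {a b : A}
  {P Q c₁ c₂ c₃ c₄ c₅ c₆ u₁ u₂ u₃ u₄ u₅ u₆ : K}

/-- The factor `c (a - P u)` of the Yang-Baxter equation. -/
def rfac (c P u : K) (a : A) : A := c • (a - (P * u) • 1)

theorem rfac_two (h : a * b = b * a) :
    rfac c₁ P u₁ a * (rfac c₂ Q u₂ b * 1) = rfac c₂ Q u₂ b * (rfac c₁ P u₁ a * 1) := by
  simp only [rfac, mul_one, smul_mul_assoc, mul_smul_comm, smul_smul]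
  rw [yangBaxter_two h, mul_comm c₁]

theorem rfac_three (ha : a * a = 1 + P • a) (hb : b * b = 1 + P • b)
    (h : a * (b * a) = b * (a * b)) (hu : u₁ * u₃ = u₂ * (u₁ + u₃ - 1)) :
    rfac c₁ P u₁ a * (rfac c₂ P u₂ b * (rfac c₃ P u₃ a * 1)) =
      rfac c₃ P u₃ b * (rfac c₂ P u₂ a * (rfac c₁ P u₁ b * 1)) := by
  simp only [rfac, mul_one, smul_mul_assoc, mul_smul_comm, smul_smul]
  rw [yangBaxter_three ha hb h hu]
  congr 1
  ring

theorem rfac_four (ha : a * a = 1 + P • a) (hb : b * b = 1 + Q • b)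
    (h : a * (b * (a * b)) = b * (a * (b * a)))
    (hu : u₁ * u₂ + u₂ * u₃ + u₃ * u₄ - u₂ - u₃ - u₁ * u₄ = 0) :
    rfac c₁ P u₁ a * (rfac c₂ Q u₂ b * (rfac c₃ P u₃ a * (rfac c₄ Q u₄ b * 1))) =
      rfac c₄ Q u₄ b * (rfac c₃ P u₃ a * (rfac c₂ Q u₂ b * (rfac c₁ P u₁ a * 1))) := by
  simp only [rfac, mul_one, smul_mul_assoc, mul_smul_comm, smul_smul]
  rw [yangBaxter_four ha hb h hu]
  congr 1
  ring

theorem rfac_six (ha : a * a = 1 + P • a) (hb : b * b = 1 + Q • b)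
    (h : a * (b * (a * (b * (a * b)))) = b * (a * (b * (a * (b * a)))))
    (hu : u₁ * u₂ + u₂ * u₃ + u₃ * u₄ + u₄ * u₅ + u₅ * u₆ - u₂ - u₃ - u₄ - u₅ - u₁ * u₆ = 0)
    (hu₁ : u₁ * u₅ = u₃ * (u₁ + u₅ - 1)) (hu₂ : u₂ * u₆ = u₄ * (u₂ + u₆ - 1))
    (hu₃ : u₂ * u₄ + u₂ * u₅ + u₃ * u₅ - u₁ * u₂ * u₄ - u₁ * u₂ * u₅ + u₁ * u₃ * u₆ + u₁ * u₄ * u₆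
      - u₂ * u₃ * u₄ - u₂ * u₃ * u₅ - u₂ * u₄ * u₅ - u₂ * u₅ * u₆ - u₃ * u₄ * u₅ - u₃ * u₅ * u₆
      + u₁ * u₂ * u₃ * u₄ - u₁ * u₂ * u₃ * u₆ + u₁ * u₂ * u₄ * u₅ + u₁ * u₂ * u₅ * u₆
      - u₁ * u₃ * u₄ * u₆ - u₁ * u₄ * u₅ * u₆ + u₂ * u₃ * u₄ * u₅ + u₂ * u₃ * u₅ * u₆
      + u₃ * u₄ * u₅ * u₆ = 0) :
    rfac c₁ P u₁ a * (rfac c₂ Q u₂ b * (rfac c₃ P u₃ a * (rfac c₄ Q u₄ b * (rfac c₅ P u₅ a *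
      (rfac c₆ Q u₆ b * 1))))) =
    rfac c₆ Q u₆ b * (rfac c₅ P u₅ a * (rfac c₄ Q u₄ b * (rfac c₃ P u₃ a * (rfac c₂ Q u₂ b *
      (rfac c₁ P u₁ a * 1))))) := by
  simp only [rfac, mul_one, smul_mul_assoc, mul_smul_comm, smul_smul]
  rw [yangBaxter_six ha hb h hu hu₁ hu₂ hu₃]
  congr 1
  ring

/-- As soon as u₁ + u₂ = 1 the quadratic relation makes the product of the two factors scalar, and
`hc` normalizes the scalar to 1. -/
theorem rfac_mul_rfac (ha : a * a = 1 + P • a) (hu : u₁ + u₂ = 1)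
    (hc : c₁ * c₂ * (1 + P * P * (u₁ * u₂)) = 1) : rfac c₁ P u₁ a * rfac c₂ P u₂ a = 1 := by
  have h : (a - (P * u₁) • 1) * (a - (P * u₂) • 1) = (1 + P * P * (u₁ * u₂)) • 1 := by
    simp only [sub_mul, mul_sub, smul_mul_assoc, mul_smul_comm, one_mul, mul_one, ha]
    linear_combination (norm := module) (-P * hu) • a
  rw [rfac, rfac, smul_mul_assoc, mul_smul_comm, smul_smul, h, smul_smul, hc, one_smul]

end YangBaxter

namespace EuclideanRootSystem

variable {ι V : Type*} [Finite ι] [NormedAddCommGroup V] [InnerProductSpace ℝ V]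
variable {S : EuclideanRootSystem ι V}

/-! ### The functions `c_a` -/

instance : MulAction S.W S.R where
  smul w a := ⟨w • (a : S.Aff), S.act_mem_R w a.2⟩
  one_smul a := Subtype.ext (one_smul S.W (a : S.Aff))
  mul_smul u w a := Subtype.ext (mul_smul u w (a : S.Aff))

theorem coe_smul_R (w : S.W) (a : S.R) : ((w • a : S.R) : S.Aff) = w • (a : S.Aff) := rfl

theorem Mult.toFun_smul_R (κ : S.Mult) (w : S.W) (a : S.R) : κ.toFun (w • a) = κ.toFun a :=
  κ.inv' w a

theorem snd_ne_zero (a : S.R) : (a : S.Aff).2 ≠ 0 := by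
  obtain ⟨_, r, i, rfl⟩ := a
  exact S.cor_ne_zero i

/-- The gradient of an affine root is nonzero, so the constant coefficient survives. All
denominators are thus nonzero for every q and k, roots of unity included. -/
theorem QParam.sub_mul_e_ne_zero (q : S.QParam) {x y : ℂ} (hx : x ≠ 0) (a : S.R) :
    algebraMap ℂ S.CTK x - algebraMap ℂ S.CTK y * q.e a ≠ 0 := by
  rw [IsScalarTower.algebraMap_apply ℂ S.CT S.CTK, IsScalarTower.algebraMap_apply ℂ S.CT S.CTK,
    QParam.e, ← map_mul, ← map_sub, Ne, IsFractionRing.to_map_eq_zero_iff, sub_eq_zero]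
  intro h
  have h1 : algebraMap ℂ S.CT x = AddMonoidAlgebra.single 0 x := rfl
  have h2 : algebraMap ℂ S.CT y = AddMonoidAlgebra.single 0 y := rfl
  rw [h1, h2, QParam.mon, AddMonoidAlgebra.single_mul_single, zero_add] at h
  have h3 := DFunLike.congr_fun (congrArg AddMonoidAlgebra.coeff h) 0
  rw [AddMonoidAlgebra.coeff_single, AddMonoidAlgebra.coeff_single, Finsupp.single_eq_same,
    Finsupp.single_eq_of_ne (snd_ne_zero a).symm] at h3
  exact hx h3

theorem QParam.den1_ne_zero (q : S.QParam) (a : S.R) : q.den1 a ≠ 0 := by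
  have := q.sub_mul_e_ne_zero (y := 1) one_ne_zero a
  rwa [map_one, one_mul] at this

theorem QParam.den2_ne_zero (q : S.QParam) (κ : S.Mult) (a : S.R) : q.den2 κ a ≠ 0 :=
  q.sub_mul_e_ne_zero (Units.ne_zero _) a

/-- Powers of q are defined through a floor, which is additive here because one of the two exponents
is an integer after multiplication by `m`. -/
theorem QParam.e_add (q : S.QParam) {a : S.Aff} (ha : ∃ z : ℤ, a.1 = z) (b : S.Aff) :
    q.e (a + b) = q.e a * q.e b := by
  obtain ⟨z, hz⟩ := ha
  rw [QParam.e, QParam.e, QParam.e, ← map_mul, QParam.mon, QParam.mon, QParam.mon,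
    AddMonoidAlgebra.single_mul_single]
  congr 2
  rw [← Units.val_mul, QParam.pow, QParam.pow, QParam.pow, ← zpow_add]
  congr 2
  have h1 : (q.m : ℝ) * a.1 = ((q.m * z : ℤ) : ℝ) := by rw [hz]; push_cast; rfl
  change ⌊(q.m : ℝ) * (a.1 + b.1)⌋ = _
  rw [mul_add, h1, Int.floor_intCast_add, Int.floor_intCast]

theorem QParam.e_nsmul_add (q : S.QParam) {a : S.Aff} (ha : ∃ z : ℤ, a.1 = z) (b : S.Aff) (n : ℕ) :
    q.e (n • a + b) = q.e a ^ n * q.e b := by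
  induction n with
  | zero => simp
  | succ n ih => rw [succ_nsmul', add_assoc, q.e_add ha, ih, pow_succ', mul_assoc]

theorem exists_int_simple_fst (j : Option S.Idx) : ∃ z : ℤ, (S.simple j).1 = z := by
  cases j with
  | none => exact ⟨1, by simp [simple]⟩
  | some i => exact ⟨0, by simp [simple]⟩

theorem QParam.e_simple (q : S.QParam) (i j : Option S.Idx) (m n : ℕ) :
    q.e (m • S.simple i + n • S.simple j) = q.e (S.simple i) ^ m * q.e (S.simple j) ^ n := by
  rw [q.e_nsmul_add (exists_int_simple_fst i)]
  have h : q.e 0 = 1 := by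
    rw [QParam.e, QParam.mon, QParam.pow]
    simp [← AddMonoidAlgebra.one_def]
  have := q.e_nsmul_add (exists_int_simple_fst j) 0 n
  rw [add_zero, h, mul_one] at this
  rw [this]

variable (k : S.Mult) (q : S.QParam)

/-- The function `(1 - e_q^a)⁻¹`. -/
def ufun (a : S.R) : Csn k q := ⟨(q.den1 a)⁻¹, Algebra.subset_adjoin (Or.inl (Or.inr ⟨a, rfl⟩))⟩

theorem coe_smul_Csn (w : S.W) (f : Csn k q) : ((w • f : Csn k q) : S.CTK) = q.actK w f := rfl

theorem smul_ufun (w : S.W) (a : S.R) : w • ufun k q a = ufun k q (w • a) := by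
  apply Subtype.ext
  rw [coe_smul_Csn]
  change q.actK w (1 - q.e _)⁻¹ = (1 - q.e _)⁻¹
  rw [map_inv₀, map_sub, map_one, q.actK_e]
  rfl

theorem cfun_eq (z : ℂˣ) (a : S.R) : cfun k q z a =
    algebraMap ℂ _ (z : ℂ) - algebraMap ℂ _ ((z : ℂ) - (z⁻¹ : ℂˣ)) * ufun k q a := by
  apply Subtype.ext
  change _ * (q.den1 a)⁻¹ = algebraMap ℂ S.CTK z - algebraMap ℂ S.CTK _ * (q.den1 a)⁻¹
  have h := q.den1_ne_zero a
  rw [mul_inv_eq_iff_eq_mul₀ h, sub_mul, mul_assoc, inv_mul_cancel₀ h, QParam.den1, map_sub]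
  ring

/-- The functions `(κ_a⁻¹ - κ_a e_q^a)⁻¹` belong to `ℂ_{σ,∇}^{k,q}[T]`. -/
def Admissible (κ : S.Mult) : Prop := ∀ a : S.R, (q.den2 κ a)⁻¹ ∈ Csn k q

theorem admissible_self : Admissible k q k := fun a => Algebra.subset_adjoin (Or.inr ⟨a, rfl⟩)

/-- The element is the affine reflection in `a`. It shows that a multiplicity function takes the
same value at `a` and at `-a`. -/
theorem exists_smul_eq_neg (a : S.R) : ∃ w : S.W, w • (a : S.Aff) = -(a : S.Aff) := by
  obtain ⟨_, r, i, rfl⟩ := a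
  refine ⟨S.tau (-(r • S.cor i)) * S.incl (S.refl0 i), ?_⟩
  change _ • S.aroot r i = - S.aroot r i
  rw [mul_smul, incl_smul, tau_smul]
  have h : S.refl0 i • S.cor i = -S.cor i := S.refl0_smul_cor_self i
  refine Prod.ext ?_ h
  change S.nu i * r - ⟪((-(r • S.cor i) : S.Pv) : V), ((S.refl0 i • S.cor i : S.Pv) : V)⟫ =
    -(S.nu i * r)
  have hp := S.pr_cast (S.cor i) i
  rw [pr_cor_self] at hp
  rw [h, AddSubgroup.coe_neg, AddSubgroup.coe_neg, inner_neg_neg, AddSubgroup.coe_zsmul,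
    ← Int.cast_smul_eq_zsmul ℝ, real_inner_smul_left]
  nth_rw 2 [cor_eq]
  rw [inner_smul_right, ← hp]
  push_cast
  ring

theorem QParam.e_neg_mul_e (q : S.QParam) (a : S.R) : q.e (-(a : S.Aff)) * q.e a = 1 := by
  rw [QParam.e, QParam.e, ← map_mul, QParam.mon, QParam.mon, AddMonoidAlgebra.single_mul_single]
  obtain ⟨_, r, i, rfl⟩ := a
  obtain ⟨N, hN⟩ := S.exists_nat_nu i
  have e1 : (S.nu i * r : ℝ) = ((N * r : ℤ) : ℝ) := by rw [hN]; push_cast; rfl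
  have e2 : q.pow (-(S.nu i * r)) * q.pow (S.nu i * r) = 1 := by
    rw [QParam.pow, QParam.pow, e1, ← Int.cast_neg, ← Int.cast_natCast, ← Int.cast_mul,
      ← Int.cast_mul, Int.floor_intCast, Int.floor_intCast, ← zpow_add]
    simp
  have e3 : ((q.pow (-(S.nu i * r)) : ℂ) * (q.pow (S.nu i * r) : ℂ)) = 1 := by
    rw [← Units.val_mul, e2, Units.val_one]
  change algebraMap S.CT S.CTK (AddMonoidAlgebra.single (-S.cor i + S.cor i)
    ((q.pow (-(S.nu i * r)) : ℂ) * (q.pow (S.nu i * r) : ℂ))) = 1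
  rw [e3, neg_add_cancel, ← AddMonoidAlgebra.one_def, map_one]

/-- From k_a - k_a⁻¹ e^a = -e^a (k_a⁻¹ - k_a e^{-a}) and k_{-a} = k_a, the denominators for k⁻¹ are
already inverted in the ring built from k. The cocycle for k⁻¹, from which π is obtained, therefore
lives over the same functions. -/
theorem admissible_inv : Admissible k q k.inv := by
  intro a
  obtain ⟨w, hw⟩ := exists_smul_eq_neg a
  have hk : k.toFun (w • a) = k.toFun a := k.toFun_smul_R w a
  have he : q.e ((w • a : S.R) : S.Aff) * q.e a = 1 := by
    rw [coe_smul_R, hw, q.e_neg_mul_e]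
  have key : q.den2 k.inv a = -(q.e a) * q.den2 k (w • a) := by
    have h1 : ((k.inv.toFun a)⁻¹ : ℂˣ) = k.toFun a := inv_inv _
    have h2 : k.inv.toFun a = (k.toFun a)⁻¹ := rfl
    rw [QParam.den2, QParam.den2, h1, h2, hk]
    linear_combination (-algebraMap ℂ S.CTK (k.toFun a)) * he
  have h3 : (q.den2 k.inv a)⁻¹ = -(q.e ((w • a : S.R) : S.Aff)) * (q.den2 k (w • a))⁻¹ := by
    rw [key, mul_inv, inv_neg]
    congr 2
    exact inv_eq_of_mul_eq_one_left he
  rw [h3]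
  exact mul_mem (neg_mem (Algebra.subset_adjoin (Or.inl (Or.inl ⟨_, rfl⟩)))) (admissible_self k q _)

variable {k q}
variable {κ : S.Mult} (hκ : Admissible k q κ)

/-- The function `(c_a^{κ,q})⁻¹`. -/
def cinvA (a : S.R) : Csn k q :=
  ⟨q.den1 a * (q.den2 κ a)⁻¹,
    mul_mem (sub_mem (one_mem _) (Algebra.subset_adjoin (Or.inl (Or.inl ⟨_, rfl⟩)))) (hκ a)⟩

theorem smul_cinvA (w : S.W) (a : S.R) : w • cinvA hκ a = cinvA hκ (w • a) := by
  apply Subtype.ext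
  rw [coe_smul_Csn]
  change q.actK w (q.den1 a * (q.den2 κ a)⁻¹) = _
  simp only [QParam.den1, QParam.den2]
  rw [map_mul, map_inv₀, map_sub, map_sub, map_mul, q.actK_e, AlgEquiv.commutes, AlgEquiv.commutes,
    map_one, ← κ.toFun_smul_R w a]
  rfl

theorem cfun_mul_cinvA (a : S.R) : cfun k q (κ.toFun a) a * cinvA hκ a = 1 := by
  apply Subtype.ext
  change q.den2 κ a * (q.den1 a)⁻¹ * (q.den1 a * (q.den2 κ a)⁻¹) = 1
  rw [mul_assoc, inv_mul_cancel_left₀ (q.den1_ne_zero a), mul_inv_cancel₀ (q.den2_ne_zero κ a)]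

/-! ### The Yang-Baxter equation -/

/-- The element `(c_b)⁻¹ (T_j + c_b - κ_j)` of `ℂ_{σ,∇}[T] ⊗ H(κ)`. -/
def rmat (j : Option S.Idx) (b : S.R) : Csn k q ⊗[ℂ] Hecke κ :=
  rfac (cinvA hκ b) (algebraMap ℂ (Csn k q) (κ.p j)) (ufun k q b) ((1 : Csn k q) ⊗ₜ[ℂ] T κ j)

/-- The product of the `rmat` along an alternating product. -/
def chain : ℕ → Option S.Idx → Option S.Idx → S.W → Csn k q ⊗[ℂ] Hecke κ
  | 0, _, _, _ => 1
  | n + 1, i, j, w => rmat hκ i (w • simpleR i) * chain n j i (w * S.s i)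

theorem one_tmul_T_mul_self (j : Option S.Idx) :
    ((1 : Csn k q) ⊗ₜ[ℂ] T κ j) * ((1 : Csn k q) ⊗ₜ[ℂ] T κ j) =
      1 + algebraMap ℂ (Csn k q) (κ.p j) • ((1 : Csn k q) ⊗ₜ[ℂ] T κ j) := by
  rw [Algebra.TensorProduct.tmul_mul_tmul, T_mul_T, mul_one, TensorProduct.tmul_add,
    ← Algebra.TensorProduct.one_def, algebraMap_smul, TensorProduct.tmul_smul]

theorem chain_succ (n : ℕ) (i j : Option S.Idx) (w : S.W) :
    chain hκ (n + 1) i j w = rmat hκ i (w • simpleR i) * chain hκ n j i (w * S.s i) := rfl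

theorem chain_zero (i j : Option S.Idx) (w : S.W) : chain hκ 0 i j w = 1 := rfl

/-- Rank two: the action of a simple reflection in the coordinates given by two simple roots. -/
theorem s_smul_left {i j : Option S.Idx} {x : ℤ} (h : S.cart i j = x) (m n : ℤ) :
    S.s i • (m • S.simple i + n • S.simple j) = (n * x - m) • S.simple i + n • S.simple j := by
  have e1 := S.s_smul_simple i j
  have e0 := S.affAction.s_simple i
  have h1 : S.s i • S.simple j = S.simple j + S.cart i j • S.simple i := e1
  have h0 : S.s i • S.simple i = -S.simple i := e0
  rw [smul_add, RootAction.smul_zsmul', RootAction.smul_zsmul', h1, h0, h]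
  module

theorem s_smul_right {i j : Option S.Idx} {y : ℤ} (h : S.cart j i = y) (m n : ℤ) :
    S.s j • (m • S.simple i + n • S.simple j) = m • S.simple i + (m * y - n) • S.simple j := by
  rw [add_comm, s_smul_left h, add_comm]

theorem T_braid' {i j : Option S.Idx} (hij : i ≠ j) {m : ℕ} (hm : 0 < m)
    (ho : orderOf (S.s i * S.s j) = m) : altProd m (T κ i) (T κ j) = altProd m (T κ j) (T κ i) := by
  have hb := T_braid κ hij (by rw [← orderOf_pos_iff, ho]; exact hm)
  rwa [ho] at hb

theorem chain_two {i j : Option S.Idx} (hij : i ≠ j) (h1 : S.cart i j = 0) (h2 : S.cart j i = 0) :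
    orderOf (S.s i * S.s j) = 2 ∧ chain hκ 2 i j 1 = chain hκ 2 j i 1 := by
  have e1 := S.s_smul_simple i j
  have e2 := S.s_smul_simple j i
  rw [h1] at e1
  rw [h2] at e2
  have ho : orderOf (S.s i * S.s j) = 2 :=
    RootAction.orderOf_of_zero_zero (Φ := S.affAction) hij e1 e2
  refine ⟨ho, ?_⟩
  have hb := T_braid' (κ := κ) hij two_pos ho
  simp only [altProd, mul_one] at hb
  rw [zero_smul, add_zero] at e1 e2
  have r1 : S.s i • simpleR j = simpleR j := Subtype.ext e1
  have r2 : S.s j • simpleR i = simpleR i := Subtype.ext e2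
  simp only [chain_succ, chain_zero, one_mul, one_smul, r1, r2]
  refine rfac_two ?_
  simp only [Algebra.TensorProduct.tmul_mul_tmul, hb]

/-- The two words run through the positive roots spanned by the two simple roots in opposite orders;
this is what the identities r1, r2 and r3 record. The equation is then `rfac_three` with u_a = (1 -
e^a)⁻¹. The two parameters agree because the two simple roots are conjugate. -/
theorem chain_three {i j : Option S.Idx} (hij : i ≠ j) (h1 : S.cart i j = 1) (h2 : S.cart j i = 1) :
    orderOf (S.s i * S.s j) = 3 ∧ chain hκ 3 i j 1 = chain hκ 3 j i 1 := by
  have e1 := S.s_smul_simple i j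
  have e2 := S.s_smul_simple j i
  rw [h1] at e1
  rw [h2] at e2
  have ho : orderOf (S.s i * S.s j) = 3 :=
    RootAction.orderOf_of_one_one (Φ := S.affAction) hij e1 e2
  refine ⟨ho, ?_⟩
  have hb := T_braid' (κ := κ) hij three_pos ho
  simp only [altProd, mul_one] at hb
  have hi : S.simple i = (1 : ℤ) • S.simple i + (0 : ℤ) • S.simple j := by module
  have hj : S.simple j = (0 : ℤ) • S.simple i + (1 : ℤ) • S.simple j := by module
  have r2 : (S.s i * S.s j) • simpleR i = simpleR j := Subtype.ext (by
    change (S.s i * S.s j) • S.simple i = S.simple j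
    rw [mul_smul, hi, s_smul_right h2, s_smul_left h1]; norm_num)
  have r3 : (S.s j * S.s i) • simpleR j = simpleR i := Subtype.ext (by
    change (S.s j * S.s i) • S.simple j = S.simple i
    rw [mul_smul, hj, s_smul_left h1, s_smul_right h2]; norm_num)
  have c1 : S.s i • S.simple j = 1 • S.simple i + 1 • S.simple j := by
    rw [hj, s_smul_left h1]; module
  have r1 : S.s j • simpleR i = S.s i • simpleR j := Subtype.ext (by
    change S.s j • S.simple i = S.s i • S.simple j
    rw [c1, hi, s_smul_right h2]; module)
  have hp : κ.p j = κ.p i := (κ.p_eq (S.s i * S.s j) i j (congrArg Subtype.val r2)).symm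
  simp only [chain_succ, chain_zero, one_mul, one_smul, r1, r2, r3, rmat, hp]
  refine rfac_three (one_tmul_T_mul_self i) (hp ▸ one_tmul_T_mul_self j) ?_ ?_
  · simp only [Algebra.TensorProduct.tmul_mul_tmul, hb]
  · have he := q.e_simple i j 1 1
    rw [← c1, pow_one, pow_one] at he
    have d1 := q.den1_ne_zero (simpleR i)
    have d2 := q.den1_ne_zero (S.s i • simpleR j)
    have d3 := q.den1_ne_zero (simpleR j)
    apply Subtype.ext
    change (q.den1 _)⁻¹ * (q.den1 _)⁻¹ = (q.den1 _)⁻¹ * ((q.den1 _)⁻¹ + (q.den1 _)⁻¹ - 1)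
    simp only [QParam.den1, coe_smul_R] at d1 d2 d3 ⊢
    change (1 - q.e (S.s i • S.simple j)) ≠ 0 at d2
    change _ = (1 - q.e (S.s i • S.simple j))⁻¹ * _
    rw [he] at d2 ⊢
    exact inv_one_sub_mul_inv_one_sub d1 d3 d2

end EuclideanRootSystem

end

/-! ### The Yang-Baxter equation for double and triple bonds. -/

noncomputable section

section RationalIdentities

variable {F : Type*} [Field F] {x y u₁ u₂ u₃ u₄ u₅ u₆ : F}

theorem rational_identity_four (h1 : 1 - x ≠ 0) (h2 : 1 - x * y ≠ 0) (h3 : 1 - x * y ^ 2 ≠ 0)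
    (h4 : 1 - y ≠ 0) (e1 : u₁ = (1 - x)⁻¹) (e2 : u₂ = (1 - x * y)⁻¹) (e3 : u₃ = (1 - x * y ^ 2)⁻¹)
    (e4 : u₄ = (1 - y)⁻¹) : u₁ * u₂ + u₂ * u₃ + u₃ * u₄ - u₂ - u₃ - u₁ * u₄ = 0 := by
  subst e1 e2 e3 e4
  field_simp
  ring

theorem rational_identity_six_quadratic (h1 : 1 - x ≠ 0) (h2 : 1 - x * y ≠ 0)
    (h3 : 1 - x ^ 2 * y ^ 3 ≠ 0) (h4 : 1 - x * y ^ 2 ≠ 0) (h5 : 1 - x * y ^ 3 ≠ 0) (h6 : 1 - y ≠ 0)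
    (e1 : u₁ = (1 - x)⁻¹) (e2 : u₂ = (1 - x * y)⁻¹) (e3 : u₃ = (1 - x ^ 2 * y ^ 3)⁻¹)
    (e4 : u₄ = (1 - x * y ^ 2)⁻¹) (e5 : u₅ = (1 - x * y ^ 3)⁻¹) (e6 : u₆ = (1 - y)⁻¹) :
    u₁ * u₂ + u₂ * u₃ + u₃ * u₄ + u₄ * u₅ + u₅ * u₆ - u₂ - u₃ - u₄ - u₅ - u₁ * u₆ = 0 := by
  subst e1 e2 e3 e4 e5 e6
  field_simp
  ring

end RationalIdentities

namespace EuclideanRootSystem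

variable {ι V : Type*} [Finite ι] [NormedAddCommGroup V] [InnerProductSpace ℝ V]
variable {S : EuclideanRootSystem ι V} {k : S.Mult} {q : S.QParam} {κ : S.Mult}

/-- Turns the functions attached to a rank-two subsystem into explicit rational functions of the two
monomials e^{a_i} and e^{a_j}, to which the rational identities apply. -/
theorem coe_ufun {b : S.R} {i j : Option S.Idx} {m n : ℕ}
    (h : (b : S.Aff) = (m : ℤ) • S.simple i + (n : ℤ) • S.simple j) :
    (ufun k q b : S.CTK) = (1 - q.e (S.simple i) ^ m * q.e (S.simple j) ^ n)⁻¹ ∧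
      1 - q.e (S.simple i) ^ m * q.e (S.simple j) ^ n ≠ 0 := by
  have h1 := q.den1_ne_zero b
  have h2 := q.e_simple i j m n
  rw [natCast_zsmul, natCast_zsmul] at h
  rw [← h2, ← h]
  exact ⟨rfl, h1⟩

variable (hκ : Admissible k q κ)

theorem chain_four {i j : Option S.Idx} (hij : i ≠ j) (h1 : S.cart i j = 1) (h2 : S.cart j i = 2) :
    orderOf (S.s i * S.s j) = 4 ∧ chain hκ 4 i j 1 = chain hκ 4 j i 1 := by
  have e1 := S.s_smul_simple i j
  have e2 := S.s_smul_simple j i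
  rw [h1] at e1
  rw [h2] at e2
  have ho : orderOf (S.s i * S.s j) = 4 :=
    RootAction.orderOf_of_one_two (Φ := S.affAction) hij e1 e2
  refine ⟨ho, ?_⟩
  have hb := T_braid' (κ := κ) hij four_pos ho
  simp only [altProd, mul_one] at hb
  have hi : ((simpleR i : S.R) : S.Aff) = (1 : ℤ) • S.simple i + (0 : ℤ) • S.simple j := by
    change S.simple i = _; module
  have hj : ((simpleR j : S.R) : S.Aff) = (0 : ℤ) • S.simple i + (1 : ℤ) • S.simple j := by
    change S.simple j = _; module
  have b2 : ((S.s i • simpleR j : S.R) : S.Aff) = (1 : ℤ) • S.simple i + (1 : ℤ) • S.simple j := by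
    rw [coe_smul_R, hj, s_smul_left h1]; norm_num
  have b3 : (((S.s i * S.s j) • simpleR i : S.R) : S.Aff) =
      (1 : ℤ) • S.simple i + (2 : ℤ) • S.simple j := by
    rw [coe_smul_R, mul_smul, hi, s_smul_right h2, s_smul_left h1]; norm_num
  have r4 : (S.s i * S.s j * S.s i) • simpleR j = simpleR j := Subtype.ext (by
    rw [coe_smul_R, mul_smul, mul_smul, ← coe_smul_R, b2, s_smul_right h2, s_smul_left h1, hj]
    norm_num)
  have r5 : S.s j • simpleR i = (S.s i * S.s j) • simpleR i := Subtype.ext (by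
    rw [b3, coe_smul_R, hi, s_smul_right h2]; norm_num)
  have r6 : (S.s j * S.s i) • simpleR j = S.s i • simpleR j := Subtype.ext (by
    rw [b2, coe_smul_R, mul_smul, ← coe_smul_R, b2, s_smul_right h2]; norm_num)
  have r7 : (S.s j * S.s i * S.s j) • simpleR i = simpleR i := Subtype.ext (by
    rw [mul_assoc, mul_smul, coe_smul_R, b3, s_smul_right h2, hi]; norm_num)
  simp only [chain_succ, chain_zero, one_mul, one_smul, r4, r5, r6, r7]
  obtain ⟨f1, g1⟩ := coe_ufun (k := k) (q := q) (m := 1) (n := 0) hi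
  obtain ⟨f2, g2⟩ := coe_ufun (k := k) (q := q) (m := 1) (n := 1) b2
  obtain ⟨f3, g3⟩ := coe_ufun (k := k) (q := q) (m := 1) (n := 2) b3
  obtain ⟨f4, g4⟩ := coe_ufun (k := k) (q := q) (m := 0) (n := 1) hj
  simp only [pow_one, pow_zero, one_mul, mul_one] at f1 f2 f3 f4 g1 g2 g3 g4
  refine rfac_four (one_tmul_T_mul_self i) (one_tmul_T_mul_self j) ?_ ?_
  · simp only [Algebra.TensorProduct.tmul_mul_tmul, hb]
  · exact Subtype.ext (rational_identity_four g1 g2 g3 g4 f1 f2 f3 f4)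

theorem chain_six {i j : Option S.Idx} (hij : i ≠ j) (h1 : S.cart i j = 1) (h2 : S.cart j i = 3) :
    orderOf (S.s i * S.s j) = 6 ∧ chain hκ 6 i j 1 = chain hκ 6 j i 1 := by
  have e1 := S.s_smul_simple i j
  have e2 := S.s_smul_simple j i
  rw [h1] at e1
  rw [h2] at e2
  have ho : orderOf (S.s i * S.s j) = 6 :=
    RootAction.orderOf_of_one_three (Φ := S.affAction) hij e1 e2
  refine ⟨ho, ?_⟩
  have hb := T_braid' (κ := κ) hij (by norm_num) ho
  simp only [altProd, mul_one] at hb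
  have hi : ((simpleR i : S.R) : S.Aff) = (1 : ℤ) • S.simple i + (0 : ℤ) • S.simple j := by
    change S.simple i = _; module
  have hj : ((simpleR j : S.R) : S.Aff) = (0 : ℤ) • S.simple i + (1 : ℤ) • S.simple j := by
    change S.simple j = _; module
  have b2 : ((S.s i • simpleR j : S.R) : S.Aff) = (1 : ℤ) • S.simple i + (1 : ℤ) • S.simple j := by
    rw [coe_smul_R, hj, s_smul_left h1]; norm_num
  have b3 : (((S.s i * S.s j) • simpleR i : S.R) : S.Aff) =
      (2 : ℤ) • S.simple i + (3 : ℤ) • S.simple j := by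
    rw [coe_smul_R, mul_smul, hi, s_smul_right h2, s_smul_left h1]; norm_num
  have b4 : (((S.s i * S.s j * S.s i) • simpleR j : S.R) : S.Aff) =
      (1 : ℤ) • S.simple i + (2 : ℤ) • S.simple j := by
    rw [coe_smul_R, mul_smul, mul_smul, ← coe_smul_R, b2, s_smul_right h2, s_smul_left h1]
    norm_num
  have b5 : (((S.s i * S.s j * S.s i * S.s j) • simpleR i : S.R) : S.Aff) =
      (1 : ℤ) • S.simple i + (3 : ℤ) • S.simple j := by
    rw [coe_smul_R, mul_assoc, mul_smul, mul_smul, ← coe_smul_R, b3, s_smul_right h2,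
      s_smul_left h1]
    norm_num
  have r6 : (S.s i * S.s j * S.s i * S.s j * S.s i) • simpleR j = simpleR j := Subtype.ext (by
    rw [coe_smul_R, mul_assoc, mul_assoc, ← mul_assoc (S.s i), mul_smul, mul_smul,
      ← coe_smul_R, b4, s_smul_right h2, s_smul_left h1, hj]
    norm_num)
  have r7 : S.s j • simpleR i = (S.s i * S.s j * S.s i * S.s j) • simpleR i := Subtype.ext (by
    rw [b5, coe_smul_R, hi, s_smul_right h2]; norm_num)
  have r8 : (S.s j * S.s i) • simpleR j = (S.s i * S.s j * S.s i) • simpleR j := Subtype.ext (by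
    rw [b4, coe_smul_R, mul_smul, ← coe_smul_R, b2, s_smul_right h2]; norm_num)
  have r9 : (S.s j * S.s i * S.s j) • simpleR i = (S.s i * S.s j) • simpleR i := Subtype.ext (by
    rw [b3, mul_assoc, mul_smul, coe_smul_R, b3, s_smul_right h2]; norm_num)
  have r10 : (S.s j * S.s i * S.s j * S.s i) • simpleR j = S.s i • simpleR j := Subtype.ext (by
    rw [b2, mul_assoc, mul_assoc, ← mul_assoc (S.s i), mul_smul, coe_smul_R, b4,
      s_smul_right h2]
    norm_num)
  have r11 : (S.s j * S.s i * S.s j * S.s i * S.s j) • simpleR i = simpleR i := Subtype.ext (by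
    rw [mul_assoc, mul_assoc, mul_assoc, ← mul_assoc (S.s i), mul_smul,
      coe_smul_R, ← mul_assoc, b5, s_smul_right h2, hi]
    norm_num)
  simp only [chain_succ, chain_zero, one_mul, one_smul, r6, r7, r8, r9, r10, r11]
  obtain ⟨f1, g1⟩ := coe_ufun (k := k) (q := q) (m := 1) (n := 0) hi
  obtain ⟨f2, g2⟩ := coe_ufun (k := k) (q := q) (m := 1) (n := 1) b2
  obtain ⟨f3, g3⟩ := coe_ufun (k := k) (q := q) (m := 2) (n := 3) b3
  obtain ⟨f4, g4⟩ := coe_ufun (k := k) (q := q) (m := 1) (n := 2) b4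
  obtain ⟨f5, g5⟩ := coe_ufun (k := k) (q := q) (m := 1) (n := 3) b5
  obtain ⟨f6, g6⟩ := coe_ufun (k := k) (q := q) (m := 0) (n := 1) hj
  simp only [pow_one, pow_zero, one_mul, mul_one] at f1 f2 f3 f4 f5 f6 g1 g2 g3 g4 g5 g6
  refine rfac_six (one_tmul_T_mul_self i) (one_tmul_T_mul_self j) ?_ ?_ ?_ ?_ ?_
  · simp only [Algebra.TensorProduct.tmul_mul_tmul, hb]
  · exact Subtype.ext (rational_identity_six_quadratic g1 g2 g3 g4 g5 g6 f1 f2 f3 f4 f5 f6)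
  · apply Subtype.ext
    have e : q.e (S.simple i) ^ 2 * q.e (S.simple j) ^ 3 =
      q.e (S.simple i) * (q.e (S.simple i) * q.e (S.simple j) ^ 3) := by ring
    have := inv_one_sub_mul_inv_one_sub g1 g5 (by rw [← e]; exact g3)
    rw [← e, ← f1, ← f3, ← f5] at this
    exact this
  · apply Subtype.ext
    have e : q.e (S.simple i) * q.e (S.simple j) ^ 2 =
      q.e (S.simple i) * q.e (S.simple j) * q.e (S.simple j) := by ring
    have := inv_one_sub_mul_inv_one_sub g2 g6 (by rw [← e]; exact g4)
    rw [← e, ← f2, ← f4, ← f6] at this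
    exact this
  · exact Subtype.ext (rational_identity_six g1 g2 g3 g4 g5 g6 f1 f2 f3 f4 f5 f6)

theorem chain_orderOf {i j : Option S.Idx} (hij : i ≠ j) (h : IsOfFinOrder (S.s i * S.s j)) :
    chain hκ (orderOf (S.s i * S.s j)) i j 1 = chain hκ (orderOf (S.s i * S.s j)) j i 1 := by
  have ho : orderOf (S.s j * S.s i) = orderOf (S.s i * S.s j) :=
    RootAction.orderOf_s_comm (Φ := S.affAction) i j
  rcases S.cart_cases hij h with h | h | h | h | h | h
  · have := chain_two hκ hij h.1 h.2
    rw [this.1]; exact this.2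
  · have := chain_three hκ hij h.1 h.2
    rw [this.1]; exact this.2
  · have := chain_four hκ hij h.1 h.2
    rw [this.1]; exact this.2
  · have := chain_four hκ hij.symm h.2 h.1
    rw [← ho, this.1]; exact this.2.symm
  · have := chain_six hκ hij h.1 h.2
    rw [this.1]; exact this.2
  · have := chain_six hκ hij.symm h.2 h.1
    rw [← ho, this.1]; exact this.2.symm

end EuclideanRootSystem

end

noncomputable section

set_option linter.unusedSectionVars false

open EuclideanRootSystem

/-! ### Crossed products -/

/-- An algebra `D` that contains the algebra `C` and the group `G` with the relations of the
crossed product, and that acts on `C`. -/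
structure Crossed (C D G : Type*) [CommRing C] [Algebra ℂ C] [Ring D] [Algebra ℂ D] [Group G]
    [MulSemiringAction G C] where
  fn : C →ₐ[ℂ] D
  gp : G →* D
  comm : ∀ w f, gp w * fn f = fn (w • f) * gp w
  act : D →ₐ[ℂ] Module.End ℂ C
  act_fn : ∀ f g, act (fn f) g = f * g
  act_gp : ∀ w g, act (gp w) g = w • g

namespace Crossed

variable {C D H G B E : Type*} [CommRing C] [Algebra ℂ C] [Ring D] [Algebra ℂ D] [Ring H]
  [Algebra ℂ H] [Group G] [MulSemiringAction G C] [SMulCommClass G ℂ C] [AddCommGroup E]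
  [DistribMulAction G E]

variable (C H) in
/-- The action of `w` on the first factor of `C ⊗ H`. -/
def actB (w : G) : C ⊗[ℂ] H →ₐ[ℂ] C ⊗[ℂ] H :=
  Algebra.TensorProduct.map (MulSemiringAction.toAlgHom ℂ C w) (AlgHom.id ℂ H)

theorem actB_tmul (w : G) (f : C) (h : H) : actB C H w (f ⊗ₜ h) = (w • f) ⊗ₜ h := rfl

/-- The product of translates along an alternating product. -/
def chain (s : B → G) (A : B → C ⊗[ℂ] H) : ℕ → B → B → G → C ⊗[ℂ] H
  | 0, _, _, _ => 1
  | n + 1, i, j, w => actB C H w (A i) * chain s A n j i (w * s i)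

variable (X : Crossed C D G)

variable (H) in
/-- The embedding of `C ⊗ H` into `D ⊗ H`. -/
def emb : C ⊗[ℂ] H →ₐ[ℂ] D ⊗[ℂ] H := Algebra.TensorProduct.map X.fn (AlgHom.id ℂ H)

theorem emb_tmul (f : C) (h : H) : X.emb H (f ⊗ₜ h) = X.fn f ⊗ₜ h := rfl

variable (H) in
/-- The element `w ⊗ 1`. -/
def gT (w : G) : D ⊗[ℂ] H := X.gp w ⊗ₜ 1

theorem gT_mul_gT (u w : G) : X.gT H u * X.gT H w = X.gT H (u * w) := by
  rw [gT, gT, gT, Algebra.TensorProduct.tmul_mul_tmul, ← map_mul, mul_one]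

theorem gT_one : X.gT H 1 = 1 := by rw [gT, map_one]; rfl

theorem gT_mul_emb (w : G) (z : C ⊗[ℂ] H) :
    X.gT H w * X.emb H z = X.emb H (actB C H w z) * X.gT H w := by
  induction z using TensorProduct.induction_on with
  | zero => simp only [map_zero, mul_zero, zero_mul]
  | tmul f h =>
    rw [emb_tmul, actB_tmul, emb_tmul, gT, Algebra.TensorProduct.tmul_mul_tmul,
      Algebra.TensorProduct.tmul_mul_tmul, X.comm, one_mul, mul_one]
  | add x y hx hy => simp only [map_add, mul_add, add_mul, hx, hy]

/-- Group elements are moved to the right, acting on coefficients as they pass. A braid relation in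
D ⊗ H thereby splits into one in the group and one between the coefficient products `chain`. -/
theorem gT_mul_altProd (s : B → G) (A : B → C ⊗[ℂ] H) (n : ℕ) (i j : B) (w : G) :
    X.gT H w * altProd n (X.emb H (A i) * X.gT H (s i)) (X.emb H (A j) * X.gT H (s j)) =
      X.emb H (chain s A n i j w) * X.gT H (w * altProd n (s i) (s j)) := by
  induction n generalizing i j w with
  | zero => simp only [altProd, chain, map_one, mul_one, one_mul]
  | succ n ih =>
    rw [altProd_succ, altProd_succ, chain, ← mul_assoc, ← mul_assoc, gT_mul_emb,
      mul_assoc _ (X.gT H w), gT_mul_gT, mul_assoc, ih, map_mul, mul_assoc, mul_assoc]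

/-- A one-cocycle, given on simple reflections and on elements of length zero. -/
structure Cocycle (C H : Type*) [CommRing C] [Algebra ℂ C] [Ring H] [Algebra ℂ H]
    [MulSemiringAction G C] [SMulCommClass G ℂ C] (Φ : RootAction G B E) where
  A : B → C ⊗[ℂ] H
  Z : G → H
  braid : ∀ i j, i ≠ j → IsOfFinOrder (Φ.s i * Φ.s j) →
    chain Φ.s A (orderOf (Φ.s i * Φ.s j)) i j 1 = chain Φ.s A (orderOf (Φ.s i * Φ.s j)) j i 1
  unitary : ∀ j, A j * actB C H (Φ.s j) (A j) = 1
  Z_one : Z 1 = 1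
  Z_mul : ∀ g h, Φ.len g = 0 → Φ.len h = 0 → Z (g * h) = Z g * Z h
  Z_A : ∀ g i j, Φ.len g = 0 → g • Φ.simple i = Φ.simple j →
    (1 ⊗ₜ Z g) * actB C H g (A i) = A j * (1 ⊗ₜ Z g)

variable {Φ : RootAction G B E} (K : Cocycle C H Φ)

/-- The braid data defined by a cocycle. -/
def data : Φ.BraidData (D ⊗[ℂ] H) where
  X j := X.emb H (K.A j) * X.gT H (Φ.s j)
  Z g := X.emb H (1 ⊗ₜ K.Z g) * X.gT H g
  braid i j hij h := by
    have h1 := X.gT_mul_altProd Φ.s K.A (orderOf (Φ.s i * Φ.s j)) i j 1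
    have h2 := X.gT_mul_altProd Φ.s K.A (orderOf (Φ.s i * Φ.s j)) j i 1
    rw [gT_one, one_mul, one_mul] at h1 h2
    rw [h1, h2, K.braid i j hij h, (altProd_eq_iff (Φ.s_mul_s i) (Φ.s_mul_s j) _).mpr
      (pow_orderOf_eq_one _)]
  Z_one := by rw [K.Z_one, gT_one, mul_one, ← Algebra.TensorProduct.one_def, map_one]
  Z_mul g h hg hh := by
    rw [mul_assoc, ← mul_assoc (X.gT H g), gT_mul_emb, actB_tmul, smul_one, mul_assoc, gT_mul_gT,
      ← mul_assoc, ← map_mul, Algebra.TensorProduct.tmul_mul_tmul, one_mul, K.Z_mul g h hg hh]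
  Z_X g i j hg h := by
    rw [mul_assoc, ← mul_assoc (X.gT H g), gT_mul_emb, mul_assoc, gT_mul_gT, ← mul_assoc, ← map_mul,
      K.Z_A g i j hg h, Φ.conj g i j h, mul_assoc, ← mul_assoc (X.gT H _), gT_mul_emb, actB_tmul,
      smul_one, mul_assoc, gT_mul_gT, map_mul, mul_assoc]

/-- The homomorphism from the group defined by a cocycle. -/
def hom : G →* D ⊗[ℂ] H :=
  (X.data K).liftHom fun j => by
    change X.emb H (K.A j) * X.gT H (Φ.s j) * (X.emb H (K.A j) * X.gT H (Φ.s j)) = 1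
    rw [mul_assoc, ← mul_assoc (X.gT H _), gT_mul_emb, mul_assoc, gT_mul_gT, Φ.s_mul_s, gT_one,
      mul_one, ← map_mul, K.unitary, map_one]

theorem hom_s (j : B) : X.hom K (Φ.s j) = X.emb H (K.A j) * X.gT H (Φ.s j) :=
  (X.data K).lift_s j

theorem hom_zero {g : G} (hg : Φ.len g = 0) : X.hom K g = X.gp g ⊗ₜ K.Z g := by
  refine ((X.data K).lift_of_len_eq_zero hg).trans ?_
  change X.emb H (1 ⊗ₜ K.Z g) * X.gT H g = _
  rw [emb_tmul, gT, Algebra.TensorProduct.tmul_mul_tmul, map_one, one_mul, mul_one]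

theorem hom_comm (w : G) (f : C) :
    (X.fn (w • f) ⊗ₜ 1 : D ⊗[ℂ] H) * X.hom K w = X.hom K w * (X.fn f ⊗ₜ 1) := by
  induction w using Φ.induction_left generalizing f with
  | h0 g hg =>
    rw [hom_zero _ _ hg, Algebra.TensorProduct.tmul_mul_tmul, Algebra.TensorProduct.tmul_mul_tmul,
      X.comm, one_mul, mul_one]
  | hs j g _ ih =>
    have h1 : (X.fn (Φ.s j • g • f) ⊗ₜ 1 : D ⊗[ℂ] H) * X.hom K (Φ.s j) =
        X.hom K (Φ.s j) * (X.fn (g • f) ⊗ₜ 1) := by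
      have e1 : ∀ f, (X.fn f ⊗ₜ 1 : D ⊗[ℂ] H) = X.emb H (f ⊗ₜ 1) := fun f => rfl
      rw [hom_s, e1, e1, mul_assoc, gT_mul_emb, actB_tmul, ← mul_assoc, ← mul_assoc, ← map_mul,
        ← map_mul]
      congr 2
      -- The subalgebra C ⊗ 1 is central in C ⊗ H because C is commutative.
      exact Algebra.commutes (R := C) (A := C ⊗[ℂ] H) _ _
    rw [map_mul, mul_smul, ← mul_assoc, h1, mul_assoc, ih, mul_assoc]

variable (H) in
/-- The action of `D ⊗ H` on `C ⊗ H`. -/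
def actT : D ⊗[ℂ] H →ₐ[ℂ] Module.End ℂ (C ⊗[ℂ] H) :=
  (Module.endTensorEndAlgHom (R := ℂ) (S := ℂ) (A := ℂ) (M := C) (N := H)).comp
    (Algebra.TensorProduct.map X.act (Algebra.lmul ℂ H))

theorem actT_tmul (d : D) (h : H) (f : C) (h' : H) :
    X.actT H (d ⊗ₜ h) (f ⊗ₜ h') = X.act d f ⊗ₜ (h * h') := rfl

theorem actT_emb (z y : C ⊗[ℂ] H) : X.actT H (X.emb H z) y = z * y := by
  induction z using TensorProduct.induction_on with
  | zero => simp only [map_zero, zero_mul, LinearMap.zero_apply]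
  | tmul f h =>
    induction y using TensorProduct.induction_on with
    | zero => simp only [map_zero, mul_zero]
    | tmul f' h' => rw [emb_tmul, actT_tmul, X.act_fn, Algebra.TensorProduct.tmul_mul_tmul]
    | add x y hx hy => simp only [map_add, mul_add, hx, hy]
  | add x y hx hy => simp only [map_add, add_mul, LinearMap.add_apply, hx, hy]

theorem actT_gT (w : G) (y : C ⊗[ℂ] H) : X.actT H (X.gT H w) y = actB C H w y := by
  induction y using TensorProduct.induction_on with
  | zero => simp only [map_zero]
  | tmul f' h' => rw [gT, actT_tmul, X.act_gp, actB_tmul, one_mul]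
  | add x y hx hy => simp only [map_add, hx, hy]

/-- The values of the cocycle. -/
def coc (w : G) : C ⊗[ℂ] H := X.actT H (X.hom K w) 1

theorem coc_s_mul (j : B) (w : G) :
    X.coc K (Φ.s j * w) = K.A j * actB C H (Φ.s j) (X.coc K w) := by
  rw [coc, map_mul, map_mul, hom_s, map_mul, Module.End.mul_apply, Module.End.mul_apply, actT_emb,
    actT_gT]
  rfl

theorem coc_zero {g : G} (hg : Φ.len g = 0) : X.coc K g = 1 ⊗ₜ K.Z g := by
  rw [coc, hom_zero _ _ hg, Algebra.TensorProduct.one_def, actT_tmul, X.act_gp, smul_one, mul_one]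

section Triangular

variable [IsDomain C] {b : Module.Basis G ℂ H} {T : B → H} {c : B → G → ℂ} {ci d : B → C}

theorem coord_actB (w y : G) (z : C ⊗[ℂ] H) :
    (b.baseChange C).coord y (actB C H w z) = w • (b.baseChange C).coord y z := by
  induction z using TensorProduct.induction_on with
  | zero => simp only [map_zero, smul_zero]
  | tmul f h =>
    rw [actB_tmul, Module.Basis.coord_apply, Module.Basis.coord_apply,
      Module.Basis.baseChange_repr_tmul, Module.Basis.baseChange_repr_tmul]
    exact (smul_comm w _ f).symm
  | add x y hx hy => simp only [map_add, smul_add, hx, hy]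

theorem coord_T_mul (hT : ∀ j y, T j * b y = b (Φ.s j * y) + c j y • b y) (j : B) (y : G)
    (z : C ⊗[ℂ] H) :
    (b.baseChange C).coord y (((1 : C) ⊗ₜ T j) * z) = (b.baseChange C).coord (Φ.s j * y) z +
      algebraMap ℂ C (c j y) * (b.baseChange C).coord y z := by
  classical
  have key : (b.baseChange C).coord y ∘ₗ LinearMap.mulLeft C ((1 : C) ⊗ₜ[ℂ] T j) =
      (b.baseChange C).coord (Φ.s j * y) + algebraMap ℂ C (c j y) • (b.baseChange C).coord y := by
    refine (b.baseChange C).ext fun x => ?_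
    simp only [LinearMap.comp_apply, LinearMap.mulLeft_apply, LinearMap.add_apply,
      LinearMap.smul_apply, Module.Basis.baseChange_apply, Algebra.TensorProduct.tmul_mul_tmul,
      mul_one, hT, TensorProduct.tmul_add, map_add, Module.Basis.coord_apply,
      Module.Basis.baseChange_repr_tmul, map_smul, Module.Basis.repr_self,
      Finsupp.smul_apply, Finsupp.single_apply]
    have e1 : (Φ.s j * x = y) ↔ (x = Φ.s j * y) := by
      constructor
      · rintro rfl; rw [Φ.s_mul_s_mul]
      · rintro rfl; rw [Φ.s_mul_s_mul]
    by_cases hxy : x = y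
    · subst hxy
      simp [e1, Algebra.smul_def]
    · simp [e1, hxy]
  exact LinearMap.congr_fun key z

/-- Triangularity: each ascent multiplies on the left by a term with nonzero coefficient `ci j` at
`T j`, which moves the leading term from `g` to `s j * g`; every other term sits at an element of
smaller length. -/
theorem coord_coc (hT : ∀ j y, T j * b y = b (Φ.s j * y) + c j y • b y)
    (hZ : ∀ g, Φ.len g = 0 → K.Z g = b g)
    (hA : ∀ j, K.A j = ci j ⊗ₜ T j + d j ⊗ₜ 1) (hci : ∀ j, ci j ≠ 0) (w : G) :
    (b.baseChange C).coord w (X.coc K w) ≠ 0 ∧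
      ∀ y, y ≠ w → Φ.len w ≤ Φ.len y → (b.baseChange C).coord y (X.coc K w) = 0 := by
  classical
  induction w using Φ.induction_left with
  | h0 g hg =>
    rw [coc_zero _ _ hg, hZ g hg]
    simp only [Module.Basis.coord_apply, Module.Basis.baseChange_repr_tmul, Module.Basis.repr_self]
    refine ⟨by simp, fun y hy _ => ?_⟩
    rw [Finsupp.single_eq_of_ne hy, zero_smul]
  | hs j g hj ih =>
    have key : ∀ y, (b.baseChange C).coord y (X.coc K (Φ.s j * g)) =
        ci j * (Φ.s j • (b.baseChange C).coord (Φ.s j * y) (X.coc K g)) +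
          (ci j * algebraMap ℂ C (c j y) + d j) * (Φ.s j • (b.baseChange C).coord y (X.coc K g)) := by
      intro y
      have e1 : K.A j = ci j • ((1 : C) ⊗ₜ[ℂ] T j) + d j • 1 := by
        rw [hA, Algebra.TensorProduct.one_def, TensorProduct.smul_tmul', TensorProduct.smul_tmul',
          smul_eq_mul, smul_eq_mul, mul_one, mul_one]
      rw [coc_s_mul, e1, add_mul, smul_mul_assoc, smul_mul_assoc, one_mul, map_add, map_smul,
        map_smul, coord_T_mul hT, coord_actB, coord_actB, smul_eq_mul, smul_eq_mul]
      ring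
    have hlen := RootAction.len_s_mul hj
    constructor
    · rw [key, Φ.s_mul_s_mul, ih.2 (Φ.s j * g) (fun h => by rw [h] at hlen; omega) (by omega),
        smul_zero, mul_zero, add_zero]
      exact mul_ne_zero (hci j) ((smul_ne_zero_iff_ne _).mpr ih.1)
    · intro y hy hle
      have h1 : Φ.s j * y ≠ g := fun h => hy (by rw [← h, Φ.s_mul_s_mul])
      have h2 := RootAction.len_le_len_s_mul (Φ := Φ) j y
      rw [key, ih.2 _ h1 (by omega), ih.2 y (fun h => by rw [h] at hle; omega) (by omega),
        smul_zero, mul_zero, mul_zero, add_zero]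

theorem coc_injective (hT : ∀ j y, T j * b y = b (Φ.s j * y) + c j y • b y)
    (hZ : ∀ g, Φ.len g = 0 → K.Z g = b g)
    (hA : ∀ j, K.A j = ci j ⊗ₜ T j + d j ⊗ₜ 1) (hci : ∀ j, ci j ≠ 0) (f : G →₀ C)
    (h : f.sum (fun w a => a • X.coc K w) = 0) : f = 0 := by
  by_contra hf
  -- At an element of maximal length in the support, only the leading term of its own summand
  -- contributes.
  obtain ⟨w, hw, hmax⟩ := Finset.exists_max_image f.support Φ.len (Finsupp.support_nonempty_iff.mpr hf)
  have h1 := congrArg ((b.baseChange C).coord w) h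
  rw [map_zero, Finsupp.sum, map_sum, Finset.sum_eq_single w] at h1
  · rw [map_smul, smul_eq_mul, mul_eq_zero] at h1
    rcases h1 with h1 | h1
    · exact Finsupp.mem_support_iff.mp hw h1
    · exact (X.coord_coc K hT hZ hA hci w).1 h1
  · intro y hy hyw
    rw [map_smul, (X.coord_coc K hT hZ hA hci y).2 w hyw.symm (hmax y hy), smul_zero]
  · intro h'; exact absurd hw h'

end Triangular

end Crossed

end

/-! ### The skew group algebra, its map ∇ and the Demazure-Lusztig operators. -/

noncomputable section

set_option linter.unusedSectionVars false

open EuclideanRootSystem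

namespace Crossed

variable {C H G B E : Type*} [CommRing C] [Algebra ℂ C] [Ring H]
  [Algebra ℂ H] [Group G] [MulSemiringAction G C] [SMulCommClass G ℂ C] [AddCommGroup E]
  [DistribMulAction G E]

variable (C G) in
/-- The skew group algebra as a crossed product. -/
def skew : Crossed C (SkewMonoidAlgebra C G) G where
  fn := { SkewMonoidAlgebra.singleOneRingHom with commutes' := fun _ => rfl }
  gp := SkewMonoidAlgebra.of C G
  comm w f := by
    change SkewMonoidAlgebra.single w 1 * SkewMonoidAlgebra.single 1 f =
      SkewMonoidAlgebra.single 1 (w • f) * SkewMonoidAlgebra.single w 1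
    rw [SkewMonoidAlgebra.single_mul_single, SkewMonoidAlgebra.single_mul_single, one_smul, one_mul,
      mul_one, one_mul, mul_one]
  act := SkewMonoidAlgebra.liftNCAlgHom (Algebra.lmul ℂ C)
    (DistribMulAction.toModuleEnd ℂ C) fun {x y} => by
      refine LinearMap.ext fun z => ?_
      change y • x * y • z = y • (x * z)
      rw [smul_mul']
  act_fn f g := by
    refine LinearMap.congr_fun (f := SkewMonoidAlgebra.liftNC _ _ (SkewMonoidAlgebra.single 1 f))
      (g := Algebra.lmul ℂ C f) ?_ g
    rw [SkewMonoidAlgebra.liftNC_single]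
    refine LinearMap.ext fun x => ?_
    change f * (1 : G) • x = f * x
    rw [one_smul]
  act_gp w g := by
    refine LinearMap.congr_fun (f := SkewMonoidAlgebra.liftNC _ _ (SkewMonoidAlgebra.single w 1))
      (g := DistribMulAction.toModuleEnd ℂ C w) ?_ g
    rw [SkewMonoidAlgebra.liftNC_single]
    refine LinearMap.ext fun x => ?_
    change 1 * w • x = w • x
    rw [one_mul]

theorem skew_single (w : G) (f : C) :
    SkewMonoidAlgebra.single w f = (skew C G).fn f * (skew C G).gp w := by
  change _ = SkewMonoidAlgebra.single 1 f * SkewMonoidAlgebra.single w 1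
  rw [SkewMonoidAlgebra.single_mul_single, one_smul, one_mul, mul_one]

theorem skew_algHom_ext {A : Type*} [Semiring A] [Algebra ℂ A] (Φ : RootAction G B E)
    {F F' : SkewMonoidAlgebra C G →ₐ[ℂ] A}
    (hf : ∀ f, F ((skew C G).fn f) = F' ((skew C G).fn f))
    (hs : ∀ j, F ((skew C G).gp (Φ.s j)) = F' ((skew C G).gp (Φ.s j)))
    (h0 : ∀ g, Φ.len g = 0 → F ((skew C G).gp g) = F' ((skew C G).gp g)) : F = F' := by
  have h : ∀ g, F ((skew C G).gp g) = F' ((skew C G).gp g) := by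
    intro g
    induction g using Φ.induction_left with
    | h0 g hg => exact h0 g hg
    | hs j g _ ih => rw [map_mul, map_mul, map_mul, hs, ih]
  refine AlgHom.ext fun x => ?_
  induction x using SkewMonoidAlgebra.induction_on with
  | zero => rw [map_zero, map_zero]
  | single w f => rw [skew_single, map_mul, map_mul, hf, h]
  | add x y hx hy => rw [map_add, map_add, hx, hy]

variable {Φ : RootAction G B E} (K : Cocycle C H Φ)

/-- The homomorphism from the skew group algebra defined by a cocycle. -/
def nabla : SkewMonoidAlgebra C G →ₐ[ℂ] SkewMonoidAlgebra C G ⊗[ℂ] H :=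
  SkewMonoidAlgebra.liftNCAlgHom (Algebra.TensorProduct.includeLeft.comp (skew C G).fn)
    ((skew C G).hom K) fun {_ _} => (skew C G).hom_comm K _ _

theorem nabla_fn (f : C) : nabla K ((skew C G).fn f) = (skew C G).fn f ⊗ₜ 1 := by
  change SkewMonoidAlgebra.liftNC _ _ (SkewMonoidAlgebra.single 1 f) = _
  rw [SkewMonoidAlgebra.liftNC_single, map_one, mul_one]
  rfl

theorem nabla_gp (w : G) : nabla K ((skew C G).gp w) = (skew C G).hom K w := by
  change SkewMonoidAlgebra.liftNC _ _ (SkewMonoidAlgebra.single w 1) = _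
  rw [SkewMonoidAlgebra.liftNC_single]
  refine (congrArg (· * _) (map_one (Algebra.TensorProduct.includeLeft.comp (skew C G).fn))).trans ?_
  exact one_mul _

theorem nabla_s {j : B} {a d : C} {h : H} (hA : K.A j = a ⊗ₜ h + d ⊗ₜ 1) :
    nabla K ((skew C G).gp (Φ.s j)) = ((skew C G).fn a * (skew C G).gp (Φ.s j)) ⊗ₜ h +
      ((skew C G).fn d * (skew C G).gp (Φ.s j)) ⊗ₜ 1 := by
  rw [nabla_gp, hom_s, hA, map_add, add_mul, emb_tmul, emb_tmul, gT,
    Algebra.TensorProduct.tmul_mul_tmul, Algebra.TensorProduct.tmul_mul_tmul, mul_one, mul_one]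

theorem nabla_zero {g : G} (hg : Φ.len g = 0) :
    nabla K ((skew C G).gp g) = (skew C G).gp g ⊗ₜ K.Z g := by
  rw [nabla_gp, hom_zero _ _ hg]

/-- The orbit map of `1` under the homomorphism defined by a cocycle. -/
def orb : SkewMonoidAlgebra C G →ₗ[ℂ] C ⊗[ℂ] H where
  toFun x := (skew C G).actT H (nabla K x) 1
  map_add' x y := by rw [map_add, map_add, LinearMap.add_apply]
  map_smul' c x := by rw [map_smul, map_smul, LinearMap.smul_apply]; rfl

theorem orb_one : orb K 1 = 1 ⊗ₜ 1 := by
  change (skew C G).actT H (nabla K 1) 1 = _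
  rw [map_one (nabla K), map_one ((skew C G).actT H)]; rfl

theorem orb_fn_mul (f : C) (x : SkewMonoidAlgebra C G) :
    orb K ((skew C G).fn f * x) = f • orb K x := by
  change (skew C G).actT H (nabla K (_ * x)) 1 = _
  have e1 : ((skew C G).fn f ⊗ₜ 1 : SkewMonoidAlgebra C G ⊗[ℂ] H) = (skew C G).emb H (f ⊗ₜ 1) := rfl
  rw [map_mul, map_mul, Module.End.mul_apply, nabla_fn, e1, actT_emb, Algebra.smul_def]
  rfl

theorem orb_s_mul (j : B) (x : SkewMonoidAlgebra C G) :
    orb K ((skew C G).gp (Φ.s j) * x) = K.A j * actB C H (Φ.s j) (orb K x) := by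
  change (skew C G).actT H (nabla K (_ * x)) 1 = _
  rw [map_mul, map_mul, Module.End.mul_apply, nabla_gp, hom_s, map_mul, Module.End.mul_apply,
    actT_emb, actT_gT]
  rfl

theorem orb_zero_mul {g : G} (hg : Φ.len g = 0) (x : SkewMonoidAlgebra C G) :
    orb K ((skew C G).gp g * x) = (1 ⊗ₜ K.Z g) * actB C H g (orb K x) := by
  change (skew C G).actT H (nabla K (_ * x)) 1 = _
  have e1 : ((skew C G).gp g ⊗ₜ K.Z g : SkewMonoidAlgebra C G ⊗[ℂ] H) =
      (skew C G).emb H (1 ⊗ₜ K.Z g) * (skew C G).gT H g := by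
    rw [emb_tmul, gT, Algebra.TensorProduct.tmul_mul_tmul, map_one, one_mul, mul_one]
  rw [map_mul, map_mul, Module.End.mul_apply, nabla_gp, hom_zero _ _ hg, e1, map_mul,
    Module.End.mul_apply, actT_emb, actT_gT]
  rfl

theorem orb_gp (w : G) : orb K ((skew C G).gp w) = (skew C G).coc K w := by
  change (skew C G).actT H (nabla K _) 1 = _
  rw [nabla_gp]; rfl

section Polynomial

variable [IsDomain C] {b : Module.Basis G ℂ H} {T : B → H} {c : B → G → ℂ} {ci d : B → C}

/-- Evaluation at 1 ⊗ 1 loses nothing, by triangularity of the cocycle; relations in the skew group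
algebra can be checked on this one vector. -/
theorem orb_injective (hT : ∀ j y, T j * b y = b (Φ.s j * y) + c j y • b y)
    (hZ : ∀ g, Φ.len g = 0 → K.Z g = b g)
    (hA : ∀ j, K.A j = ci j ⊗ₜ T j + d j ⊗ₜ 1) (hci : ∀ j, ci j ≠ 0) :
    Function.Injective (orb K) := by
  refine (injective_iff_map_eq_zero _).mpr fun x hx => ?_
  have h := (skew C G).coc_injective K hT hZ hA hci x.coeff ?_
  · exact SkewMonoidAlgebra.coeff_eq_zero.mp h
  · rw [← hx]
    conv_rhs => rw [← SkewMonoidAlgebra.sum_single x, SkewMonoidAlgebra.sum_def, Finsupp.sum,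
      map_sum]
    refine Finset.sum_congr rfl fun w _ => ?_
    rw [skew_single, orb_fn_mul, orb_gp]

variable {z : B → ℂ} {cf : B → C}

/-- Under s_j the vector 1 ⊗ h becomes c⁻¹ ⊗ T_j h + (c - z)c⁻¹ ⊗ h. In z + c(s_j - 1) all terms
except 1 ⊗ T_j h cancel, so on such vectors the Demazure-Lusztig operators act as the Hecke
generators. -/
theorem orb_demazure_mul (hA : ∀ j, K.A j = ci j ⊗ₜ T j + d j ⊗ₜ 1) (hc : ∀ j, cf j * ci j = 1)
    (hd : ∀ j, d j = (cf j - algebraMap ℂ C (z j)) * ci j) (j : B) {x : SkewMonoidAlgebra C G}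
    {h : H} (hx : orb K x = 1 ⊗ₜ h) :
    orb K ((algebraMap ℂ _ (z j) + (skew C G).fn (cf j) * ((skew C G).gp (Φ.s j) - 1)) * x) =
      1 ⊗ₜ (T j * h) := by
  have e0 : (algebraMap ℂ (SkewMonoidAlgebra C G) (z j)) =
      (skew C G).fn (algebraMap ℂ C (z j)) := rfl
  rw [add_mul, mul_assoc, sub_mul, one_mul, map_add, e0, orb_fn_mul, orb_fn_mul, map_sub, orb_s_mul,
    hx, actB_tmul, smul_one, hA, add_mul, Algebra.TensorProduct.tmul_mul_tmul,
    Algebra.TensorProduct.tmul_mul_tmul, mul_one, mul_one, one_mul, smul_sub, smul_add,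
    TensorProduct.smul_tmul', TensorProduct.smul_tmul', TensorProduct.smul_tmul',
    TensorProduct.smul_tmul', smul_eq_mul, smul_eq_mul, smul_eq_mul, smul_eq_mul, hc, hd,
    mul_left_comm, hc, mul_one, mul_one, mul_one, TensorProduct.sub_tmul]
  abel

theorem orb_altProd_mul (hA : ∀ j, K.A j = ci j ⊗ₜ T j + d j ⊗ₜ 1) (hc : ∀ j, cf j * ci j = 1)
    (hd : ∀ j, d j = (cf j - algebraMap ℂ C (z j)) * ci j) (n : ℕ) (i j : B)
    {x : SkewMonoidAlgebra C G} {h : H} (hx : orb K x = 1 ⊗ₜ h) :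
    orb K (altProd n
      (algebraMap ℂ _ (z i) + (skew C G).fn (cf i) * ((skew C G).gp (Φ.s i) - 1))
      (algebraMap ℂ _ (z j) + (skew C G).fn (cf j) * ((skew C G).gp (Φ.s j) - 1)) * x) =
      1 ⊗ₜ (altProd n (T i) (T j) * h) := by
  induction n generalizing i j with
  | zero => rw [altProd, altProd, one_mul, one_mul, hx]
  | succ n ih => rw [altProd, altProd, mul_assoc, mul_assoc, orb_demazure_mul K hA hc hd i (ih j i)]

/-- The Demazure-Lusztig operators of a cocycle satisfy the relations of the `T_j`. -/
def demazureData (hT : ∀ j y, T j * b y = b (Φ.s j * y) + c j y • b y)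
    (hZ : ∀ g, Φ.len g = 0 → K.Z g = b g) (hA : ∀ j, K.A j = ci j ⊗ₜ T j + d j ⊗ₜ 1)
    (hc : ∀ j, cf j * ci j = 1) (hd : ∀ j, d j = (cf j - algebraMap ℂ C (z j)) * ci j)
    (D : Φ.BraidData H) (hX : D.X = T) (hDZ : D.Z = K.Z) :
    Φ.BraidData (SkewMonoidAlgebra C G) where
  X j := algebraMap ℂ _ (z j) + (skew C G).fn (cf j) * ((skew C G).gp (Φ.s j) - 1)
  Z := (skew C G).gp
  braid i j hij h := by
    -- The two sides have orbit images 1 ⊗ (alternating word in the `T`), and these words agree in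
    -- `H`.
    refine orb_injective K hT hZ hA (fun j h0 => ?_) ?_
    · have := hc j; rw [h0, mul_zero] at this; exact zero_ne_one this
    · rw [← mul_one (altProd _ _ _), orb_altProd_mul K hA hc hd _ i j (orb_one K),
        ← mul_one (altProd _ (algebraMap ℂ _ (z j) + _) _),
        orb_altProd_mul K hA hc hd _ j i (orb_one K)]
      rw [← hX, D.braid i j hij h]
  Z_one := map_one _
  Z_mul _ _ _ _ := map_mul _ _ _
  Z_X g i j hg h := by
    refine orb_injective K hT hZ hA (fun j h0 => ?_) ?_
    · have := hc j; rw [h0, mul_zero] at this; exact zero_ne_one this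
    · have h1 := orb_demazure_mul K hA hc hd i (orb_one K)
      rw [mul_one] at h1
      have h2 : orb K ((skew C G).gp g) = 1 ⊗ₜ K.Z g := by
        rw [orb_gp, coc_zero _ _ hg]
      rw [orb_zero_mul K hg, h1, orb_demazure_mul K hA hc hd j h2, actB_tmul, smul_one,
        Algebra.TensorProduct.tmul_mul_tmul, mul_one, mul_one, ← hX, ← hDZ, D.Z_X g i j hg h]

theorem demazureData_mul_self (hT : ∀ j y, T j * b y = b (Φ.s j * y) + c j y • b y)
    (hZ : ∀ g, Φ.len g = 0 → K.Z g = b g) (hA : ∀ j, K.A j = ci j ⊗ₜ T j + d j ⊗ₜ 1)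
    (hc : ∀ j, cf j * ci j = 1) (hd : ∀ j, d j = (cf j - algebraMap ℂ C (z j)) * ci j)
    (D : Φ.BraidData H) (hX : D.X = T) (hDZ : D.Z = K.Z) {p : B → ℂ}
    (hq : ∀ j, T j * T j = 1 + p j • T j) (j : B) :
    (demazureData K hT hZ hA hc hd D hX hDZ).X j * (demazureData K hT hZ hA hc hd D hX hDZ).X j =
      1 + p j • (demazureData K hT hZ hA hc hd D hX hDZ).X j := by
  have h1 := orb_demazure_mul K hA hc hd j (orb_one K)
  rw [mul_one, mul_one] at h1
  refine orb_injective K hT hZ hA (fun j h0 => ?_) ?_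
  · have := hc j; rw [h0, mul_zero] at this; exact zero_ne_one this
  · change orb K ((algebraMap ℂ _ (z j) + (skew C G).fn (cf j) * ((skew C G).gp (Φ.s j) - 1)) *
      (algebraMap ℂ _ (z j) + (skew C G).fn (cf j) * ((skew C G).gp (Φ.s j) - 1))) =
      orb K (1 + p j • (algebraMap ℂ _ (z j) +
        (skew C G).fn (cf j) * ((skew C G).gp (Φ.s j) - 1)))
    rw [orb_demazure_mul K hA hc hd j h1, map_add, map_smul, h1, hq, orb_one,
      TensorProduct.tmul_add, TensorProduct.tmul_smul]

end Polynomial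

end Crossed

end

/-! ### The quantum affine KZ cocycle and the existence of ∇ and π. -/

noncomputable section

set_option linter.unusedSectionVars false

namespace EuclideanRootSystem

variable {ι V : Type*} [Finite ι] [NormedAddCommGroup V] [InnerProductSpace ℝ V]
  {S : EuclideanRootSystem ι V} {k : S.Mult} {q : S.QParam} {κ : S.Mult} (hκ : Admissible k q κ)

theorem rfac_eq_add {C A : Type*} [CommRing C] [Ring A] [Algebra C A] (c P u : C) (a : A) :
    rfac c P u a = c • a + (c * -(P * u)) • 1 := by
  rw [rfac]; module

theorem rmat_eq (j : Option S.Idx) (b : S.R) : rmat hκ j b = cinvA hκ b ⊗ₜ T κ j +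
    (cinvA hκ b * -(algebraMap ℂ (Csn k q) (κ.p j) * ufun k q b)) ⊗ₜ 1 := by
  rw [rmat, rfac_eq_add, Algebra.TensorProduct.one_def, TensorProduct.smul_tmul',
    TensorProduct.smul_tmul', smul_eq_mul, smul_eq_mul, mul_one, mul_one]

theorem smul_algebraMap_Csn (w : S.W) (x : ℂ) :
    w • algebraMap ℂ (Csn k q) x = algebraMap ℂ (Csn k q) x := smul_algebraMap w x

theorem actB_rmat (w : S.W) (j : Option S.Idx) (b : S.R) :
    Crossed.actB (Csn k q) (Hecke κ) w (rmat hκ j b) = rmat hκ j (w • b) := by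
  rw [rmat_eq, rmat_eq, map_add, Crossed.actB_tmul, Crossed.actB_tmul, smul_mul', smul_neg,
    smul_mul', smul_algebraMap_Csn, smul_cinvA, smul_ufun]

theorem crossed_chain_eq (n : ℕ) (i j : Option S.Idx) (w : S.W) :
    Crossed.chain (C := Csn k q) (H := Hecke κ) S.affAction.s
      (fun j => rmat hκ j (simpleR j)) n i j w = chain hκ n i j w := by
  induction n generalizing i j w with
  | zero => rfl
  | succ n ih =>
    rw [chain_succ, Crossed.chain, actB_rmat, ih]
    rfl

theorem ufun_add_ufun {a b : S.R} (h : (b : S.Aff) = -(a : S.Aff)) :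
    ufun k q a + ufun k q b = 1 := by
  apply Subtype.ext
  change (q.den1 a)⁻¹ + (q.den1 b)⁻¹ = 1
  have h1 := q.den1_ne_zero a
  have h2 := q.den1_ne_zero b
  have he := q.e_neg_mul_e a
  rw [← h] at he
  rw [inv_add_inv h1 h2, div_eq_one_iff_eq (mul_ne_zero h1 h2), QParam.den1, QParam.den1]
  linear_combination -he

/-- The bracket is c_a c_{-a}: with z = κ_a, c_a = z - pu, c_{-a} = z - pv and u + v = 1, the
product is z² - pz + p²uv, and z² = 1 + pz. -/
theorem cinvA_mul_cinvA {a b : S.R} (h : (b : S.Aff) = -(a : S.Aff)) (hb : κ.toFun b = κ.toFun a)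
    {p : ℂ} (hp : p = κ.toFun a - ((κ.toFun a)⁻¹ : ℂˣ)) :
    cinvA hκ a * cinvA hκ b * (1 + algebraMap ℂ (Csn k q) p * algebraMap ℂ (Csn k q) p *
      (ufun k q a * ufun k q b)) = 1 := by
  have h1 := cfun_mul_cinvA hκ a
  have h2 := cfun_mul_cinvA hκ b
  have hu := ufun_add_ufun (k := k) (q := q) h
  rw [cfun_eq] at h1 h2
  rw [hb] at h2
  rw [← hp] at h1 h2
  have hz : algebraMap ℂ (Csn k q) (κ.toFun a) * algebraMap ℂ (Csn k q) (κ.toFun a) =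
      1 + algebraMap ℂ (Csn k q) p * algebraMap ℂ (Csn k q) (κ.toFun a) := by
    rw [← map_mul, ← map_mul, ← map_one (algebraMap ℂ (Csn k q)), ← map_add, hp]
    congr 1
    have : (κ.toFun a : ℂ) * ((κ.toFun a)⁻¹ : ℂˣ) = 1 := by simp
    linear_combination this
  generalize cinvA hκ a = A at *
  generalize cinvA hκ b = B at *
  generalize algebraMap ℂ (Csn k q) (κ.toFun a) = z at *
  generalize algebraMap ℂ (Csn k q) p = P at *
  generalize ufun k q a = u at *
  generalize ufun k q b = v at *
  linear_combination (-A * B) * hz + (A * B * P * z) * hu + h1 * ((z - P * v) * B) + h2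

theorem p_eq_toFun (j : Option S.Idx) :
    κ.p j = (κ.toFun (simpleR j) : ℂ) - ((κ.toFun (simpleR j))⁻¹ : ℂˣ) := rfl

/-- The cocycle of the quantum affine KZ equations. -/
def cocycle : Crossed.Cocycle (Csn k q) (Hecke κ) S.affAction where
  A j := rmat hκ j (simpleR j)
  Z := (heckeData κ).Z
  braid i j hij h := by
    rw [crossed_chain_eq, crossed_chain_eq]
    exact chain_orderOf hκ hij h
  unitary j := by
    rw [actB_rmat]
    have hs : (((S.affAction.s j • simpleR j : S.R)) : S.Aff) = -((simpleR j : S.R) : S.Aff) :=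
      S.affAction.s_simple j
    refine rfac_mul_rfac (one_tmul_T_mul_self j) (ufun_add_ufun hs) ?_
    exact cinvA_mul_cinvA hκ hs (κ.toFun_smul_R _ _) (p_eq_toFun j)
  Z_one := (heckeData κ).Z_one
  Z_mul := (heckeData κ).Z_mul
  Z_A g i j hg h := by
    have hs : g • (simpleR i : S.R) = simpleR j := Subtype.ext h
    have hv : κ.p i = κ.p j := by
      rw [p_eq_toFun, p_eq_toFun, ← hs, κ.toFun_smul_R]
    have hZ : (heckeData κ).Z g * T κ i = T κ j * (heckeData κ).Z g :=
      (heckeData κ).Z_X g i j hg h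
    rw [actB_rmat, hs, rmat_eq, rmat_eq, mul_add, add_mul, Algebra.TensorProduct.tmul_mul_tmul,
      Algebra.TensorProduct.tmul_mul_tmul, Algebra.TensorProduct.tmul_mul_tmul,
      Algebra.TensorProduct.tmul_mul_tmul, hZ, hv, one_mul, one_mul, one_mul, mul_one, mul_one,
      mul_one]

theorem cfun_sub (z : ℂˣ) (a : S.R) : cfun k q z a - algebraMap ℂ _ (z : ℂ) =
    -(algebraMap ℂ (Csn k q) ((z : ℂ) - (z⁻¹ : ℂˣ)) * ufun k q a) := by
  rw [cfun_eq]; ring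

theorem cocycle_A_self (j : Option S.Idx) : (cocycle (admissible_self k q)).A j =
    cinv k q (simpleR j) ⊗ₜ T k j + ((cfun k q (k.val j) (simpleR j) -
      algebraMap ℂ _ (k.val j : ℂ)) * cinv k q (simpleR j)) ⊗ₜ 1 := by
  refine (rmat_eq (admissible_self k q) j (simpleR j)).trans ?_
  rw [cfun_sub, mul_comm (cinvA _ _)]
  rfl

theorem nabla_gp_s (j : Option S.Idx) :
    Crossed.nabla (C := Csn k q) (H := Hecke k) (cocycle (admissible_self k q)) (gp k q (S.s j)) =
    (fn k q (cinv k q (simpleR j)) * gp k q (S.s j)) ⊗ₜ T k j +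
    (fn k q ((cfun k q (k.val j) (simpleR j) - algebraMap ℂ _ (k.val j : ℂ)) *
      cinv k q (simpleR j)) * gp k q (S.s j)) ⊗ₜ 1 := by
  have h := Crossed.nabla_s (C := Csn k q) (H := Hecke k) (cocycle (admissible_self k q)) (j := j)
    (a := cinv k q (simpleR j)) (h := T k j) (d := (cfun k q (k.val j) (simpleR j) -
      algebraMap ℂ _ (k.val j : ℂ)) * cinv k q (simpleR j))
  have h2 := cocycle_A_self (k := k) (q := q) j
  exact h h2

theorem isNabla_nabla (k : S.Mult) (q : S.QParam) :
    IsNabla k q (Crossed.nabla (C := Csn k q) (H := Hecke k) (cocycle (admissible_self k q))) := by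
  refine ⟨fun f => Crossed.nabla_fn (C := Csn k q) (H := Hecke k) (cocycle (admissible_self k q)) f,
    fun j => ?_, fun o => ?_⟩
  · exact nabla_gp_s j
  · have h := Crossed.nabla_zero (C := Csn k q) (H := Hecke k) (cocycle (admissible_self k q))
      (Om_len o)
    have h' : (cocycle (admissible_self k q)).Z o = TO k o := heckeData_Z k o
    rw [h'] at h
    exact h

theorem existsUnique_nabla (k : S.Mult) (q : S.QParam) :
    ∃! D : Smash k q →ₐ[ℂ] Smash k q ⊗[ℂ] Hecke k, IsNabla k q D := by
  refine ⟨Crossed.nabla (C := Csn k q) (H := Hecke k) (cocycle (admissible_self k q)),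
    isNabla_nabla k q, fun D hD => ?_⟩
  have hN := isNabla_nabla k q
  refine Crossed.skew_algHom_ext (C := Csn k q) (A := Smash k q ⊗[ℂ] Hecke k) S.affAction
    (fun f => ?_) (fun j => ?_) (fun g hg => ?_)
  · exact (hD.1 f).trans (hN.1 f).symm
  · exact (hD.2.1 j).trans (hN.2.1 j).symm
  · exact (hD.2.2 ⟨g, hg⟩).trans (hN.2.2 ⟨g, hg⟩).symm

-- Triangularity uses only that the correction to T_{s_j y} is a scalar multiple of T_y, so its
-- coefficient is chosen without reference to the sign of a root.
open Classical in
theorem T_mul_basisTw (κ : S.Mult) (j : Option S.Idx) (y : S.W) :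
    T κ j * basisTw κ y = basisTw κ (S.affAction.s j * y) +
      (if T κ j * Tw κ y = Tw κ (S.s j * y) then 0 else κ.p j) • basisTw κ y := by
  rw [basisTw_apply, basisTw_apply]
  split_ifs with h
  · rw [zero_smul, add_zero]; exact h
  · exact (T_mul_Tw κ j y).resolve_left h

theorem cocycle_A_inv (j : Option S.Idx) : (cocycle (admissible_inv k q)).A j =
    cinvA (admissible_inv k q) (simpleR j) ⊗ₜ T k.inv j + ((cfun k q (k.inv.val j) (simpleR j) -
      algebraMap ℂ _ (k.inv.val j : ℂ)) * cinvA (admissible_inv k q) (simpleR j)) ⊗ₜ 1 := by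
  refine (rmat_eq (admissible_inv k q) j (simpleR j)).trans ?_
  rw [cfun_sub, mul_comm (cinvA _ _)]
  rfl

theorem cocycle_Z_inv (g : S.W) (hg : S.affAction.len g = 0) :
    (cocycle (admissible_inv k q)).Z g = basisTw k.inv g := by
  rw [basisTw_apply]
  exact (heckeData_Z k.inv ⟨g, hg⟩).trans (Tw_Om k.inv ⟨g, hg⟩).symm

theorem cfun_mul_cinvA_inv (j : Option S.Idx) : cfun k q (k.inv.val j) (simpleR j) *
    cinvA (admissible_inv k q) (simpleR j) = 1 := cfun_mul_cinvA _ _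

variable (k q) in
/-- The Demazure-Lusztig operators. -/
def piData : S.affAction.BraidData (Smash k q) :=
  Crossed.demazureData (C := Csn k q) (H := Hecke k.inv) (T := T k.inv)
    (ci := fun j => cinvA (admissible_inv k q) (simpleR j)) (z := fun j => (k.inv.val j : ℂ))
    (cf := fun j => cfun k q (k.inv.val j) (simpleR j))
    (d := fun j => (cfun k q (k.inv.val j) (simpleR j) - algebraMap ℂ _ (k.inv.val j : ℂ)) *
      cinvA (admissible_inv k q) (simpleR j))
    (cocycle (admissible_inv k q)) (T_mul_basisTw k.inv) cocycle_Z_inv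
    cocycle_A_inv cfun_mul_cinvA_inv (fun _ => rfl) (heckeData k.inv) rfl rfl

theorem piData_mul_self (j : Option S.Idx) :
    (piData k q).X j * (piData k q).X j = 1 + k.inv.p j • (piData k q).X j :=
  Crossed.demazureData_mul_self (C := Csn k q) (H := Hecke k.inv) (T := T k.inv)
    (ci := fun j => cinvA (admissible_inv k q) (simpleR j)) (z := fun j => (k.inv.val j : ℂ))
    (cf := fun j => cfun k q (k.inv.val j) (simpleR j))
    (d := fun j => (cfun k q (k.inv.val j) (simpleR j) - algebraMap ℂ _ (k.inv.val j : ℂ)) *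
      cinvA (admissible_inv k q) (simpleR j))
    (cocycle (admissible_inv k q)) (T_mul_basisTw k.inv) cocycle_Z_inv
    cocycle_A_inv cfun_mul_cinvA_inv (fun _ => rfl) (heckeData k.inv) rfl rfl (T_mul_T k.inv) j

theorem exists_isPi (k : S.Mult) (q : S.QParam) :
    ∃ π : Hecke k.inv →ₐ[ℂ] Smash k q, IsPi k q π := by
  refine ⟨heckeLift (A := Smash k q) k.inv (piData k q) piData_mul_self, fun j => ?_, fun o => ?_⟩
  · exact heckeLift_T (A := Smash k q) k.inv (piData k q) piData_mul_self j
  · exact heckeLift_TO (A := Smash k q) k.inv (piData k q) piData_mul_self o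

theorem existsUnique_pi (k : S.Mult) (q : S.QParam) :
    ∃! π : Hecke k.inv →ₐ[ℂ] Smash k q, IsPi k q π := by
  obtain ⟨π, hπ⟩ := exists_isPi k q
  refine ⟨π, hπ, fun π' h => hecke_algHom_ext (A := Smash k q) (fun j => ?_) (fun o => ?_)⟩
  · rw [hπ.1, h.1]
  · rw [hπ.2, h.2]

end EuclideanRootSystem

end

noncomputable section

set_option linter.unusedSectionVars false

namespace EuclideanRootSystem

variable {ι V : Type*} [Finite ι] [NormedAddCommGroup V] [InnerProductSpace ℝ V]
  (S : EuclideanRootSystem ι V)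

/-! ### Dominant coweights -/

theorem isPos_simple (i : S.Idx) : S.base.IsPos i :=
  (S.finAction_pos i).mp (S.finAction.pos_simple i)

/-- The pairing with a root as a homomorphism. -/
def prHom (i : ι) : S.Pv →+ ℤ where
  toFun x := S.pr x i
  map_zero' := by
    have := S.pr_add 0 0 i
    rw [add_zero] at this
    omega
  map_add' x y := S.pr_add x y i

variable {S}

theorem Pv_ext {x y : S.Pv} (h : ∀ i : S.Idx, S.pr x i = S.pr y i) : x = y := by
  rw [← sub_eq_zero]
  apply Subtype.ext
  change ((x - y : S.Pv) : V) = 0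
  rw [← inner_self_eq_zero (𝕜 := ℝ), S.inner_eq_sum_fundVec]
  refine Finset.sum_eq_zero fun i _ => ?_
  rw [← pr_cast, pr_sub, h i, sub_self, Int.cast_zero, mul_zero]

theorem isDominant_iff {x : S.Pv} : IsDominant x ↔ ∀ i : S.Idx, 0 ≤ S.pr x i := by
  constructor
  · intro h i
    have := h i (S.isPos_simple i)
    rw [← pr_cast] at this
    exact_mod_cast this
  · intro h i hi
    refine Dom.inner_nonneg (fun j => ?_) (S.inner_fundVec_nonneg hi)
    rw [← pr_cast]
    exact_mod_cast h j

theorem IsDominant.pr_nonneg {x : S.Pv} (h : IsDominant x) {i : ι} (hi : S.base.IsPos i) :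
    0 ≤ S.pr x i := by
  have := h i hi
  rw [← pr_cast] at this
  exact_mod_cast this

theorem IsDominant.pr_nonpos {x : S.Pv} (h : IsDominant x) {i : ι} (hi : ¬ S.base.IsPos i) :
    S.pr x i ≤ 0 := by
  obtain ⟨j, hj, hj'⟩ := S.neg_cor i
  have := h.pr_nonneg ((S.isPos_of_cor_eq_neg hj').mpr hi)
  rw [S.pr_of_root_neg hj] at this
  omega

theorem IsDominant.add {x y : S.Pv} (hx : IsDominant x) (hy : IsDominant y) :
    IsDominant (x + y) :=
  isDominant_iff.mpr fun i => by
    rw [pr_add]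
    exact add_nonneg (isDominant_iff.mp hx i) (isDominant_iff.mp hy i)

/-- The fundamental coweights. -/
def fund (i : S.Idx) : S.Pv := ⟨S.fundVec i, fun j => by
  obtain ⟨f, hf, _⟩ := S.exists_int_inner_fundVec j
  exact ⟨f i, hf i⟩⟩

open Classical in
theorem pr_fund (i j : S.Idx) : S.pr (fund i) j = if i = j then 1 else 0 := by
  have h : (S.pr (fund i) j : ℝ) = ⟪S.fundVec i, S.root j⟫ := pr_cast _ _ _
  rw [S.inner_fundVec_root] at h
  split_ifs at h ⊢ <;> exact_mod_cast h

/-- The coweight with prescribed pairings with the simple roots. -/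
def comb (n : S.Idx → ℤ) : S.Pv := ∑ i, n i • fund i

theorem pr_comb (n : S.Idx → ℤ) (j : S.Idx) : S.pr (comb n) j = n j := by
  change S.prHom j (comb n) = _
  rw [comb, map_sum]
  refine (Finset.sum_eq_single j (fun i _ hi => ?_) (by simp)).trans ?_
  · rw [map_zsmul]
    change n i • S.pr (fund i) j = 0
    rw [pr_fund, if_neg hi, smul_zero]
  · rw [map_zsmul]
    change n j • S.pr (fund j) j = n j
    rw [pr_fund, if_pos rfl, smul_eq_mul, mul_one]

theorem eq_comb (x : S.Pv) : x = comb fun i => S.pr x i :=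
  Pv_ext fun i => (pr_comb (fun i : S.Idx => S.pr x i) i).symm

theorem isDominant_comb {n : S.Idx → ℤ} (hn : ∀ i, 0 ≤ n i) : IsDominant (comb n) :=
  isDominant_iff.mpr fun i => by rw [pr_comb]; exact hn i

/-- Positive and negative parts of the coordinates. The last clause lets commutation of T_i with
Y^λ, when λ pairs to zero with α_i, be checked on dominant coweights. -/
theorem exists_dominant_sub (x : S.Pv) : ∃ μ ν : S.Pv, IsDominant μ ∧ IsDominant ν ∧ x = μ - ν ∧
    ∀ i : S.Idx, S.pr x i = 0 → S.pr μ i = 0 ∧ S.pr ν i = 0 := by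
  refine ⟨comb fun i => max (S.pr x i) 0, comb fun i => max (-S.pr x i) 0,
    isDominant_comb fun i => le_max_right _ _, isDominant_comb fun i => le_max_right _ _,
    Pv_ext fun i => ?_, fun i hi => ?_⟩
  · rw [pr_sub, pr_comb, pr_comb]; omega
  · rw [pr_comb, pr_comb, hi]; simp

/-! ### Lengths of translations -/

theorem tau_add (x y : S.Pv) : S.tau (x + y) = S.tau x * S.tau y := by
  rw [tau, tau, tau, ofAdd_add, map_mul]

theorem incl_mul_tau (u : S.W0) (x : S.Pv) : S.incl u * S.tau x = S.tau (u • x) * S.incl u := by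
  refine S.W_ext fun a => ?_
  rw [mul_smul, mul_smul, incl_smul, tau_smul, tau_smul, incl_smul]
  refine Prod.ext ?_ rfl
  change a.1 - S.ip x a.2 = a.1 - S.ip (u • x) (u • a.2)
  rw [ip_smul_smul]

/-- A dominant translation can invert only roots with positive gradient, and their images have
negative constant term. It is therefore enough that `g` leaves such images negative. -/
theorem len_mul_tau {g : S.W} {y : S.Pv} (hy : IsDominant y)
    (hg : ∀ r i, r < 0 → S.base.IsPos i → S.affAction.Pos (-(g • S.aroot r i))) :
    S.affAction.len (g * S.tau y) = S.affAction.len g + S.affAction.len (S.tau y) := by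
  refine RootAction.len_mul_of_inv fun a ha h => ?_
  obtain ⟨r, i, rfl⟩ : ∃ r i, a = S.aroot r i := ha.1
  rw [tau_smul_aroot, neg_pos_aroot_iff] at h
  rw [affAction_pos_aroot] at ha
  rw [mul_smul, tau_smul_aroot]
  by_cases hi : S.base.IsPos i
  · simp only [hi, not_true, and_false, or_false] at h
    exact hg _ _ h hi
  · have := hy.pr_nonpos hi
    simp only [hi, and_false, or_false] at ha
    omega

theorem len_tau_mul_tau {x y : S.Pv} (hx : IsDominant x) (hy : IsDominant y) :
    S.affAction.len (S.tau x * S.tau y) =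
      S.affAction.len (S.tau x) + S.affAction.len (S.tau y) := by
  refine len_mul_tau hy fun r i hr hi => ?_
  rw [tau_smul_aroot, neg_pos_aroot_iff]
  have := hx.pr_nonneg hi
  omega

theorem len_incl_mul_tau (u : S.W0) {y : S.Pv} (hy : IsDominant y) :
    S.affAction.len (S.incl u * S.tau y) =
      S.affAction.len (S.incl u) + S.affAction.len (S.tau y) := by
  refine len_mul_tau hy fun r i hr hi => ?_
  rw [incl_smul_aroot, neg_pos_aroot_iff]
  omega

/-! ### The commuting elements `Y^λ` -/

variable (k : S.Mult)

theorem TwU_tau_add {x y : S.Pv} (hx : IsDominant x) (hy : IsDominant y) :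
    TwU k (S.tau (x + y)) = TwU k (S.tau x) * TwU k (S.tau y) := by
  rw [tau_add, TwU_mul k (len_tau_mul_tau hx hy)]

theorem TwU_tau_comm {x y : S.Pv} (hx : IsDominant x) (hy : IsDominant y) :
    TwU k (S.tau x) * TwU k (S.tau y) = TwU k (S.tau y) * TwU k (S.tau x) := by
  rw [← TwU_tau_add k hx hy, add_comm, TwU_tau_add k hy hx]

/-- Dominant translations have additive lengths, so their T's commute and the quotient does not
depend on the chosen difference. This replaces the choice in the definition of `Y` by any convenient
one. -/
theorem Y_sub {μ ν : S.Pv} (hμ : IsDominant μ) (hν : IsDominant ν) :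
    Y k (μ - ν) = (TwU k (S.tau μ) * (TwU k (S.tau ν))⁻¹ : (Hecke k)ˣ) := by
  have h : ∃ p : S.Pv × S.Pv, IsDominant p.1 ∧ IsDominant p.2 ∧ μ - ν = p.1 - p.2 :=
    ⟨(μ, ν), hμ, hν, rfl⟩
  rw [Y, dif_pos h]
  obtain ⟨h1, h2, h3⟩ := h.choose_spec
  generalize h.choose = p at h1 h2 h3
  rw [← val_TwU, ← val_TwU, Ring.inverse_unit, ← Units.val_mul]
  congr 1
  have h4 : p.1 + ν = μ + p.2 := by
    rw [← sub_eq_sub_iff_add_eq_add, h3]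
  have h5 := congrArg (fun x => TwU k (S.tau x)) h4
  simp only [TwU_tau_add k h1 hν, TwU_tau_add k hμ h2] at h5
  have c : Commute (TwU k (S.tau ν))⁻¹ (TwU k (S.tau p.2)) :=
    Commute.inv_left (TwU_tau_comm k hν h2)
  rw [mul_inv_eq_iff_eq_mul, mul_assoc, c.eq, ← mul_assoc, ← h5, mul_inv_cancel_right]

theorem Y_of_dominant {x : S.Pv} (hx : IsDominant x) : Y k x = Tw k (S.tau x) := by
  have h0 : IsDominant (0 : S.Pv) := isDominant_iff.mpr fun i => (map_zero (S.prHom i)).ge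
  have h := Y_sub k hx h0
  have h1 : TwU k (S.tau 0) = 1 := Units.ext (Tw_one k)
  rw [sub_zero, h1, inv_one, mul_one] at h
  exact h

theorem Y_zero : Y k (0 : S.Pv) = 1 :=
  (Y_of_dominant k (isDominant_iff.mpr fun i => (map_zero (S.prHom i)).ge)).trans (Tw_one k)

theorem Y_add (x y : S.Pv) : Y k (x + y) = Y k x * Y k y := by
  obtain ⟨μ, ν, hμ, hν, rfl, -⟩ := exists_dominant_sub x
  obtain ⟨μ', ν', hμ', hν', rfl, -⟩ := exists_dominant_sub y
  rw [sub_add_sub_comm, Y_sub k (hμ.add hμ') (hν.add hν'), Y_sub k hμ hν, Y_sub k hμ' hν',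
    ← Units.val_mul]
  congr 1
  rw [TwU_tau_add k hμ hμ', TwU_tau_add k hν hν', mul_inv_rev]
  have c1 : Commute (TwU k (S.tau ν))⁻¹ (TwU k (S.tau μ')) :=
    Commute.inv_left (TwU_tau_comm k hν hμ')
  have c2 : Commute (TwU k (S.tau ν))⁻¹ (TwU k (S.tau ν'))⁻¹ :=
    (Commute.inv_inv (TwU_tau_comm k hν hν'))
  rw [mul_assoc, mul_assoc, ← mul_assoc (TwU k (S.tau ν))⁻¹, c1.eq, mul_assoc, c2.eq]

theorem Y_mul_Y_neg (x : S.Pv) : Y k x * Y k (-x) = 1 := by rw [← Y_add, add_neg_cancel, Y_zero]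

theorem Y_neg_mul_Y (x : S.Pv) : Y k (-x) * Y k x = 1 := by rw [← Y_add, neg_add_cancel, Y_zero]

theorem Tw_incl_mul_Y (u : S.W0) {x : S.Pv} (hx : IsDominant x) :
    Tw k (S.incl u) * Y k x = Tw k (S.incl u * S.tau x) := by
  rw [Y_of_dominant k hx, Tw_mul k (len_incl_mul_tau u hx)]

/-! ### The relations between the `T_i` and the `Y^λ` -/

theorem s_some_mul_tau (i : S.Idx) (x : S.Pv) :
    S.s (some i) * S.tau x = S.tau (S.refl0 i • x) * S.s (some i) := incl_mul_tau _ _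

theorem T_mul_Y_of_dominant {i : S.Idx} {x : S.Pv} (hx : IsDominant x) (h : S.pr x i = 0) :
    T k (some i) * Tw k (S.tau x) = Tw k (S.tau x) * T k (some i) := by
  have h1 := s_some_mul_tau i x
  rw [refl0_smul, h, zero_smul, sub_zero] at h1
  have hl : S.affAction.len (S.s (some i) * S.tau x) =
      S.affAction.len (S.s (some i)) + S.affAction.len (S.tau x) := len_incl_mul_tau _ hx
  rw [← Tw_s, ← Tw_mul k hl, h1, Tw_mul]
  rw [← h1, hl, add_comm]

theorem T_mul_Y_of_pr_eq_zero {i : S.Idx} {x : S.Pv} (h : S.pr x i = 0) :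
    T k (some i) * Y k x = Y k x * T k (some i) := by
  obtain ⟨μ, ν, hμ, hν, rfl, h'⟩ := exists_dominant_sub x
  obtain ⟨h1, h2⟩ := h' i h
  rw [Y_sub k hμ hν]
  have c1 : Commute (T k (some i)) (TwU k (S.tau μ) : Hecke k) := T_mul_Y_of_dominant k hμ h1
  have c2 : Commute (T k (some i)) (TwU k (S.tau ν) : Hecke k) := T_mul_Y_of_dominant k hν h2
  rw [Units.val_mul]
  exact (c1.mul_right c2.units_inv_right).eq

theorem T_eq (j : Option S.Idx) : T k j = Tinv k j + k.p j • 1 := (sub_add_cancel _ _).symm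

/-- The element τ(x)s_i has square τ(x + s_i x), and the lengths add. Since T_{τ(x)s_i} = Y^x T_i⁻¹
and x + s_i x is dominant, (Y^x T_i⁻¹)² = Y^x Y^{s_i x}; cancelling Y^x gives the relation. -/
theorem Tinv_mul_Y_mul_Tinv {i : S.Idx} {x : S.Pv} (hx : IsDominant x) (h : S.pr x i = 1) :
    Tinv k (some i) * Y k x * Tinv k (some i) = Y k (S.refl0 i • x) := by
  have hα : S.simple (some i) = S.aroot 0 i := by
    rw [aroot, Int.cast_zero, mul_zero]; rfl
  have hsα : S.s (some i) • S.aroot 0 i = -S.aroot 0 i := by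
    rw [← hα]; exact S.affAction.s_simple (some i)
  have hg : S.affAction.Pos ((S.tau x * S.s (some i)) • S.simple (some i)) := by
    rw [mul_smul, hα, hsα, smul_neg, tau_smul_aroot, neg_pos_aroot_iff, h]
    omega
  have h1 : Tw k (S.tau x) = Tw k (S.tau x * S.s (some i)) * T k (some i) := by
    rw [← Tw_mul_s k hg]
    congr 1
    exact (S.affAction.mul_s_mul_s (some i) _).symm
  have h1' : Tw k (S.tau x * S.s (some i)) = Y k x * Tinv k (some i) := by
    rw [Y_of_dominant k hx, h1, mul_assoc, T_mul_Tinv, mul_one]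
  have h2 : S.tau x * S.s (some i) * (S.tau x * S.s (some i)) = S.tau (x + S.refl0 i • x) := by
    rw [mul_assoc, ← mul_assoc (S.s (some i)), s_some_mul_tau, mul_assoc,
      show S.s (some i) * S.s (some i) = 1 from S.affAction.s_mul_s _, mul_one, tau_add]
  -- The pairing with α_j is 2⟨x, α_j⟩ - ⟨α_i^∨, α_j⟩, which is 0 for j = i and otherwise a sum of
  -- two nonnegative numbers.
  have hd : IsDominant (x + S.refl0 i • x) := isDominant_iff.mpr fun j => by
    rw [pr_add, refl0_smul, pr_sub, h, one_smul, pr_cor]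
    by_cases hij : j = i
    · subst hij
      rw [← pr_cor, pr_cor_self, h]
      norm_num
    · have h3 := S.base.pairingIn_le_zero_of_ne (fun e => hij (Subtype.ext e)) j.2 i.2
      have h4 := isDominant_iff.mp hx j
      omega
  have hl : S.affAction.len (S.tau x * S.s (some i) * (S.tau x * S.s (some i))) =
      S.affAction.len (S.tau x * S.s (some i)) + S.affAction.len (S.tau x * S.s (some i)) := by
    -- The reflection s_i changes the sign of a gradient only for ±α_i, where ⟨x, ±α_i⟩ = ±1 is
    -- known; for the other gradients dominance of x decides.
    refine RootAction.len_mul_of_inv fun a ha hn => ?_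
    obtain ⟨r, l, rfl⟩ : ∃ r l, a = S.aroot r l := ha.1
    have e1 : S.s (some i) • S.aroot r l = S.aroot r (S.refl0 i • l) := incl_smul_aroot S _ _ _
    rw [mul_smul, e1, tau_smul_aroot, neg_pos_aroot_iff] at hn
    rw [h2, tau_smul_aroot, neg_pos_aroot_iff, pr_add]
    rw [affAction_pos_aroot] at ha
    have e2 : S.pr (S.refl0 i • x) l = S.pr x (S.refl0 i • l) := by
      rw [← S.pr_smul (S.refl0 i) x (S.refl0 i • l), ← mul_smul, refl0_mul_self, one_smul]
    rw [e2]
    have pos_iff : ∀ l, S.finAction.Pos (S.cor l) ↔ S.base.IsPos l := S.finAction_pos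
    have e3 : S.finAction.s i • S.cor l = S.cor (S.refl0 i • l) := S.smul_cor _ _
    by_cases hl : S.base.IsPos l
    · have h5 := hx.pr_nonneg hl
      by_cases hl' : S.base.IsPos (S.refl0 i • l)
      · simp only [hl', not_true, and_false, or_false] at hn
        omega
      · have h6 : S.cor l = S.cor i := RootAction.Pos.eq_simple_of_neg (Φ := S.finAction)
          ((pos_iff l).mpr hl) (by
            rw [e3]
            exact (RootAction.not_pos_iff (Φ := S.finAction) ⟨_, rfl⟩).mp
              (fun h => hl' ((pos_iff _).mp h)))
        have h7 := S.cor_injective h6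
        subst h7
        have e4 : S.pr x (S.refl0 i • (i : ι)) = -1 := by
          rw [← e2, refl0_smul, pr_sub, h, one_smul, pr_cor_self]; norm_num
        rw [e4] at hn ⊢
        simp only [hl, not_true, and_false, or_false] at *
        omega
    · simp only [hl, not_false_eq_true, and_false, or_false, and_true] at ha ⊢
      have h5 := hx.pr_nonpos hl
      by_cases hl' : S.base.IsPos (S.refl0 i • l)
      · obtain ⟨m, hm, hm'⟩ := S.neg_cor l
        have hmp := (S.isPos_of_cor_eq_neg hm').mpr hl
        have e5 : S.finAction.s i • S.cor m = -S.cor (S.refl0 i • l) := by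
          rw [hm', smul_neg, e3]
        have h6 : S.cor m = S.cor i := RootAction.Pos.eq_simple_of_neg (Φ := S.finAction)
          ((pos_iff m).mpr hmp) (by rw [e5, neg_neg, pos_iff]; exact hl')
        have h7 := S.cor_injective h6
        subst h7
        have e6 : S.pr x l = -1 := by
          have := S.pr_of_root_neg hm x
          omega
        have e4 : S.pr x (S.refl0 i • l) = 1 := by
          rw [← e2, refl0_smul, pr_sub, h, one_smul, e6]
          have := S.pr_of_root_neg hm (S.cor i)
          rw [pr_cor_self] at this
          omega
        rw [e4] at hn ⊢
        simp only [hl', not_true, and_false, or_false] at hn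
        omega
      · have := hx.pr_nonpos hl'
        omega
  have h3 := Tw_mul k hl
  rw [h2, ← Y_of_dominant k hd, Y_add, h1'] at h3
  have h4 := congrArg (Y k (-x) * ·) h3
  simp only [← mul_assoc, Y_neg_mul_Y, one_mul] at h4
  exact h4.symm

theorem Y_mul_T {i : S.Idx} {x : S.Pv} (hx : IsDominant x) (h : S.pr x i = 1) :
    Y k x * T k (some i) = T k (some i) * Y k (S.refl0 i • x) + k.p (some i) • Y k x := by
  rw [← Tinv_mul_Y_mul_Tinv k hx h, ← mul_assoc, ← mul_assoc, T_mul_Tinv, one_mul]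
  conv_lhs => rw [T_eq]
  rw [mul_add, mul_smul_comm, mul_one]

end EuclideanRootSystem

end

noncomputable section

set_option linter.unusedSectionVars false

namespace EuclideanRootSystem

variable {ι V : Type*} [Finite ι] [NormedAddCommGroup V] [InnerProductSpace ℝ V]
  {S : EuclideanRootSystem ι V} (k : S.Mult)

/-! ### The Bernstein presentation -/

/-- The span of the `Y^λ`. -/
def spanY : Submodule ℂ (Hecke k) := Submodule.span ℂ (Set.range (Y k))

theorem Y_mem_spanY (x : S.Pv) : Y k x ∈ spanY k := Submodule.subset_span ⟨x, rfl⟩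

theorem Y_mul_mem_spanY (x : S.Pv) {b : Hecke k} (hb : b ∈ spanY k) : Y k x * b ∈ spanY k := by
  induction hb using Submodule.span_induction with
  | zero => rw [mul_zero]; exact zero_mem _
  | add a b _ _ ha hb => rw [mul_add]; exact add_mem ha hb
  | smul c a _ ha => rw [mul_smul_comm]; exact Submodule.smul_mem _ _ ha
  | mem b hb =>
    obtain ⟨y, rfl⟩ := hb
    rw [← Y_add]
    exact Y_mem_spanY k _

theorem mul_Y_mem_spanY (x : S.Pv) {b : Hecke k} (hb : b ∈ spanY k) : b * Y k x ∈ spanY k := by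
  induction hb using Submodule.span_induction with
  | zero => rw [zero_mul]; exact zero_mem _
  | add a b _ _ ha hb => rw [add_mul]; exact add_mem ha hb
  | smul c a _ ha => rw [smul_mul_assoc]; exact Submodule.smul_mem _ _ ha
  | mem b hb =>
    obtain ⟨y, rfl⟩ := hb
    rw [← Y_add]
    exact Y_mem_spanY k _

/-- The coweights with this property form a subgroup, so the fundamental ones suffice: pairing 1 is
`Y_mul_T` and pairing 0 is commutation. The exact correction term is not needed, only that it lies
in the span of the Y's. -/
theorem exists_Y_mul_T (i : S.Idx) (x : S.Pv) :
    ∃ b ∈ spanY k, Y k x * T k (some i) = T k (some i) * Y k (S.refl0 i • x) + b := by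
  let B : AddSubgroup S.Pv :=
    { carrier := {x | ∃ b ∈ spanY k,
        Y k x * T k (some i) = T k (some i) * Y k (S.refl0 i • x) + b}
      zero_mem' := ⟨0, zero_mem _, by rw [smul_zero, Y_zero, one_mul, mul_one, add_zero]⟩
      add_mem' := by
        rintro x y ⟨b, hb, hx⟩ ⟨c, hc, hy⟩
        refine ⟨b * Y k (S.refl0 i • y) + Y k x * c,
          add_mem (mul_Y_mem_spanY k _ hb) (Y_mul_mem_spanY k _ hc), ?_⟩
        rw [Y_add, mul_assoc, hy, mul_add, ← mul_assoc, hx, add_mul, mul_assoc, ← Y_add, ← smul_add,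
          add_assoc]
      neg_mem' := by
        rintro x ⟨b, hb, hx⟩
        refine ⟨-(Y k (-x) * b * Y k (-(S.refl0 i • x))), Submodule.neg_mem _
          (mul_Y_mem_spanY k _ (Y_mul_mem_spanY k _ hb)), ?_⟩
        have h := congrArg (fun z => Y k (-x) * z * Y k (-(S.refl0 i • x))) hx
        simp only [mul_add, add_mul] at h
        rw [← mul_assoc, Y_neg_mul_Y, one_mul, mul_assoc, mul_assoc, Y_mul_Y_neg, mul_one] at h
        rw [smul_neg, h, add_neg_cancel_right] }
  have hf : ∀ j : S.Idx, fund j ∈ B := by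
    classical
    intro j
    by_cases hij : j = i
    · subst hij
      refine ⟨k.p (some j) • Y k (fund j), Submodule.smul_mem _ _ (Y_mem_spanY k _), ?_⟩
      refine Y_mul_T k (isDominant_iff.mpr fun l => ?_) (by rw [pr_fund, if_pos rfl])
      rw [pr_fund]; split_ifs <;> norm_num
    · refine ⟨0, zero_mem _, ?_⟩
      have h0 : S.pr (fund j) i = 0 := by rw [pr_fund, if_neg hij]
      rw [refl0_smul, h0, zero_smul, sub_zero, T_mul_Y_of_pr_eq_zero k h0, add_zero]
  have : x ∈ B := by
    rw [eq_comb x]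
    exact B.sum_mem fun j _ => B.zsmul_mem (hf j) _
  exact this

theorem Tw_mul_T (w : S.W) (j : Option S.Idx) :
    Tw k w * T k j = Tw k (w * S.s j) ∨ Tw k w * T k j = Tw k (w * S.s j) + k.p j • Tw k w := by
  rcases S.affAction.pos_or_neg (S.affAction.smul_simple_mem w j) with h | h
  · exact Or.inl (Tw_mul_s k h).symm
  · right
    have h2 := Tw_mul_s k (g := w * S.s j) (j := j) (by
      rw [mul_smul]
      rw [show S.s j • S.simple j = -S.simple j from S.affAction.s_simple j, smul_neg]
      exact h)
    rw [show w * S.s j * S.s j = w from S.affAction.mul_s_mul_s j w] at h2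
    rw [h2, mul_assoc, T_mul_T, mul_add, mul_one, mul_smul_comm]

variable {k} in
theorem Y_mem_heckeI (I : Set S.Idx) (x : S.Pv) : Y k x ∈ HeckeI k I :=
  Algebra.subset_adjoin (Or.inl ⟨x, rfl⟩)

variable {k} in
theorem T_mem_heckeI {I : Set S.Idx} {i : S.Idx} (hi : i ∈ I) : T k (some i) ∈ HeckeI k I :=
  Algebra.subset_adjoin (Or.inr ⟨i, hi, rfl⟩)

theorem W0_induction {p : S.W0 → Prop} (h1 : p 1)
    (hs : ∀ i u, S.finAction.Pos (u⁻¹ • S.finAction.simple i) → p u → p (S.finAction.s i * u))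
    (u : S.W0) : p u :=
  S.finAction.induction_left (fun g hg => by rwa [S.eq_one_of_finAction_len_eq_zero hg]) hs u

theorem pos_incl_inv_smul {u : S.W0} {i : S.Idx} :
    S.affAction.Pos ((S.incl u)⁻¹ • S.simple (some i)) ↔
      S.finAction.Pos (u⁻¹ • S.finAction.simple i) := by
  rw [RootAction.pos_inv_smul_simple_iff, ← len_incl, ← len_incl, map_mul, incl_s]
  exact RootAction.pos_inv_smul_simple_iff (Φ := S.affAction)

theorem pos_incl_smul {u : S.W0} {i : S.Idx} :
    S.affAction.Pos ((S.incl u) • S.simple (some i)) ↔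
      S.finAction.Pos (u • S.finAction.simple i) := by
  rw [RootAction.pos_smul_simple_iff, ← len_incl, ← len_incl, map_mul, incl_s]
  exact RootAction.pos_smul_simple_iff (Φ := S.affAction)

theorem Tw_incl_s_mul {u : S.W0} {i : S.Idx} (h : S.finAction.Pos (u⁻¹ • S.finAction.simple i)) :
    Tw k (S.incl (S.finAction.s i * u)) = T k (some i) * Tw k (S.incl u) := by
  have h' := Tw_s_mul k (g := S.incl u) (j := some i) (pos_incl_inv_smul.mpr h)
  rwa [show S.s (some i) * S.incl u = S.incl (S.finAction.s i * u) from
    (map_mul S.incl _ _).symm] at h'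

theorem Tw_incl_mul_s {u : S.W0} {i : S.Idx} (h : S.finAction.Pos (u • S.finAction.simple i)) :
    Tw k (S.incl (u * S.finAction.s i)) = Tw k (S.incl u) * T k (some i) := by
  have h' := Tw_mul_s k (g := S.incl u) (j := some i) (pos_incl_smul.mpr h)
  rwa [show S.incl u * S.s (some i) = S.incl (u * S.finAction.s i) from
    (map_mul S.incl _ _).symm] at h'

theorem Tw_incl_mem (u : S.W0) : Tw k (S.incl u) ∈ HeckeI k Set.univ := by
  induction u using W0_induction with
  | h1 => rw [map_one, Tw_one]; exact one_mem _
  | hs i u h ih =>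
    rw [Tw_incl_s_mul k h]
    exact mul_mem (T_mem_heckeI (Set.mem_univ i)) ih

theorem Tw_incl_mul_tau_mem (u : S.W0) {x : S.Pv} (hx : IsDominant x) :
    Tw k (S.incl u * S.tau x) ∈ HeckeI k Set.univ := by
  rw [← Tw_incl_mul_Y k u hx]
  exact mul_mem (Tw_incl_mem k u) (Y_mem_heckeI _ x)

theorem mem_of_mul_Y_mem {I : Set S.Idx} {h : Hecke k} {x : S.Pv} (hh : h * Y k x ∈ HeckeI k I) :
    h ∈ HeckeI k I := by
  have := mul_mem hh (Y_mem_heckeI I (-x))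
  rwa [mul_assoc, Y_mul_Y_neg, mul_one] at this

theorem W_eq (w : S.W) : w = S.incl w.right * S.tau (w.right⁻¹ • w.left.toAdd) := by
  rw [incl_mul_tau, smul_inv_smul]
  exact (SemidirectProduct.inl_left_mul_inr_right w).symm

/-- Write φ^∨ = μ - ν with μ and ν dominant. Then s_0 τ(μ) = s_φ τ(ν), so T_0 Y^μ is expressed
through elements of the algebra, and Y^μ is invertible there. -/
theorem T_none_mem : T k none ∈ HeckeI k (Set.univ : Set S.Idx) := by
  obtain ⟨μ, ν, hμ, hν, h, -⟩ := exists_dominant_sub (S.cor S.phi)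
  have h1 : S.s none * S.tau μ = S.incl (S.refl0 S.phi) * S.tau ν := by
    change S.incl (S.refl0 S.phi) * S.tau (-S.cor S.phi) * S.tau μ = _
    rw [mul_assoc, ← tau_add, h]
    congr 2
    abel
  refine mem_of_mul_Y_mem k (x := μ) ?_
  rw [Y_of_dominant k hμ]
  have m1 := Tw_incl_mul_tau_mem k (S.refl0 S.phi) hν
  rcases T_mul_Tw k none (S.tau μ) with e | e <;> rw [e, h1]
  · exact m1
  · refine add_mem m1 (Subalgebra.smul_mem _ ?_ _)
    rw [← Y_of_dominant k hμ]
    exact Y_mem_heckeI _ μ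

/-- A suitable dominant translation on the right makes ω into u τ(μ) with u in W₀ and μ dominant. -/
theorem TO_mem (o : S.Om) : TO k o ∈ HeckeI k (Set.univ : Set S.Idx) := by
  obtain ⟨μ, ν, hμ, hν, h, -⟩ :=
    exists_dominant_sub ((o : S.W).right⁻¹ • (o : S.W).left.toAdd : S.Pv)
  have h1 : (o : S.W) * S.tau ν = S.incl (o : S.W).right * S.tau μ := by
    conv_lhs => rw [W_eq (o : S.W)]
    rw [mul_assoc, ← tau_add, h, sub_add_cancel]
  refine mem_of_mul_Y_mem k (x := ν) ?_
  rw [Y_of_dominant k hν, ← Tw_Om, ← Tw_mul, h1]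
  · exact Tw_incl_mul_tau_mem k _ hμ
  · rw [RootAction.len_mul_of_left (Om_len o), Om_len, zero_add]

theorem heckeI_univ : HeckeI k (Set.univ : Set S.Idx) = ⊤ := by
  have h : ∀ w : S.W, Tw k w ∈ HeckeI k (Set.univ : Set S.Idx) := by
    intro w
    induction w using S.affAction.induction_left with
    | h0 g hg => exact Tw_Om k ⟨g, hg⟩ ▸ TO_mem k _
    | hs j g hj ih =>
      change Tw k (S.s j * g) ∈ _
      rw [Tw_s_mul k hj]
      refine mul_mem ?_ ih
      cases j with
      | none => exact T_none_mem k
      | some i => exact T_mem_heckeI (Set.mem_univ i)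
  refine eq_top_iff.mpr fun x _ => ?_
  have hx : x ∈ Submodule.span ℂ (Set.range (Tw k : S.W → Hecke k)) := by
    rw [span_Tw]; trivial
  have hle : Submodule.span ℂ (Set.range (Tw k : S.W → Hecke k)) ≤
      Subalgebra.toSubmodule (HeckeI k (Set.univ : Set S.Idx)) := by
    refine Submodule.span_le.mpr ?_
    rintro _ ⟨w, rfl⟩
    exact h w
  exact hle hx

/-- The element `T_u Y^λ`. -/
def TY (p : S.W0 × S.Pv) : Hecke k := Tw k (S.incl p.1) * Y k p.2

theorem TY_mem (u : S.W0) (x : S.Pv) :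
    Tw k (S.incl u) * Y k x ∈ Submodule.span ℂ (Set.range (TY k)) :=
  Submodule.subset_span ⟨(u, x), rfl⟩

theorem Tw_mul_spanY (u : S.W0) {b : Hecke k} (hb : b ∈ spanY k) :
    Tw k (S.incl u) * b ∈ Submodule.span ℂ (Set.range (TY k)) := by
  induction hb using Submodule.span_induction with
  | zero => rw [mul_zero]; exact zero_mem _
  | add a b _ _ ha hb => rw [mul_add]; exact add_mem ha hb
  | smul c a _ ha => rw [mul_smul_comm]; exact Submodule.smul_mem _ _ ha
  | mem b hb =>
    obtain ⟨y, rfl⟩ := hb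
    exact TY_mem k u y

/-- The span contains 1 and is stable under right multiplication by the Y's and T_i's, which
generate by `heckeI_univ`. -/
theorem span_TY : Submodule.span ℂ (Set.range (TY k)) = (⊤ : Submodule ℂ (Hecke k)) := by
  have key : ∀ z ∈ HeckeI k (Set.univ : Set S.Idx), ∀ x ∈ Submodule.span ℂ (Set.range (TY k)),
      x * z ∈ Submodule.span ℂ (Set.range (TY k)) := by
    intro z hz
    induction hz using Algebra.adjoin_induction with
    | algebraMap r =>
      intro x hx
      rw [← Algebra.commutes, ← Algebra.smul_def]
      exact Submodule.smul_mem _ _ hx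
    | add a b _ _ ha hb => intro x hx; rw [mul_add]; exact add_mem (ha x hx) (hb x hx)
    | mul a b _ _ ha hb => intro x hx; rw [← mul_assoc]; exact hb _ (ha x hx)
    | mem z hz =>
      intro x hx
      induction hx using Submodule.span_induction with
      | zero => rw [zero_mul]; exact zero_mem _
      | add a b _ _ ha hb => rw [add_mul]; exact add_mem ha hb
      | smul c a _ ha => rw [smul_mul_assoc]; exact Submodule.smul_mem _ _ ha
      | mem x hx =>
        obtain ⟨⟨u, y⟩, rfl⟩ := hx
        change Tw k (S.incl u) * Y k y * z ∈ _
        rcases hz with ⟨x, rfl⟩ | ⟨i, -, rfl⟩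
        · rw [mul_assoc, ← Y_add]
          exact TY_mem k u _
        · obtain ⟨b, hb, h⟩ := exists_Y_mul_T k i y
          change Tw k (S.incl u) * Y k y * T k (some i) ∈ _
          rw [mul_assoc, h, mul_add, ← mul_assoc]
          refine add_mem ?_ (Tw_mul_spanY k u hb)
          have e : S.incl u * S.s (some i) = S.incl (u * S.refl0 i) := (map_mul S.incl _ _).symm
          rcases Tw_mul_T k (S.incl u) (some i) with e' | e' <;> rw [e', e]
          · exact TY_mem k _ _
          · rw [add_mul, smul_mul_assoc]
            exact add_mem (TY_mem k _ _) (Submodule.smul_mem _ _ (TY_mem k _ _))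
  refine eq_top_iff.mpr fun z _ => ?_
  have hz : z ∈ HeckeI k (Set.univ : Set S.Idx) := by rw [heckeI_univ]; trivial
  have h1 : (1 : Hecke k) ∈ Submodule.span ℂ (Set.range (TY k)) := by
    have := TY_mem k 1 0
    rwa [map_one, Tw_one, Y_zero, one_mul] at this
  have := key z hz 1 h1
  rwa [one_mul] at this

theorem exists_dominant_add (s : Finset (S.W0 × S.Pv)) :
    ∃ μ : S.Pv, ∀ p ∈ s, IsDominant (p.2 + μ) := by
  classical
  choose f g hf hg h _ using exists_dominant_sub (S := S)
  refine ⟨∑ p ∈ s, g p.2, fun p hp => ?_⟩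
  rw [← Finset.add_sum_erase s _ hp, ← add_assoc]
  have h2 : p.2 + g p.2 = f p.2 := eq_sub_iff_add_eq.mp (h p.2)
  rw [h2]
  refine (hf p.2).add ?_
  refine Finset.sum_induction _ IsDominant (fun _ _ h h' => h.add h') ?_ fun q _ => hg q.2
  exact isDominant_iff.mpr fun i => (map_zero (S.prHom i)).ge

/-- Multiplying a relation by Y^μ with μ dominant enough makes all its coweights dominant; it then
becomes a relation between distinct T_w. -/
theorem linearIndependent_TY : LinearIndependent ℂ (TY k) := by
  rw [linearIndependent_iff']
  intro s c hc p hp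
  obtain ⟨μ, hμ⟩ := exists_dominant_add s
  have hinj : Function.Injective fun p : S.W0 × S.Pv => S.incl p.1 * S.tau (p.2 + μ) := by
    intro p q h
    have hr : p.1 = q.1 := by
      have := congrArg SemidirectProduct.right h
      simpa [incl, tau] using this
    have h' : S.incl p.1 * S.tau (p.2 + μ) = S.incl q.1 * S.tau (q.2 + μ) := h
    rw [hr] at h'
    have h2 := mul_left_cancel h'
    have h3 : p.2 + μ = q.2 + μ := by
      have := SemidirectProduct.inl_injective h2
      exact Multiplicative.ofAdd.injective this
    exact Prod.ext hr (add_right_cancel h3)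
  refine linearIndependent_iff'.mp ((linearIndependent_Tw k).comp _ hinj) s c ?_ p hp
  have h := congrArg (· * Y k μ) hc
  simp only [zero_mul, Finset.sum_mul] at h
  rw [← h]
  refine Finset.sum_congr rfl fun q hq => ?_
  rw [smul_mul_assoc, TY, mul_assoc, ← Y_add, Tw_incl_mul_Y k _ (hμ q hq)]
  rfl

/-- The basis `T_u Y^λ` of the Hecke algebra. -/
def basisTY : Module.Basis (S.W0 × S.Pv) ℂ (Hecke k) :=
  Module.Basis.mk (linearIndependent_TY k) (span_TY k).ge

theorem basisTY_apply (p : S.W0 × S.Pv) : basisTY k p = TY k p := Module.Basis.mk_apply ..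

/-- The span of the `T_u Y^λ` with `l(u) < n`. -/
def lower (n : ℕ) : Submodule ℂ (Hecke k) :=
  Submodule.span ℂ {z | ∃ (u : S.W0) (x : S.Pv), S.finAction.len u < n ∧
    z = Tw k (S.incl u) * Y k x}

theorem lower_mono {m n : ℕ} (h : m ≤ n) : lower k m ≤ lower k n :=
  Submodule.span_mono fun _ ⟨u, x, hu, hz⟩ => ⟨u, x, hu.trans_le h, hz⟩

theorem T_mul_mem_lower (i : S.Idx) {n : ℕ} {z : Hecke k} (hz : z ∈ lower k n) :
    T k (some i) * z ∈ lower k (n + 1) := by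
  induction hz using Submodule.span_induction with
  | zero => rw [mul_zero]; exact zero_mem _
  | add a b _ _ ha hb => rw [mul_add]; exact add_mem ha hb
  | smul c a _ ha => rw [mul_smul_comm]; exact Submodule.smul_mem _ _ ha
  | mem z hz =>
    obtain ⟨u, x, hu, rfl⟩ := hz
    have e : S.s (some i) * S.incl u = S.incl (S.finAction.s i * u) := (map_mul S.incl _ _).symm
    have hl := RootAction.len_s_mul_le (Φ := S.finAction) i u
    have m1 : Tw k (S.incl (S.finAction.s i * u)) * Y k x ∈ lower k (n + 1) :=
      Submodule.subset_span ⟨_, x, by omega, rfl⟩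
    rw [← mul_assoc]
    rcases T_mul_Tw k (some i) (S.incl u) with e' | e' <;> rw [e', e]
    · exact m1
    · rw [add_mul, smul_mul_assoc]
      exact add_mem m1 (Submodule.smul_mem _ _ (Submodule.subset_span ⟨u, x, by omega, rfl⟩))

/-- Triangularity of the Y's with respect to length. It identifies the eigenvalue of Y^x on the top
coordinate of the induced module. -/
theorem exists_Y_mul_Tw (u : S.W0) (x : S.Pv) : ∃ b ∈ lower k (S.finAction.len u),
    Y k x * Tw k (S.incl u) = Tw k (S.incl u) * Y k (u⁻¹ • x) + b := by
  induction u using W0_induction generalizing x with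
  | h1 =>
    refine ⟨0, zero_mem _, ?_⟩
    rw [map_one, Tw_one, inv_one, one_smul, mul_one, one_mul, add_zero]
  | hs i u h ih =>
    obtain ⟨b, hb, hi⟩ := exists_Y_mul_T k i x
    obtain ⟨c, hc, hu⟩ := ih (S.refl0 i • x)
    have hl := RootAction.len_s_mul (Φ := S.finAction) h
    have hbm : ∀ b ∈ spanY k, b * Tw k (S.incl u) ∈ lower k (S.finAction.len u + 1) := by
      intro b hb
      induction hb using Submodule.span_induction with
      | zero => rw [zero_mul]; exact zero_mem _
      | add a b _ _ ha hb => rw [add_mul]; exact add_mem ha hb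
      | smul c a _ ha => rw [smul_mul_assoc]; exact Submodule.smul_mem _ _ ha
      | mem b hb =>
        obtain ⟨y, rfl⟩ := hb
        obtain ⟨c, hc, hu⟩ := ih y
        rw [hu]
        exact add_mem (Submodule.subset_span ⟨u, _, by omega, rfl⟩)
          (lower_mono k (by omega) hc)
    refine ⟨T k (some i) * c + b * Tw k (S.incl u), ?_, ?_⟩
    · rw [hl]
      exact add_mem (T_mul_mem_lower k i hc) (hbm b hb)
    · have e : (S.finAction.s i * u)⁻¹ • x = u⁻¹ • S.refl0 i • x := by
        rw [mul_inv_rev, mul_smul, S.finAction.s_inv]; rfl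
      rw [Tw_incl_s_mul k h, ← mul_assoc, hi, add_mul, mul_assoc, hu, mul_add, e, mul_assoc,
        add_assoc]

end EuclideanRootSystem

end

/-! ### Products over inversion sets. -/

noncomputable section

set_option linter.unusedSectionVars false

namespace RootAction

variable {G B E : Type*} [Group G] [AddCommGroup E] [DistribMulAction G E] {Φ : RootAction G B E}

theorem inv_s_mul {g : G} {j : B} (h : Φ.Pos (g⁻¹ • Φ.simple j)) :
    Φ.inv (Φ.s j * g) = insert (g⁻¹ • Φ.simple j) (Φ.inv g) := by
  ext a
  simp only [Set.mem_insert_iff, inv, Set.mem_ofPred_eq, mul_smul]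
  constructor
  · rintro ⟨h1, h2⟩
    rcases Φ.pos_or_neg (Φ.smul_mem g h1.1) with h3 | h3
    · left
      rw [← h3.eq_simple_of_neg h2, inv_smul_smul]
    · exact Or.inr ⟨h1, h3⟩
  · rintro (rfl | ⟨h1, h2⟩)
    · refine ⟨h, ?_⟩
      rw [smul_inv_smul, Φ.s_simple, neg_neg]
      exact Φ.pos_simple j
    · refine ⟨h1, ?_⟩
      rw [← smul_neg]
      refine h2.s_smul fun h3 => ?_
      rw [← h3, smul_neg, inv_smul_smul] at h
      exact h1.not_neg h

variable {M : Type*} [CommGroup M]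

variable (Φ) in
/-- The product over the roots that `g` makes negative. -/
def invProd (c : E → M) (g : G) : M := ∏ᶠ a ∈ Φ.inv g, c a

variable {c : E → M}

/-- A W₀-invariant function multiplied over the inversions gains one factor at each ascent. The
value of a character on T_u is thereby defined without choosing a reduced word. -/
theorem invProd_mul_s (hc : ∀ (g : G) a, c (g • a) = c a) {g : G} {j : B}
    (h : Φ.Pos (g • Φ.simple j)) : Φ.invProd c (g * Φ.s j) = c (Φ.simple j) * Φ.invProd c g := by
  rw [invProd, inv_mul_s h, finprod_mem_insert _ _ ((Φ.inv_finite g).image _),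
    finprod_mem_image (MulAction.injective _).injOn]
  · simp only [hc]; rfl
  · rintro ⟨a, ha, h2⟩
    have h2' : Φ.s j • a = Φ.simple j := h2
    have h3 : a = -Φ.simple j := by rw [← Φ.s_smul_s_smul j a, h2', Φ.s_simple]
    rw [h3] at ha
    exact (Φ.pos_simple j).not_neg ha.1

theorem invProd_s_mul (hc : ∀ (g : G) a, c (g • a) = c a) {g : G} {j : B}
    (h : Φ.Pos (g⁻¹ • Φ.simple j)) :
    Φ.invProd c (Φ.s j * g) = c (Φ.simple j) * Φ.invProd c g := by
  rw [invProd, inv_s_mul h, finprod_mem_insert _ _ (Φ.inv_finite g), hc]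
  · rfl
  · intro h1
    have h2 := h1.2
    rw [smul_inv_smul] at h2
    exact (Φ.pos_simple j).not_neg h2

theorem pos_s_mul_smul {g : G} {j : B} (h : Φ.Pos (-(g • Φ.simple j))) :
    Φ.Pos ((g * Φ.s j) • Φ.simple j) := by rwa [mul_smul, Φ.s_simple, smul_neg]

theorem pos_s_mul_inv_smul {g : G} {j : B} (h : Φ.Pos (-(g⁻¹ • Φ.simple j))) :
    Φ.Pos ((Φ.s j * g)⁻¹ • Φ.simple j) := by
  rwa [mul_inv_rev, mul_smul, Φ.s_inv, Φ.s_simple, smul_neg]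

end RootAction

namespace EuclideanRootSystem

variable {ι V : Type*} [Finite ι] [NormedAddCommGroup V] [InnerProductSpace ℝ V]
  {S : EuclideanRootSystem ι V} {I : Set S.Idx}

/-! ### Parabolic subgroups -/

theorem s_mem_W0sub {i : S.Idx} (hi : i ∈ I) : S.finAction.s i ∈ S.W0sub I :=
  Subgroup.subset_closure ⟨i, hi, rfl⟩

theorem sub_smul_mem_span {v : S.W0} (hv : v ∈ S.W0sub I) (x : S.Pv) :
    x - v • x ∈ Submodule.span ℤ (S.finAction.simple '' I) := by
  induction hv using Subgroup.closure_induction generalizing x with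
  | mem v hv =>
    obtain ⟨i, hi, rfl⟩ := hv
    change x - S.refl0 i • x ∈ _
    rw [refl0_smul, sub_sub_cancel]
    exact Submodule.smul_mem _ _ (Submodule.subset_span ⟨i, hi, rfl⟩)
  | one => rw [one_smul, sub_self]; exact zero_mem _
  | mul u v _ _ hu hv =>
    have := add_mem (hv x) (hu (v • x))
    rwa [sub_add_sub_cancel, ← mul_smul] at this
  | inv v _ hv =>
    have := Submodule.neg_mem _ (hv (v⁻¹ • x))
    rwa [smul_inv_smul, neg_sub] at this

theorem mem_closure_of_W0sub {v : S.W0} (hv : v ∈ S.W0sub I) {a : S.Pv} (ha : S.finAction.Pos a)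
    (h : S.finAction.Pos (-(v • a))) : a ∈ AddSubmonoid.closure (S.finAction.simple '' I) :=
  RootAction.mem_closure_of_add_mem_span ha.2 h.2 (by
    rw [← sub_eq_add_neg]; exact sub_smul_mem_span hv a)

theorem mem_W0min_iff {w : S.W0} :
    w ∈ S.W0min I ↔ ∀ i ∈ I, S.finAction.Pos (w • S.finAction.simple i) := by
  refine forall₂_congr fun i _ => ?_
  rw [RootAction.pos_smul_simple_iff, len0_eq, len0_eq]
  rfl

theorem pos_smul_of_mem_W0min {w : S.W0} (hw : w ∈ S.W0min I) {a : S.Pv} (ha : S.finAction.Pos a)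
    (haI : a ∈ AddSubmonoid.closure (S.finAction.simple '' I)) : S.finAction.Pos (w • a) :=
  RootAction.Pos.of_smul_simple (mem_W0min_iff.mp hw) ha.1 haI

/-- A simple root made negative by v⁻¹w lies in the span of `I`, together with its image. On
positive roots of that span both v and w preserve positivity, which gives contradictory signs for w
applied to the root. -/
theorem eq_of_mem_W0min {v w : S.W0} (hv : v ∈ S.W0min I) (hw : w ∈ S.W0min I)
    (h : v⁻¹ * w ∈ S.W0sub I) : v = w := by
  by_contra hne
  have hl : S.finAction.len (v⁻¹ * w) ≠ 0 := fun h0 =>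
    hne (inv_mul_eq_one.mp (S.eq_one_of_finAction_len_eq_zero h0))
  obtain ⟨i, hi⟩ := RootAction.exists_neg_of_len_ne_zero hl
  have h1 := mem_closure_of_W0sub h (S.finAction.pos_simple i) hi
  have h2 := pos_smul_of_mem_W0min hw (S.finAction.pos_simple i) h1
  have h3 := sub_smul_mem_span h (S.finAction.simple i)
  have h4 : S.finAction.simple i ∈ Submodule.span ℤ (S.finAction.simple '' I) :=
    (AddSubmonoid.closure_le (S := (Submodule.span ℤ (S.finAction.simple '' I)).toAddSubmonoid)).mpr
      Submodule.subset_span h1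
  have h5 : -((v⁻¹ * w) • S.finAction.simple i) ∈
      Submodule.span ℤ (S.finAction.simple '' I) := by
    have := sub_mem h3 h4
    rwa [sub_sub_cancel_left] at this
  have h6 := pos_smul_of_mem_W0min hv hi (hi.mem_closure_of_mem_span h5)
  rw [smul_neg, mul_smul, smul_inv_smul] at h6
  exact h2.not_neg h6

/-- Maximal length excludes right ascents, so every simple root, hence every positive root, becomes
negative. -/
theorem w0_smul_neg {a : S.Pv} (ha : S.finAction.Pos a) : S.finAction.Pos (-(S.w0 • a)) := by
  have h1 : ∀ i, S.finAction.Pos (-(S.w0 • S.finAction.simple i)) := by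
    intro i
    rw [← RootAction.not_pos_iff (S.finAction.smul_simple_mem _ _),
      RootAction.pos_smul_simple_iff, ← len0_eq, ← len0_eq, not_lt]
    exact S.exists_longest.choose_spec _
  refine ⟨S.finAction.neg_mem (S.finAction.smul_mem _ ha.1), ?_⟩
  obtain ⟨hR, ha⟩ := ha
  clear hR
  induction ha using AddSubmonoid.closure_induction with
  | mem a ha => obtain ⟨i, rfl⟩ := ha; exact (h1 i).2
  | zero => rw [smul_zero, neg_zero]; exact zero_mem _
  | add a b _ _ ha hb => rw [smul_add, neg_add]; exact add_mem ha hb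

variable (S I) in
/-- The minimal representative of the coset of the longest element. -/
abbrev wbar : S.W0 := S.minRep I S.w0

theorem wbar_spec : (S.wbar I)⁻¹ * S.w0 ∈ S.W0sub I ∧
    ∀ v : S.W0, v⁻¹ * S.w0 ∈ S.W0sub I → S.len0 (S.wbar I) ≤ S.len0 v :=
  (S.exists_minRep I S.w0).choose_spec

theorem len_wbar_le {u : S.W0} (h : (S.wbar I)⁻¹ * u ∈ S.W0sub I) :
    S.finAction.len (S.wbar I) ≤ S.finAction.len u := by
  rw [← len0_eq, ← len0_eq]
  refine wbar_spec.2 u ?_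
  have := mul_mem (inv_mem h) (wbar_spec (S := S) (I := I)).1
  rwa [mul_inv_rev, inv_inv, mul_assoc, mul_inv_cancel_left] at this

theorem wbar_mem : S.wbar I ∈ S.W0min I := by
  rw [mem_W0min_iff]
  intro i hi
  rw [← RootAction.not_pos_neg_iff (S.finAction.smul_simple_mem _ _)]
  intro h
  have h1 := RootAction.len_mul_s_of_neg h
  have h2 := len_wbar_le (S := S) (I := I) (u := S.wbar I * S.finAction.s i) (by
    rw [inv_mul_cancel_left]; exact s_mem_W0sub hi)
  omega

/-- Write w̄₀ = w₀v with v ∈ W_{0,I}. Positive roots that v inverts lie in the span of `I`, where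
`w` keeps them positive; so an inversion of `w` stays positive under v and is negated by w₀. -/
theorem neg_wbar_smul {w : S.W0} (hw : w ∈ S.W0min I) {a : S.Pv} (ha : S.finAction.Pos a)
    (h : S.finAction.Pos (-(w • a))) : S.finAction.Pos (-(S.wbar I • a)) := by
  have hu := inv_mem (wbar_spec (S := S) (I := I)).1
  have e : S.wbar I • a = S.w0 • ((S.wbar I)⁻¹ * S.w0)⁻¹ • a := by
    rw [mul_inv_rev, inv_inv, mul_smul, smul_inv_smul]
  rw [e]
  refine w0_smul_neg ((RootAction.not_pos_neg_iff (S.finAction.smul_mem _ ha.1)).mp fun h1 => ?_)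
  exact (pos_smul_of_mem_W0min hw ha (mem_closure_of_W0sub hu ha h1)).not_neg h

theorem len_le_len_wbar {w : S.W0} (hw : w ∈ S.W0min I) :
    S.finAction.len w ≤ S.finAction.len (S.wbar I) :=
  Set.ncard_le_ncard (fun _ ha => ⟨ha.1, neg_wbar_smul hw ha.1 ha.2⟩) (S.finAction.inv_finite _)

theorem s_mul_mem_W0min {w : S.W0} (hw : w ∈ S.W0min I) {j : S.Idx}
    (hj : ∀ i ∈ I, w⁻¹ • S.finAction.simple j ≠ S.finAction.simple i) :
    S.finAction.s j * w ∈ S.W0min I := by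
  rw [mem_W0min_iff] at hw ⊢
  intro i hi
  rw [mul_smul]
  refine (hw i hi).s_smul fun h => hj i hi ?_
  rw [← h, inv_smul_smul]

/-- A left descent of w w̄₀⁻¹ is a left ascent of `w` that remains among the minimal
representatives, since inversions of `w` are inversions of w̄₀. This connects every minimal
representative with w̄₀. -/
theorem exists_ascent {w : S.W0} (hw : w ∈ S.W0min I) (hne : w ≠ S.wbar I) :
    ∃ i, S.finAction.Pos (w⁻¹ • S.finAction.simple i) ∧ S.finAction.s i * w ∈ S.W0min I ∧
      S.finAction.Pos (-((w * (S.wbar I)⁻¹)⁻¹ • S.finAction.simple i)) := by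
  have hl : S.finAction.len (w * (S.wbar I)⁻¹) ≠ 0 := fun h0 =>
    hne (mul_inv_eq_one.mp (S.eq_one_of_finAction_len_eq_zero h0))
  obtain ⟨i, hi⟩ := RootAction.exists_neg_left_of_len_ne_zero hl
  have e : (w * (S.wbar I)⁻¹)⁻¹ • S.finAction.simple i =
      S.wbar I • w⁻¹ • S.finAction.simple i := by rw [mul_inv_rev, inv_inv, mul_smul]
  refine ⟨i, ?_, s_mul_mem_W0min hw fun i' hi' h => ?_, hi⟩
  · rw [← RootAction.not_pos_neg_iff (S.finAction.smul_simple_mem _ _)]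
    intro h
    have := neg_wbar_smul hw h (by
      rw [smul_neg, smul_inv_smul, neg_neg]; exact S.finAction.pos_simple i)
    rw [smul_neg, neg_neg, ← e] at this
    exact this.not_neg hi
  · rw [e, h] at hi
    exact (mem_W0min_iff.mp wbar_mem i' hi').not_neg hi

/-- Otherwise s_j w̄₀ would be a minimal representative longer than w̄₀. -/
theorem exists_of_pos_wbar_inv {j : S.Idx}
    (h : S.finAction.Pos ((S.wbar I)⁻¹ • S.finAction.simple j)) :
    ∃ i ∈ I, (S.wbar I)⁻¹ • S.finAction.simple j = S.finAction.simple i := by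
  by_contra! h'
  have h1 := len_le_len_wbar (s_mul_mem_W0min wbar_mem h')
  have h2 := RootAction.len_s_mul (Φ := S.finAction) h
  omega

theorem mem_star_iff {j : S.Idx} :
    j ∈ S.star I ↔ ∃ i ∈ I, S.wbar I • S.finAction.simple i = S.finAction.simple j := by
  refine exists_congr fun i => and_congr_right fun _ => ?_
  change S.wbar I • S.root i = S.root j ↔ S.wbar I • S.cor i = S.cor j
  rw [smul_root, smul_cor]
  exact ⟨fun h => congrArg S.cor (S.P.root.injective h),
    fun h => congrArg S.root (S.cor_injective h)⟩

/-- Split w̄₀α_i = P + N by the sign that w̄₀⁻¹ gives to simple roots. Then -w̄₀⁻¹N is positive and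
lies in the cone of `I`, which w̄₀ keeps positive, so both N and -N are positive and N = 0. Now α_i
is a combination of the simple roots w̄₀⁻¹α_j, so it is one of them. -/
theorem exists_wbar_smul {i : S.Idx} (hi : i ∈ I) :
    ∃ j ∈ S.star I, S.wbar I • S.finAction.simple i = S.finAction.simple j := by
  let Φ := S.finAction
  let J : Set S.Idx := {j | Φ.Pos ((S.wbar I)⁻¹ • Φ.simple j)}
  have hpos := mem_W0min_iff.mp (wbar_mem (S := S) (I := I)) i hi
  have hdec : S.wbar I • Φ.simple i ∈
      AddSubmonoid.closure (Φ.simple '' J) ⊔ AddSubmonoid.closure (Φ.simple '' Jᶜ) := by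
    rw [← AddSubmonoid.closure_union, ← Set.image_union, Set.union_compl_self, Set.image_univ]
    exact hpos.2
  obtain ⟨P, hP, N, hN, hPN⟩ := AddSubmonoid.mem_sup.mp hdec
  have hP' : ∀ I' : Set S.Idx, (∀ j ∈ J, ∃ i ∈ I', (S.wbar I)⁻¹ • Φ.simple j = Φ.simple i) →
      (S.wbar I)⁻¹ • P ∈ AddSubmonoid.closure (Φ.simple '' I') := by
    intro I' hI'
    clear hPN
    induction hP using AddSubmonoid.closure_induction with
    | mem a ha =>
      obtain ⟨j, hj, rfl⟩ := ha
      obtain ⟨i, hi, h⟩ := hI' j hj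
      rw [h]
      exact AddSubmonoid.subset_closure ⟨i, hi, rfl⟩
    | zero => rw [smul_zero]; exact zero_mem _
    | add a b _ _ ha hb => rw [smul_add]; exact add_mem ha hb
  have hN' : -((S.wbar I)⁻¹ • N) ∈ AddSubmonoid.closure (Set.range Φ.simple) := by
    clear hPN
    induction hN using AddSubmonoid.closure_induction with
    | mem a ha =>
      obtain ⟨j, hj, rfl⟩ := ha
      exact ((RootAction.not_pos_iff (Φ.smul_simple_mem _ _)).mp hj).2
    | zero => rw [smul_zero, neg_zero]; exact zero_mem _
    | add a b _ _ ha hb => rw [smul_add, neg_add]; exact add_mem ha hb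
  have hN0 : N ∈ AddSubmonoid.closure (Set.range Φ.simple) :=
    AddSubmonoid.closure_mono (Set.image_subset_range _ _) hN
  have hspan : ∀ I' : Set S.Idx, ∀ a ∈ AddSubmonoid.closure (Φ.simple '' I'),
      a ∈ Submodule.span ℤ (Φ.simple '' I') := fun I' a ha =>
    (AddSubmonoid.closure_le (S := (Submodule.span ℤ (Φ.simple '' I')).toAddSubmonoid)).mpr
      Submodule.subset_span ha
  have e1 : Φ.simple i = (S.wbar I)⁻¹ • P + (S.wbar I)⁻¹ • N := by
    rw [← smul_add, hPN, inv_smul_smul]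
  have h1 : -((S.wbar I)⁻¹ • N) ∈ AddSubmonoid.closure (Φ.simple '' I) := by
    refine RootAction.mem_closure_of_add_mem_span (y := Φ.simple i) hN' (Φ.pos_simple i).2 ?_
    rw [e1, neg_add_cancel_comm_assoc]
    exact hspan I _ (hP' I fun j hj => exists_of_pos_wbar_inv hj)
  have h2 : -N ∈ AddSubmonoid.closure (Set.range Φ.simple) := by
    have h3 : ∀ a ∈ AddSubmonoid.closure (Φ.simple '' I),
        S.wbar I • a ∈ AddSubmonoid.closure (Set.range Φ.simple) := by
      intro a ha
      induction ha using AddSubmonoid.closure_induction with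
      | mem a ha =>
        obtain ⟨l, hl, rfl⟩ := ha
        exact (mem_W0min_iff.mp wbar_mem l hl).2
      | zero => rw [smul_zero]; exact zero_mem _
      | add a b _ _ ha hb => rw [smul_add]; exact add_mem ha hb
    have := h3 _ h1
    rwa [smul_neg, smul_inv_smul] at this
  have hN00 : N = 0 := by
    have := RootAction.mem_closure_of_add_mem_span (Φ := Φ) (I := ∅) hN0 h2 (by simp)
    simpa using this
  rw [hN00, smul_zero, add_zero] at e1
  have hex : ∃ j ∈ J, (S.wbar I)⁻¹ • Φ.simple j = Φ.simple i := by
    by_contra! hno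
    have h3 := hspan _ _ (hP' {i}ᶜ fun j hj => by
      obtain ⟨i', _, h⟩ := exists_of_pos_wbar_inv hj
      exact ⟨i', fun h' => hno j hj (by rw [h, Set.mem_singleton_iff.mp h']), h⟩)
    rw [← e1] at h3
    exact Φ.linInd.notMem_span_image (by simp) h3
  obtain ⟨j, _, hj⟩ := hex
  have h4 : S.wbar I • Φ.simple i = Φ.simple j := by rw [← hj, smul_inv_smul]
  exact ⟨j, mem_star_iff.mpr ⟨i, hi, h4⟩, h4⟩

theorem mul_wbar_mem {y : S.W0} (hy : y ∈ S.W0min (S.star I)) : y * S.wbar I ∈ S.W0min I := by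
  rw [mem_W0min_iff] at hy ⊢
  intro i hi
  obtain ⟨j, hj, h⟩ := exists_wbar_smul hi
  rw [mul_smul, h]
  exact hy j hj

end EuclideanRootSystem

end

noncomputable section

set_option linter.unusedSectionVars false

namespace EuclideanRootSystem

variable {ι V : Type*} [Finite ι] [NormedAddCommGroup V] [InnerProductSpace ℝ V]
  {S : EuclideanRootSystem ι V} (k : S.Mult) (ε : ℤˣ)

/-! ### The values of the characters -/

/-- The value `ε k_i^ε` of the characters on `T_i`. -/
def cval (i : S.Idx) : ℂ := ((ε : ℤ) : ℂ) * (k.val (some i) ^ (ε : ℤ) : ℂˣ)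

theorem cval_mul_self (i : S.Idx) : cval k ε i * cval k ε i = 1 + k.p (some i) * cval k ε i := by
  have h : (k.val (some i) : ℂ) * ((k.val (some i))⁻¹ : ℂˣ) = 1 := by simp
  rcases Int.units_eq_one_or ε with rfl | rfl
  · simp only [cval, Mult.p, Units.val_one, Int.cast_one, one_mul, zpow_one]
    linear_combination h
  · simp only [cval, Mult.p, Units.val_neg, Units.val_one, Int.cast_neg, Int.cast_one, zpow_neg,
      zpow_one]
    linear_combination h

/-- This is where γ^{α_i^∨} = k_i^{±2} enters. With t = γ^{-α_i^∨} it is the relation `Y_mul_T`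
evaluated by the character, after division by the common torus value. -/
theorem cval_eq_add {i : S.Idx} {t : ℂ} (ht : ((k.val (some i) ^ (ε : ℤ)) ^ 2 : ℂˣ) * t = 1) :
    cval k ε i * t + k.p (some i) = cval k ε i := by
  have h : (k.val (some i) : ℂ) * ((k.val (some i))⁻¹ : ℂˣ) = 1 := by simp
  rcases Int.units_eq_one_or ε with rfl | rfl
  · simp only [cval, Mult.p, Units.val_one, Int.cast_one, one_mul, zpow_one, Units.val_pow_eq_pow_val]
      at ht ⊢
    linear_combination (((k.val (some i))⁻¹ : ℂˣ) : ℂ) * ht - ((k.val (some i) : ℂ) * t) * h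
  · simp only [cval, Mult.p, Units.val_neg, Units.val_one, Int.cast_neg, Int.cast_one, zpow_neg,
      zpow_one, Units.val_pow_eq_pow_val] at ht ⊢
    linear_combination (-(k.val (some i) : ℂ)) * ht + ((((k.val (some i))⁻¹ : ℂˣ) : ℂ) * t) * h

open Classical in
/-- The value of the characters at a root. -/
def cpar (x : S.Pv) : ℂˣ :=
  if h : ((0, x) : S.Aff) ∈ S.R then
    Units.map (Int.castRingHom ℂ).toMonoidHom ε * k.toFun ⟨(0, x), h⟩ ^ (ε : ℤ) else 1

theorem cpar_simple (i : S.Idx) : (cpar k ε (S.finAction.simple i) : ℂ) = cval k ε i := by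
  have h : ((0, S.finAction.simple i) : S.Aff) ∈ S.R := S.simple_mem_R (some i)
  rw [cpar, dif_pos h, Units.val_mul]
  rfl

theorem cpar_smul (u : S.W0) (x : S.Pv) : cpar k ε (u • x) = cpar k ε x := by
  have e : S.incl u • ((0, x) : S.Aff) = (0, u • x) := incl_smul S u _
  by_cases h : ((0, x) : S.Aff) ∈ S.R
  · have h' : ((0, u • x) : S.Aff) ∈ S.R := by rw [← e]; exact S.act_mem_R _ h
    rw [cpar, cpar, dif_pos h, dif_pos h',
      k.toFun_smul (a := ⟨(0, x), h⟩) (b := ⟨(0, u • x), h'⟩) (S.incl u) e]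
  · have hux : ((0, u • x) : S.Aff) ∉ S.R := fun h' => h (by
      have := S.act_mem_R (S.incl u)⁻¹ h'
      rwa [← smul_eq_act, ← e, inv_smul_smul] at this)
    rw [cpar, cpar, dif_neg h, dif_neg hux]

/-- The value of the characters on `T_u`. -/
def chi0 (u : S.W0) : ℂˣ := S.finAction.invProd (cpar k ε) u

theorem chi0_mul_s {u : S.W0} {i : S.Idx} (h : S.finAction.Pos (u • S.finAction.simple i)) :
    (chi0 k ε (u * S.finAction.s i) : ℂ) = cval k ε i * chi0 k ε u := by
  rw [chi0, RootAction.invProd_mul_s (cpar_smul k ε) h, Units.val_mul, cpar_simple]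
  rfl

theorem chi0_s_mul {u : S.W0} {i : S.Idx} (h : S.finAction.Pos (u⁻¹ • S.finAction.simple i)) :
    (chi0 k ε (S.finAction.s i * u) : ℂ) = cval k ε i * chi0 k ε u := by
  rw [chi0, RootAction.invProd_s_mul (cpar_smul k ε) h, Units.val_mul, cpar_simple]
  rfl

open Classical in
/-- The functions on `W₀` that are dual to the minimal coset representatives. -/
def dualFun (I : Set S.Idx) (v u : S.W0) : ℂ :=
  if v⁻¹ * u ∈ S.W0sub I then (chi0 k ε u : ℂ) * ((chi0 k ε v)⁻¹ : ℂˣ) else 0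

/-- The property of a function on `W₀` that makes its extension equivariant for `H_I`. -/
def IsCharFun (I : Set S.Idx) (g : S.W0 → ℂ) : Prop :=
  ∀ i ∈ I, ∀ u : S.W0, S.finAction.Pos (u • S.finAction.simple i) →
    g (u * S.finAction.s i) = cval k ε i * g u

theorem isCharFun_dualFun (I : Set S.Idx) (v : S.W0) : IsCharFun k ε I (dualFun k ε I v) := by
  intro i hi u hu
  have h : v⁻¹ * (u * S.finAction.s i) ∈ S.W0sub I ↔ v⁻¹ * u ∈ S.W0sub I := by
    rw [← mul_assoc]
    exact (S.W0sub I).mul_mem_cancel_right (s_mem_W0sub hi)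
  by_cases hm : v⁻¹ * u ∈ S.W0sub I
  · rw [dualFun, if_pos (h.mpr hm), dualFun, if_pos hm, chi0_mul_s k ε hu, mul_assoc]
  · rw [dualFun, if_neg (fun h' => hm (h.mp h')), dualFun, if_neg hm, mul_zero]

theorem dualFun_self (I : Set S.Idx) (v : S.W0) : dualFun k ε I v v = 1 := by
  rw [dualFun, if_pos (by rw [inv_mul_cancel]; exact one_mem _)]
  simp

theorem dualFun_of_ne {I : Set S.Idx} {v w : S.W0} (hv : v ∈ S.W0min I) (hw : w ∈ S.W0min I)
    (h : v ≠ w) : dualFun k ε I v w = 0 :=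
  if_neg fun hm => h (eq_of_mem_W0min hv hw hm)

/-! ### Equivariant functionals -/

/-- The value of a point of the torus. -/
def tv (γ : S.Torus) (x : S.Pv) : ℂ := (γ (.ofAdd x) : ℂˣ)

theorem tv_add (γ : S.Torus) (x y : S.Pv) : tv γ (x + y) = tv γ x * tv γ y := by
  rw [tv, ofAdd_add, map_mul, Units.val_mul]; rfl

theorem tv_zero (γ : S.Torus) : tv γ 0 = 1 := by
  rw [tv, ofAdd_zero, map_one, Units.val_one]

theorem tv_mul_tv_neg (γ : S.Torus) (x : S.Pv) : tv γ x * tv γ (-x) = 1 := by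
  rw [← tv_add, add_neg_cancel, tv_zero]

/-- The functional with `T_u Y^λ ↦ g(u) γ^λ`. -/
def extFun (γ : S.Torus) (g : S.W0 → ℂ) : Hecke k →ₗ[ℂ] ℂ :=
  (basisTY k).constr ℂ fun p => g p.1 * tv γ p.2

variable {k ε} {γ : S.Torus} {g : S.W0 → ℂ} {I : Set S.Idx}

theorem extFun_apply (u : S.W0) (x : S.Pv) :
    extFun k γ g (Tw k (S.incl u) * Y k x) = g u * tv γ x := by
  have h : Tw k (S.incl u) * Y k x = basisTY k (u, x) := (basisTY_apply k (u, x)).symm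
  rw [h, extFun, Module.Basis.constr_basis]

theorem extFun_Tw (u : S.W0) : extFun k γ g (Tw k (S.incl u)) = g u := by
  have := extFun_apply (k := k) (γ := γ) (g := g) u 0
  rwa [Y_zero, mul_one, tv_zero, mul_one] at this

theorem hecke_induction {p : Hecke k → Prop} (h : Hecke k)
    (hb : ∀ u x, p (Tw k (S.incl u) * Y k x)) (h0 : p 0) (ha : ∀ a b, p a → p b → p (a + b))
    (hs : ∀ (c : ℂ) a, p a → p (c • a)) : p h := by
  have hh : h ∈ Submodule.span ℂ (Set.range (TY k)) := by rw [span_TY]; trivial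
  induction hh using Submodule.span_induction with
  | zero => exact h0
  | add a b _ _ h1 h2 => exact ha a b h1 h2
  | smul c a _ h1 => exact hs c a h1
  | mem a h1 => obtain ⟨⟨u, x⟩, rfl⟩ := h1; exact hb u x

theorem extFun_mul_Y (h : Hecke k) (x : S.Pv) :
    extFun k γ g (h * Y k x) = tv γ x * extFun k γ g h := by
  induction h using hecke_induction with
  | hb u y => rw [mul_assoc, ← Y_add, extFun_apply, extFun_apply, tv_add]; ring
  | h0 => rw [zero_mul, map_zero, mul_zero]
  | ha a b ha hb => rw [add_mul, map_add, map_add, ha, hb, mul_add]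
  | hs c a ha =>
    rw [smul_mul_assoc, map_smul, map_smul, ha, smul_eq_mul, smul_eq_mul, mul_left_comm]

theorem extFun_Tw_mul_T (hg : IsCharFun k ε I g) {i : S.Idx} (hi : i ∈ I) (u : S.W0) :
    extFun k γ g (Tw k (S.incl u) * T k (some i)) = cval k ε i * g u := by
  rcases S.finAction.pos_or_neg (S.finAction.smul_simple_mem u i) with h | h
  · rw [← Tw_incl_mul_s k h, extFun_Tw, hg i hi u h]
  · have h' := RootAction.pos_s_mul_smul h
    have e := Tw_incl_mul_s k h'
    have eg := hg i hi _ h'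
    rw [S.finAction.mul_s_mul_s] at e eg
    rw [e, mul_assoc, T_mul_T, mul_add, mul_one, mul_smul_comm, ← e, map_add, map_smul, extFun_Tw,
      extFun_Tw, smul_eq_mul, eg]
    linear_combination -(g (u * S.finAction.s i)) * cval_mul_self k ε i

/-- Equivariance under T_i is first clear on the T_u. It is then carried across right multiplication
by Y^x, it being enough to treat coweights that pair to zero with α_i and plus or minus the i-th
fundamental coweight. -/
theorem extFun_mul_T (hγ : γ ∈ torusI k ε I) (hg : IsCharFun k ε I g) {i : S.Idx} (hi : i ∈ I)
    (h : Hecke k) : extFun k γ g (h * T k (some i)) = cval k ε i * extFun k γ g h := by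
  have hα : cval k ε i * tv γ (-S.cor i) + k.p (some i) = cval k ε i := by
    refine cval_eq_add k ε ?_
    rw [← hγ i hi]
    exact tv_mul_tv_neg γ _
  -- The condition is an implication for each `h`, so it composes under addition but not evidently
  -- under negation; hence a submonoid.
  let B : AddSubmonoid S.Pv :=
    { carrier := {x | ∀ h, extFun k γ g (h * T k (some i)) = cval k ε i * extFun k γ g h →
        extFun k γ g (h * Y k x * T k (some i)) = cval k ε i * extFun k γ g (h * Y k x)}
      zero_mem' := fun h hh => by rwa [Y_zero, mul_one]
      add_mem' := fun {x y} hx hy h hh => by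
        rw [Y_add, ← mul_assoc]
        exact hy _ (hx h hh) }
  have h0 : ∀ x : S.Pv, S.pr x i = 0 → x ∈ B := by
    intro x hx h hh
    rw [mul_assoc, ← T_mul_Y_of_pr_eq_zero k hx, ← mul_assoc, extFun_mul_Y, extFun_mul_Y, hh,
      mul_left_comm]
  have hp : S.pr (fund i) i = 1 := by rw [pr_fund, if_pos rfl]
  have hd : IsDominant (fund i : S.Pv) := isDominant_iff.mpr fun l => by
    classical
    rw [pr_fund]; split_ifs <;> norm_num
  have hsω : S.refl0 i • (fund i : S.Pv) = fund i + -S.cor i := by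
    rw [refl0_smul, hp, one_smul, sub_eq_add_neg]
  have hω : ∀ h : Hecke k, extFun k γ g (h * Y k (fund i) * T k (some i)) =
      tv γ (fund i) * (tv γ (-S.cor i) * extFun k γ g (h * T k (some i)) +
        k.p (some i) * extFun k γ g h) := by
    intro h
    rw [mul_assoc, Y_mul_T k hd hp, mul_add, mul_smul_comm, map_add, map_smul, ← mul_assoc,
      extFun_mul_Y, extFun_mul_Y, hsω, tv_add, smul_eq_mul]
    ring
  have h1 : fund i ∈ B := by
    intro h hh
    rw [hω, hh, extFun_mul_Y]
    linear_combination (tv γ (fund i) * extFun k γ g h) * hα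
  -- The formula `hω` at h Y^{-ϖ}, for the i-th fundamental coweight ϖ, has the known term h T_i on
  -- the left and can be solved for the value at h Y^{-ϖ} T_i, since torus values are invertible.
  have h2 : -fund i ∈ B := by
    intro h hh
    have e := hω (h * Y k (-fund i))
    rw [mul_assoc h, Y_neg_mul_Y, mul_one, hh, extFun_mul_Y] at e
    rw [extFun_mul_Y]
    have t1 := tv_mul_tv_neg γ (fund i)
    have t2 := tv_mul_tv_neg γ (-S.cor i)
    rw [neg_neg] at t2
    generalize extFun k γ g (h * Y k (-fund i) * T k (some i)) = X at *
    generalize extFun k γ g h = F at *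
    generalize tv γ (fund i) = w at *
    generalize tv γ (-fund i) = w' at *
    generalize tv γ (-S.cor i) = a at *
    generalize tv γ (S.cor i) = a' at *
    generalize cval k ε i = c at *
    generalize k.p (some i) = p at *
    linear_combination (-w' * a') * e - (X * a * a' + F * w' * a' * p) * t1 +
      (w' * c * F - X) * t2 - (w' * a' * F) * hα
  have hf : ∀ (j : S.Idx) (n : ℤ), n • (fund j : S.Pv) ∈ B := by
    intro j n
    by_cases hij : j = i
    · subst hij
      rcases Int.eq_nat_or_neg n with ⟨m, rfl | rfl⟩
      · rw [natCast_zsmul]; exact nsmul_mem h1 m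
      · rw [neg_smul, natCast_zsmul, ← smul_neg]; exact nsmul_mem h2 m
    · refine h0 _ ?_
      change S.prHom i (n • fund j) = 0
      rw [map_zsmul]
      change n • S.pr (fund j) i = 0
      rw [pr_fund, if_neg hij, smul_zero]
  have hB : ∀ x : S.Pv, x ∈ B := fun x => by
    rw [eq_comb x]
    exact B.sum_mem fun j _ => hf j _
  induction h using hecke_induction with
  | hb u y =>
    refine hB y _ ?_
    rw [extFun_Tw_mul_T hg hi, extFun_Tw]
  | h0 => rw [zero_mul, map_zero, mul_zero]
  | ha a b ha hb => rw [add_mul, map_add, map_add, ha, hb, mul_add]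
  | hs c a ha =>
    rw [smul_mul_assoc, map_smul, map_smul, ha, smul_eq_mul, smul_eq_mul, mul_left_comm]

/-- Right multiplication by an element of H_I scales the functional, and the scalar is read off at h
= 1. It is multiplicative, which produces the character without generators and relations for H_I. -/
theorem exists_extFun_mul (hγ : γ ∈ torusI k ε I) (hg : IsCharFun k ε I g) {z : Hecke k}
    (hz : z ∈ HeckeI k I) : ∃ c : ℂ, ∀ h, extFun k γ g (h * z) = c * extFun k γ g h := by
  induction hz using Algebra.adjoin_induction with
  | algebraMap r =>
    exact ⟨r, fun h => by
      rw [← Algebra.commutes, ← Algebra.smul_def, map_smul, smul_eq_mul]⟩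
  | add a b _ _ ha hb =>
    obtain ⟨c, hc⟩ := ha
    obtain ⟨d, hd⟩ := hb
    exact ⟨c + d, fun h => by rw [mul_add, map_add, hc, hd, add_mul]⟩
  | mul a b _ _ ha hb =>
    obtain ⟨c, hc⟩ := ha
    obtain ⟨d, hd⟩ := hb
    exact ⟨d * c, fun h => by rw [← mul_assoc, hd, hc, mul_assoc]⟩
  | mem z hz =>
    rcases hz with ⟨x, rfl⟩ | ⟨i, hi, rfl⟩
    · exact ⟨_, fun h => extFun_mul_Y h x⟩
    · exact ⟨_, fun h => extFun_mul_T hγ hg hi h⟩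

theorem extFun_mul_heckeI (hγ : γ ∈ torusI k ε I) (hg : IsCharFun k ε I g)
    {χ : HeckeI k I →ₐ[ℂ] ℂ} (hχ : IsChi k ε I γ χ) (h : Hecke k) (z : HeckeI k I) :
    extFun k γ g (h * z) = χ z * extFun k γ g h := by
  obtain ⟨z, hz⟩ := z
  induction hz using Algebra.adjoin_induction generalizing h with
  | algebraMap r =>
    have e : χ ⟨algebraMap ℂ _ r, Subalgebra.algebraMap_mem _ r⟩ = r := χ.commutes r
    change extFun k γ g (h * algebraMap ℂ _ r) = χ ⟨algebraMap ℂ _ r, _⟩ * _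
    rw [e, ← Algebra.commutes, ← Algebra.smul_def, map_smul, smul_eq_mul]
  | add a b ha' hb' ha hb =>
    have e : χ ⟨a + b, add_mem ha' hb'⟩ = χ ⟨a, ha'⟩ + χ ⟨b, hb'⟩ := map_add χ ⟨a, ha'⟩ ⟨b, hb'⟩
    change extFun k γ g (h * (a + b)) = χ ⟨a + b, _⟩ * _
    have h1 := ha h
    have h2 := hb h
    rw [e, mul_add, map_add, add_mul]
    exact congrArg₂ _ h1 h2
  | mul a b ha' hb' ha hb =>
    have e : χ ⟨a * b, mul_mem ha' hb'⟩ = χ ⟨a, ha'⟩ * χ ⟨b, hb'⟩ := map_mul χ ⟨a, ha'⟩ ⟨b, hb'⟩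
    change extFun k γ g (h * (a * b)) = χ ⟨a * b, _⟩ * _
    have h1 := ha h
    have h2 := hb (h * a)
    change extFun k γ g (h * a) = _ at h1
    change extFun k γ g (h * a * b) = _ at h2
    rw [e, ← mul_assoc, h2, h1]
    change χ ⟨b, hb'⟩ * (χ ⟨a, ha'⟩ * _) = _
    ring
  | mem z hz =>
    rcases hz with ⟨x, rfl⟩ | ⟨i, hi, rfl⟩
    · exact (extFun_mul_Y h x).trans (congrArg (· * _) (hχ.1 x).symm)
    · exact (extFun_mul_T hγ hg hi h).trans (congrArg (· * _) (hχ.2 ⟨i, hi⟩).symm)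

theorem extFun_dualFun_one : extFun k γ (dualFun k ε I 1) 1 = 1 := by
  have := extFun_Tw (k := k) (γ := γ) (g := dualFun k ε I 1) 1
  rwa [map_one, Tw_one, dualFun_self] at this

theorem existsUnique_chi (hγ : γ ∈ torusI k ε I) :
    ∃! χ : HeckeI k I →ₐ[ℂ] ℂ, IsChi k ε I γ χ := by
  have hg := isCharFun_dualFun k ε I 1
  have key : ∀ (z : HeckeI k I) h, extFun k γ (dualFun k ε I 1) (h * z) =
      extFun k γ (dualFun k ε I 1) z * extFun k γ (dualFun k ε I 1) h := by
    intro z h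
    obtain ⟨c, hc⟩ := exists_extFun_mul hγ hg z.2
    have h1 := hc 1
    rw [one_mul, extFun_dualFun_one, mul_one] at h1
    rw [hc h, h1]
  refine ⟨AlgHom.ofLinearMap ((extFun k γ (dualFun k ε I 1)).comp
    (Subalgebra.toSubmodule (HeckeI k I)).subtype) extFun_dualFun_one fun a b => ?_, ⟨fun x => ?_,
      fun i => ?_⟩, fun χ hχ => ?_⟩
  · exact (key b a).trans (mul_comm _ _)
  · change extFun k γ (dualFun k ε I 1) (Y k x) = tv γ x
    rw [← one_mul (Y k x), extFun_mul_Y, extFun_dualFun_one, mul_one]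
  · change extFun k γ (dualFun k ε I 1) (T k (some i)) = cval k ε i
    rw [← one_mul (T k _), extFun_mul_T hγ hg i.2, extFun_dualFun_one, mul_one]
  · refine AlgHom.ext fun z => ?_
    change χ z = extFun k γ (dualFun k ε I 1) z
    rw [← one_mul (z : Hecke k), extFun_mul_heckeI hγ hg hχ, extFun_dualFun_one, mul_one]

end EuclideanRootSystem

end

noncomputable section

set_option linter.unusedSectionVars false

namespace EuclideanRootSystem

variable {ι V : Type*} [Finite ι] [NormedAddCommGroup V] [InnerProductSpace ℝ V]
  {S : EuclideanRootSystem ι V} {k : S.Mult} {ε : ℤˣ} {γ : S.Torus} {I : Set S.Idx}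

/-! ### The dual basis of the induced module -/

/-- Descents in `I` are split off T_u on the right until a minimal representative remains. -/
theorem span_Tw_mul_heckeI (k : S.Mult) (I : Set S.Idx) :
    Submodule.span ℂ {h : Hecke k | ∃ w ∈ S.W0min I, ∃ z : HeckeI k I, h = Tw k (S.incl w) * z} =
      ⊤ := by
  have hmul : ∀ z ∈ HeckeI k I, ∀ h ∈ Submodule.span ℂ {h : Hecke k | ∃ w ∈ S.W0min I,
      ∃ z : HeckeI k I, h = Tw k (S.incl w) * z}, h * z ∈ Submodule.span ℂ {h : Hecke k |
      ∃ w ∈ S.W0min I, ∃ z : HeckeI k I, h = Tw k (S.incl w) * z} := by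
    intro z hz h hh
    induction hh using Submodule.span_induction with
    | zero => rw [zero_mul]; exact zero_mem _
    | add a b _ _ ha hb => rw [add_mul]; exact add_mem ha hb
    | smul c a _ ha => rw [smul_mul_assoc]; exact Submodule.smul_mem _ _ ha
    | mem h hh =>
      obtain ⟨w, hw, z', rfl⟩ := hh
      rw [mul_assoc]
      exact Submodule.subset_span ⟨w, hw, z' * ⟨z, hz⟩, rfl⟩
  have hT : ∀ n, ∀ u : S.W0, S.finAction.len u = n → Tw k (S.incl u) ∈ Submodule.span ℂ
      {h : Hecke k | ∃ w ∈ S.W0min I, ∃ z : HeckeI k I, h = Tw k (S.incl w) * z} := by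
    intro n
    induction n with
    | zero =>
      intro u hu
      have hu' := RootAction.len_eq_zero_iff_simple.mp hu
      exact Submodule.subset_span ⟨u, mem_W0min_iff.mpr fun i _ => hu' i, 1, (mul_one _).symm⟩
    | succ n ih =>
      intro u hu
      by_cases hm : u ∈ S.W0min I
      · exact Submodule.subset_span ⟨u, hm, 1, (mul_one _).symm⟩
      · rw [mem_W0min_iff] at hm
        push Not at hm
        obtain ⟨i, hi, h⟩ := hm
        rw [RootAction.not_pos_iff (S.finAction.smul_simple_mem _ _)] at h
        have e := Tw_incl_mul_s k (RootAction.pos_s_mul_smul h)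
        rw [S.finAction.mul_s_mul_s] at e
        rw [e]
        have := RootAction.len_mul_s_of_neg h
        exact hmul _ (T_mem_heckeI hi) _ (ih _ (by omega))
  refine eq_top_iff.mpr fun h hh => ?_
  clear hh
  induction h using hecke_induction with
  | hb u x => exact hmul _ (Y_mem_heckeI I x) _ (hT _ u rfl)
  | h0 => exact zero_mem _
  | ha a b ha hb => exact add_mem ha hb
  | hs c a ha => exact Submodule.smul_mem _ _ ha

theorem eq_of_equivariant {χ : HeckeI k I → ℂ} {f g : Hecke k →ₗ[ℂ] ℂ}
    (hf : ∀ h (z : HeckeI k I), f (h * z) = χ z * f h)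
    (hg : ∀ h (z : HeckeI k I), g (h * z) = χ z * g h)
    (h : ∀ w ∈ S.W0min I, f (Tw k (S.incl w)) = g (Tw k (S.incl w))) : f = g := by
  refine LinearMap.ext_on (span_Tw_mul_heckeI k I) ?_
  rintro _ ⟨w, hw, z, rfl⟩
  rw [hf, hg, h w hw]

variable (k ε γ I) in
/-- The functional that is dual to `v_w`. -/
def dual (w : S.W0) : Hecke k →ₗ[ℂ] ℂ := extFun k γ (dualFun k ε I w)

theorem dual_mul (hγ : γ ∈ torusI k ε I) {χ : HeckeI k I →ₐ[ℂ] ℂ} (hχ : IsChi k ε I γ χ) (w : S.W0)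
    (h : Hecke k) (z : HeckeI k I) : dual k ε γ I w (h * z) = χ z * dual k ε γ I w h :=
  extFun_mul_heckeI hγ (isCharFun_dualFun k ε I w) hχ h z

theorem dual_Tw (v u : S.W0) : dual k ε γ I v (Tw k (S.incl u)) = dualFun k ε I v u := extFun_Tw u

/-- For j ∈ I* there is i ∈ I with s_j w̄₀ = w̄₀ s_i, so left multiplication by s_j preserves the
coset w̄₀ W_{0,I}. -/
theorem dualFun_wbar_s_mul {j : S.Idx} (hj : j ∈ S.star I) {u : S.W0}
    (h : S.finAction.Pos (u⁻¹ • S.finAction.simple j)) :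
    dualFun k ε I (S.wbar I) (S.finAction.s j * u) =
      cval k ε j * dualFun k ε I (S.wbar I) u := by
  obtain ⟨i, hi, hij⟩ := mem_star_iff.mp hj
  have hc := S.finAction.conj _ _ _ hij
  have e : (S.wbar I)⁻¹ * (S.finAction.s j * u) = S.finAction.s i * ((S.wbar I)⁻¹ * u) := by
    rw [inv_mul_eq_iff_eq_mul, ← mul_assoc, hc, mul_assoc, mul_inv_cancel_left]
  have hm : (S.wbar I)⁻¹ * (S.finAction.s j * u) ∈ S.W0sub I ↔ (S.wbar I)⁻¹ * u ∈ S.W0sub I := by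
    rw [e]
    exact (S.W0sub I).mul_mem_cancel_left (s_mem_W0sub hi)
  by_cases h' : (S.wbar I)⁻¹ * u ∈ S.W0sub I
  · rw [dualFun, if_pos (hm.mpr h'), dualFun, if_pos h', chi0_s_mul k ε h, mul_assoc]
  · rw [dualFun, if_neg (fun h'' => h' (hm.mp h'')), dualFun, if_neg h', mul_zero]

theorem dual_wbar_T_mul {j : S.Idx} (hj : j ∈ S.star I) (h : Hecke k) :
    dual k ε γ I (S.wbar I) (T k (some j) * h) =
      cval k ε j * dual k ε γ I (S.wbar I) h := by
  induction h using hecke_induction with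
  | hb u x =>
    rw [dual, ← mul_assoc, extFun_mul_Y, extFun_mul_Y, mul_left_comm]
    congr 1
    rcases S.finAction.pos_or_neg (S.finAction.smul_simple_mem u⁻¹ j) with h | h
    · rw [← Tw_incl_s_mul k h, extFun_Tw, extFun_Tw, dualFun_wbar_s_mul hj h]
    · have h' := RootAction.pos_s_mul_inv_smul h
      have e := Tw_incl_s_mul k h'
      have eg := dualFun_wbar_s_mul (k := k) (ε := ε) hj h'
      rw [S.finAction.s_mul_s_mul] at e eg
      rw [e, ← mul_assoc, T_mul_T, add_mul, one_mul, smul_mul_assoc, ← e, map_add, map_smul,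
        extFun_Tw, extFun_Tw, smul_eq_mul, eg]
      linear_combination -(dualFun k ε I (S.wbar I) (S.finAction.s j * u)) * cval_mul_self k ε j
  | h0 => rw [mul_zero, map_zero, mul_zero]
  | ha a b ha hb => rw [mul_add, map_add, map_add, ha, hb, mul_add]
  | hs c a ha =>
    rw [mul_smul_comm, map_smul, map_smul, ha, smul_eq_mul, smul_eq_mul, mul_left_comm]

/-- The element w̄₀ is shortest in its coset, so shorter elements lie outside the support of the
functional. -/
theorem dual_wbar_lower {n : ℕ} (hn : n ≤ S.finAction.len (S.wbar I)) {b : Hecke k}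
    (hb : b ∈ lower k n) : dual k ε γ I (S.wbar I) b = 0 := by
  induction hb using Submodule.span_induction with
  | zero => rw [map_zero]
  | add a b _ _ ha hb => rw [map_add, ha, hb, add_zero]
  | smul c a _ ha => rw [map_smul, ha, smul_zero]
  | mem b hb =>
    obtain ⟨u, x, hu, rfl⟩ := hb
    rw [dual, extFun_mul_Y, extFun_Tw, dualFun, if_neg, mul_zero]
    intro h
    have := len_wbar_le h
    omega

/-- By equivariance it is enough to test on T_w with `w` minimal. Such `w` is no longer than w̄₀, so
the lower terms of Y^x T_w vanish and the leading term contributes only for w = w̄₀. -/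
theorem dual_wbar_Y_mul (hγ : γ ∈ torusI k ε I) {χ : HeckeI k I →ₐ[ℂ] ℂ} (hχ : IsChi k ε I γ χ)
    (x : S.Pv) (h : Hecke k) : dual k ε γ I (S.wbar I) (Y k x * h) =
      tv γ ((S.wbar I)⁻¹ • x) * dual k ε γ I (S.wbar I) h := by
  refine LinearMap.congr_fun (f := (dual k ε γ I (S.wbar I)).comp (LinearMap.mulLeft ℂ (Y k x)))
    (g := tv γ ((S.wbar I)⁻¹ • x) • dual k ε γ I (S.wbar I))
    (eq_of_equivariant (χ := χ) (fun h z => ?_) (fun h z => ?_) (fun w hw => ?_)) h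
  · change dual k ε γ I (S.wbar I) (Y k x * (h * z)) = _ * dual k ε γ I (S.wbar I) (Y k x * h)
    rw [← mul_assoc, dual_mul hγ hχ]
  · rw [LinearMap.smul_apply, LinearMap.smul_apply, dual_mul hγ hχ, smul_eq_mul, smul_eq_mul,
      mul_left_comm]
  · change dual k ε γ I (S.wbar I) (Y k x * Tw k (S.incl w)) = _ * _
    obtain ⟨b, hb, e⟩ := exists_Y_mul_Tw k w x
    rw [e, map_add, dual_wbar_lower (len_le_len_wbar hw) hb, add_zero, dual, extFun_mul_Y,
      extFun_Tw]
    by_cases hne : S.wbar I = w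
    · rw [← hne]
    · rw [dualFun_of_ne k ε wbar_mem hw hne, mul_zero, mul_zero]

/-- Among minimal representatives only x = s_i w contributes: there T_i T_x = T_w + p T_x has
coefficient 1 at `w`. At x = w the product is T_{s_i w}, with no component at `w`. -/
theorem dual_T_mul (hγ : γ ∈ torusI k ε I) {χ : HeckeI k I →ₐ[ℂ] ℂ} (hχ : IsChi k ε I γ χ)
    {w : S.W0} (hw : w ∈ S.W0min I) {i : S.Idx} (hp : S.finAction.Pos (w⁻¹ • S.finAction.simple i))
    (hw' : S.finAction.s i * w ∈ S.W0min I) (h : Hecke k) :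
    dual k ε γ I w (T k (some i) * h) = dual k ε γ I (S.finAction.s i * w) h := by
  refine LinearMap.congr_fun (f := (dual k ε γ I w).comp (LinearMap.mulLeft ℂ (T k (some i))))
    (g := dual k ε γ I (S.finAction.s i * w))
    (eq_of_equivariant (χ := χ) (fun h z => ?_) (dual_mul hγ hχ _) (fun x hx => ?_)) h
  · change dual k ε γ I w (T k (some i) * (h * z)) = _ * dual k ε γ I w (T k (some i) * h)
    rw [← mul_assoc, dual_mul hγ hχ]
  · change dual k ε γ I w (T k (some i) * Tw k (S.incl x)) = _
    have hsne : S.finAction.s i * w ≠ w := fun h => by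
      have := RootAction.len_s_mul hp
      rw [h] at this
      omega
    rw [dual_Tw]
    by_cases hxw : S.finAction.s i * w = x
    · have e := Tw_incl_s_mul k hp
      rw [← hxw, dualFun_self, e, ← mul_assoc, T_mul_T, add_mul, one_mul, smul_mul_assoc, ← e,
        map_add, map_smul, dual_Tw, dual_Tw, dualFun_self,
        dualFun_of_ne k ε hw hw' hsne.symm, smul_zero, add_zero]
    · rw [dualFun_of_ne k ε hw' hx hxw]
      have h0 : dualFun k ε I w (S.finAction.s i * x) = 0 := by
        refine if_neg fun h' => hxw (eq_of_mem_W0min hw' hx ?_)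
        rwa [mul_inv_rev, S.finAction.s_inv, mul_assoc]
      rcases S.finAction.pos_or_neg (S.finAction.smul_simple_mem x⁻¹ i) with hpx | hpx
      · rw [← Tw_incl_s_mul k hpx, dual_Tw, h0]
      · have h' := RootAction.pos_s_mul_inv_smul hpx
        have e := Tw_incl_s_mul k h'
        rw [S.finAction.s_mul_s_mul] at e
        have hne : w ≠ x := by
          rintro rfl
          exact hp.not_neg hpx
        rw [e, ← mul_assoc, T_mul_T, add_mul, one_mul, smul_mul_assoc, ← e, map_add, map_smul,
          dual_Tw, dual_Tw, h0, dualFun_of_ne k ε hw hx hne, smul_zero, add_zero]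

/-- Iterates `dual_T_mul` along the ascents from `w` to w̄₀. -/
theorem dual_Tw_mul (hγ : γ ∈ torusI k ε I) {χ : HeckeI k I →ₐ[ℂ] ℂ} (hχ : IsChi k ε I γ χ)
    {w : S.W0} (hw : w ∈ S.W0min I) (h : Hecke k) :
    dual k ε γ I w (Tw k (S.incl (w * (S.wbar I)⁻¹)) * h) = dual k ε γ I (S.wbar I) h := by
  induction hn : S.finAction.len (w * (S.wbar I)⁻¹) generalizing w with
  | zero =>
    have hw' := mul_inv_eq_one.mp (S.eq_one_of_finAction_len_eq_zero hn)
    rw [hw', mul_inv_cancel, map_one, Tw_one, one_mul]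
  | succ n ih =>
    have hne : w ≠ S.wbar I := by
      rintro rfl
      rw [mul_inv_cancel, S.finAction.len_one] at hn
      omega
    obtain ⟨i, h1, h2, h3⟩ := exists_ascent hw hne
    have h4 := RootAction.pos_s_mul_inv_smul h3
    have e := Tw_incl_s_mul k h4
    rw [S.finAction.s_mul_s_mul] at e
    have hl := RootAction.len_s_mul (Φ := S.finAction) h4
    rw [S.finAction.s_mul_s_mul] at hl
    have h5 := ih h2 (by rw [mul_assoc]; omega)
    rw [e, mul_assoc, dual_T_mul hγ hχ hw h1 h2, ← mul_assoc (S.finAction.s i) w, h5]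

theorem dual_wbar_inv_mul (hγ : γ ∈ torusI k ε I) {χ : HeckeI k I →ₐ[ℂ] ℂ} (hχ : IsChi k ε I γ χ)
    {w : S.W0} (hw : w ∈ S.W0min I) (h : Hecke k) :
    dual k ε γ I (S.wbar I) (((TwU k (S.incl (w * (S.wbar I)⁻¹)))⁻¹ : (Hecke k)ˣ) * h) =
      dual k ε γ I w h := by
  rw [← dual_Tw_mul hγ hχ hw, ← mul_assoc, ← val_TwU, Units.mul_inv, one_mul]

/-! ### The anti-isomorphism -/

/-- The homomorphism `u ↦ u⁻¹` to the opposite monoid. -/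
def invOp (A : Type*) [Monoid A] : Aˣ →* Aᵐᵒᵖ where
  toFun u := .op ((u⁻¹ : Aˣ) : A)
  map_one' := by rw [inv_one]; rfl
  map_mul' u v := by rw [mul_inv_rev, Units.val_mul, MulOpposite.op_mul]

variable (k) in
/-- The braid data for the anti-isomorphism `H(k⁻¹) → H(k)`. -/
def dagData : S.affAction.BraidData (Hecke k)ᵐᵒᵖ where
  X j := invOp _ (TU k j)
  Z g := invOp _ (TwU k g)
  braid i j hij h := by
    rw [← map_altProd, ← map_altProd]
    congr 1
    refine Units.ext ?_
    have e := map_altProd (Units.coeHom (Hecke k))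
    refine (e _ _ _).trans (Eq.trans ?_ (e _ _ _).symm)
    exact T_braid k hij h
  Z_one := by
    have : TwU k (1 : S.W) = 1 := Units.ext (Tw_one k)
    rw [this, map_one]
  Z_mul g h hg _ := by
    rw [← map_mul, TwU_mul]
    rw [RootAction.len_mul_of_left hg, hg, zero_add]
  Z_X g i j hg h := by
    rw [← map_mul, ← map_mul]
    congr 1
    refine Units.ext ?_
    have := (heckeData k).Z_X g i j hg h
    rw [heckeData_Z k ⟨g, hg⟩, ← Tw_Om] at this
    exact this

theorem dagData_mul_self (j : Option S.Idx) : (dagData k).X j * (dagData k).X j =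
    1 + k.inv.p j • (dagData k).X j := by
  change MulOpposite.op (Tinv k j) * MulOpposite.op (Tinv k j) =
    1 + k.inv.p j • MulOpposite.op (Tinv k j)
  have hp : k.inv.p j = -k.p j := by
    change (((k.val j)⁻¹ : ℂˣ) : ℂ) - (((k.val j)⁻¹)⁻¹ : ℂˣ) = -((k.val j : ℂ) - ((k.val j)⁻¹ : ℂˣ))
    rw [inv_inv, neg_sub]
  rw [← MulOpposite.op_mul, ← MulOpposite.op_smul, ← MulOpposite.op_one, ← MulOpposite.op_add]
  congr 1
  have h1 := T_eq k j
  have h2 := Tinv_mul_T k j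
  rw [h1, mul_add, mul_smul_comm, mul_one] at h2
  rw [← h2, hp]
  module

variable (k) in
/-- The anti-isomorphism `H(k⁻¹) → H(k)` with `T_w ↦ T_w⁻¹`. -/
def dag : Hecke k.inv →ₐ[ℂ] (Hecke k)ᵐᵒᵖ :=
  heckeLift (A := (Hecke k)ᵐᵒᵖ) k.inv (dagData k) dagData_mul_self

theorem dag_T (j : Option S.Idx) : dag k (T k.inv j) = .op (Tinv k j) :=
  heckeLift_T (A := (Hecke k)ᵐᵒᵖ) k.inv (dagData k) dagData_mul_self j

theorem dag_TO (o : S.Om) :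
    dag k (TO k.inv o) = .op (((TwU k (o : S.W))⁻¹ : (Hecke k)ˣ) : Hecke k) :=
  heckeLift_TO (A := (Hecke k)ᵐᵒᵖ) k.inv (dagData k) dagData_mul_self o

theorem dag_Tw (w : S.W) : dag k (Tw k.inv w) = .op (((TwU k w)⁻¹ : (Hecke k)ˣ) : Hecke k) := by
  induction w using S.affAction.induction_left with
  | h0 g hg =>
    rw [show Tw k.inv g = TO k.inv ⟨g, hg⟩ from Tw_Om k.inv ⟨g, hg⟩, dag_TO]
  | hs j g hj ih =>
    have h1 : Tw k.inv (S.affAction.s j * g) = T k.inv j * Tw k.inv g := Tw_s_mul k.inv hj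
    have h2 : TwU k (S.affAction.s j * g) = TU k j * TwU k g := Units.ext (Tw_s_mul k hj)
    rw [h1, h2, map_mul, ih, dag_T, mul_inv_rev, Units.val_mul, MulOpposite.op_mul]
    rfl

/-- For dominant coweights this is T_{τ(μ)} ↦ T_{τ(μ)}⁻¹; the general case follows by applying `dag`
to Y^{μ-ν} Y^ν = Y^μ and cancelling a unit. -/
theorem dag_Y (x : S.Pv) : dag k (Y k.inv x) = .op (Y k (-x)) := by
  obtain ⟨μ, ν, hμ, hν, rfl, -⟩ := exists_dominant_sub x
  have h1 : Y k.inv (μ - ν) * Y k.inv ν = Y k.inv μ := by rw [← Y_add, sub_add_cancel]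
  have h2 := congrArg (dag k) h1
  rw [map_mul, Y_of_dominant k.inv hμ, Y_of_dominant k.inv hν, dag_Tw, dag_Tw] at h2
  have h3 := congrArg MulOpposite.unop h2
  rw [MulOpposite.unop_mul, MulOpposite.unop_op, MulOpposite.unop_op] at h3
  rw [neg_sub, Y_sub k hν hμ, Units.val_mul, ← h3, Units.mul_inv_cancel_left]
  rfl

end EuclideanRootSystem

end

noncomputable section

set_option linter.unusedSectionVars false

/-! ### Intertwining vectors in a tensor product -/

namespace Intertwining

variable {A L M J : Type*} [Ring A] [Algebra ℂ A] [AddCommGroup L] [Module ℂ L] [AddCommGroup M]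
  [Module ℂ M] [Fintype J] (P : A →ₐ[ℂ] Module.End ℂ L) (Q : A →ₐ[ℂ] (Module.End ℂ M)ᵐᵒᵖ)

/-- The contraction of `L ⊗ M` with a functional on `M`. -/
def contract (L : Type*) [AddCommGroup L] [Module ℂ L] (f : M →ₗ[ℂ] ℂ) : L ⊗[ℂ] M →ₗ[ℂ] L :=
  (TensorProduct.rid ℂ L).toLinearMap.comp (LinearMap.lTensor L f)

theorem contract_tmul (f : M →ₗ[ℂ] ℂ) (x : L) (m : M) : contract L f (x ⊗ₜ m) = f m • x := by
  rw [contract, LinearMap.comp_apply, LinearMap.lTensor_tmul, LinearEquiv.coe_coe,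
    TensorProduct.rid_tmul]

theorem contract_smul (f : M →ₗ[ℂ] ℂ) (c : ℂ) (ψ : L ⊗[ℂ] M) :
    contract L (c • f) ψ = c • contract L f ψ := by
  rw [contract, LinearMap.lTensor_smul, LinearMap.comp_smul, LinearMap.smul_apply, contract]

theorem contract_rTensor (f : M →ₗ[ℂ] ℂ) (u : Module.End ℂ L) (ψ : L ⊗[ℂ] M) :
    contract L f (LinearMap.rTensor M u ψ) = u (contract L f ψ) := by
  induction ψ using TensorProduct.induction_on with
  | zero => simp only [map_zero]
  | add x y hx hy => simp only [map_add, hx, hy]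
  | tmul x m => rw [LinearMap.rTensor_tmul, contract_tmul, contract_tmul, map_smul]

theorem contract_lTensor (f : M →ₗ[ℂ] ℂ) (u : Module.End ℂ M) (ψ : L ⊗[ℂ] M) :
    contract L f (LinearMap.lTensor L u ψ) = contract L (f.comp u) ψ := by
  induction ψ using TensorProduct.induction_on with
  | zero => simp only [map_zero]
  | add x y hx hy => simp only [map_add, hx, hy]
  | tmul x m => rw [LinearMap.lTensor_tmul, contract_tmul, contract_tmul, LinearMap.comp_apply]

/-- The vectors `ψ` of `L ⊗ M` with `(P(h) ⊗ 1) ψ = (1 ⊗ Q(h)) ψ` for all `h`. -/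
def IsIntertwining (ψ : L ⊗[ℂ] M) : Prop :=
  ∀ h : A, LinearMap.rTensor M (P h) ψ = LinearMap.lTensor L (Q h).unop ψ

variable {f : J → M →ₗ[ℂ] ℂ} {v : J → M} {t : M →ₗ[ℂ] ℂ} {b : J → A}

theorem eq_sum_of_span [DecidableEq J] (hs : Submodule.span ℂ (Set.range v) = ⊤)
    (hf : ∀ w x, f w (v x) = if w = x then 1 else 0) (m : M) : m = ∑ w, f w m • v w := by
  have hm : m ∈ Submodule.span ℂ (Set.range v) := hs ▸ Submodule.mem_top
  induction hm using Submodule.span_induction with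
  | mem x hx =>
    obtain ⟨w, rfl⟩ := hx
    simp only [hf, ite_smul, one_smul, zero_smul, Finset.sum_ite_eq', Finset.mem_univ, if_true]
  | zero => simp only [map_zero, zero_smul, Finset.sum_const_zero]
  | add x y _ _ hx hy =>
    simp only [map_add, add_smul, Finset.sum_add_distrib]
    rw [← hx, ← hy]
  | smul c x _ hx =>
    simp only [map_smul, smul_assoc, ← Finset.smul_sum]
    rw [← hx]

theorem eq_sum_contract (hv : ∀ m, m = ∑ w, f w m • v w) (ψ : L ⊗[ℂ] M) :
    ψ = ∑ w, contract L (f w) ψ ⊗ₜ[ℂ] v w := by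
  induction ψ using TensorProduct.induction_on with
  | zero => simp only [map_zero, TensorProduct.zero_tmul, Finset.sum_const_zero]
  | add x y hx hy =>
    simp only [map_add, TensorProduct.add_tmul, Finset.sum_add_distrib]
    rw [← hx, ← hy]
  | tmul x m =>
    conv_lhs => rw [hv m, TensorProduct.tmul_sum]
    refine Finset.sum_congr rfl fun w _ => ?_
    rw [contract_tmul, TensorProduct.smul_tmul]

variable {P Q}

/-- Contraction exchanges the two actions, so a functional that is an eigenvector for the transposed
action produces an eigenvector in L. -/
theorem IsIntertwining.contract_comp {ψ : L ⊗[ℂ] M} (hψ : IsIntertwining P Q ψ) (h : A) :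
    contract L (t.comp (Q h).unop) ψ = P h (contract L t ψ) := by
  rw [← contract_lTensor, ← hψ h, contract_rTensor]

theorem IsIntertwining.eq_sum {ψ : L ⊗[ℂ] M} (hψ : IsIntertwining P Q ψ)
    (hv : ∀ m, m = ∑ w, f w m • v w) (hb : ∀ w, t.comp (Q (b w)).unop = f w) :
    ψ = ∑ w, P (b w) (contract L t ψ) ⊗ₜ[ℂ] v w := by
  conv_lhs => rw [eq_sum_contract hv ψ]
  refine Finset.sum_congr rfl fun w _ => ?_
  rw [← hb, hψ.contract_comp]

/-- The vector φ transforms under Z as the functional t does, and A is spanned by the products of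
the `b w` with Z. So A acts on the vectors P(b_w)φ with the same coefficients as on the dual basis,
which is the intertwining property. -/
theorem isIntertwining_sum [DecidableEq J] (hv : ∀ m, m = ∑ w, f w m • v w)
    (hf : ∀ w x, f w (v x) = if w = x then 1 else 0)
    (hb : ∀ w, t.comp (Q (b w)).unop = f w) {Z : Set A} {χ : A → ℂ}
    (hZ : Submodule.span ℂ {h : A | ∃ w, ∃ z ∈ Z, h = b w * z} = ⊤)
    (ht : ∀ z ∈ Z, t.comp (Q z).unop = χ z • t) {φ : L} (hφ : ∀ z ∈ Z, P z φ = χ z • φ) :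
    IsIntertwining P Q (∑ w, P (b w) φ ⊗ₜ[ℂ] v w) := by
  have hQ (a c : A) : (Q (a * c)).unop = (Q c).unop * (Q a).unop := by
    rw [map_mul, MulOpposite.unop_mul]
  -- For h = b_y z both sides equal χ(z) P(b_y)φ; linearity and `hZ` give the rest.
  have key (h : A) : P h φ = ∑ w, t ((Q h).unop (v w)) • P (b w) φ := by
    have hh : h ∈ Submodule.span ℂ {h : A | ∃ w, ∃ z ∈ Z, h = b w * z} := hZ ▸ Submodule.mem_top
    induction hh using Submodule.span_induction with
    | zero =>
      simp only [map_zero, MulOpposite.unop_zero, LinearMap.zero_apply, zero_smul,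
        Finset.sum_const_zero]
    | add x y _ _ hx hy =>
      simp only [map_add, MulOpposite.unop_add, LinearMap.add_apply, add_smul,
        Finset.sum_add_distrib, hx, hy]
    | smul c x _ hx =>
      simp only [map_smul, MulOpposite.unop_smul, LinearMap.smul_apply, smul_assoc,
        ← Finset.smul_sum, hx]
    | mem x hx =>
      obtain ⟨y, z, hz, rfl⟩ := hx
      have e (w : J) : t ((Q (b y * z)).unop (v w)) = if y = w then χ z else 0 := by
        have h1 := LinearMap.congr_fun (ht z hz) ((Q (b y)).unop (v w))
        have h2 := LinearMap.congr_fun (hb y) (v w)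
        rw [LinearMap.comp_apply] at h1 h2
        rw [hQ, Module.End.mul_apply, h1, LinearMap.smul_apply, h2, hf, smul_eq_mul, mul_ite,
          mul_one, mul_zero]
      simp only [e, ite_smul, zero_smul, Finset.sum_ite_eq, Finset.mem_univ, if_true]
      rw [map_mul, Module.End.mul_apply, hφ z hz, map_smul]
  intro h
  rw [map_sum, map_sum]
  have e1 (w : J) : LinearMap.rTensor M (P h) (P (b w) φ ⊗ₜ[ℂ] v w) =
      ∑ x, P (b x) φ ⊗ₜ[ℂ] (f w ((Q h).unop (v x)) • v w) := by
    rw [LinearMap.rTensor_tmul, ← Module.End.mul_apply, ← map_mul, key, TensorProduct.sum_tmul]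
    refine Finset.sum_congr rfl fun x _ => ?_
    rw [hQ, Module.End.mul_apply, TensorProduct.smul_tmul, ← hb w]
    rfl
  rw [Finset.sum_congr rfl fun w _ => e1 w, Finset.sum_comm]
  refine Finset.sum_congr rfl fun x _ => ?_
  rw [LinearMap.lTensor_tmul, ← TensorProduct.tmul_sum, ← hv]

theorem contract_sum [DecidableEq J] (hf : ∀ w x, f w (v x) = if w = x then 1 else 0) {j : J}
    (hj : b j = 1) (φ : L) : contract L (f j) (∑ w, P (b w) φ ⊗ₜ[ℂ] v w) = φ := by
  rw [map_sum]
  simp only [contract_tmul, hf, ite_smul, zero_smul, one_smul, Finset.sum_ite_eq, Finset.mem_univ,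
    if_true]
  rw [hj, map_one, Module.End.one_apply]

end Intertwining

namespace EuclideanRootSystem

variable {ι V : Type*} [Finite ι] [NormedAddCommGroup V] [InnerProductSpace ℝ V]
  {S : EuclideanRootSystem ι V} {k : S.Mult} {q : S.QParam} {ε : ℤˣ} {γ : S.Torus} {I : Set S.Idx}

/-! ### The dual spectral point -/

theorem tv_torusAct_inv (w : S.W0) (γ : S.Torus) (x : S.Pv) :
    tv (torusAct w γ⁻¹) x = tv γ (w⁻¹ • -x) := by
  have h : γ (.ofAdd (w⁻¹ • x)) * γ (.ofAdd (w⁻¹ • -x)) = 1 := by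
    rw [← map_mul, ← ofAdd_add, ← smul_add, add_neg_cancel, smul_zero, ofAdd_zero, map_one]
  have h' : γ (.ofAdd (w⁻¹ • -x)) = (γ (.ofAdd (w⁻¹ • x)))⁻¹ := (inv_eq_of_mul_eq_one_right h).symm
  rw [tv, tv, h']
  rfl

theorem val_star {i j : S.Idx} (h : S.wbar I • S.finAction.simple i = S.finAction.simple j) :
    k.val (some i) = k.val (some j) := by
  refine k.val_eq (w := S.incl (S.wbar I)) ?_
  rw [incl_smul]
  exact Prod.ext rfl h

theorem torusAct_mem_torusI (hγ : γ ∈ torusI k ε I) :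
    torusAct (S.wbar I) γ⁻¹ ∈ torusI k.inv ε (S.star I) := by
  intro j hj
  obtain ⟨i, hi, h⟩ := mem_star_iff.mp hj
  have h1 : (S.wbar I)⁻¹ • S.cor j = S.cor i := inv_smul_eq_iff.mpr h.symm
  have h2 : torusAct (S.wbar I) γ⁻¹ (.ofAdd (S.cor j)) =
      (γ (.ofAdd ((S.wbar I)⁻¹ • S.cor j)))⁻¹ := rfl
  have h3 : k.inv.val (some j) = (k.val (some j))⁻¹ := rfl
  rw [h2, h1, hγ i hi, val_star h, h3, inv_zpow, inv_pow]

theorem cval_mul_cval_inv (j : S.Idx) : cval k ε j * cval k.inv ε j = 1 := by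
  have h3 : k.inv.val (some j) = (k.val (some j))⁻¹ := rfl
  have h : ((ε : ℤ) : ℂ) * ((ε : ℤ) : ℂ) = 1 := by
    rw [← Int.cast_mul, ← Units.val_mul, Int.units_mul_self, Units.val_one, Int.cast_one]
  rw [cval, cval, h3, inv_zpow, mul_mul_mul_comm, h, Units.mul_inv, mul_one]

/-! ### The coordinates of the induced module -/

section Ind

variable {χ : HeckeI k I →ₐ[ℂ] ℂ}

theorem eq_zero_of_mem_span {g : Hecke k →ₗ[ℂ] ℂ}
    (hg : ∀ h (z : HeckeI k I), g (h * z) = χ z * g h) {x : Hecke k}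
    (hx : x ∈ Submodule.span (Hecke k)
      (Set.range fun h : HeckeI k I => (h : Hecke k) - algebraMap ℂ (Hecke k) (χ h))) :
    g x = 0 := by
  suffices h : ∀ a, g (a * x) = 0 by simpa only [one_mul] using h 1
  induction hx using Submodule.span_induction with
  | zero => intro a; rw [mul_zero, map_zero]
  | add x y _ _ hx hy => intro a; rw [mul_add, map_add, hx, hy, add_zero]
  | smul c x _ hx => intro a; rw [smul_eq_mul, ← mul_assoc, hx]
  | mem x hx =>
    obtain ⟨z, rfl⟩ := hx
    intro a
    rw [mul_sub, map_sub, hg, ← Algebra.commutes, ← Algebra.smul_def, map_smul, smul_eq_mul,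
      sub_self]

/-- A functional on `H(k)` that is `χ`-equivariant on the right descends to the induced module. -/
def indFun (g : Hecke k →ₗ[ℂ] ℂ) (hg : ∀ h (z : HeckeI k I), g (h * z) = χ z * g h) :
    Ind k I χ →ₗ[ℂ] ℂ :=
  (Submodule.liftQ ((Submodule.span (Hecke k)
    (Set.range fun h : HeckeI k I => (h : Hecke k) - algebraMap ℂ (Hecke k) (χ h))).restrictScalars ℂ)
    g fun _ hx => eq_zero_of_mem_span hg hx).comp
    (Submodule.Quotient.restrictScalarsEquiv ℂ _).symm.toLinearMap

variable (I χ) in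
/-- The class of `h` in the induced module. -/
def indMk (h : Hecke k) : Ind k I χ := Submodule.Quotient.mk h

theorem indMk_Tw (w : S.W0) : indMk I χ (Tw k (S.incl w)) = vec k I χ w := rfl

theorem indMk_mul (h : Hecke k) (z : HeckeI k I) : indMk I χ (h * z) = χ z • indMk I χ h := by
  have e : χ z • indMk I χ h = indMk I χ (h * algebraMap ℂ (Hecke k) (χ z)) := by
    rw [← Algebra.commutes, ← Algebra.smul_def]; rfl
  rw [e]
  refine (Submodule.Quotient.eq _).mpr ?_
  rw [← mul_sub]
  exact Submodule.smul_mem _ h (Submodule.subset_span ⟨z, rfl⟩)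

variable (I χ) in
theorem span_vec : Submodule.span ℂ (Set.range fun w : S.W0min I => vec k I χ w) = ⊤ := by
  refine eq_top_iff.mpr fun m hm => ?_
  clear hm
  induction m using Submodule.Quotient.induction_on with
  | H h =>
    have hh : h ∈ Submodule.span ℂ {h : Hecke k | ∃ w ∈ S.W0min I, ∃ z : HeckeI k I,
        h = Tw k (S.incl w) * z} := span_Tw_mul_heckeI k I ▸ Submodule.mem_top
    change indMk I χ h ∈ _
    induction hh using Submodule.span_induction with
    | zero => exact zero_mem _
    | add x y _ _ hx hy => exact add_mem hx hy
    | smul c x _ hx => exact Submodule.smul_mem _ c hx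
    | mem x hx =>
      obtain ⟨w, hw, z, rfl⟩ := hx
      rw [indMk_mul]
      exact Submodule.smul_mem _ _ (Submodule.subset_span ⟨⟨w, hw⟩, rfl⟩)

variable (hγ : γ ∈ torusI k ε I) (hχ : IsChi k ε I γ χ)

/-- The coordinate functional of `v_w`. -/
def coord (w : S.W0) : Ind k I χ →ₗ[ℂ] ℂ := indFun (dual k ε γ I w) (dual_mul hγ hχ w)

theorem coord_indMk (w : S.W0) (h : Hecke k) : coord hγ hχ w (indMk I χ h) = dual k ε γ I w h := rfl

open Classical in
theorem coord_vec (w x : S.W0min I) :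
    coord hγ hχ w (vec k I χ x) = if w = x then 1 else 0 := by
  rw [← indMk_Tw, coord_indMk, dual_Tw]
  split_ifs with h
  · rw [h, dualFun_self]
  · exact dualFun_of_ne k ε w.2 x.2 fun h' => h (Subtype.ext h')

theorem eq_sum_coord (m : Ind k I χ) :
    m = ∑ w : S.W0min I, coord hγ hχ w m • vec k I χ w := by
  classical
  exact Intertwining.eq_sum_of_span (f := fun w : S.W0min I => coord hγ hχ w)
    (v := fun w : S.W0min I => vec k I χ w) (span_vec I χ) (coord_vec hγ hχ) m

variable (k) in
/-- The right action of `H(k⁻¹)` on an `H(k)`-module through the anti-isomorphism. -/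
def dagRep (N : Type*) [AddCommGroup N] [Module ℂ N] [Module (Hecke k) N]
    [IsScalarTower ℂ (Hecke k) N] : Hecke k.inv →ₐ[ℂ] (Module.End ℂ N)ᵐᵒᵖ :=
  (AlgHom.op (Algebra.lsmul ℂ ℂ N)).comp (dag k)

theorem coord_dagRep_Tw {w : S.W0} (hw : w ∈ S.W0min I) :
    (coord hγ hχ (S.wbar I)).comp
      (dagRep k (Ind k I χ) (Tw k.inv (S.incl (w * (S.wbar I)⁻¹)))).unop = coord hγ hχ w := by
  refine LinearMap.ext fun m => ?_
  induction m using Submodule.Quotient.induction_on with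
  | H h =>
    change coord hγ hχ (S.wbar I) (indMk I χ ((dag k _).unop * h)) = coord hγ hχ w (indMk I χ h)
    rw [dag_Tw, coord_indMk, coord_indMk]
    exact dual_wbar_inv_mul hγ hχ hw h

theorem dual_wbar_Tinv_mul {j : S.Idx} (hj : j ∈ S.star I) (h : Hecke k) :
    dual k ε γ I (S.wbar I) (Tinv k (some j) * h) =
      cval k.inv ε j * dual k ε γ I (S.wbar I) h := by
  have h1 := dual_wbar_T_mul (ε := ε) (γ := γ) hj (Tinv k (some j) * h)
  rw [← mul_assoc, T_mul_Tinv, one_mul] at h1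
  rw [h1, ← mul_assoc, mul_comm (cval k.inv ε j), cval_mul_cval_inv, one_mul]

theorem coord_dagRep {χ' : HeckeI k.inv (S.star I) →ₐ[ℂ] ℂ}
    (hχ' : IsChi k.inv ε (S.star I) (torusAct (S.wbar I) γ⁻¹) χ') (z : HeckeI k.inv (S.star I)) :
    (coord hγ hχ (S.wbar I)).comp (dagRep k (Ind k I χ) z).unop =
      χ' z • coord hγ hχ (S.wbar I) := by
  obtain ⟨z, hz⟩ := z
  induction hz using Algebra.adjoin_induction with
  | mem x hx =>
    refine LinearMap.ext fun m => ?_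
    induction m using Submodule.Quotient.induction_on with
    | H h =>
      change coord hγ hχ (S.wbar I) (indMk I χ ((dag k _).unop * h)) =
        _ * coord hγ hχ (S.wbar I) (indMk I χ h)
      rw [coord_indMk, coord_indMk]
      obtain ⟨x, rfl⟩ | ⟨j, hj, rfl⟩ := hx
      · rw [show χ' ⟨Y k.inv x, _⟩ = tv (torusAct (S.wbar I) γ⁻¹) x from hχ'.1 x,
          tv_torusAct_inv]
        refine (congrArg (fun a => dual k ε γ I (S.wbar I) (MulOpposite.unop a * h))
          (dag_Y x)).trans ?_
        exact dual_wbar_Y_mul hγ hχ (-x) h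
      · rw [show χ' ⟨(fun i : S.Idx => T k.inv (some i)) j, _⟩ = cval k.inv ε j from hχ'.2 ⟨j, hj⟩]
        refine (congrArg (fun a => dual k ε γ I (S.wbar I) (MulOpposite.unop a * h))
          (dag_T (some j))).trans ?_
        exact dual_wbar_Tinv_mul hj h
  | algebraMap c =>
    have : χ' ⟨algebraMap ℂ _ c, Subalgebra.algebraMap_mem _ c⟩ = c := χ'.commutes c
    rw [this, AlgHom.commutes, MulOpposite.algebraMap_apply, MulOpposite.unop_op]
    refine LinearMap.ext fun m => ?_
    change coord hγ hχ (S.wbar I) (c • m) = _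
    rw [map_smul]; rfl
  | add a b ha hb h1 h2 =>
    have : χ' ⟨a + b, add_mem ha hb⟩ = χ' ⟨a, ha⟩ + χ' ⟨b, hb⟩ := map_add χ' ⟨a, ha⟩ ⟨b, hb⟩
    rw [this, add_smul, ← h1, ← h2, map_add, MulOpposite.unop_add, LinearMap.comp_add]
  | mul a b ha hb h1 h2 =>
    have : χ' ⟨a * b, mul_mem ha hb⟩ = χ' ⟨a, ha⟩ * χ' ⟨b, hb⟩ := map_mul χ' ⟨a, ha⟩ ⟨b, hb⟩
    rw [this, map_mul, MulOpposite.unop_mul, Module.End.mul_eq_comp, ← LinearMap.comp_assoc, h2,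
      LinearMap.smul_comp, h1, smul_smul, mul_comm]

end Ind

end EuclideanRootSystem

end

noncomputable section

set_option linter.unusedSectionVars false

namespace EuclideanRootSystem

variable {ι V : Type*} [Finite ι] [NormedAddCommGroup V] [InnerProductSpace ℝ V]
  {S : EuclideanRootSystem ι V} {k : S.Mult} {q : S.QParam} {ε : ℤˣ} {γ : S.Torus} {I : Set S.Idx}

/-! ### Invariant vectors are intertwining vectors -/

/-- The reflection replaces e^a by e^{-a}, which has the same effect on c_a as inverting the
parameter. This is why π is attached to k⁻¹ while ∇ is attached to k. -/
theorem s_smul_cfun (j : Option S.Idx) : S.s j • cfun k q (k.val j) (simpleR j) =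
    cfun k q (k.inv.val j) (simpleR j) := by
  have hs : (((S.affAction.s j • simpleR j : S.R)) : S.Aff) = -((simpleR j : S.R) : S.Aff) :=
    S.affAction.s_simple j
  have hu := ufun_add_ufun (k := k) (q := q) hs
  have hv : k.inv.val j = (k.val j)⁻¹ := rfl
  rw [cfun_eq, cfun_eq, hv, smul_sub, smul_mul', smul_algebraMap_Csn, smul_algebraMap_Csn,
    smul_ufun, inv_inv, map_sub, map_sub]
  have hu' : ufun k q (simpleR j) + ufun k q (S.s j • simpleR j) = 1 := hu
  linear_combination (algebraMap ℂ (Csn k q) ((k.val j)⁻¹ : ℂˣ) -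
    algebraMap ℂ (Csn k q) (k.val j)) * hu'

theorem gp_mul_gp (u w : S.W) : gp k q u * gp k q w = gp k q (u * w) :=
  (map_mul (Crossed.skew (Csn k q) S.W).gp u w).symm

theorem cfun_mul_cinv (j : Option S.Idx) :
    cfun k q (k.val j) (simpleR j) * cinv k q (simpleR j) = 1 :=
  cfun_mul_cinvA (admissible_self k q) (simpleR j)

/-- The element s c inverts c⁻¹ s, and s c times the scalar part of ∇(s) differs from s c only by π
and a constant. -/
theorem crossed_identities {A C G : Type*} [Ring A] [Algebra ℂ A] [CommRing C] [Algebra ℂ C]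
    [Group G] [MulSemiringAction G C] (X : Crossed C A G) {s : G} (hs : s * s = 1) {c c' ci : C}
    (hc : c * ci = 1) (hc' : s • c = c') (z z' : ℂ) {π : A}
    (hπ : π = algebraMap ℂ A z' + X.fn c' * (X.gp s - 1)) :
    (X.gp s * X.fn c) * (X.fn ci * X.gp s) = 1 ∧ (X.fn ci * X.gp s) * (X.gp s * X.fn c) = 1 ∧
      (X.gp s * X.fn c) * (X.fn ((c - algebraMap ℂ C z) * ci) * X.gp s) + π + (z - z') • 1 =
        X.gp s * X.fn c := by
  have hss : X.gp s * X.gp s = 1 := by rw [← map_mul, hs, map_one]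
  have h1 : X.fn c * X.fn ci = 1 := by rw [← map_mul, hc, map_one]
  have h2 : X.fn ci * X.fn c = 1 := by rw [← map_mul, mul_comm, hc, map_one]
  refine ⟨?_, ?_, ?_⟩
  · rw [mul_assoc, ← mul_assoc (X.fn c), h1, one_mul, hss]
  · rw [mul_assoc, ← mul_assoc (X.gp s), hss, one_mul, h2]
  · have h3 : c * ((c - algebraMap ℂ C z) * ci) = c - algebraMap ℂ C z := by
      rw [mul_left_comm, hc, mul_one]
    rw [mul_assoc, ← mul_assoc (X.fn c), ← map_mul, h3, map_sub, sub_mul, mul_sub, ← mul_assoc,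
      X.comm, hc', mul_assoc, hss, mul_one, AlgHom.commutes, ← mul_assoc, ← Algebra.commutes,
      mul_assoc, hss, mul_one, hπ, mul_sub, mul_one, sub_smul, Algebra.algebraMap_eq_smul_one,
      Algebra.algebraMap_eq_smul_one]
    abel

section Equation

variable {A H X : Type*} [Ring A] [Algebra ℂ A] [Ring H] [Algebra ℂ H] [AddCommGroup X]
  [Module ℂ X] (ρ : A →ₐ[ℂ] Module.End ℂ X) (σ : H →ₐ[ℂ] Module.End ℂ X)

/-- Applying the invertible operator of x' isolates t; the identity `hy` then trades the rest for π,
and the constants p cancel. -/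
theorem eq_iff_of_identities {x x' y π : A} {p : ℂ} {t ti : H}
    (hx : x' * x = 1) (hx' : x * x' = 1) (hy : x' * y + π + p • 1 = x') (ht : t = ti + p • 1)
    (ψ : X) : (ρ x * σ t + ρ y) ψ = ψ ↔ ρ π ψ = σ ti ψ := by
  have e1 : (ρ x * σ t + ρ y) ψ = ψ ↔ (ρ x' * (ρ x * σ t + ρ y)) ψ = ρ x' ψ := by
    refine ⟨fun h => by rw [Module.End.mul_apply, h], fun h => ?_⟩
    have h' := congrArg (ρ x) h
    rwa [← Module.End.mul_apply, ← Module.End.mul_apply, ← mul_assoc, ← map_mul, hx', map_one,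
      one_mul, Module.End.one_apply] at h'
  have e2 : ρ x' * (ρ x * σ t + ρ y) = σ t + ρ (x' * y) := by
    rw [mul_add, ← mul_assoc, ← map_mul, hx, map_one, one_mul, map_mul]
  have e3 := LinearMap.congr_fun (congrArg ρ hy) ψ
  rw [e1, e2, ht, ← e3, map_add, map_add, map_add, map_smul, map_smul, map_one, map_one]
  simp only [LinearMap.add_apply, LinearMap.smul_apply, Module.End.one_apply]
  constructor
  · intro h
    have h' : σ ti ψ + (p • ψ + (ρ (x' * y)) ψ) = ρ π ψ + (p • ψ + (ρ (x' * y)) ψ) := by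
      rw [← add_assoc, h]; abel
    exact (add_right_cancel h').symm
  · intro h
    rw [h]; abel

theorem map_tmul_eq_mul (F : A ⊗[ℂ] H →ₐ[ℂ] Module.End ℂ X) (a : A) (h : H) :
    F (a ⊗ₜ h) = F.comp Algebra.TensorProduct.includeLeft a *
      F.comp Algebra.TensorProduct.includeRight h := by
  change _ = F (a ⊗ₜ 1) * F (1 ⊗ₜ h)
  rw [← map_mul, Algebra.TensorProduct.tmul_mul_tmul, mul_one, one_mul]

theorem commute_map_tmul (F : A ⊗[ℂ] H →ₐ[ℂ] Module.End ℂ X) (a : A) (h : H) :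
    Commute (F.comp Algebra.TensorProduct.includeLeft a : Module.End ℂ X)
      (F.comp Algebra.TensorProduct.includeRight h) := by
  change F (a ⊗ₜ 1) * F (1 ⊗ₜ h) = F (1 ⊗ₜ h) * F (a ⊗ₜ 1)
  rw [← map_mul, ← map_mul, Algebra.TensorProduct.tmul_mul_tmul,
    Algebra.TensorProduct.tmul_mul_tmul, mul_one, one_mul, mul_one, one_mul]

end Equation

section Modules

variable (L : Type*) [AddCommGroup L] [Module ℂ L] [Module (Smash k q) L]
  [IsScalarTower ℂ (Smash k q) L] (N : Type*) [AddCommGroup N] [Module ℂ N] [Module (Hecke k) N]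
    [IsScalarTower ℂ (Hecke k) N]

variable (k q) in
/-- The action of the smashed product on `L ⊗ N`. -/
def leftRep : Smash k q →ₐ[ℂ] Module.End ℂ (L ⊗[ℂ] N) :=
  (gammaRep (k := k) (q := q) L N).comp Algebra.TensorProduct.includeLeft

variable (k q) in
/-- The action of the Hecke algebra on `L ⊗ N`. -/
def rightRep : Hecke k →ₐ[ℂ] Module.End ℂ (L ⊗[ℂ] N) :=
  (gammaRep (k := k) (q := q) L N).comp Algebra.TensorProduct.includeRight

theorem leftRep_apply (a : Smash k q) (ψ : L ⊗[ℂ] N) :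
    leftRep k q L N a ψ = LinearMap.rTensor N (Algebra.lsmul ℂ ℂ L a) ψ := by
  induction ψ using TensorProduct.induction_on with
  | zero => simp only [map_zero]
  | add x y hx hy => rw [map_add, map_add, hx, hy]
  | tmul x m =>
    change (a • x) ⊗ₜ[ℂ] ((1 : Hecke k) • m) = (a • x) ⊗ₜ[ℂ] m
    rw [one_smul]

theorem rightRep_apply (h : Hecke k) (ψ : L ⊗[ℂ] N) :
    rightRep k q L N h ψ = LinearMap.lTensor L (Algebra.lsmul ℂ ℂ N h) ψ := by
  induction ψ using TensorProduct.induction_on with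
  | zero => simp only [map_zero]
  | add x y hx hy => rw [map_add, map_add, hx, hy]
  | tmul x m =>
    change ((1 : Smash k q) • x) ⊗ₜ[ℂ] (h • m) = x ⊗ₜ[ℂ] (h • m)
    rw [one_smul]

theorem gammaRep_tmul (a : Smash k q) (h : Hecke k) :
    gammaRep (k := k) (q := q) L N (a ⊗ₜ h) = leftRep k q L N a * rightRep k q L N h :=
  map_tmul_eq_mul (A := Smash k q) (H := Hecke k) _ a h

theorem commute_leftRep_rightRep (a : Smash k q) (h : Hecke k) :
    Commute (leftRep k q L N a) (rightRep k q L N h) :=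
  commute_map_tmul (A := Smash k q) (H := Hecke k) _ a h

variable {L N} {π : Hecke k.inv →ₐ[ℂ] Smash k q} {D : Smash k q →ₐ[ℂ] Smash k q ⊗[ℂ] Hecke k}

theorem gammaRep_s_iff (hπ : IsPi k q π) (hD : IsNabla k q D) (j : Option S.Idx)
    (ψ : L ⊗[ℂ] N) : gammaRep (k := k) (q := q) L N (D (gp k q (S.s j))) ψ = ψ ↔
      leftRep k q L N (π (T k.inv j)) ψ = rightRep k q L N (dag k (T k.inv j)).unop ψ := by
  have hs : S.s j * S.s j = 1 := S.affAction.s_mul_s j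
  obtain ⟨h1, h2, h3⟩ := crossed_identities (A := Smash k q) (C := Csn k q) (G := S.W)
    (Crossed.skew (Csn k q) S.W) hs (cfun_mul_cinv j) (s_smul_cfun j) (k.val j : ℂ)
    (k.inv.val j : ℂ) (hπ.1 j)
  have hp : ((k.val j : ℂ) - (k.inv.val j : ℂ)) = k.p j := rfl
  rw [hp] at h3
  have e := eq_iff_of_identities (A := Smash k q) (H := Hecke k) (leftRep k q L N)
    (rightRep k q L N) h1 h2 h3 (T_eq k j) ψ
  rw [hD.2.1 j, dag_T]
  refine Iff.trans (Eq.congr_left ?_) e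
  refine (LinearMap.congr_fun (map_add (gammaRep (k := k) (q := q) L N) _ _) ψ).trans ?_
  rw [gammaRep_tmul, gammaRep_tmul, map_one (rightRep k q L N), mul_one]
  rfl

theorem gammaRep_Om_iff (hπ : IsPi k q π) (hD : IsNabla k q D) (o : S.Om)
    (ψ : L ⊗[ℂ] N) : gammaRep (k := k) (q := q) L N (D (gp k q o)) ψ = ψ ↔
      leftRep k q L N (π (TO k.inv o)) ψ = rightRep k q L N (dag k (TO k.inv o)).unop ψ := by
  rw [hD.2.2 o, gammaRep_tmul, hπ.2, dag_TO, MulOpposite.unop_op,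
    (commute_leftRep_rightRep L N _ _).eq, ← Tw_Om, Module.End.mul_apply, ← val_TwU]
  constructor
  · intro h
    conv_rhs => rw [← h]
    rw [← Module.End.mul_apply, ← map_mul, Units.inv_mul, map_one, Module.End.one_apply]
  · intro h
    rw [h, ← Module.End.mul_apply, ← map_mul, Units.mul_inv, map_one, Module.End.one_apply]

/-- Both conditions are multiplicative, one along `W` and the other along the basis T_w, and they
agree on the s_j and on Ω. The order reversal in `dag` matches because the two actions on L ⊗ N
commute. -/
theorem mem_kzInvariants_iff (hπ : IsPi k q π) (hD : IsNabla k q D) (ψ : L ⊗[ℂ] N) :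
    ψ ∈ kzInvariants L D N ↔
      Intertwining.IsIntertwining ((Algebra.lsmul ℂ ℂ L).comp π) (dagRep k N) ψ := by
  have hI : Intertwining.IsIntertwining ((Algebra.lsmul ℂ ℂ L).comp π) (dagRep k N) ψ ↔
      ∀ h, leftRep k q L N (π h) ψ = rightRep k q L N (dag k h).unop ψ := by
    refine forall_congr' fun h => ?_
    rw [leftRep_apply, rightRep_apply]
    rfl
  rw [hI]
  constructor
  · intro hψ h
    have hT (w : S.W) : leftRep k q L N (π (Tw k.inv w)) ψ =
        rightRep k q L N (dag k (Tw k.inv w)).unop ψ := by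
      induction w using S.affAction.induction_left with
      | h0 g hg =>
        rw [show Tw k.inv g = TO k.inv ⟨g, hg⟩ from Tw_Om k.inv ⟨g, hg⟩]
        exact (gammaRep_Om_iff hπ hD ⟨g, hg⟩ ψ).mp (hψ g)
      | hs j g hj ih =>
        have h1 : Tw k.inv (S.affAction.s j * g) = T k.inv j * Tw k.inv g := Tw_s_mul k.inv hj
        rw [h1, map_mul, map_mul, map_mul, MulOpposite.unop_mul, map_mul, Module.End.mul_apply, ih,
          ← Module.End.mul_apply, (commute_leftRep_rightRep L N _ _).eq, Module.End.mul_apply,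
          (gammaRep_s_iff hπ hD j ψ).mp (hψ (S.s j)), Module.End.mul_apply]
    have hh : h ∈ Submodule.span ℂ (Set.range (basisTw k.inv)) :=
      (basisTw k.inv).span_eq ▸ Submodule.mem_top
    induction hh using Submodule.span_induction with
    | zero => simp only [map_zero, MulOpposite.unop_zero]
    | add x y _ _ hx hy =>
      rw [map_add, map_add, map_add, MulOpposite.unop_add, map_add, LinearMap.add_apply,
        LinearMap.add_apply, hx, hy]
    | smul c x _ hx =>
      rw [map_smul, map_smul, map_smul, MulOpposite.unop_smul, map_smul, LinearMap.smul_apply,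
        LinearMap.smul_apply, hx]
    | mem x hx =>
      obtain ⟨w, rfl⟩ := hx
      rw [basisTw_apply]
      exact hT w
  · intro h w
    induction w using S.affAction.induction_left with
    | h0 g hg => exact (gammaRep_Om_iff hπ hD ⟨g, hg⟩ ψ).mpr (h _)
    | hs j g hj ih =>
      have e : gammaRep (k := k) (q := q) L N (D (gp k q (S.affAction.s j * g))) =
          gammaRep (k := k) (q := q) L N (D (gp k q (S.s j))) *
            gammaRep (k := k) (q := q) L N (D (gp k q g)) := by
        rw [show gp k q (S.affAction.s j * g) = gp k q (S.s j) * gp k q g from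
          (gp_mul_gp _ _).symm]
        exact map_mul ((gammaRep (k := k) (q := q) L N).comp D) _ _
      rw [e, Module.End.mul_apply, ih]
      exact (gammaRep_s_iff hπ hD j ψ).mpr (h _)

end Modules

/-! ### The correspondence -/

section Correspondence

variable {χ : HeckeI k I →ₐ[ℂ] ℂ} {χ' : HeckeI k.inv (S.star I) →ₐ[ℂ] ℂ}
  {π : Hecke k.inv →ₐ[ℂ] Smash k q} {D : Smash k q →ₐ[ℂ] Smash k q ⊗[ℂ] Hecke k}
  {L : Type*} [AddCommGroup L] [Module ℂ L] [Module (Smash k q) L] [IsScalarTower ℂ (Smash k q) L]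

variable (L π I χ) in
/-- The map `φ ↦ ψ_φ` as a linear map. -/
def psiHom : L →ₗ[ℂ] L ⊗[ℂ] Ind k I χ where
  toFun := psi L π I χ
  map_add' a b := by
    simp only [psi, smul_add, TensorProduct.add_tmul, Finset.sum_add_distrib]
  map_smul' c a := by
    simp only [psi, smul_comm _ c a, ← TensorProduct.smul_tmul', Finset.smul_sum, RingHom.id_apply]

variable (hγ : γ ∈ torusI k ε I) (hχ : IsChi k ε I γ χ)

theorem contract_psi (φ : L) :
    Intertwining.contract L (coord hγ hχ (S.wbar I)) (psi L π I χ φ) = φ := by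
  classical
  exact Intertwining.contract_sum (P := (Algebra.lsmul ℂ ℂ L).comp π)
    (f := fun w : S.W0min I => coord hγ hχ w) (v := fun w : S.W0min I => vec k I χ w)
    (b := fun w : S.W0min I => Tw k.inv (S.incl (w * (S.wbar I)⁻¹))) (coord_vec hγ hχ)
    (j := ⟨S.wbar I, wbar_mem⟩) (by simp only [mul_inv_cancel, map_one, Tw_one]) φ

/-- If y is minimal for I*, then y w̄₀ is minimal for `I`; so every T_y occurs among the T_{w
w̄₀⁻¹}, and the spanning statement for I* applies. -/
theorem span_Tw_wbar_inv (k : S.Mult) (I : Set S.Idx) :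
    Submodule.span ℂ {h : Hecke k | ∃ w : S.W0min I, ∃ z ∈ (HeckeI k (S.star I) : Set (Hecke k)),
      h = Tw k (S.incl (w * (S.wbar I)⁻¹)) * z} = ⊤ := by
  rw [eq_top_iff, ← span_Tw_mul_heckeI k (S.star I)]
  refine Submodule.span_mono ?_
  rintro _ ⟨w, hw, z, rfl⟩
  exact ⟨⟨w * S.wbar I, mul_wbar_mem hw⟩, z, z.2, by rw [mul_inv_cancel_right]⟩

theorem psi_mem (hγ : γ ∈ torusI k ε I) (hχ : IsChi k ε I γ χ) (hπ : IsPi k q π) (hD : IsNabla k q D)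
    (hχ' : IsChi k.inv ε (S.star I) (torusAct (S.wbar I) γ⁻¹) χ') {φ : L}
    (hφ : φ ∈ eigenspace L π (S.star I) χ') : psi L π I χ φ ∈ kzInvariants L D (Ind k I χ) := by
  classical
  rw [mem_kzInvariants_iff hπ hD]
  refine Intertwining.isIntertwining_sum (P := (Algebra.lsmul ℂ ℂ L).comp π)
    (f := fun w : S.W0min I => coord hγ hχ w) (v := fun w : S.W0min I => vec k I χ w)
    (t := coord hγ hχ (S.wbar I))
    (b := fun w : S.W0min I => Tw k.inv (S.incl (w * (S.wbar I)⁻¹)))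
    (eq_sum_coord hγ hχ) (coord_vec hγ hχ) (fun w => coord_dagRep_Tw hγ hχ w.2)
    (Z := HeckeI k.inv (S.star I))
    (χ := fun z => if hz : z ∈ HeckeI k.inv (S.star I) then χ' ⟨z, hz⟩ else 0)
    (span_Tw_wbar_inv k.inv I) (fun z hz => ?_) (fun z hz => ?_)
  · rw [dif_pos (show z ∈ HeckeI k.inv (S.star I) from hz)]
    exact coord_dagRep hγ hχ hχ' ⟨z, hz⟩
  · rw [dif_pos (show z ∈ HeckeI k.inv (S.star I) from hz)]
    exact hφ ⟨z, hz⟩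

theorem contract_mem (hπ : IsPi k q π) (hD : IsNabla k q D)
    (hχ' : IsChi k.inv ε (S.star I) (torusAct (S.wbar I) γ⁻¹) χ') {ψ : L ⊗[ℂ] Ind k I χ}
    (hψ : ψ ∈ kzInvariants L D (Ind k I χ)) :
    Intertwining.contract L (coord hγ hχ (S.wbar I)) ψ ∈ eigenspace L π (S.star I) χ' := by
  rw [mem_kzInvariants_iff hπ hD] at hψ
  intro z
  have h := hψ.contract_comp (t := coord hγ hχ (S.wbar I)) z
  rw [coord_dagRep hγ hχ hχ'] at h
  refine h.symm.trans ?_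
  rw [Intertwining.contract_smul]

theorem psi_contract (hπ : IsPi k q π) (hD : IsNabla k q D) {ψ : L ⊗[ℂ] Ind k I χ}
    (hψ : ψ ∈ kzInvariants L D (Ind k I χ)) :
    psi L π I χ (Intertwining.contract L (coord hγ hχ (S.wbar I)) ψ) = ψ := by
  rw [mem_kzInvariants_iff hπ hD] at hψ
  exact (hψ.eq_sum (f := fun w : S.W0min I => coord hγ hχ w)
    (v := fun w : S.W0min I => vec k I χ w) (t := coord hγ hχ (S.wbar I))
    (b := fun w : S.W0min I => Tw k.inv (S.incl (w * (S.wbar I)⁻¹)))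
    (eq_sum_coord hγ hχ) (fun w => coord_dagRep_Tw hγ hχ w.2)).symm

/-- The isomorphism `φ ↦ ψ_φ`. -/
def psiEquiv (hπ : IsPi k q π) (hD : IsNabla k q D)
    (hχ' : IsChi k.inv ε (S.star I) (torusAct (S.wbar I) γ⁻¹) χ') :
    eigenspace L π (S.star I) χ' ≃ₗ[ℂ] kzInvariants L D (Ind k I χ) :=
  LinearEquiv.ofLinearMap
    ((psiHom I χ π L).restrict fun _ hφ => psi_mem hγ hχ hπ hD hχ' hφ)
    ((Intertwining.contract L (coord hγ hχ (S.wbar I))).restrict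
      fun _ hψ => contract_mem hγ hχ hπ hD hχ' hψ)
    (LinearMap.ext fun ψ => Subtype.ext (psi_contract hγ hχ hπ hD ψ.2))
    (LinearMap.ext fun φ => Subtype.ext (contract_psi hγ hχ φ.1))

end Correspondence

end EuclideanRootSystem

end

open EuclideanRootSystem in
theorem mainTheorem1 {ι V : Type*} [Finite ι] [NormedAddCommGroup V] [InnerProductSpace ℝ V]
    [FiniteDimensional ℝ V] (S : EuclideanRootSystem ι V) (k : S.Mult) (q : S.QParam)
    (ε : ℤˣ) (I : Set S.Idx) (γ : S.Torus) (hγ : γ ∈ torusI k ε I) :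
    (∃! π : Hecke k.inv →ₐ[ℂ] Smash k q, IsPi k q π) ∧
    (∃! D : Smash k q →ₐ[ℂ] Smash k q ⊗[ℂ] Hecke k, IsNabla k q D) ∧
    (∃! χ : HeckeI k I →ₐ[ℂ] ℂ, IsChi k ε I γ χ) ∧
    (∃! χ' : HeckeI k.inv (S.star I) →ₐ[ℂ] ℂ,
      IsChi k.inv ε (S.star I) (torusAct (S.minRep I S.w0) γ⁻¹) χ') ∧
    ∀ (π : Hecke k.inv →ₐ[ℂ] Smash k q) (D : Smash k q →ₐ[ℂ] Smash k q ⊗[ℂ] Hecke k)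
      (χ : HeckeI k I →ₐ[ℂ] ℂ) (χ' : HeckeI k.inv (S.star I) →ₐ[ℂ] ℂ),
      IsPi k q π → IsNabla k q D → IsChi k ε I γ χ →
      IsChi k.inv ε (S.star I) (torusAct (S.minRep I S.w0) γ⁻¹) χ' →
      ∀ (L : Type*) [AddCommGroup L] [Module ℂ L] [Module (Smash k q) L]
        [IsScalarTower ℂ (Smash k q) L],
        ∃ e : eigenspace L π (S.star I) χ' ≃ₗ[ℂ] kzInvariants L D (Ind k I χ),
          ∀ f : eigenspace L π (S.star I) χ',
            (e f : L ⊗[ℂ] Ind k I χ) = psi L π I χ f := by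
  refine ⟨existsUnique_pi k q, existsUnique_nabla k q, existsUnique_chi hγ,
    existsUnique_chi (torusAct_mem_torusI hγ), ?_⟩
  intro π D χ χ' hπ hD hχ hχ' L _ _ _ _
  exact ⟨psiEquiv hγ hχ hπ hD hχ', fun f => rfl⟩
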